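/- **Theorem 4.1 (classical Schwarz algorithm for the time-discretized Maxwell system).** Let $\varepsilon,\mu,\eta>0$, $\sigma\ge 0$, $L\ge 0$, $Z=\sqrt{\mu/\varepsilon}$ (for a time step $\Delta t$, $\sqrt\eta=2/\Delta t$), and let $J,g\in L^2(\mathbb R^3)^3$ (complex valued). Consider the system $$-\sqrt\eta\,\varepsilon E+\operatorname{curl}H-\sigma E=J,\qquad \sqrt\eta\,\mu H+\operatorname{curl}E=g \qquad (\ast)$$ (with weak curls in $L^2$), the subdomains $\Omega_1=(-\infty,L)\times\mathbb R^2$, $\Omega_2=(0,\infty)\times\mathbb R^2$ with outward unit normals $n_1=(1,0,0)$, $n_2=(-1,0,0)$, the interfaces $\Gamma_{12}=\{L\}\times\mathbb R^2$, $\Gamma_{21}=\{0\}\times\mathbb R^2$, and the characteristic operator $$\mathcal B_n(E,H)=n\times \tfrac{E}{Z}+n\times(n\times H),$$ which gives the incoming characteristic variables for the outward normal $n$. From an initial guess $(E^{j,0},H^{j,0})\in L^2(\Omega_j)^6$, $j=1,2$, the classical Schwarz algorithm computes, for $n\ge 1$, solutions $(E^{j,n},H^{j,n})\in L^2(\Omega_j)^6$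 of $(\ast)$ in $\Omega_j$ with $$\mathcal B_{n_1}(E^{1,n},H^{1,n})=\mathcal B_{n_1}(E^{2,n-1},H^{2,n-1})\ \text{on }\Gamma_{12},\qquad \mathcal B_{n_2}(E^{2,n},H^{2,n})=\mathcal B_{n_2}(E^{1,n-1},H^{1,n-1})\ \text{on }\Gamma_{21},$$ where the traces of these fields on a plane $\{a\}\times\mathbb R^2$ are the limits, in the sense of distributions in $(y,z)$, of their means over slabs of thickness $h\to0^+$ adjacent to the plane, taken from the side $x<a$ for the field of index $1$ and from the side $x>a$ for the field of index $2$. (a) The system $(\ast)$ has a unique solution $(E,H)\in L^2(\mathbb R^3)^6$. If the components $E^{j,0},H^{j,0}$ of the initial guess have weak curls in $L^2(\Omega_j)^3$, the iterates exist and are unique. (b) For every initial guess in $L^2(\Omega_1)^6\times L^2(\Omega_2)^6$ and all iterates computed from it, $(E^{j,n},H^{j,n})\to(E,H)|_{\Omega_j}$ in $L^2(\Omega_j)^6$ as $n\to\infty$, $j=1,2$; this includes the non-overlapping case $L=0$. (c) For $k=(k_y,k_z)\in\mathbb R^2$ let $\rho_{cla}(k)$, the convergence factor of the Fourier mode $k$,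 be the square root of the spectral radius of the linear map by which two steps of the algorithm, with $J=g=0$, act on the modes $e^{i(k_yy+k_zz)}(\hat E(x),\hat H(x))$ in $\Omega_1$ with $\hat E,\hat H\in L^2(-\infty,L)^3$. Put $$R_{cla}=\frac{\sqrt{L\tilde\eta+2\sqrt{\varepsilon\mu}}-\sqrt{L\tilde\eta}}{\sqrt{L\tilde\eta+2\sqrt{\varepsilon\mu}}+\sqrt{L\tilde\eta}}\;e^{-\sqrt{L\sqrt\eta}\,\sqrt{L\tilde\eta+2\sqrt{\varepsilon\mu}}},\qquad \tilde\eta=\sqrt\eta\,\varepsilon\mu .$$ Then for every $k\in\mathbb R^2$ this spectral radius is attained by an eigenvalue, $\rho_{cla}(k)<1$ and $\rho_{cla}(k)\le R_{cla}$. If $L>0$, then $R_{cla}<1$. Moreover, for $j=1,2$ and $n\ge1$, the $L^2(\Omega_j)^6$ norm of the error $(E^{j,n+2}-E,H^{j,n+2}-H)$ is at most $R_{cla}^2$ times that of $(E^{j,n}-E,H^{j,n}-H)$. -/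

import Mathlib

open MeasureTheory Filter Topology Set

open scoped ContDiff Matrix

noncomputable section

namespace MaxwellSchwarz

/-- Points `(x, (y, z))` of `ℝ³ = ℝ × ℝ²`, with Lebesgue measure. -/
abbrev Space : Type := ℝ × EuclideanSpace ℝ (Fin 2)

/-- Field values, with the Hermitian norm of `ℂ³`. -/
abbrev Vec : Type := EuclideanSpace ℂ (Fin 3)

/-- The material constants and `η`, where `√η = 2 / Δt` for the time step `Δt`. -/
structure Params where
  ε : ℝ
  μ : ℝ
  σ : ℝ
  η : ℝ

/-- The impedance `Z = √(μ/ε)`. -/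
def Params.Z (c : Params) : ℝ := Real.sqrt (c.μ / c.ε)

/-- The unit coordinate vectors in the directions `x`, `y`, `z`. -/
def dir : Fin 3 → Space :=
  ![(1, 0), (0, EuclideanSpace.single 0 1), (0, EuclideanSpace.single 1 1)]

/-- The partial derivative of the `i`-th component of `φ` in the `j`-th coordinate direction. -/
def pd (j i : Fin 3) (φ : Space → Vec) (p : Space) : ℂ :=
  fderiv ℝ (fun q => φ q i) p (dir j)

/-- The classical curl of a differentiable field. -/
def curl (φ : Space → Vec) (p : Space) : Vec :=
  !₂[pd 1 2 φ p - pd 2 1 φ p, pd 2 0 φ p - pd 0 2 φ p, pd 0 1 φ p - pd 1 0 φ p]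

/-- The bilinear product `∑ aᵢ bᵢ`. -/
def dot (a b : Vec) : ℂ := ∑ i, a i * b i

/-- The cross product of `ℂ³`. -/
def cross (a b : Vec) : Vec :=
  WithLp.toLp 2 (crossProduct (WithLp.ofLp a) (WithLp.ofLp b))

/-- `L²(Ω)³`. -/
abbrev L2Field (Ω : Set Space) : Type := Lp Vec 2 (volume.restrict Ω)

/-- Pairs `(E, H)` in `L²(Ω)⁶`. -/
abbrev L2Pair (Ω : Set Space) : Type := L2Field Ω × L2Field Ω

/-- `C` is the weak curl of `F` in the open set `Ω`: integration by parts against smooth fields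
that are compactly supported in `Ω`. -/
def HasWeakCurl (Ω : Set Space) (F C : Space → Vec) : Prop :=
  ∀ φ : Space → Vec, ContDiff ℝ ∞ φ → HasCompactSupport φ → tsupport φ ⊆ Ω →
    ∫ p in Ω, dot (F p) (curl φ p) = ∫ p in Ω, dot (C p) (φ p)

/-- Both components of the pair have a weak curl in `L²(Ω)³`. -/
def HasL2Curl {Ω : Set Space} (u : L2Pair Ω) : Prop :=
  (∃ C : L2Field Ω, HasWeakCurl Ω u.1 C) ∧ ∃ C : L2Field Ω, HasWeakCurl Ω u.2 C

/-- The pair `u = (E, H)` solves the time-discretized Maxwell system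
`-√η ε E + curl H - σ E = J`, `√η μ H + curl E = g` in `Ω`. -/
def SolvesMaxwell (c : Params) {Ω : Set Space} (u : L2Pair Ω) (J g : Space → Vec) : Prop :=
  ∃ curlE curlH : L2Field Ω, HasWeakCurl Ω u.1 curlE ∧ HasWeakCurl Ω u.2 curlH ∧
    (∀ᵐ p ∂(volume.restrict Ω),
      -((Real.sqrt c.η * c.ε) • u.1 p) + curlH p - c.σ • u.1 p = J p) ∧
    (∀ᵐ p ∂(volume.restrict Ω),
      (Real.sqrt c.η * c.μ) • u.2 p + curlE p = g p)

/-- `Ω₁ = (-∞, L) × ℝ²`. -/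
def Ω₁ (L : ℝ) : Set Space := {p | p.1 < L}

/-- `Ω₂ = (0, ∞) × ℝ²`. -/
def Ω₂ : Set Space := {p | 0 < p.1}

/-- The outward unit normal of `Ω₁`. -/
def n₁ : Vec := EuclideanSpace.single 0 1

/-- The outward unit normal of `Ω₂`. -/
def n₂ : Vec := -n₁

/-- The characteristic (impedance) operator `n × E / Z + n × (n × H)`. For the outward normal
`n = (1, 0, 0)` it is `(0, -(E₃ / Z + H₂), E₂ / Z - H₃)`, that is, up to constant factors, the pair
of incoming characteristic variables (those of the negative eigenvalue of the characteristic
matrix). -/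
def impedance (c : Params) (n E H : Vec) : Vec :=
  (c.Z)⁻¹ • cross n E + cross n (cross n H)

/-- `B_n(E, H)` as a field. -/
def impedanceField (c : Params) (n : Vec) {Ω : Set Space} (u : L2Pair Ω) (p : Space) : Vec :=
  impedance c n (u.1 p) (u.2 p)

/-- Mean over the slab `x ∈ I`, `I` an interval of length `h`, of `F` tested against a function `ψ`
of `(y, z)`. -/
def slabMean (F : Space → Vec) (I : Set ℝ) (h : ℝ) (ψ : EuclideanSpace ℝ (Fin 2) → ℂ) : Vec :=
  h⁻¹ • ∫ p in {p : Space | p.1 ∈ I}, ψ p.2 • F p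

/-- On the plane `{a} × ℝ²` the trace of `F` from the side `x < a` and the trace of `G` from the
side `x > a` both exist, in the sense of distributions in `(y, z)`, and coincide. -/
def TracesAgree (a : ℝ) (F G : Space → Vec) : Prop :=
  ∀ ψ : EuclideanSpace ℝ (Fin 2) → ℂ, ContDiff ℝ ∞ ψ → HasCompactSupport ψ →
    ∃ l : Vec,
      Tendsto (fun h : ℝ => slabMean F (Ioo (a - h) a) h ψ) (𝓝[>] 0) (𝓝 l) ∧
      Tendsto (fun h : ℝ => slabMean G (Ioo a (a + h)) h ψ) (𝓝[>] 0) (𝓝 l)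

/-- The classical Schwarz algorithm with overlap `L` and sources `J`, `g`; `u₁ 0` and `u₂ 0` are
the initial guesses. -/
structure IsSchwarzIteration (c : Params) (L : ℝ) (J g : Space → Vec)
    (u₁ : ℕ → L2Pair (Ω₁ L)) (u₂ : ℕ → L2Pair Ω₂) : Prop where
  solves₁ : ∀ n, SolvesMaxwell c (u₁ (n + 1)) J g
  trans₁ : ∀ n, TracesAgree L (impedanceField c n₁ (u₁ (n + 1))) (impedanceField c n₁ (u₂ n))
  solves₂ : ∀ n, SolvesMaxwell c (u₂ (n + 1)) J g
  trans₂ : ∀ n, TracesAgree 0 (impedanceField c n₂ (u₁ n)) (impedanceField c n₂ (u₂ (n + 1)))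

/-- The `L²(Ω)⁶` norm of the error `u - U` on `Ω`, for a pair `U` on the whole space. -/
def l2Error {Ω : Set Space} (u : L2Pair Ω) (U : L2Pair univ) : ENNReal :=
  (eLpNorm (fun p => u.1 p - U.1 p) 2 (volume.restrict Ω) ^ 2 +
    eLpNorm (fun p => u.2 p - U.2 p) 2 (volume.restrict Ω) ^ 2) ^ (1 / 2 : ℝ)

/-- The field `e^{i (k_y y + k_z z)} F(x)`. -/
def planeWave (k : EuclideanSpace ℝ (Fin 2)) (F : ℝ → Vec) (p : Space) : Vec :=
  Complex.exp (Complex.I * (inner ℝ k p.2 : ℝ)) • F p.1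

/-- `u = (E, H)` consists of the profiles in `x` of a Fourier mode `k` of the error in `I × ℝ²`,
`I` an open half-line: the fields `e^{i k·(y, z)} E(x)`, `e^{i k·(y, z)} H(x)` solve the homogeneous
system, and the profiles are square integrable and continuous up to the end point of `I`. -/
structure IsMode (c : Params) (k : EuclideanSpace ℝ (Fin 2)) (I : Set ℝ)
    (u : (ℝ → Vec) × (ℝ → Vec)) : Prop where
  memLp_E : MemLp u.1 2 (volume.restrict I)
  memLp_H : MemLp u.2 2 (volume.restrict I)
  continuousOn_E : ContinuousOn u.1 (closure I)
  continuousOn_H : ContinuousOn u.2 (closure I)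
  differentiableOn_E : DifferentiableOn ℝ u.1 I
  differentiableOn_H : DifferentiableOn ℝ u.2 I
  eq_E : ∀ p : Space, p.1 ∈ I →
    -((Real.sqrt c.η * c.ε) • planeWave k u.1 p) + curl (planeWave k u.2) p
      - c.σ • planeWave k u.1 p = 0
  eq_H : ∀ p : Space, p.1 ∈ I →
    (Real.sqrt c.η * c.μ) • planeWave k u.2 p + curl (planeWave k u.1) p = 0

/-- Eigenvalues of the linear map by which a complete iteration (two steps `u ↦ v ↦ w`) of the
algorithm acts on the modes `k` in `Ω₁`. -/
def modeEigenvalues (c : Params) (L : ℝ) (k : EuclideanSpace ℝ (Fin 2)) : Set ℂ :=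
  {κ | ∃ u v w : (ℝ → Vec) × (ℝ → Vec),
    IsMode c k (Iio L) u ∧ IsMode c k (Ioi 0) v ∧ IsMode c k (Iio L) w ∧
    (∃ x < L, u.1 x ≠ 0 ∨ u.2 x ≠ 0) ∧
    impedance c n₂ (v.1 0) (v.2 0) = impedance c n₂ (u.1 0) (u.2 0) ∧
    impedance c n₁ (w.1 L) (w.2 L) = impedance c n₁ (v.1 L) (v.2 L) ∧
    ∀ x < L, w.1 x = κ • u.1 x ∧ w.2 x = κ • u.2 x}

/-- The convergence factor of the Fourier mode `k`: the square root of the spectral radius of a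
complete iteration (two steps). -/
def convergenceFactor (c : Params) (L : ℝ) (k : EuclideanSpace ℝ (Fin 2)) : ℝ :=
  Real.sqrt (sSup ((fun κ : ℂ => ‖κ‖) '' modeEigenvalues c L k))

/-- The explicit bound for the convergence factor. -/
def Rcla (c : Params) (L : ℝ) : ℝ :=
  (Real.sqrt (L * (Real.sqrt c.η * (c.ε * c.μ)) + 2 * Real.sqrt (c.ε * c.μ))
      - Real.sqrt (L * (Real.sqrt c.η * (c.ε * c.μ)))) /
    (Real.sqrt (L * (Real.sqrt c.η * (c.ε * c.μ)) + 2 * Real.sqrt (c.ε * c.μ))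
      + Real.sqrt (L * (Real.sqrt c.η * (c.ε * c.μ)))) *
    Real.exp (-(Real.sqrt (L * Real.sqrt c.η) *
      Real.sqrt (L * (Real.sqrt c.η * (c.ε * c.μ)) + 2 * Real.sqrt (c.ε * c.μ))))

end MaxwellSchwarz

end

/-!
Everything is translation invariant in `(y, z)`, so a partial Fourier transform in these variables
decouples the frequencies. For a half-space with boundary `{a} × ℝ²` it is a unitary map (`hat`) onto
`L²(ℝ²; L²(0, ∞))`: its values are profiles in the distance to the boundary. A weak curl in the
half-space becomes, for almost every frequency, a system of weak ordinary differential equations for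
the profiles (`HasWeakCurl.ae_hat`); the tangential components are therefore continuous up to the
boundary, and two traces in the sense of distributions agree if and only if the boundary values of
almost all profiles agree (`tracesAgree_iff`).

Eliminating the normal components from the homogeneous system shows that each tangential profile `f`
satisfies `f'' = λ² f` with `λ² = |2πk|² + (√η ε + σ) √η μ`. As `f' + λ f` solves `u' = λ u` and is
square integrable, it vanishes: only the decaying exponentials `e^{-λ t}` remain, with two free
amplitudes (`exists_mode`, `IsHomogeneous.ae_exists_mode`). The impedance operator is diagonal in the
longitudinal and transverse polarizations of these modes (`impedanceComp_polarization`), with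
reflection coefficients `(λ - q) / (λ + q)` and `(p - λ) / (p + λ)`, where `p = √η √(ε μ)`, `p ≤ q`
and `p q = (√η ε + σ) √η μ ≤ λ²`, so the transverse one dominates. The energy is diagonal too. Hence
one step of the algorithm multiplies the energy of the frequency `k` by at most `ρ(k)²`, with
`ρ = (λ - p) / (λ + p) e^{-λ L} < 1` (`modeEnergy_le`, `hatEnergy_le`). The maximum of `ρ` over `λ`
is at `λ² = p² + 2 p / L` and equals `Rcla` (`reflection_le_Rcla`). The bound for two steps follows
by the theorem of Plancherel. For `L = 0` the factors `ρ(k)` are not bounded away from `1`, and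
convergence follows by dominated convergence in `k` (`tendsto_lintegral_of_alternating`). For single
modes in the classical sense the same bound holds for each eigenvalue, and a transverse mode is an
eigenvector with eigenvalue `ρ²` (`isGreatest_modeEigenvalues`).

For the whole space, a solution exists by orthogonal decomposition along the closed graph of the curl
(`exists_curl_decomposition`). It is unique because the two halves of a homogeneous solution bound
the energies of each other with the factor `ρ² < 1`. A solution in a subdomain with prescribed
impedance data is the restriction of the solution in the whole space plus a superposition of decaying
modes (`exists_homogeneous`): traces of fields with square integrable curls are `O(√(1 + |k|))` times
a square integrable function of `k`, the amplitudes are bounded by the data uniformly in `k`, and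
`‖e^{-λ t}‖ = (2 λ)^{-1/2}` makes up for the growth.
-/

open FourierTransform SchwartzMap

open scoped LineDeriv

noncomputable section

namespace MaxwellSchwarz

/-! ### Weak derivatives on the half-line -/

/-- `L²(0, ∞)`, the profiles of a field in the distance to a plane. -/
abbrev Profile : Type := Lp ℂ 2 (volume.restrict (Ioi (0 : ℝ)))

/-- `h` is the weak derivative of `f` on `(0, ∞)`. -/
def IsWeakDeriv (f h : ℝ → ℂ) : Prop :=
  ∀ χ : ℝ → ℝ, ContDiff ℝ ∞ χ → HasCompactSupport χ → tsupport χ ⊆ Ioi 0 →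
    ∫ t in Ioi (0 : ℝ), ((deriv χ t : ℝ) : ℂ) * f t = -∫ t in Ioi (0 : ℝ), (χ t : ℂ) * h t

lemma exists_Icc_of_tsupport {χ : ℝ → ℝ} (hc : HasCompactSupport χ) (hs : tsupport χ ⊆ Ioi 0) :
    ∃ α β : ℝ, 0 < α ∧ tsupport χ ⊆ Icc α β := by
  rcases (tsupport χ).eq_empty_or_nonempty with h | h
  · exact ⟨1, 1, one_pos, by simp [h]⟩
  · exact ⟨sInf (tsupport χ), sSup (tsupport χ), hs (hc.isCompact.sInf_mem h), fun t ht =>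
      ⟨csInf_le hc.isCompact.bddBelow ht, le_csSup hc.isCompact.bddAbove ht⟩⟩

/-- A test function of mean zero is the derivative of a test function. -/
lemma exists_primitive {ξ : ℝ → ℝ} (hξ : ContDiff ℝ ∞ ξ) (hc : HasCompactSupport ξ)
    (hs : tsupport ξ ⊆ Ioi 0) (h0 : ∫ t, ξ t = 0) :
    ∃ Ξ : ℝ → ℝ, ContDiff ℝ ∞ Ξ ∧ HasCompactSupport Ξ ∧ tsupport Ξ ⊆ Ioi 0 ∧ deriv Ξ = ξ := by
  obtain ⟨α, β, hα, hI⟩ := exists_Icc_of_tsupport hc hs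
  have hz : ∀ t, t ∉ Icc α β → ξ t = 0 := fun t ht => image_eq_zero_of_notMem_tsupport
    (fun h => ht (hI h))
  set Ξ : ℝ → ℝ := fun t => ∫ s in (0 : ℝ)..t, ξ s with hΞ
  have hd : ∀ t, HasDerivAt Ξ (ξ t) t := fun t =>
    (hξ.continuous.integral_hasStrictDerivAt 0 t).hasDerivAt
  have hder : deriv Ξ = ξ := funext fun t => (hd t).deriv
  have hsupp : tsupport Ξ ⊆ Icc α β := by
    refine closure_minimal ?_ isClosed_Icc
    intro t ht
    by_contra hn
    apply ht
    rcases lt_or_ge t α with h | h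
    · refine intervalIntegral.integral_zero_ae (Eventually.of_forall fun s hs => hz s ?_)
      intro hs'
      have : s ≤ max 0 t := hs.2
      exact absurd (hs'.1.trans this) (not_le.2 (max_lt hα h))
    · have hβ : β < t := by
        by_contra hb
        exact hn ⟨h, not_lt.1 hb⟩
      have : ∫ s, ξ s = ∫ s in (0 : ℝ)..t, ξ s := by
        rw [intervalIntegral.integral_of_le (hα.le.trans h)]
        refine (setIntegral_eq_integral_of_forall_compl_eq_zero fun s hs => hz s ?_).symm
        intro hs'
        exact hs ⟨hα.trans_le hs'.1, hs'.2.trans hβ.le⟩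
      exact this.symm.trans h0
  refine ⟨Ξ, ?_, HasCompactSupport.of_support_subset_isCompact isCompact_Icc
    (subset_tsupport _ |>.trans hsupp), hsupp.trans fun t ht => hα.trans_le ht.1, hder⟩
  rw [contDiff_infty_iff_deriv]
  exact ⟨fun t => (hd t).differentiableAt, hder ▸ hξ⟩

lemma exists_unit_bump : ∃ χ : ℝ → ℝ, ContDiff ℝ ∞ χ ∧ HasCompactSupport χ ∧
    tsupport χ ⊆ Ioi 0 ∧ ∫ t, χ t = 1 := by
  let b : ContDiffBump (2 : ℝ) := ⟨1 / 2, 1, by norm_num, by norm_num⟩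
  refine ⟨b.normed volume, b.contDiff_normed, b.hasCompactSupport_normed, ?_,
    b.integral_normed⟩
  rw [b.tsupport_normed_eq, Real.closedBall_eq_Icc]
  intro t ht
  have : b.rOut = 1 := rfl
  rw [this] at ht
  exact lt_of_lt_of_le (by norm_num) ht.1

lemma setIntegral_Ioi_test {χ : ℝ → ℝ} (hs : tsupport χ ⊆ Ioi 0) (w : ℝ → ℂ) :
    ∫ t in Ioi (0 : ℝ), (χ t : ℂ) * w t = ∫ t, (χ t : ℂ) * w t :=
  setIntegral_eq_integral_of_forall_compl_eq_zero fun t ht => by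
    rw [image_eq_zero_of_notMem_tsupport (fun h => ht (hs h))]; simp

lemma integrable_test_mul {χ : ℝ → ℝ} (hχ : Continuous χ) (hc : HasCompactSupport χ)
    (hs : tsupport χ ⊆ Ioi 0) {w : ℝ → ℂ} (hw : LocallyIntegrableOn w (Ioi 0)) :
    Integrable (fun t => (χ t : ℂ) * w t) := by
  have h1 : IntegrableOn w (tsupport χ) :=
    hw.integrableOn_compact_subset hs hc.isCompact
  have h2 : IntegrableOn (fun t => (χ t : ℂ) * w t) (tsupport χ) :=
    IntegrableOn.continuousOn_mul (Complex.continuous_ofReal.comp hχ).continuousOn h1 hc.isCompact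
  rwa [integrableOn_iff_integrable_of_support_subset] at h2
  intro t ht
  refine subset_tsupport _ ?_
  intro h
  apply ht
  simp [h]

/-- The lemma of du Bois-Reymond on the half-line. -/
lemma ae_const_of_isWeakDeriv_zero {w : ℝ → ℂ} (hw : LocallyIntegrableOn w (Ioi 0))
    (h : IsWeakDeriv w 0) : ∃ c : ℂ, ∀ᵐ t ∂(volume.restrict (Ioi (0 : ℝ))), w t = c := by
  obtain ⟨χ₀, h₀, hc₀, hs₀, hi₀⟩ := exists_unit_bump
  refine ⟨∫ t, (χ₀ t : ℂ) * w t, ?_⟩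
  set c : ℂ := ∫ t, (χ₀ t : ℂ) * w t with hcdef
  have hconst : LocallyIntegrableOn (fun _ : ℝ => c) (Ioi 0) :=
    (locallyIntegrable_const c).locallyIntegrableOn _
  have key := IsOpen.ae_eq_zero_of_integral_contDiff_smul_eq_zero (μ := volume)
    (f := fun t => w t - c) isOpen_Ioi (hw.sub hconst) ?_
  · rw [ae_restrict_iff' measurableSet_Ioi]
    filter_upwards [key] with t ht h't
    exact sub_eq_zero.1 (ht h't)
  · intro χ hχ hc hs
    set m : ℝ := ∫ t, χ t with hm
    have hξc : HasCompactSupport (fun t => χ t - m * χ₀ t) := hc.sub (hc₀.mul_left)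
    have hξs : tsupport (fun t => χ t - m * χ₀ t) ⊆ Ioi 0 := by
      refine (tsupport_sub _ _).trans (union_subset hs ?_)
      exact (tsupport_mul_subset_right).trans hs₀
    have hiχ : Integrable χ := hχ.continuous.integrable_of_hasCompactSupport hc
    have hiχ₀ : Integrable χ₀ := h₀.continuous.integrable_of_hasCompactSupport hc₀
    have hz : ∫ t, (χ t - m * χ₀ t) = 0 := by
      rw [integral_sub hiχ (hiχ₀.const_mul m), integral_const_mul, hi₀]
      simp [hm]
    obtain ⟨Ξ, hΞ, hΞc, hΞs, hΞd⟩ := exists_primitive (hχ.sub (contDiff_const.mul h₀)) hξc hξs hz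
    have hk := h Ξ hΞ hΞc hΞs
    rw [hΞd] at hk
    simp only [Pi.zero_apply, mul_zero, integral_zero, neg_zero] at hk
    have hk' := setIntegral_Ioi_test hξs w
    rw [hk] at hk'
    have i1 := integrable_test_mul hχ.continuous hc hs hw
    have i2 := integrable_test_mul h₀.continuous hc₀ hs₀ hw
    have e1 : (fun t => ((χ t - m * χ₀ t : ℝ) : ℂ) * w t)
        = fun t => (χ t : ℂ) * w t - (m : ℂ) * ((χ₀ t : ℂ) * w t) := by
      funext t; push_cast; ring
    rw [e1, integral_sub i1 (i2.const_mul _), integral_const_mul, ← hcdef] at hk'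
    have e2 : (fun t => χ t • (w t - c)) = fun t => (χ t : ℂ) * w t - (χ t : ℂ) * c := by
      funext t; rw [Complex.real_smul]; ring
    have i3 : Integrable (fun t => (χ t : ℂ) * c) := (hiχ.ofReal (𝕜 := ℂ)).mul_const c
    rw [e2, integral_sub i1 i3, integral_mul_const]
    have e3 : ∫ t, (χ t : ℂ) = (m : ℂ) := by rw [hm]; exact integral_ofReal
    rw [e3]
    exact hk'.symm

lemma locallyIntegrableOn_of_memLp {f : ℝ → ℂ} (hf : MemLp f 2 (volume.restrict (Ioi 0))) :
    LocallyIntegrableOn f (Ioi 0) :=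
  locallyIntegrableOn_of_locallyIntegrable_restrict (hf.locallyIntegrable (by norm_num))

lemma integrableOn_of_memLp {f : ℝ → ℂ} (hf : MemLp f 2 (volume.restrict (Ioi 0))) {S : Set ℝ}
    (hS : S ⊆ Ioi 0) (hv : volume S ≠ ⊤) : IntegrableOn f S := by
  have h1 : MemLp f 2 (volume.restrict S) := hf.mono_measure (Measure.restrict_mono hS le_rfl)
  have : IsFiniteMeasure (volume.restrict S) := ⟨by simpa using hv.lt_top⟩
  exact h1.integrable (by norm_num)

/-- The Cauchy-Schwarz inequality against an indicator function. -/
lemma norm_setIntegral_le_sqrt (f : Profile) {S : Set ℝ} (hm : MeasurableSet S)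
    (hS : S ⊆ Ioi 0) (hv : volume S ≠ ⊤) :
    ‖∫ t in S, f t‖ ≤ Real.sqrt (volume.real S) * ‖f‖ := by
  have hv' : (volume.restrict (Ioi (0 : ℝ))) S ≠ ⊤ := by
    rw [Measure.restrict_apply hm, inter_eq_left.2 hS]; exact hv
  have h1 := L2.inner_indicatorConstLp_one (𝕜 := ℂ) hm hv' f
  rw [Measure.restrict_restrict hm, inter_eq_left.2 hS] at h1
  rw [← h1]
  refine (norm_inner_le_norm _ _).trans (le_of_eq ?_)
  rw [norm_indicatorConstLp (by norm_num) (by norm_num)]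
  have : (volume.restrict (Ioi (0 : ℝ))).real S = volume.real S := by
    rw [measureReal_def, measureReal_def, Measure.restrict_apply hm, inter_eq_left.2 hS]
  rw [this, Real.sqrt_eq_rpow]
  norm_num

/-- Integration by parts for the primitive of an integrable function, against a test function
that need not vanish at `0`. -/
lemma integral_deriv_mul_primitive {h : ℝ → ℂ} (hh : MemLp h 2 (volume.restrict (Ioi 0)))
    {χ : ℝ → ℝ} (hχ : ContDiff ℝ ∞ χ) (hc : HasCompactSupport χ) (c : ℂ) :
    ∫ t in Ioi (0 : ℝ), ((deriv χ t : ℝ) : ℂ) * (c + ∫ s in (0 : ℝ)..t, h s)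
      = -((χ 0 : ℝ) : ℂ) * c - ∫ t in Ioi (0 : ℝ), (χ t : ℂ) * h t := by
  obtain ⟨T₀, hT₀⟩ := hc.isCompact.bddAbove
  set T : ℝ := max T₀ 0 + 1 with hT
  have hTpos : 0 < T := by positivity
  have hz : ∀ t, T ≤ t → χ t = 0 := fun t ht => image_eq_zero_of_notMem_tsupport fun h => by
    have h1 := hT₀ h
    have h2 := le_max_left T₀ 0
    linarith
  have hz' : ∀ t, T ≤ t → deriv χ t = 0 := fun t ht => by
    refine image_eq_zero_of_notMem_tsupport fun h => ?_
    have h1 := hT₀ (tsupport_deriv_subset h)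
    have h2 := le_max_left T₀ 0
    linarith
  have hχd : Continuous (deriv χ) := hχ.continuous_deriv (by norm_num)
  have hd : ∀ t, HasDerivAt (fun t => ((χ t : ℝ) : ℂ)) ((deriv χ t : ℝ) : ℂ) t := fun t =>
    ((hχ.differentiable (by norm_num) t).hasDerivAt).ofReal_comp
  have hftc : ∀ s, ∫ t in s..T, ((deriv χ t : ℝ) : ℂ) = -((χ s : ℝ) : ℂ) := fun s => by
    rw [intervalIntegral.integral_eq_sub_of_hasDerivAt (fun t _ => hd t)
      ((Complex.continuous_ofReal.comp hχd).intervalIntegrable _ _), hz T le_rfl]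
    simp
  have hcut : ∀ g : ℝ → ℂ, (∀ t, T ≤ t → g t = 0) →
      ∫ t in Ioi (0 : ℝ), g t = ∫ t in Ioc 0 T, g t := fun g hg => by
    refine setIntegral_eq_of_subset_of_forall_sdiff_eq_zero measurableSet_Ioi
      Ioc_subset_Ioi_self ?_
    intro t ht
    exact hg t (le_of_not_gt fun h => ht.2 ⟨ht.1, h.le⟩)
  have hhT : IntegrableOn h (Ioc 0 T) :=
    integrableOn_of_memLp hh Ioc_subset_Ioi_self (by simp)
  rw [hcut _ fun t ht => by rw [hz' t ht]; simp, hcut _ fun t ht => by rw [hz t ht]; simp]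
  have hdT : IntegrableOn (fun t => ((deriv χ t : ℝ) : ℂ)) (Ioc 0 T) :=
    (Complex.continuous_ofReal.comp hχd).integrableOn_Ioc
  set D : Set (ℝ × ℝ) := {q | q.2 ≤ q.1} with hD
  have hDm : MeasurableSet D := measurableSet_le measurable_snd measurable_fst
  have hprod : Integrable (D.indicator fun q : ℝ × ℝ => ((deriv χ q.1 : ℝ) : ℂ) * h q.2)
      ((volume.restrict (Ioc 0 T)).prod (volume.restrict (Ioc 0 T))) :=
    (Integrable.mul_prod hdT hhT).indicator hDm
  have swap := integral_integral_swap (f := fun t s =>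
    D.indicator (fun q : ℝ × ℝ => ((deriv χ q.1 : ℝ) : ℂ) * h q.2) (t, s)) hprod
  have lhs : ∀ t ∈ Ioc 0 T, ∫ s in Ioc 0 T,
      D.indicator (fun q : ℝ × ℝ => ((deriv χ q.1 : ℝ) : ℂ) * h q.2) (t, s)
      = ((deriv χ t : ℝ) : ℂ) * ∫ s in (0 : ℝ)..t, h s := fun t ht => by
    rw [intervalIntegral.integral_of_le ht.1.le, ← integral_const_mul,
      ← integral_indicator measurableSet_Ioc, ← integral_indicator measurableSet_Ioc]
    congr 1
    funext s
    by_cases hs : s ∈ Ioc 0 t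
    · rw [indicator_of_mem (show s ∈ Ioc 0 T from ⟨hs.1, hs.2.trans ht.2⟩), indicator_of_mem hs,
        indicator_of_mem (show (t, s) ∈ D from hs.2)]
    · rw [indicator_of_notMem hs]
      by_cases hs' : s ∈ Ioc 0 T
      · rw [indicator_of_mem hs', indicator_of_notMem]
        exact fun hh => hs ⟨hs'.1, hh⟩
      · rw [indicator_of_notMem hs']
  have rhs : ∀ s ∈ Ioc 0 T, ∫ t in Ioc 0 T,
      D.indicator (fun q : ℝ × ℝ => ((deriv χ q.1 : ℝ) : ℂ) * h q.2) (t, s)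
      = -((χ s : ℂ) * h s) := fun s hs => by
    have : -((χ s : ℂ) * h s) = ∫ t in Icc s T, ((deriv χ t : ℝ) : ℂ) * h s := by
      rw [integral_Icc_eq_integral_Ioc, ← intervalIntegral.integral_of_le hs.2,
        intervalIntegral.integral_mul_const, hftc]
      ring
    rw [this, ← integral_indicator measurableSet_Ioc, ← integral_indicator measurableSet_Icc]
    congr 1
    funext t
    by_cases ht : t ∈ Icc s T
    · rw [indicator_of_mem (show t ∈ Ioc 0 T from ⟨hs.1.trans_le ht.1, ht.2⟩),
        indicator_of_mem ht, indicator_of_mem (show (t, s) ∈ D from ht.1)]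
    · rw [indicator_of_notMem ht]
      by_cases ht' : t ∈ Ioc 0 T
      · rw [indicator_of_mem ht', indicator_of_notMem]
        exact fun hh => ht ⟨hh, ht'.2⟩
      · rw [indicator_of_notMem ht']
  rw [setIntegral_congr_fun measurableSet_Ioc lhs, setIntegral_congr_fun measurableSet_Ioc rhs,
    integral_neg] at swap
  have hprim : ContinuousOn (fun t => ∫ s in (0 : ℝ)..t, h s) (Icc 0 T) := by
    have := intervalIntegral.continuousOn_primitive_interval (μ := volume) (f := h) (a := 0)
      (b := T) (by
        rw [uIcc_of_le hTpos.le, integrableOn_Icc_iff_integrableOn_Ioc]; exact hhT)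
    rwa [uIcc_of_le hTpos.le] at this
  have hi2 : IntegrableOn (fun t => ((deriv χ t : ℝ) : ℂ) * ∫ s in (0 : ℝ)..t, h s) (Ioc 0 T) :=
    (ContinuousOn.integrableOn_Icc ((Complex.continuous_ofReal.comp hχd).continuousOn.mul
      hprim)).mono_set Ioc_subset_Icc_self
  simp only [mul_add]
  rw [integral_add (hdT.mul_const c) hi2, swap, integral_mul_const,
    ← intervalIntegral.integral_of_le hTpos.le, hftc]
  ring

/-- A function with a weak derivative is the primitive of that derivative. -/
lemma IsWeakDeriv.exists_primitive {f h : ℝ → ℂ} (hd : IsWeakDeriv f h)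
    (hf : MemLp f 2 (volume.restrict (Ioi 0))) (hh : MemLp h 2 (volume.restrict (Ioi 0))) :
    ∃ c : ℂ, ∀ᵐ t ∂(volume.restrict (Ioi (0 : ℝ))), f t = c + ∫ s in (0 : ℝ)..t, h s := by
  have hint : ∀ T, 0 ≤ T → IntegrableOn h (Icc 0 T) := fun T hT => by
    rw [integrableOn_Icc_iff_integrableOn_Ioc]
    exact integrableOn_of_memLp hh Ioc_subset_Ioi_self (by simp)
  have hcont : ContinuousOn (fun t => ∫ s in (0 : ℝ)..t, h s) (Ioi 0) := by
    intro t ht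
    have h1 := intervalIntegral.continuousOn_primitive_interval (μ := volume) (f := h) (a := 0)
      (b := t + 1) (by rw [uIcc_of_le (by linarith [mem_Ioi.1 ht])]; exact hint _ (by linarith [mem_Ioi.1 ht]))
    rw [uIcc_of_le (by linarith [mem_Ioi.1 ht])] at h1
    exact (h1.continuousAt (Icc_mem_nhds ht (by linarith))).continuousWithinAt
  have hw : LocallyIntegrableOn (fun t => f t - ∫ s in (0 : ℝ)..t, h s) (Ioi 0) :=
    (locallyIntegrableOn_of_memLp hf).sub (hcont.locallyIntegrableOn measurableSet_Ioi)
  suffices hwd : IsWeakDeriv (fun t => f t - ∫ s in (0 : ℝ)..t, h s) 0 by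
    obtain ⟨c, hc⟩ := ae_const_of_isWeakDeriv_zero hw hwd
    exact ⟨c, hc.mono fun t ht => by rw [← ht]; ring⟩
  · intro χ hχ hχc hχs
    have hχ' : Continuous (deriv χ) := hχ.continuous_deriv (by norm_num)
    have hs' : tsupport (deriv χ) ⊆ Ioi 0 := tsupport_deriv_subset.trans hχs
    have h1 := hd χ hχ hχc hχs
    have h2 := integral_deriv_mul_primitive hh hχ hχc 0
    have i1 := (integrable_test_mul hχ' hχc.deriv hs'
      (locallyIntegrableOn_of_memLp hf)).integrableOn (s := Ioi 0)
    have i2 := (integrable_test_mul hχ' hχc.deriv hs'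
      (hcont.locallyIntegrableOn measurableSet_Ioi)).integrableOn (s := Ioi 0)
    simp only [zero_add, mul_zero, zero_sub] at h2
    simp only [mul_sub, Pi.zero_apply, mul_zero, integral_zero, neg_zero]
    rw [integral_sub i1 i2, h1, h2, sub_self]

/-- The mean of a profile over `(ℓ, ℓ + δ)`. -/
def profileMean (ℓ δ : ℝ) (f : ℝ → ℂ) : ℂ := (δ : ℂ)⁻¹ * ∫ t in Ioo ℓ (ℓ + δ), f t

/-- The value of a profile at `ℓ`, as the limit of its means to the right of `ℓ`. It is meaningful for
profiles with a weak derivative; the limit along a sequence makes it measurable in parameters. -/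
def profileTrace (ℓ : ℝ) (f : ℝ → ℂ) : ℂ :=
  limUnder atTop fun n : ℕ => profileMean ℓ (1 / ((n : ℝ) + 1)) f

lemma norm_primitive_sub_le {h : ℝ → ℂ} (hh : MemLp h 2 (volume.restrict (Ioi 0))) {ℓ t : ℝ}
    (hℓ : 0 ≤ ℓ) (ht : ℓ ≤ t) :
    ‖(∫ s in (0 : ℝ)..t, h s) - ∫ s in (0 : ℝ)..ℓ, h s‖ ≤ Real.sqrt (t - ℓ) * ‖hh.toLp h‖ := by
  have hi : ∀ x, 0 ≤ x → IntervalIntegrable h volume 0 x := fun x hx => by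
    rw [intervalIntegrable_iff_integrableOn_Ioc_of_le hx]
    exact integrableOn_of_memLp hh Ioc_subset_Ioi_self (by simp)
  rw [intervalIntegral.integral_interval_sub_left (hi t (hℓ.trans ht)) (hi ℓ hℓ),
    intervalIntegral.integral_of_le ht]
  have hsub : Ioc ℓ t ⊆ Ioi 0 := fun s hs => lt_of_le_of_lt hℓ hs.1
  have h1 : ∫ s in Ioc ℓ t, h s = ∫ s in Ioc ℓ t, (hh.toLp h) s := by
    refine integral_congr_ae ?_
    filter_upwards [ae_restrict_of_ae_restrict_of_subset hsub hh.coeFn_toLp] with s hs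
    exact hs.symm
  rw [h1]
  refine (norm_setIntegral_le_sqrt _ measurableSet_Ioc hsub (by simp)).trans (le_of_eq ?_)
  rw [Real.volume_real_Ioc_of_le ht]

lemma norm_profileMean_sub_le {h f : ℝ → ℂ} (hf : MemLp f 2 (volume.restrict (Ioi 0)))
    (hh : MemLp h 2 (volume.restrict (Ioi 0))) {c : ℂ}
    (hc : ∀ᵐ t ∂(volume.restrict (Ioi (0 : ℝ))), f t = c + ∫ s in (0 : ℝ)..t, h s)
    {ℓ δ : ℝ} (hℓ : 0 ≤ ℓ) (hδ : 0 < δ) :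
    ‖profileMean ℓ δ f - (c + ∫ s in (0 : ℝ)..ℓ, h s)‖ ≤ Real.sqrt δ * ‖hh.toLp h‖ := by
  set u := c + ∫ s in (0 : ℝ)..ℓ, h s with hu
  have hsub : Ioo ℓ (ℓ + δ) ⊆ Ioi 0 := fun s hs => lt_of_le_of_lt hℓ hs.1
  have hv : volume (Ioo ℓ (ℓ + δ)) = ENNReal.ofReal δ := by simp
  have hδ' : (δ : ℂ) ≠ 0 := by exact_mod_cast hδ.ne'
  have e : profileMean ℓ δ f - u = (δ : ℂ)⁻¹ * ∫ t in Ioo ℓ (ℓ + δ), (f t - u) := by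
    rw [integral_sub (integrableOn_of_memLp hf hsub (by simp)) (integrable_const _)]
    simp only [profileMean, integral_const, MeasurableSet.univ, measureReal_restrict_apply,
      univ_inter, Real.volume_real_Ioo_of_le (by linarith : ℓ ≤ ℓ + δ), Complex.real_smul]
    rw [mul_sub, ← mul_assoc]
    congr 1
    rw [show ℓ + δ - ℓ = δ by ring, inv_mul_cancel₀ hδ', one_mul]
  rw [e, norm_mul, norm_inv, Complex.norm_real, Real.norm_of_nonneg hδ.le]
  have hb : ‖∫ t in Ioo ℓ (ℓ + δ), (f t - u)‖ ≤
      (Real.sqrt δ * ‖hh.toLp h‖) * volume.real (Ioo ℓ (ℓ + δ)) := by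
    refine norm_setIntegral_le_of_norm_le_const_ae' (by simp) ?_
    have h1 := ae_restrict_of_ae_restrict_of_subset hsub hc
    rw [ae_restrict_iff' measurableSet_Ioo] at h1
    filter_upwards [h1] with t ht hmem
    rw [ht hmem, hu, add_sub_add_left_eq_sub]
    refine (norm_primitive_sub_le hh hℓ hmem.1.le).trans ?_
    gcongr
    linarith [hmem.2]
  rw [Real.volume_real_Ioo_of_le (by linarith : ℓ ≤ ℓ + δ), show ℓ + δ - ℓ = δ by ring] at hb
  calc δ⁻¹ * _ ≤ δ⁻¹ * (Real.sqrt δ * ‖hh.toLp h‖ * δ) := by gcongr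
    _ = _ := by field_simp

lemma profileTrace_eq {h f : ℝ → ℂ} (hf : MemLp f 2 (volume.restrict (Ioi 0)))
    (hh : MemLp h 2 (volume.restrict (Ioi 0))) {c : ℂ}
    (hc : ∀ᵐ t ∂(volume.restrict (Ioi (0 : ℝ))), f t = c + ∫ s in (0 : ℝ)..t, h s)
    {ℓ : ℝ} (hℓ : 0 ≤ ℓ) : profileTrace ℓ f = c + ∫ s in (0 : ℝ)..ℓ, h s := by
  refine Tendsto.limUnder_eq ?_
  rw [tendsto_iff_norm_sub_tendsto_zero]
  refine squeeze_zero (fun _ => norm_nonneg _)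
    (fun n => norm_profileMean_sub_le hf hh hc hℓ (by positivity)) ?_
  have h1 : Tendsto (fun n : ℕ => Real.sqrt (1 / ((n : ℝ) + 1))) atTop (𝓝 0) := by
    have := (Real.continuous_sqrt.tendsto 0).comp (tendsto_one_div_add_atTop_nhds_zero_nat (𝕜 := ℝ))
    simpa [Function.comp_def] using this
  simpa using h1.mul_const ‖hh.toLp h‖

lemma IsWeakDeriv.norm_profileMean_sub_profileTrace_le {f h : Profile} (hd : IsWeakDeriv f h)
    {ℓ δ : ℝ} (hℓ : 0 ≤ ℓ) (hδ : 0 < δ) :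
    ‖profileMean ℓ δ f - profileTrace ℓ f‖ ≤ Real.sqrt δ * ‖h‖ := by
  obtain ⟨c, hc⟩ := hd.exists_primitive (Lp.memLp f) (Lp.memLp h)
  rw [profileTrace_eq (Lp.memLp f) (Lp.memLp h) hc hℓ]
  simpa using norm_profileMean_sub_le (Lp.memLp f) (Lp.memLp h) hc hℓ hδ

lemma IsWeakDeriv.integral_test {f h : Profile} (hd : IsWeakDeriv f h)
    {χ : ℝ → ℝ} (hχ : ContDiff ℝ ∞ χ) (hc : HasCompactSupport χ) :
    ∫ t in Ioi (0 : ℝ), ((deriv χ t : ℝ) : ℂ) * f t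
      = -((χ 0 : ℝ) : ℂ) * profileTrace 0 f - ∫ t in Ioi (0 : ℝ), (χ t : ℂ) * h t := by
  obtain ⟨c, hc'⟩ := hd.exists_primitive (Lp.memLp f) (Lp.memLp h)
  rw [profileTrace_eq (Lp.memLp f) (Lp.memLp h) hc' le_rfl, intervalIntegral.integral_same,
    add_zero, ← integral_deriv_mul_primitive (Lp.memLp h) hχ hc]
  refine integral_congr_ae ?_
  filter_upwards [hc'] with t ht
  rw [ht]

lemma norm_profileMean_le (f : Profile) {ℓ δ : ℝ} (hℓ : 0 ≤ ℓ) (hδ : 0 < δ) :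
    ‖profileMean ℓ δ f‖ ≤ (Real.sqrt δ)⁻¹ * ‖f‖ := by
  have hsub : Ioo ℓ (ℓ + δ) ⊆ Ioi 0 := fun s hs => lt_of_le_of_lt hℓ hs.1
  have := norm_setIntegral_le_sqrt f measurableSet_Ioo hsub (by simp)
  rw [Real.volume_real_Ioo_of_le (by linarith : ℓ ≤ ℓ + δ), show ℓ + δ - ℓ = δ by ring] at this
  rw [profileMean, norm_mul, norm_inv, Complex.norm_real, Real.norm_of_nonneg hδ.le]
  calc δ⁻¹ * _ ≤ δ⁻¹ * (Real.sqrt δ * ‖f‖) := by gcongr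
    _ = _ := by
      have h := Real.mul_self_sqrt hδ.le
      have : Real.sqrt δ ≠ 0 := (Real.sqrt_pos.2 hδ).ne'
      nth_rw 1 [← h]
      field_simp

/-- The trace inequality with the scaling parameter `s`. -/
lemma IsWeakDeriv.norm_profileTrace_le {f h : Profile} (hd : IsWeakDeriv f h)
    {ℓ s : ℝ} (hℓ : 0 ≤ ℓ) (hs : 0 < s) :
    ‖profileTrace ℓ f‖ ≤ Real.sqrt s * (‖f‖ + ‖h‖ / s) := by
  have h1 := hd.norm_profileMean_sub_profileTrace_le hℓ (inv_pos.2 hs)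
  have h2 := norm_profileMean_le f hℓ (inv_pos.2 hs)
  have h3 : ‖profileTrace ℓ f‖ ≤ ‖profileMean ℓ s⁻¹ f‖ + ‖profileMean ℓ s⁻¹ f - profileTrace ℓ f‖ := by
    have := norm_sub_le (profileMean ℓ s⁻¹ f) (profileMean ℓ s⁻¹ f - profileTrace ℓ f)
    simpa using this
  refine h3.trans ((add_le_add h2 h1).trans (le_of_eq ?_))
  rw [Real.sqrt_inv, inv_inv, mul_add]
  congr 1
  have h := Real.mul_self_sqrt hs.le
  have : Real.sqrt s ≠ 0 := (Real.sqrt_pos.2 hs).ne'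
  nth_rw 3 [← h]
  field_simp

/-- Solutions of `f' = m f`. -/
lemma IsWeakDeriv.eq_exp {f : ℝ → ℂ} (hf : MemLp f 2 (volume.restrict (Ioi 0))) {m : ℝ}
    (hd : IsWeakDeriv f fun t => m * f t) :
    ∃ c : ℂ, ∀ᵐ t ∂(volume.restrict (Ioi (0 : ℝ))), f t = c * Real.exp (m * t) := by
  have hexp : ContDiff ℝ ∞ (fun t : ℝ => Real.exp (-(m * t))) := by fun_prop
  have hloc := locallyIntegrableOn_of_memLp hf
  have hw : LocallyIntegrableOn (fun t => (Real.exp (-(m * t)) : ℂ) * f t) (Ioi 0) :=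
    hloc.continuousOn_mul (Complex.continuous_ofReal.comp hexp.continuous).continuousOn
      isOpen_Ioi.isLocallyClosed
  suffices hwd : IsWeakDeriv (fun t => (Real.exp (-(m * t)) : ℂ) * f t) 0 by
    obtain ⟨c, hc⟩ := ae_const_of_isWeakDeriv_zero hw hwd
    refine ⟨c, hc.mono fun t ht => ?_⟩
    rw [← ht, Real.exp_neg]
    have : (Real.exp (m * t) : ℂ) ≠ 0 := by exact_mod_cast (Real.exp_pos _).ne'
    push_cast at this ⊢
    field_simp
  · intro χ hχ hχc hχs
    have hp : ContDiff ℝ ∞ fun t => χ t * Real.exp (-(m * t)) := hχ.mul hexp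
    have hps : tsupport (fun t => χ t * Real.exp (-(m * t))) ⊆ Ioi 0 :=
      (tsupport_mul_subset_left).trans hχs
    have h1 := hd _ hp hχc.mul_right hps
    have hder : ∀ t, deriv (fun t => χ t * Real.exp (-(m * t))) t
        = deriv χ t * Real.exp (-(m * t)) - m * (χ t * Real.exp (-(m * t))) := fun t => by
      have e1 : HasDerivAt χ (deriv χ t) t := (hχ.differentiable (by norm_num) t).hasDerivAt
      have e2 : HasDerivAt (fun t : ℝ => Real.exp (-(m * t))) (Real.exp (-(m * t)) * (-(m * 1))) t :=
        (((hasDerivAt_id t).const_mul m).neg).exp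
      refine (e1.mul e2).deriv.trans ?_
      ring
    have hχ' : Continuous (deriv χ) := hχ.continuous_deriv (by norm_num)
    have hs' : tsupport (deriv χ) ⊆ Ioi 0 := tsupport_deriv_subset.trans hχs
    have i1 := (integrable_test_mul hχ' hχc.deriv hs' hw).integrableOn (s := Ioi 0)
    have i2 := ((integrable_test_mul hχ.continuous hχc hχs hw).const_mul (m : ℂ)).integrableOn
      (s := Ioi 0)
    have e3 : (fun t => ((deriv (fun t => χ t * Real.exp (-(m * t))) t : ℝ) : ℂ) * f t)
        = fun t => ((deriv χ t : ℝ) : ℂ) * ((Real.exp (-(m * t)) : ℂ) * f t)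
          - (m : ℂ) * ((χ t : ℂ) * ((Real.exp (-(m * t)) : ℂ) * f t)) := by
      funext t
      rw [hder]
      push_cast
      ring
    have e4 : (fun t => ((χ t * Real.exp (-(m * t)) : ℝ) : ℂ) * (m * f t))
        = fun t => (m : ℂ) * ((χ t : ℂ) * ((Real.exp (-(m * t)) : ℂ) * f t)) := by
      funext t
      push_cast
      ring
    rw [e3, e4, integral_sub i1 i2] at h1
    simp only [Pi.zero_apply, mul_zero, integral_zero, neg_zero]
    linear_combination h1

/-! ### Exponential profiles -/

lemma integrableOn_exp_neg {r : ℝ} (hr : 0 < r) :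
    IntegrableOn (fun t => Real.exp (-(r * t))) (Ioi 0) := by
  have := integrableOn_exp_mul_Ioi (a := -r) (by linarith) 0
  simpa [neg_mul] using this

lemma memLp_exp {lam : ℝ} (hl : 0 < lam) :
    MemLp (fun t : ℝ => (Real.exp (-(lam * t)) : ℂ)) 2 (volume.restrict (Ioi 0)) := by
  rw [memLp_two_iff_integrable_sq_norm
    (by exact (Complex.continuous_ofReal.comp (by fun_prop)).aestronglyMeasurable)]
  have := integrableOn_exp_neg (r := 2 * lam) (by linarith)
  refine this.congr (Eventually.of_forall fun t => ?_)
  simp only [Complex.norm_real, Real.norm_of_nonneg (Real.exp_pos _).le]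
  rw [← Real.exp_nat_mul]
  congr 1
  push_cast
  ring

/-- The profile `e^{-λ t}` (zero for `λ ≤ 0`, where it is not square integrable). -/
def expProfile (lam : ℝ) : Profile :=
  if h : 0 < lam then (memLp_exp h).toLp _ else 0

lemma expProfile_ae {lam : ℝ} (hl : 0 < lam) :
    expProfile lam =ᵐ[volume.restrict (Ioi 0)] fun t => (Real.exp (-(lam * t)) : ℂ) := by
  rw [expProfile, dif_pos hl]
  exact (memLp_exp hl).coeFn_toLp

lemma norm_expProfile_sq {lam : ℝ} (hl : 0 < lam) : ‖expProfile lam‖ ^ 2 = (2 * lam)⁻¹ := by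
  have h1 := L2.inner_def (𝕜 := ℂ) (expProfile lam) (expProfile lam)
  have h2 : ∫ t in Ioi (0 : ℝ), inner ℂ (expProfile lam t) (expProfile lam t)
      = ((∫ t in Ioi (0 : ℝ), Real.exp (-(2 * lam) * t) : ℝ) : ℂ) := by
    rw [← integral_complex_ofReal]
    refine integral_congr_ae ?_
    filter_upwards [expProfile_ae hl] with t ht
    rw [ht, RCLike.inner_apply, Complex.conj_ofReal, ← Complex.ofReal_mul, ← Real.exp_add]
    congr 2
    ring
  rw [h2, integral_exp_mul_Ioi (by linarith) 0, inner_self_eq_norm_sq_to_K] at h1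
  have h3 : ((‖expProfile lam‖ ^ 2 : ℝ) : ℂ) = ((-Real.exp (-(2 * lam) * 0) / -(2 * lam) : ℝ) : ℂ) := by
    rw [← h1]; push_cast; rfl
  rw [Complex.ofReal_inj.1 h3]
  simp

lemma norm_smul_expProfile_sq {lam : ℝ} (hl : 0 < lam) (c : ℂ) :
    ‖c • expProfile lam‖ ^ 2 = ‖c‖ ^ 2 / (2 * lam) := by
  rw [norm_smul, mul_pow, norm_expProfile_sq hl, div_eq_mul_inv]

lemma continuous_expProfile_comp {α : Type*} [TopologicalSpace α] {lam : α → ℝ}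
    (hc : Continuous lam) (hp : ∀ x, 0 < lam x) : Continuous fun x => expProfile (lam x) := by
  -- `‖e^{-λt} - e^{-μt}‖² = 1/(2λ) + 1/(2μ) - 2/(λ+μ)`
  have hin : ∀ l m : ℝ, 0 < l → 0 < m → inner ℂ (expProfile l) (expProfile m)
      = (((l + m)⁻¹ : ℝ) : ℂ) := fun l m hl hm => by
    rw [L2.inner_def]
    have h2 : ∫ t in Ioi (0 : ℝ), inner ℂ (expProfile l t) (expProfile m t)
        = ((∫ t in Ioi (0 : ℝ), Real.exp (-(l + m) * t) : ℝ) : ℂ) := by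
      rw [← integral_complex_ofReal]
      refine integral_congr_ae ?_
      filter_upwards [expProfile_ae hl, expProfile_ae hm] with t ht ht'
      rw [ht, ht', RCLike.inner_apply, Complex.conj_ofReal, ← Complex.ofReal_mul, ← Real.exp_add]
      congr 2
      ring
    rw [h2, integral_exp_mul_Ioi (by linarith) 0, mul_zero, Real.exp_zero, neg_div_neg_eq, one_div]
  rw [continuous_iff_continuousAt]
  intro x
  rw [ContinuousAt, tendsto_iff_norm_sub_tendsto_zero]
  have hsq : ∀ z, ‖expProfile (lam z) - expProfile (lam x)‖
      = Real.sqrt ((2 * lam z)⁻¹ - 2 * (lam z + lam x)⁻¹ + (2 * lam x)⁻¹) := fun z => by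
    rw [← Real.sqrt_sq (norm_nonneg _), @norm_sub_sq ℂ, hin _ _ (hp z) (hp x),
      norm_expProfile_sq (hp z), norm_expProfile_sq (hp x)]
    rfl
  have hlim : Tendsto (fun z => Real.sqrt ((2 * lam z)⁻¹ - 2 * (lam z + lam x)⁻¹ + (2 * lam x)⁻¹))
      (𝓝 x) (𝓝 (Real.sqrt ((2 * lam x)⁻¹ - 2 * (lam x + lam x)⁻¹ + (2 * lam x)⁻¹))) := by
    have hx := hp x
    refine (Real.continuous_sqrt.tendsto _).comp (((Tendsto.inv₀ ?_ (by positivity)).sub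
      (Tendsto.const_mul 2 (Tendsto.inv₀ ?_ (by positivity)))).add tendsto_const_nhds)
    · exact (hc.tendsto x).const_mul 2
    · exact (hc.tendsto x).add_const _
  have h0 : (2 * lam x)⁻¹ - 2 * (lam x + lam x)⁻¹ + (2 * lam x)⁻¹ = 0 := by
    rw [← two_mul (lam x)]; ring
  rw [h0, Real.sqrt_zero] at hlim
  exact hlim.congr fun z => (hsq z).symm

lemma IsWeakDeriv.congr {f f' h h' : ℝ → ℂ} (hd : IsWeakDeriv f h)
    (hf : f =ᵐ[volume.restrict (Ioi 0)] f') (hh : h =ᵐ[volume.restrict (Ioi 0)] h') :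
    IsWeakDeriv f' h' := by
  intro χ h1 h2 h3
  have e1 : ∫ t in Ioi (0 : ℝ), ((deriv χ t : ℝ) : ℂ) * f' t
      = ∫ t in Ioi (0 : ℝ), ((deriv χ t : ℝ) : ℂ) * f t :=
    integral_congr_ae (hf.mono fun t ht => by simp only [ht])
  have e2 : ∫ t in Ioi (0 : ℝ), (χ t : ℂ) * h' t = ∫ t in Ioi (0 : ℝ), (χ t : ℂ) * h t :=
    integral_congr_ae (hh.mono fun t ht => by simp only [ht])
  rw [e1, e2, hd χ h1 h2 h3]

/-- The graph of the weak derivative in `L²(0, ∞)`. -/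
def weakDerivGraph : Submodule ℂ (Profile × Profile) where
  carrier := {q | IsWeakDeriv q.1 q.2}
  zero_mem' := by
    refine IsWeakDeriv.congr (f := 0) (h := 0) ?_ (Lp.coeFn_zero _ _ _).symm
      (Lp.coeFn_zero _ _ _).symm
    intro χ _ _ _
    simp
  add_mem' := by
    rintro ⟨f, h⟩ ⟨f', h'⟩ h1 h2
    refine IsWeakDeriv.congr (f := f + f') (h := h + h') ?_ (Lp.coeFn_add _ _).symm
      (Lp.coeFn_add _ _).symm
    intro χ hχ hc hs
    have hs' : tsupport (deriv χ) ⊆ Ioi 0 := tsupport_deriv_subset.trans hs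
    have hχ' : Continuous (deriv χ) := hχ.continuous_deriv (by norm_num)
    have i1 := fun g : Profile => (integrable_test_mul hχ' hc.deriv hs'
      (locallyIntegrableOn_of_memLp (Lp.memLp g))).integrableOn (s := Ioi 0)
    have i2 := fun g : Profile => (integrable_test_mul hχ.continuous hc hs
      (locallyIntegrableOn_of_memLp (Lp.memLp g))).integrableOn (s := Ioi 0)
    simp only [Pi.add_apply, mul_add]
    rw [integral_add (i1 f) (i1 f'), integral_add (i2 h) (i2 h'), h1 χ hχ hc hs, h2 χ hχ hc hs]
    ring
  smul_mem' := by
    rintro c ⟨f, h⟩ h1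
    refine IsWeakDeriv.congr (f := c • ⇑f) (h := c • ⇑h) ?_ (Lp.coeFn_smul _ _).symm
      (Lp.coeFn_smul _ _).symm
    intro χ hχ hc hs
    simp only [Pi.smul_apply, smul_eq_mul, mul_left_comm _ c]
    rw [integral_const_mul, integral_const_mul, h1 χ hχ hc hs]
    ring

lemma mem_weakDerivGraph {f h : Profile} : (f, h) ∈ weakDerivGraph ↔ IsWeakDeriv f h := Iff.rfl

lemma weakDeriv_eq_exp {f : Profile} {m : ℝ} (h : (f, (m : ℂ) • f) ∈ weakDerivGraph) :
    ∃ c : ℂ, ∀ᵐ t ∂(volume.restrict (Ioi (0 : ℝ))), f t = c * Real.exp (m * t) := by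
  refine IsWeakDeriv.eq_exp (Lp.memLp f) (m := m) ?_
  refine IsWeakDeriv.congr (mem_weakDerivGraph.1 h) ae_eq_rfl ?_
  filter_upwards [Lp.coeFn_smul (m : ℂ) f] with t ht
  rw [ht]; rfl

/-- Growing exponentials are not square integrable. -/
lemma eq_zero_of_weakDeriv_pos {f : Profile} {m : ℝ} (hm : 0 < m)
    (h : (f, (m : ℂ) • f) ∈ weakDerivGraph) : f = 0 := by
  obtain ⟨c, hc⟩ := weakDeriv_eq_exp h
  have hc0 : c = 0 := by
    by_contra hne
    have h1 : MemLp (fun t : ℝ => c * (Real.exp (m * t) : ℂ)) 2 (volume.restrict (Ioi 0)) :=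
      (memLp_congr_ae hc).1 (Lp.memLp f)
    have h2 := h1.const_mul c⁻¹
    have h3 : MemLp (fun _ : ℝ => (1 : ℂ)) 2 (volume.restrict (Ioi (0 : ℝ))) := by
      refine h2.mono aestronglyMeasurable_const ?_
      rw [ae_restrict_iff' measurableSet_Ioi]
      refine Eventually.of_forall fun t ht => ?_
      rw [← mul_assoc, inv_mul_cancel₀ hne, one_mul, norm_one, Complex.norm_real,
        Real.norm_of_nonneg (Real.exp_pos _).le]
      exact Real.one_le_exp (mul_pos hm ht).le
    rw [memLp_const_iff (by norm_num) (by norm_num)] at h3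
    simp at h3
  rw [Lp.eq_zero_iff_ae_eq_zero]
  filter_upwards [hc] with t ht
  simp [ht, hc0]

lemma profileMean_congr {f g : ℝ → ℂ} (h : f =ᵐ[volume.restrict (Ioi 0)] g) {ℓ : ℝ} (hℓ : 0 ≤ ℓ)
    (δ : ℝ) : profileMean ℓ δ f = profileMean ℓ δ g := by
  have hsub : Ioo ℓ (ℓ + δ) ⊆ Ioi 0 := fun s hs => lt_of_le_of_lt hℓ hs.1
  rw [profileMean, profileMean, integral_congr_ae (ae_restrict_of_ae_restrict_of_subset hsub h)]

lemma profileTrace_congr {f g : ℝ → ℂ} (h : f =ᵐ[volume.restrict (Ioi 0)] g) {ℓ : ℝ} (hℓ : 0 ≤ ℓ) :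
    profileTrace ℓ f = profileTrace ℓ g := by
  simp only [profileTrace, profileMean_congr h hℓ]

lemma profileTrace_of_continuous {f : ℝ → ℂ} (hf : Continuous f) (ℓ : ℝ) :
    profileTrace ℓ f = f ℓ := by
  refine Tendsto.limUnder_eq ?_
  have h1 : HasDerivAt (fun t => ∫ s in ℓ..t, f s) (f ℓ) ℓ :=
    (hf.integral_hasStrictDerivAt ℓ ℓ).hasDerivAt
  have h2 := h1.tendsto_slope_zero_right
  have h3 : Tendsto (fun n : ℕ => 1 / ((n : ℝ) + 1)) atTop (𝓝[>] 0) := by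
    refine tendsto_nhdsWithin_iff.2 ⟨tendsto_one_div_add_atTop_nhds_zero_nat, ?_⟩
    exact Eventually.of_forall fun n => by simp only [mem_Ioi]; positivity
  refine (h2.comp h3).congr fun n => ?_
  have hp : (0 : ℝ) < 1 / ((n : ℝ) + 1) := by positivity
  simp only [Function.comp, intervalIntegral.integral_same, sub_zero, profileMean]
  rw [intervalIntegral.integral_of_le (by linarith), integral_Ioc_eq_integral_Ioo,
    Complex.real_smul, Complex.ofReal_inv]

lemma profileTrace_smul_exp {lam : ℝ} (hl : 0 < lam) (c : ℂ) {ℓ : ℝ} (hℓ : 0 ≤ ℓ) :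
    profileTrace ℓ (c • expProfile lam : Profile) = c * Real.exp (-(lam * ℓ)) := by
  have h : (c • expProfile lam : Profile) =ᵐ[volume.restrict (Ioi 0)]
      fun t => c * (Real.exp (-(lam * t)) : ℂ) := by
    filter_upwards [Lp.coeFn_smul c (expProfile lam), expProfile_ae hl] with t h1 h2
    rw [h1, Pi.smul_apply, h2, smul_eq_mul]
  rw [profileTrace_congr h hℓ, profileTrace_of_continuous]
  exact continuous_const.mul (Complex.continuous_ofReal.comp (by fun_prop))

lemma eq_smul_exp_of_weakDeriv {f : Profile} {lam : ℝ} (hl : 0 < lam)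
    (h : (f, (-lam : ℂ) • f) ∈ weakDerivGraph) : f = profileTrace 0 f • expProfile lam := by
  obtain ⟨c, hc⟩ := weakDeriv_eq_exp (f := f) (m := -lam) (by push_cast; exact h)
  have h2 : f = c • expProfile lam := by
    refine Lp.ext ?_
    filter_upwards [hc, Lp.coeFn_smul c (expProfile lam), expProfile_ae hl] with t h1 h2 h3
    rw [h1, h2, Pi.smul_apply, h3, smul_eq_mul, neg_mul]
  have h3 : profileTrace 0 f = c := by
    rw [h2, profileTrace_smul_exp hl c le_rfl]; simp
  rw [h3]
  exact h2

/-- A classical derivative on `(0, ∞)` is a weak one. -/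
lemma isWeakDeriv_of_hasDerivAt {f h : ℝ → ℂ} (hd : ∀ t, 0 < t → HasDerivAt f (h t) t)
    (hh : MemLp h 2 (volume.restrict (Ioi 0))) : IsWeakDeriv f h := by
  intro χ hχ hc hs
  have hfc : ContinuousOn f (Ioi 0) := fun t ht => (hd t ht).continuousAt.continuousWithinAt
  have hχ' : Continuous (deriv χ) := hχ.continuous_deriv (by norm_num)
  have hs' : tsupport (deriv χ) ⊆ Ioi 0 := tsupport_deriv_subset.trans hs
  have hfl : LocallyIntegrableOn f (Ioi 0) := hfc.locallyIntegrableOn measurableSet_Ioi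
  have i0 := integrable_test_mul hχ.continuous hc hs hfl
  have i1 := integrable_test_mul hχ' hc.deriv hs' hfl
  have i2 := integrable_test_mul hχ.continuous hc hs (locallyIntegrableOn_of_memLp hh)
  have hder : ∀ t, HasDerivAt (fun t => (χ t : ℂ) * f t)
      (((deriv χ t : ℝ) : ℂ) * f t + (χ t : ℂ) * h t) t := fun t => by
    by_cases ht : t ∈ tsupport χ
    · exact (((hχ.differentiable (by norm_num) t).hasDerivAt).ofReal_comp).mul (hd t (hs ht))
    · have hz : χ =ᶠ[𝓝 t] 0 := notMem_tsupport_iff_eventuallyEq.1 ht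
      have h1 : (fun t => (χ t : ℂ) * f t) =ᶠ[𝓝 t] fun _ => 0 :=
        hz.mono fun s hs => by simp [hs]
      have h2 : deriv χ t = 0 := by rw [hz.deriv_eq]; simp
      rw [h2, image_eq_zero_of_notMem_tsupport ht]
      simpa using (hasDerivAt_const t (0 : ℂ)).congr_of_eventuallyEq h1
  have := integral_eq_zero_of_hasDerivAt_of_integrable hder (i1.add i2) i0
  rw [integral_add i1 i2] at this
  rw [setIntegral_Ioi_test hs' f, setIntegral_Ioi_test hs h]
  linear_combination this

/-! ### Slices of square integrable functions -/

/-- The plane of the variables `(y, z)`. -/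
abbrev Plane : Type := EuclideanSpace ℝ (Fin 2)

/-- Lebesgue measure on `(0, ∞)`. -/
abbrev halfLine : Measure ℝ := volume.restrict (Ioi (0 : ℝ))

instance secondCountable_profile : SecondCountableTopology Profile :=
  haveI : Fact ((2 : ENNReal) ≠ ⊤) := ⟨by norm_num⟩
  inferInstance

/-- In a separable space, measurability follows from that of the distances to all points: preimages of
open sets are described by the distance to a countable dense subset of the complement. -/
lemma measurable_of_measurable_edist {α X : Type*} [MeasurableSpace α] [PseudoEMetricSpace X]
    [SecondCountableTopology X] [MeasurableSpace X] [BorelSpace X] {f : α → X}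
    (h : ∀ x, Measurable fun a => edist (f a) x) : Measurable f := by
  refine measurable_of_isOpen fun U hU => ?_
  obtain ⟨D, hDs, hDc, hDd⟩ := (TopologicalSpace.IsSeparable.of_separableSpace
    (Uᶜ : Set X)).exists_countable_dense_subset
  have h1 : Measurable fun a => Metric.infEDist (f a) D :=
    Measurable.biInf D hDc fun x _ => h x
  have h2 : f ⁻¹' U = (fun a => Metric.infEDist (f a) D) ⁻¹' (Ioi 0) := by
    ext a
    have hcl : closure D = Uᶜ := (closure_minimal hDs hU.isClosed_compl).antisymm hDd
    simp [Metric.infEDist_pos_iff_notMem_closure, hcl]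
  rw [h2]
  exact h1 measurableSet_Ioi

lemma eLpNorm_two_sq {α E : Type*} [MeasurableSpace α] [NormedAddCommGroup E] (f : α → E)
    (μ : Measure α) : eLpNorm f 2 μ ^ 2 = ∫⁻ x, ‖f x‖ₑ ^ 2 ∂μ := by
  have := eLpNorm_nnreal_pow_eq_lintegral (f := f) (μ := μ) (p := 2) (by norm_num)
  simpa using this

/-- `G y` is the class of `f(y, ·)` for almost every `y`. -/
def IsSlice (f : Plane × ℝ → ℂ) (G : Plane → Profile) : Prop :=
  ∀ᵐ y, (G y : ℝ → ℂ) =ᵐ[halfLine] fun t => f (y, t)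

lemma IsSlice.eLpNorm_eq {f : Plane × ℝ → ℂ} {G : Plane → Profile} (h : IsSlice f G)
    (hf : AEStronglyMeasurable f (volume.prod halfLine)) :
    eLpNorm G 2 volume ^ 2 = eLpNorm f 2 (volume.prod halfLine) ^ 2 := by
  rw [eLpNorm_two_sq, eLpNorm_two_sq, lintegral_prod _ (hf.enorm.pow_const 2)]
  refine lintegral_congr_ae ?_
  filter_upwards [h] with y hy
  rw [Lp.enorm_def, eLpNorm_congr_ae hy, eLpNorm_two_sq]

/-- The measurability of the slices as a function with values in `L²(0, ∞)` reduces, by separability,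
to that of their distances to fixed profiles. -/
lemma exists_isSlice {f : Plane × ℝ → ℂ} (hf : MemLp f 2 (volume.prod halfLine)) :
    ∃ G : Lp Profile 2 (volume : Measure Plane), IsSlice f G := by
  classical
  set f' := hf.1.mk f with hf'def
  have hsm : StronglyMeasurable f' := hf.1.stronglyMeasurable_mk
  have hff' : ∀ᵐ y, ∀ᵐ t ∂halfLine, f (y, t) = f' (y, t) :=
    Measure.ae_ae_of_ae_prod hf.1.ae_eq_mk
  have hf'L : MemLp f' 2 (volume.prod halfLine) := hf.ae_eq hf.1.ae_eq_mk
  have hslice : ∀ y, StronglyMeasurable fun t => f' (y, t) := fun y =>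
    hsm.comp_measurable measurable_prodMk_left
  set N : Set Plane := {y | ∫⁻ t, ‖f' (y, t)‖ₑ ^ 2 ∂halfLine < ⊤} with hN
  have hNm : MeasurableSet N := measurableSet_lt
    (Measurable.lintegral_prod_right' (f := fun q => ‖f' q‖ₑ ^ 2) (by fun_prop)) measurable_const
  have hmem : ∀ y, y ∈ N ↔ MemLp (fun t => f' (y, t)) 2 halfLine := fun y => by
    have : y ∈ N ↔ eLpNorm (fun t => f' (y, t)) 2 halfLine ^ 2 < ⊤ := by
      rw [eLpNorm_two_sq]; rfl
    rw [this, ENNReal.pow_lt_top_iff]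
    simp only [OfNat.ofNat_ne_zero, or_false]
    exact ⟨fun h => ⟨(hslice y).aestronglyMeasurable, h⟩, fun h => h.2⟩
  set G : Plane → Profile := fun y =>
    if h : MemLp (fun t => f' (y, t)) 2 halfLine then h.toLp _ else 0 with hG
  have hGm : AEStronglyMeasurable G volume := by
    borelize Profile
    refine (Measurable.stronglyMeasurable ?_).aestronglyMeasurable
    refine measurable_of_measurable_edist fun θ => ?_
    have hθ := Lp.stronglyMeasurable θ
    have h1 : Measurable fun y => (∫⁻ t, ‖f' (y, t) - θ t‖ₑ ^ 2 ∂halfLine) ^ (1 / 2 : ℝ) := by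
      refine (Measurable.lintegral_prod_right' (f := fun q : Plane × ℝ => ‖f' q - θ q.2‖ₑ ^ 2)
        ?_).pow_const _
      exact ((hsm.sub (hθ.comp_measurable measurable_snd)).enorm).pow_const 2
    have h2 : (fun y => edist (G y) θ) = fun y => if y ∈ N then
        (∫⁻ t, ‖f' (y, t) - θ t‖ₑ ^ 2 ∂halfLine) ^ (1 / 2 : ℝ) else edist 0 θ := by
      funext y
      by_cases hy : y ∈ N
      · have hy' := (hmem y).1 hy
        rw [if_pos hy]
        simp only [hG, dif_pos hy']
        rw [Lp.edist_def]
        have h3 : eLpNorm (⇑(hy'.toLp _) - ⇑θ) 2 halfLine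
            = eLpNorm (fun t => f' (y, t) - θ t) 2 halfLine :=
          eLpNorm_congr_ae (hy'.coeFn_toLp.sub ae_eq_rfl)
        rw [h3, ← eLpNorm_two_sq, ← ENNReal.rpow_natCast, ← ENNReal.rpow_mul]
        norm_num
      · rw [if_neg hy]
        simp only [hG, dif_neg fun h => hy ((hmem y).2 h)]
    rw [h2]
    exact Measurable.ite hNm h1 measurable_const
  have hNae : ∀ᵐ y, y ∈ N := by
    refine ae_lt_top (Measurable.lintegral_prod_right' (f := fun q => ‖f' q‖ₑ ^ 2) (by fun_prop)) ?_
    rw [← lintegral_prod (fun q => ‖f' q‖ₑ ^ 2) (by fun_prop), ← eLpNorm_two_sq]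
    exact (ENNReal.pow_lt_top hf'L.2).ne
  have hGs : IsSlice f G := by
    filter_upwards [hNae, hff'] with y hy hy'
    simp only [hG, dif_pos ((hmem y).1 hy)]
    exact ((hmem y).1 hy).coeFn_toLp.trans (hy'.mono fun t ht => ht.symm)
  have hGL : MemLp G 2 volume := by
    refine ⟨hGm, ?_⟩
    have := hGs.eLpNorm_eq hf.1
    by_contra hcon
    rw [not_lt, top_le_iff] at hcon
    rw [hcon] at this
    exact (ENNReal.pow_lt_top hf.2 (n := 2)).ne (by rw [← this]; simp)
  refine ⟨hGL.toLp G, ?_⟩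
  filter_upwards [hGL.coeFn_toLp, hGs] with y h1 h2
  rw [h1]; exact h2

lemma IsSlice.unique {f : Plane × ℝ → ℂ} {G G' : Lp Profile 2 (volume : Measure Plane)}
    (h : IsSlice f G) (h' : IsSlice f G') : G = G' := by
  refine Lp.ext ?_
  filter_upwards [h, h'] with y h1 h2
  exact Lp.ext (h1.trans h2.symm)

lemma IsSlice.congr {f f' : Plane × ℝ → ℂ} {G G' : Plane → Profile} (h : IsSlice f G)
    (hf : f =ᵐ[volume.prod halfLine] f') (hG : G =ᵐ[volume] G') : IsSlice f' G' := by
  filter_upwards [h, Measure.ae_ae_of_ae_prod hf, hG] with y h1 h2 h3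
  rw [← h3]
  exact h1.trans h2

lemma IsSlice.add {f f' : Plane × ℝ → ℂ} {G G' : Plane → Profile} (h : IsSlice f G)
    (h' : IsSlice f' G') : IsSlice (f + f') (G + G') := by
  filter_upwards [h, h'] with y h1 h2
  exact (Lp.coeFn_add _ _).trans (h1.add h2)

lemma IsSlice.smul {f : Plane × ℝ → ℂ} {G : Plane → Profile} (h : IsSlice f G) (c : ℂ) :
    IsSlice (c • f) (c • G) := by
  filter_upwards [h] with y h1
  exact (Lp.coeFn_smul _ _).trans (h1.const_smul c)

/-- Slicing, as a linear isometry `L²(ℝ² × (0, ∞)) → L²(ℝ²; L²(0, ∞))`. -/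
def sliceIsometry : Lp ℂ 2 ((volume : Measure Plane).prod halfLine) →ₗᵢ[ℂ]
    Lp Profile 2 (volume : Measure Plane) where
  toFun f := (exists_isSlice (Lp.memLp f)).choose
  map_add' f g := by
    refine IsSlice.unique (exists_isSlice (Lp.memLp (f + g))).choose_spec ?_
    exact ((exists_isSlice (Lp.memLp f)).choose_spec.add
      (exists_isSlice (Lp.memLp g)).choose_spec).congr (Lp.coeFn_add _ _).symm
      (Lp.coeFn_add _ _).symm
  map_smul' c f := by
    refine IsSlice.unique (exists_isSlice (Lp.memLp (c • f))).choose_spec ?_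
    exact ((exists_isSlice (Lp.memLp f)).choose_spec.smul c).congr (Lp.coeFn_smul _ _).symm
      (Lp.coeFn_smul _ _).symm
  norm_map' f := by
    have h := (exists_isSlice (Lp.memLp f)).choose_spec.eLpNorm_eq (Lp.memLp f).1
    have h2 := (ENNReal.pow_right_strictMono two_ne_zero).injective h
    simp only [Lp.norm_def]
    exact congrArg ENNReal.toReal h2

lemma sliceIsometry_isSlice (f : Lp ℂ 2 ((volume : Measure Plane).prod halfLine)) :
    IsSlice f (sliceIsometry f) := (exists_isSlice (Lp.memLp f)).choose_spec

/-- The range is closed, and it contains the products of indicators of sets of finite measure with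
profiles, which span a dense subspace. -/
lemma sliceIsometry_surjective : Function.Surjective sliceIsometry := by
  intro G
  have hcl : IsClosed (range sliceIsometry) :=
    sliceIsometry.isometry.isUniformInducing.isComplete_range.isClosed
  refine Lp.induction (p := 2) (by norm_num) (fun G => G ∈ range sliceIsometry) ?_ ?_ hcl G
  · intro θ s hs hμs
    have hmem : MemLp (fun q : Plane × ℝ => s.indicator (fun _ => (1 : ℂ)) q.1 * θ q.2) 2
        (volume.prod halfLine) := by
      have hm : AEStronglyMeasurable
          (fun q : Plane × ℝ => s.indicator (fun _ => (1 : ℂ)) q.1 * θ q.2)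
          (volume.prod halfLine) :=
        (((measurable_const.indicator hs).comp measurable_fst).stronglyMeasurable.mul
          ((Lp.stronglyMeasurable θ).comp_measurable measurable_snd)).aestronglyMeasurable
      refine ⟨hm, ?_⟩
      have h1 : eLpNorm (fun q : Plane × ℝ => s.indicator (fun _ => (1 : ℂ)) q.1 * θ q.2) 2
          (volume.prod halfLine) ^ 2 < ⊤ := by
        rw [eLpNorm_two_sq, lintegral_prod _ (hm.enorm.pow_const 2)]
        have h2 : ∀ y : Plane, ∫⁻ t, ‖s.indicator (fun _ => (1 : ℂ)) y * θ t‖ₑ ^ 2 ∂halfLine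
            = s.indicator (fun _ => ‖θ‖ₑ ^ 2) y := fun y => by
          by_cases hy : y ∈ s
          · simp only [indicator_of_mem hy, one_mul]
            rw [← eLpNorm_two_sq, Lp.enorm_def]
          · simp [indicator_of_notMem hy]
        simp only [h2]
        rw [lintegral_indicator_const hs]
        exact ENNReal.mul_lt_top (ENNReal.pow_lt_top (by simp)) hμs
      exact (ENNReal.pow_lt_top_iff.1 h1).resolve_right (by norm_num)
    refine ⟨hmem.toLp _, ?_⟩
    refine (sliceIsometry_isSlice _).unique ?_
    refine IsSlice.congr (f := fun q : Plane × ℝ => s.indicator (fun _ => (1 : ℂ)) q.1 * θ q.2)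
      (G := s.indicator fun _ => θ) ?_ hmem.coeFn_toLp.symm
      (indicatorConstLp_coeFn (hs := hs) (hμs := hμs.ne)).symm
    refine Eventually.of_forall fun y => ?_
    by_cases hy : y ∈ s
    · simp only [indicator_of_mem hy, one_mul]; exact ae_eq_rfl
    · simp only [indicator_of_notMem hy, zero_mul]; exact Lp.coeFn_zero _ _ _
  · rintro f g hf hg - ⟨f', hf'⟩ ⟨g', hg'⟩
    exact ⟨f' + g', by rw [map_add, hf', hg']⟩

/-- Slicing, as a unitary map `L²(ℝ² × (0, ∞)) ≃ L²(ℝ²; L²(0, ∞))`. -/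
def sliceEquiv : Lp ℂ 2 ((volume : Measure Plane).prod halfLine) ≃ₗᵢ[ℂ]
    Lp Profile 2 (volume : Measure Plane) :=
  LinearIsometryEquiv.ofSurjective sliceIsometry sliceIsometry_surjective

lemma sliceEquiv_isSlice (f : Lp ℂ 2 ((volume : Measure Plane).prod halfLine)) :
    IsSlice f (sliceEquiv f) := sliceIsometry_isSlice f

/-! ### The partial Fourier transform in a half-space -/

/-- The half-space `{p | 0 < τ (a - x)}` for a sign `τ`: the side `x < a` of the plane `{a} × ℝ²`
for `τ = 1`, the side `x > a` for `τ = -1`. The outward unit normal is `τ n₁`. -/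
def half (a τ : ℝ) : Set Space := {p | 0 < τ * (a - p.1)}

lemma isOpen_half (a τ : ℝ) : IsOpen (half a τ) :=
  isOpen_lt continuous_const (by fun_prop)

lemma measurableSet_half (a τ : ℝ) : MeasurableSet (half a τ) := (isOpen_half a τ).measurableSet

/-- Coordinates in a half-space: `t` is the distance to the plane. -/
def fromPlane (a τ : ℝ) (q : Plane × ℝ) : Space := (a - τ * q.2, q.1)

lemma sign_mul_self {τ : ℝ} (hτ : τ = 1 ∨ τ = -1) : τ * τ = 1 := by
  rcases hτ with rfl | rfl <;> norm_num

lemma measurePreserving_fromPlane {a τ : ℝ} (hτ : τ = 1 ∨ τ = -1) :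
    MeasurePreserving (fromPlane a τ) (volume.prod halfLine) (volume.restrict (half a τ)) := by
  have h1 : MeasurePreserving (fun t : ℝ => a - τ * t) volume volume := by
    rcases hτ with rfl | rfl
    · simpa using Measure.measurePreserving_sub_left (volume : Measure ℝ) a
    · simpa using measurePreserving_add_left (volume : Measure ℝ) a
  have h2 : MeasurePreserving (fromPlane a τ) ((volume : Measure Plane).prod (volume : Measure ℝ))
      (volume : Measure Space) :=
    (h1.prod (MeasurePreserving.id (volume : Measure Plane))).comp Measure.measurePreserving_swap
  have h3 := h2.restrict_preimage (measurableSet_half a τ)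
  have h4 : fromPlane a τ ⁻¹' half a τ = univ ×ˢ Ioi 0 := by
    ext q
    have : τ * (τ * q.2) = q.2 := by linear_combination q.2 * sign_mul_self hτ
    simp [half, fromPlane, this]
  rw [h4, ← Measure.prod_restrict, Measure.restrict_univ] at h3
  exact h3

lemma measurableEmbedding_fromPlane {a τ : ℝ} (hτ : τ = 1 ∨ τ = -1) :
    MeasurableEmbedding (fromPlane a τ) := by
  have hm : Measurable (fromPlane a τ) := by unfold fromPlane; fun_prop
  have hm' : Measurable fun p : Space => ((p.2, τ * (a - p.1)) : Plane × ℝ) := by fun_prop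
  refine MeasurableEquiv.measurableEmbedding
    { toFun := fromPlane a τ
      invFun := fun p => (p.2, τ * (a - p.1))
      left_inv := fun q => ?_
      right_inv := fun p => ?_
      measurable_toFun := hm
      measurable_invFun := hm' }
  · refine Prod.ext rfl ?_
    simp only [fromPlane]
    linear_combination q.2 * sign_mul_self hτ
  · refine Prod.ext ?_ rfl
    simp only [fromPlane]
    linear_combination (p.1 - a) * sign_mul_self hτ

/-- Partial Fourier transform in `(y, z)` of a function that is square integrable in the half-space
`half a τ`, with values in the profiles in the distance to its boundary. The value is `0` for other
functions. The kernel is `e^{-2πi ⟨k, (y, z)⟩}`, so a derivative in the direction `m` corresponds to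
the factor `2πi ⟨k, m⟩`. -/
def hat (a τ : ℝ) (F : Space → ℂ) : Lp Profile 2 (volume : Measure Plane) :=
  open scoped Classical in
  if h : MemLp (F ∘ fromPlane a τ) 2 (volume.prod halfLine) then 𝓕 (sliceEquiv (h.toLp _)) else 0

variable {a τ : ℝ}

lemma memLp_comp_fromPlane (hτ : τ = 1 ∨ τ = -1) {F : Space → ℂ}
    (hF : MemLp F 2 (volume.restrict (half a τ))) :
    MemLp (F ∘ fromPlane a τ) 2 (volume.prod halfLine) :=
  hF.comp_measurePreserving (measurePreserving_fromPlane hτ)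

lemma hat_eq (hτ : τ = 1 ∨ τ = -1) {F : Space → ℂ}
    (hF : MemLp F 2 (volume.restrict (half a τ))) :
    hat a τ F = 𝓕 (sliceEquiv ((memLp_comp_fromPlane hτ hF).toLp _)) := by
  rw [hat, dif_pos (memLp_comp_fromPlane hτ hF)]

lemma exists_slice_hat (hτ : τ = 1 ∨ τ = -1) {F : Space → ℂ}
    (hF : MemLp F 2 (volume.restrict (half a τ))) :
    ∃ G : Lp Profile 2 (volume : Measure Plane), IsSlice (F ∘ fromPlane a τ) G ∧
      hat a τ F = 𝓕 G :=
  ⟨_, (sliceEquiv_isSlice _).congr (memLp_comp_fromPlane hτ hF).coeFn_toLp ae_eq_rfl,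
    hat_eq hτ hF⟩

lemma hat_congr (hτ : τ = 1 ∨ τ = -1) {F F' : Space → ℂ}
    (hF : MemLp F 2 (volume.restrict (half a τ)))
    (h : F =ᵐ[volume.restrict (half a τ)] F') : hat a τ F = hat a τ F' := by
  have hF' := hF.ae_eq h
  rw [hat_eq hτ hF, hat_eq hτ hF']
  congr 2
  rw [MemLp.toLp_eq_toLp_iff]
  exact (measurePreserving_fromPlane hτ).quasiMeasurePreserving.ae_eq_comp h

lemma hat_sub (hτ : τ = 1 ∨ τ = -1) {F F' : Space → ℂ}
    (hF : MemLp F 2 (volume.restrict (half a τ))) (hF' : MemLp F' 2 (volume.restrict (half a τ))) :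
    hat a τ (F - F') = hat a τ F - hat a τ F' := by
  rw [hat_eq hτ hF, hat_eq hτ hF', hat_eq hτ (hF.sub hF')]
  have h1 : (memLp_comp_fromPlane hτ (hF.sub hF')).toLp _
      = (memLp_comp_fromPlane hτ hF).toLp _ - (memLp_comp_fromPlane hτ hF').toLp _ := rfl
  rw [h1, map_sub]
  exact map_sub (Lp.fourierTransformₗᵢ Plane Profile) _ _

lemma hat_smul (hτ : τ = 1 ∨ τ = -1) {F : Space → ℂ} (c : ℂ)
    (hF : MemLp F 2 (volume.restrict (half a τ))) : hat a τ (c • F) = c • hat a τ F := by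
  rw [hat_eq hτ hF, hat_eq hτ (hF.const_smul c)]
  have h1 : (memLp_comp_fromPlane hτ (hF.const_smul c)).toLp _
      = c • (memLp_comp_fromPlane hτ hF).toLp _ := rfl
  rw [h1, map_smul]
  exact map_smul (Lp.fourierTransformₗᵢ Plane Profile) _ _

/-- The theorem of Plancherel in a half-space. -/
lemma eLpNorm_hat (hτ : τ = 1 ∨ τ = -1) {F : Space → ℂ}
    (hF : MemLp F 2 (volume.restrict (half a τ))) :
    eLpNorm F 2 (volume.restrict (half a τ)) = eLpNorm (hat a τ F) 2 volume := by
  rw [← Lp.enorm_def, hat_eq hτ hF]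
  have h1 : ‖𝓕 (sliceEquiv ((memLp_comp_fromPlane hτ hF).toLp _))‖ₑ
      = ‖(memLp_comp_fromPlane hτ hF).toLp _‖ₑ := by
    rw [← ofReal_norm, ← ofReal_norm, Lp.norm_fourier_eq,
      LinearIsometryEquiv.norm_map]
  rw [h1, Lp.enorm_def, eLpNorm_congr_ae (MemLp.coeFn_toLp _),
    eLpNorm_comp_measurePreserving hF.1 (measurePreserving_fromPlane hτ)]

lemma exists_of_hat (hτ : τ = 1 ∨ τ = -1) (G : Lp Profile 2 (volume : Measure Plane)) :
    ∃ F : Space → ℂ, MemLp F 2 (volume.restrict (half a τ)) ∧ hat a τ F = G := by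
  set f := sliceEquiv.symm (𝓕⁻ G) with hf
  set e := (measurableEmbedding_fromPlane (a := a) hτ)
  set F : Space → ℂ := fun p => f (p.2, τ * (a - p.1)) with hFdef
  have hc : F ∘ fromPlane a τ = f := by
    funext q
    have : τ * (τ * q.2) = q.2 := by linear_combination q.2 * sign_mul_self hτ
    simp [hFdef, fromPlane, this]
  have hF : MemLp F 2 (volume.restrict (half a τ)) := by
    rw [← (measurePreserving_fromPlane hτ).map_eq, e.memLp_map_measure_iff, hc]
    exact Lp.memLp f
  refine ⟨F, hF, ?_⟩
  rw [hat_eq hτ hF]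
  have h1 : (memLp_comp_fromPlane hτ hF).toLp _ = f := by
    refine Lp.ext ((MemLp.coeFn_toLp _).trans ?_)
    rw [hc]
  rw [h1, hf, LinearIsometryEquiv.apply_symm_apply, fourier_fourierInv_eq]

/-- The functional `f ↦ ∫ θ f` on profiles. -/
def profilePairing {θ : ℝ → ℂ} (hθ : MemLp θ 2 halfLine) : Profile →L[ℂ] ℂ :=
  innerSL ℂ (hθ.star.toLp)

lemma profilePairing_apply {θ : ℝ → ℂ} (hθ : MemLp θ 2 halfLine) (f : Profile) :
    profilePairing hθ f = ∫ t in Ioi (0 : ℝ), θ t * f t := by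
  rw [profilePairing, innerSL_apply_apply, L2.inner_def]
  refine integral_congr_ae ?_
  filter_upwards [hθ.star.coeFn_toLp] with t ht
  rw [ht, RCLike.inner_apply, Pi.star_apply, RCLike.star_def, RCLike.conj_conj, mul_comm]

lemma integral_schwartz_smul_fourierInv (G : Lp Profile 2 (volume : Measure Plane))
    (ψ : 𝓢(Plane, ℂ)) : ∫ y, ψ y • G y = ∫ k, (𝓕⁻ ψ : 𝓢(Plane, ℂ)) k • (𝓕 G : Lp Profile 2 _) k := by
  have h := Lp.fourier_toTemperedDistribution_eq G
  have h2 := DFunLike.congr_fun h (𝓕⁻ ψ)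
  rw [TemperedDistribution.fourier_apply, Lp.toTemperedDistribution_apply,
    Lp.toTemperedDistribution_apply, fourier_fourierInv_eq] at h2
  exact h2

lemma integrable_schwartz_smul (G : Lp Profile 2 (volume : Measure Plane)) (ψ : 𝓢(Plane, ℂ)) :
    Integrable fun y => ψ y • G y :=
  memLp_one_iff_integrable.1 ((Lp.memLp G).smul (ψ.memLp 2 volume))

lemma integrable_fromPlane {F : Space → ℂ} (hF : MemLp F 2 (volume.restrict (half a τ)))
    {θ : ℝ → ℂ} (hθ : MemLp θ 2 halfLine) (ψ : 𝓢(Plane, ℂ)) (hτ : τ = 1 ∨ τ = -1) :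
    Integrable (fun q : Plane × ℝ => ψ q.1 * θ q.2 * F (fromPlane a τ q)) (volume.prod halfLine) := by
  have h1 : MemLp (fun q : Plane × ℝ => ψ q.1 * θ q.2) 2 (volume.prod halfLine) := by
    have hψ := ψ.memLp 2 (volume : Measure Plane)
    have hm : AEStronglyMeasurable (fun q : Plane × ℝ => ψ q.1 * θ q.2) (volume.prod halfLine) :=
      hψ.1.comp_fst.mul hθ.1.comp_snd
    rw [memLp_two_iff_integrable_sq_norm hm]
    have := Integrable.mul_prod (μ := (volume : Measure Plane)) (ν := halfLine)
      ((memLp_two_iff_integrable_sq_norm hψ.1).1 hψ) ((memLp_two_iff_integrable_sq_norm hθ.1).1 hθ)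
    refine this.congr (Eventually.of_forall fun q => ?_)
    simp [mul_pow]
  exact h1.integrable_mul (memLp_comp_fromPlane hτ hF)

lemma integral_half_eq (hτ : τ = 1 ∨ τ = -1) (g : Space → ℂ) :
    ∫ p in half a τ, g p = ∫ q, g (fromPlane a τ q) ∂(volume.prod halfLine) :=
  ((measurePreserving_fromPlane hτ).integral_comp (measurableEmbedding_fromPlane hτ) g).symm

/-- Testing against a product of a profile and a Schwartz function, on the Fourier side. -/
lemma integral_half_mul (hτ : τ = 1 ∨ τ = -1) {F : Space → ℂ}
    (hF : MemLp F 2 (volume.restrict (half a τ))) {θ : ℝ → ℂ} (hθ : MemLp θ 2 halfLine)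
    (ψ : 𝓢(Plane, ℂ)) :
    ∫ p in half a τ, ψ p.2 * θ (τ * (a - p.1)) * F p
      = ∫ k, (𝓕⁻ ψ : 𝓢(Plane, ℂ)) k * profilePairing hθ (hat a τ F k) := by
  obtain ⟨G, hG, hh⟩ := exists_slice_hat hτ hF
  have e1 : ∀ q : Plane × ℝ, τ * (a - (fromPlane a τ q).1) = q.2 := fun q => by
    simp only [fromPlane]; linear_combination q.2 * sign_mul_self hτ
  rw [integral_half_eq hτ]
  simp only [e1]
  have e2 : ∀ q : Plane × ℝ, (fromPlane a τ q).2 = q.1 := fun q => rfl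
  simp only [e2]
  rw [integral_prod _ (integrable_fromPlane hF hθ ψ hτ)]
  have e3 : ∫ y, ∫ t, ψ y * θ t * F (fromPlane a τ (y, t)) ∂halfLine
      = ∫ y, profilePairing hθ (ψ y • G y) := by
    refine integral_congr_ae ?_
    filter_upwards [hG] with y hy
    rw [map_smul, profilePairing_apply, smul_eq_mul, ← integral_const_mul]
    refine integral_congr_ae ?_
    filter_upwards [hy] with t ht
    rw [ht, mul_assoc]; rfl
  rw [e3, ContinuousLinearMap.integral_comp_comm _ (integrable_schwartz_smul G ψ),
    integral_schwartz_smul_fourierInv, ← hh,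
    ← ContinuousLinearMap.integral_comp_comm _ (integrable_schwartz_smul _ _)]
  simp only [map_smul, smul_eq_mul]

/-! ### Functions of the frequency of moderate growth -/

/-- Functions of the frequency that are in `L²` up to a factor `1 + ‖k‖`: the Fourier transforms of
first derivatives of `L²` functions. -/
def IsMild (G : Plane → ℂ) : Prop :=
  MemLp (fun k => ((1 + ‖k‖ : ℝ) : ℂ)⁻¹ * G k) 2 volume

lemma one_add_norm_ne_zero (k : Plane) : ((1 + ‖k‖ : ℝ) : ℂ) ≠ 0 := by
  exact_mod_cast (by positivity : (0 : ℝ) < 1 + ‖k‖).ne'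

lemma IsMild.of_norm_le {G : Plane → ℂ} {g : Plane → ℝ} (hG : AEStronglyMeasurable G volume)
    (hg : MemLp g 2 volume) (h : ∀ᵐ k, ‖G k‖ ≤ (1 + ‖k‖) * g k) : IsMild G := by
  refine hg.mono ?_ ?_
  · refine AEStronglyMeasurable.mul ?_ hG
    exact (Continuous.inv₀ (by fun_prop) one_add_norm_ne_zero).aestronglyMeasurable
  · filter_upwards [h] with k hk
    rw [norm_mul, norm_inv, Complex.norm_real, Real.norm_of_nonneg (by positivity)]
    rw [inv_mul_le_iff₀ (by positivity)]
    exact hk.trans (by gcongr; exact le_abs_self _)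

lemma IsMild.aestronglyMeasurable {G : Plane → ℂ} (h : IsMild G) :
    AEStronglyMeasurable G volume := by
  have h1 : AEStronglyMeasurable (fun k : Plane => ((1 + ‖k‖ : ℝ) : ℂ)) volume :=
    (by fun_prop : Continuous fun k : Plane => ((1 + ‖k‖ : ℝ) : ℂ)).aestronglyMeasurable
  refine (h1.mul h.1).congr (Eventually.of_forall fun k => ?_)
  simp only [Pi.mul_apply]
  rw [← mul_assoc, mul_inv_cancel₀ (one_add_norm_ne_zero k), one_mul]

lemma IsMild.of_memLp {G : Plane → ℂ} (h : MemLp G 2 volume) : IsMild G :=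
  IsMild.of_norm_le h.1 h.norm (Eventually.of_forall fun k => by
    nlinarith [norm_nonneg k, norm_nonneg (G k)])

lemma IsMild.inner_mul {G : Plane → ℂ} (h : MemLp G 2 volume) (m : Plane) :
    IsMild fun k => ((inner ℝ k m : ℝ) : ℂ) * G k := by
  refine IsMild.of_norm_le (g := fun k => ‖m‖ * ‖G k‖) ?_ (h.norm.const_mul _)
    (Eventually.of_forall fun k => ?_)
  · exact (by fun_prop : Continuous fun k : Plane => ((inner ℝ k m : ℝ) : ℂ)).aestronglyMeasurable.mul
      h.1
  · rw [norm_mul, Complex.norm_real]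
    have := norm_inner_le_norm (𝕜 := ℝ) k m
    have h2 : 0 ≤ ‖m‖ * ‖G k‖ := by positivity
    calc _ ≤ (‖k‖ * ‖m‖) * ‖G k‖ := by gcongr
      _ ≤ _ := by nlinarith

lemma IsMild.add {G G' : Plane → ℂ} (h : IsMild G) (h' : IsMild G') : IsMild (G + G') := by
  refine (MemLp.add h h').ae_eq (Eventually.of_forall fun k => ?_)
  simp [mul_add]

lemma IsMild.const_mul {G : Plane → ℂ} (h : IsMild G) (c : ℂ) : IsMild fun k => c * G k := by
  refine (MemLp.const_mul h c).ae_eq (Eventually.of_forall fun k => ?_)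
  simp only []; ring

lemma IsMild.sub {G G' : Plane → ℂ} (h : IsMild G) (h' : IsMild G') : IsMild (G - G') := by
  refine (MemLp.sub h h').ae_eq (Eventually.of_forall fun k => ?_)
  simp [mul_sub]

lemma memLp_one_add_norm_mul_schwartz (ψ : 𝓢(Plane, ℂ)) :
    MemLp (fun k => ((1 + ‖k‖ : ℝ) : ℂ) * ψ k) 2 volume := by
  have h1 := ψ.memLp 2 (volume : Measure Plane)
  have h0 := (SchwartzMap.smulLeftCLM ℂ (fun k : Plane => ((inner ℝ k (EuclideanSpace.single 0 1) : ℝ) : ℂ)) ψ).memLp 2 (volume : Measure Plane)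
  have h2 := (SchwartzMap.smulLeftCLM ℂ (fun k : Plane => ((inner ℝ k (EuclideanSpace.single 1 1) : ℝ) : ℂ)) ψ).memLp 2 (volume : Measure Plane)
  refine ((h1.norm.add h0.norm).add h2.norm).mono ?_ (Eventually.of_forall fun k => ?_)
  · exact (by fun_prop : Continuous fun k : Plane => ((1 + ‖k‖ : ℝ) : ℂ)).aestronglyMeasurable.mul h1.1
  · have hk : ‖k‖ ≤ |k 0| + |k 1| := by
      rw [EuclideanSpace.norm_eq, Fin.sum_univ_two]
      refine Real.sqrt_le_iff.2 ⟨by positivity, ?_⟩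
      simp only [Real.norm_eq_abs]
      nlinarith [abs_nonneg (k 0), abs_nonneg (k 1)]
    have e0 : Function.HasTemperateGrowth (fun k : Plane => ((inner ℝ k (EuclideanSpace.single 0 1) : ℝ) : ℂ)) := by
      fun_prop
    have e1 : Function.HasTemperateGrowth (fun k : Plane => ((inner ℝ k (EuclideanSpace.single 1 1) : ℝ) : ℂ)) := by
      fun_prop
    simp only [Pi.add_apply]
    rw [SchwartzMap.smulLeftCLM_apply_apply e0, SchwartzMap.smulLeftCLM_apply_apply e1]
    simp only [norm_mul, smul_eq_mul, Complex.norm_real, EuclideanSpace.inner_single_right]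
    simp
    rw [abs_of_nonneg (by positivity : 0 ≤ 1 + ‖k‖), abs_of_nonneg (by positivity)]
    nlinarith [norm_nonneg (ψ k)]

lemma IsMild.integrable_mul {G : Plane → ℂ} (h : IsMild G) (ψ : 𝓢(Plane, ℂ)) :
    Integrable fun k => ψ k * G k := by
  refine ((memLp_one_add_norm_mul_schwartz ψ).integrable_mul h).congr
    (Eventually.of_forall fun k => ?_)
  simp only [Pi.mul_apply]
  have := one_add_norm_ne_zero k
  field_simp

lemma IsMild.locallyIntegrable {G : Plane → ℂ} (h : IsMild G) : LocallyIntegrable G volume := by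
  have h1 := (MemLp.locallyIntegrable h (by norm_num))
  have h2 : LocallyIntegrable (fun k : Plane => ((1 + ‖k‖ : ℝ) : ℂ) * (((1 + ‖k‖ : ℝ) : ℂ)⁻¹ * G k)) :=
    (locallyIntegrableOn_univ.1 ((h1.locallyIntegrableOn univ).continuousOn_mul
      (by fun_prop : Continuous fun k : Plane => ((1 + ‖k‖ : ℝ) : ℂ)).continuousOn
      isOpen_univ.isLocallyClosed))
  refine h2.congr (Eventually.of_forall fun k => ?_)
  simp only []
  rw [← mul_assoc, mul_inv_cancel₀ (one_add_norm_ne_zero k), one_mul]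

/-- A mild function is `A + k₀ B₀ + k₁ B₁` with square integrable `A`, `B₀`, `B₁`. -/
lemma IsMild.exists_decomp {G : Plane → ℂ} (h : IsMild G) : ∃ A B₀ B₁ : Lp ℂ 2 (volume : Measure Plane),
    ∀ᵐ k, G k = A k + ((k 0 : ℝ) : ℂ) * B₀ k + ((k 1 : ℝ) : ℂ) * B₁ k := by
  have hd : ∀ k : Plane, (0 : ℝ) < 1 + ‖k‖ ^ 2 := fun k => by positivity
  have key : ∀ w : Plane → ℝ, Continuous w → (∀ k, |w k| ≤ 1 + ‖k‖) →
      MemLp (fun k => ((w k / (1 + ‖k‖ ^ 2) : ℝ) : ℂ) * G k) 2 volume := fun w hw hb => by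
    refine (h.norm.const_mul 2).mono ?_ (Eventually.of_forall fun k => ?_)
    · refine AEStronglyMeasurable.mul ?_ h.aestronglyMeasurable
      exact (Complex.continuous_ofReal.comp (hw.div (by fun_prop)
        fun k => (hd k).ne')).aestronglyMeasurable
    · rw [norm_mul ((w k / (1 + ‖k‖ ^ 2) : ℝ) : ℂ), norm_mul (2 : ℝ), norm_norm, norm_mul, norm_inv,
        Complex.norm_real, Complex.norm_real, Real.norm_eq_abs, abs_div, abs_of_pos (hd k),
        Real.norm_of_nonneg (by positivity : 0 ≤ 1 + ‖k‖),
        Real.norm_of_nonneg (by norm_num : (0 : ℝ) ≤ 2), ← mul_assoc]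
      refine mul_le_mul_of_nonneg_right ?_ (norm_nonneg _)
      rw [div_le_iff₀ (hd k), ← div_eq_mul_inv, div_mul_eq_mul_div, le_div_iff₀ (by positivity)]
      nlinarith [hb k, norm_nonneg k, abs_nonneg (w k), sq_nonneg (‖k‖ - 1)]
  have hk : ∀ (j : Fin 2) (k : Plane), |k j| ≤ ‖k‖ := fun j k => by
    simpa using PiLp.norm_apply_le k j
  have hA := key (fun _ => 1) continuous_const fun k => by simp
  have h0 := key (fun k => k 0) (by fun_prop) fun k => (hk 0 k).trans (by linarith)
  have h1 := key (fun k => k 1) (by fun_prop) fun k => (hk 1 k).trans (by linarith)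
  refine ⟨hA.toLp _, h0.toLp _, h1.toLp _, ?_⟩
  filter_upwards [hA.coeFn_toLp, h0.coeFn_toLp, h1.coeFn_toLp] with k e1 e2 e3
  rw [e1, e2, e3]
  have hn : ‖k‖ ^ 2 = k 0 ^ 2 + k 1 ^ 2 := by
    rw [EuclideanSpace.norm_sq_eq, Fin.sum_univ_two]; simp
  have hne : ((1 + ‖k‖ ^ 2 : ℝ) : ℂ) ≠ 0 := by exact_mod_cast (hd k).ne'
  rw [hn] at hne ⊢
  push_cast at hne ⊢
  field_simp
  ring

lemma integral_schwartz_mul_fourierInv (A : Lp ℂ 2 (volume : Measure Plane)) (ψ : 𝓢(Plane, ℂ)) :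
    ∫ k, (𝓕⁻ ψ : 𝓢(Plane, ℂ)) k * A k = ∫ y, ψ y * (𝓕⁻ A : Lp ℂ 2 (volume : Measure Plane)) y := by
  have h := Lp.fourierInv_toTemperedDistribution_eq A
  have h2 := DFunLike.congr_fun h ψ
  rw [TemperedDistribution.fourierInv_apply, Lp.toTemperedDistribution_apply,
    Lp.toTemperedDistribution_apply] at h2
  exact h2

lemma fourierInv_lineDeriv_apply (ψ : 𝓢(Plane, ℂ)) (m k : Plane) :
    (𝓕⁻ (∂_{m} ψ : 𝓢(Plane, ℂ)) : 𝓢(Plane, ℂ)) k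
      = -(2 * Real.pi * Complex.I) * ((inner ℝ k m : ℝ) : ℂ) * (𝓕⁻ ψ : 𝓢(Plane, ℂ)) k := by
  rw [SchwartzMap.fourierInv_lineDerivOp_eq]
  have e0 : Function.HasTemperateGrowth (fun k : Plane => inner ℝ k m) := by
    fun_prop
  rw [_root_.smul_apply, SchwartzMap.smulLeftCLM_apply_apply e0]
  simp [mul_assoc]

lemma exists_cutoff : ∃ χ : Plane → ℝ, ContDiff ℝ ∞ χ ∧ HasCompactSupport χ ∧ χ 0 = 1 ∧
    (∀ y, |χ y| ≤ 1) ∧ ∃ C, ∀ y, ‖fderiv ℝ χ y‖ ≤ C := by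
  let b : ContDiffBump (0 : Plane) := ⟨1, 2, by norm_num, by norm_num⟩
  have hc : HasCompactSupport (fderiv ℝ b) := b.hasCompactSupport.fderiv ℝ
  obtain ⟨C, hC⟩ := hc.exists_bound_of_continuous (b.contDiff.continuous_fderiv (n := ∞) (by norm_num))
  refine ⟨b, b.contDiff, b.hasCompactSupport, b.one_of_mem_closedBall (by simp [b.rIn_pos.le]),
    fun y => ?_, C, hC⟩
  rw [abs_of_nonneg b.nonneg]
  exact b.le_one

/-- A distribution that is the derivative of an `L²` function and vanishes on test functions
vanishes on Schwartz functions. -/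
lemma integral_schwartz_eq_zero {A B₀ B₁ : Plane → ℂ} {m₀ m₁ : Plane} (hA : MemLp A 2 volume)
    (h0 : MemLp B₀ 2 volume) (h1 : MemLp B₁ 2 volume)
    (h : ∀ ψ : Plane → ℂ, ContDiff ℝ ∞ ψ → HasCompactSupport ψ →
      ∫ y, (ψ y * A y + fderiv ℝ ψ y m₀ * B₀ y + fderiv ℝ ψ y m₁ * B₁ y) = 0)
    (φ : 𝓢(Plane, ℂ)) :
    ∫ y, (φ y * A y + fderiv ℝ φ y m₀ * B₀ y + fderiv ℝ φ y m₁ * B₁ y) = 0 := by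
  obtain ⟨χ, hχ, hχc, hχ0, hχ1, C, hC⟩ := exists_cutoff
  have hC0 : 0 ≤ C := (norm_nonneg _).trans (hC 0)
  -- apply the hypothesis to `χ (r n • y) φ y`: the derivative of the cutoff is `O(r n)`
  set r : ℕ → ℝ := fun n => 1 / ((n : ℝ) + 1) with hr
  have hr0 : ∀ n, 0 < r n := fun n => by simp only [hr]; positivity
  have hr1 : ∀ n, r n ≤ 1 := fun n => by
    simp only [hr]
    rw [div_le_one (by positivity)]
    linarith [(Nat.cast_nonneg n : (0 : ℝ) ≤ n)]
  have hrt : Tendsto r atTop (𝓝 0) := tendsto_one_div_add_atTop_nhds_zero_nat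
  have hφd : ∀ y, HasFDerivAt φ (fderiv ℝ φ y) y := fun y => φ.differentiableAt.hasFDerivAt
  have hder : ∀ n y (m : Plane), fderiv ℝ (fun y => ((χ (r n • y) : ℝ) : ℂ) * φ y) y m
      = ((χ (r n • y) : ℝ) : ℂ) * fderiv ℝ φ y m
        + (r n : ℂ) * ((fderiv ℝ χ (r n • y) m : ℝ) : ℂ) * φ y := fun n y m => by
    have e1 : HasFDerivAt (fun y : Plane => χ (r n • y))
        ((fderiv ℝ χ (r n • y)).comp (r n • ContinuousLinearMap.id ℝ Plane)) y :=
      (hχ.differentiable (by norm_num) _).hasFDerivAt.comp y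
        ((hasFDerivAt_id y).const_smul (r n))
    have e2 := (Complex.ofRealCLM.hasFDerivAt.comp y e1).mul (hφd y)
    have e3 : fderiv ℝ (fun y => ((χ (r n • y) : ℝ) : ℂ) * φ y) y = _ := e2.fderiv
    rw [e3]
    simp
    ring
  have hz : ∀ n, ∫ y, ((((χ (r n • y) : ℝ) : ℂ) * φ y) * A y
      + fderiv ℝ (fun y => ((χ (r n • y) : ℝ) : ℂ) * φ y) y m₀ * B₀ y
      + fderiv ℝ (fun y => ((χ (r n • y) : ℝ) : ℂ) * φ y) y m₁ * B₁ y) = 0 := fun n => by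
    refine h _ ?_ ?_
    · have : ContDiff ℝ ∞ fun y : Plane => χ (r n • y) := hχ.comp (by fun_prop)
      exact (Complex.ofRealCLM.contDiff.comp this).mul (φ.smooth ⊤)
    · have h1 : HasCompactSupport fun y : Plane => χ (r n • y) :=
        hχc.comp_smul (hr0 n).ne'
      have h2 : HasCompactSupport fun y : Plane => ((χ (r n • y) : ℝ) : ℂ) :=
        h1.comp_left (g := fun x : ℝ => (x : ℂ)) (by simp)
      exact h2.mul_right
  have hφL := φ.memLp 2 (volume : Measure Plane)
  have hdL : ∀ m : Plane, MemLp (fun y => fderiv ℝ φ y m) 2 volume := fun m =>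
    (∂_{m} φ : 𝓢(Plane, ℂ)).memLp 2 (volume : Measure Plane)
  have lim : Tendsto (fun n => ∫ y, ((((χ (r n • y) : ℝ) : ℂ) * φ y) * A y
      + fderiv ℝ (fun y => ((χ (r n • y) : ℝ) : ℂ) * φ y) y m₀ * B₀ y
      + fderiv ℝ (fun y => ((χ (r n • y) : ℝ) : ℂ) * φ y) y m₁ * B₁ y)) atTop
      (𝓝 (∫ y, (φ y * A y + fderiv ℝ φ y m₀ * B₀ y + fderiv ℝ φ y m₁ * B₁ y))) := by
    refine tendsto_integral_of_dominated_convergence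
      (fun y => ‖φ y‖ * ‖A y‖ + (‖fderiv ℝ φ y m₀‖ + C * ‖m₀‖ * ‖φ y‖) * ‖B₀ y‖
        + (‖fderiv ℝ φ y m₁‖ + C * ‖m₁‖ * ‖φ y‖) * ‖B₁ y‖) ?_ ?_ ?_ ?_
    · intro n
      have hcx : Continuous fun y : Plane => ((χ (r n • y) : ℝ) : ℂ) :=
        Complex.continuous_ofReal.comp (hχ.continuous.comp (by fun_prop))
      have hcd : ∀ m : Plane, Continuous fun y : Plane => ((fderiv ℝ χ (r n • y) m : ℝ) : ℂ) := fun m =>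
        Complex.continuous_ofReal.comp (((hχ.continuous_fderiv (by norm_num)).comp
          (by fun_prop : Continuous fun y : Plane => r n • y)).clm_apply continuous_const)
      simp only [hder]
      refine ((hcx.aestronglyMeasurable.mul hφL.1).mul hA.1).add ?_ |>.add ?_
      · exact ((hcx.aestronglyMeasurable.mul (hdL m₀).1).add
          ((aestronglyMeasurable_const.mul (hcd m₀).aestronglyMeasurable).mul hφL.1)).mul h0.1
      · exact ((hcx.aestronglyMeasurable.mul (hdL m₁).1).add
          ((aestronglyMeasurable_const.mul (hcd m₁).aestronglyMeasurable).mul hφL.1)).mul h1.1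
    · exact ((hφL.norm.integrable_mul hA.norm).add
        (((hdL m₀).norm.add (hφL.norm.const_mul _)).integrable_mul h0.norm)).add
        (((hdL m₁).norm.add (hφL.norm.const_mul _)).integrable_mul h1.norm)
    · refine fun n => Eventually.of_forall fun y => ?_
      have hb : ∀ m, ‖fderiv ℝ (fun y => ((χ (r n • y) : ℝ) : ℂ) * φ y) y m‖
          ≤ ‖fderiv ℝ φ y m‖ + C * ‖m‖ * ‖φ y‖ := fun m => by
        rw [hder]
        refine (norm_add_le _ _).trans (add_le_add ?_ ?_)
        · rw [norm_mul, Complex.norm_real]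
          exact mul_le_of_le_one_left (norm_nonneg _) (hχ1 _)
        · rw [norm_mul, norm_mul, Complex.norm_real, Complex.norm_real, Real.norm_of_nonneg (hr0 n).le]
          refine mul_le_mul_of_nonneg_right ?_ (norm_nonneg _)
          calc r n * ‖fderiv ℝ χ (r n • y) m‖ ≤ 1 * ‖fderiv ℝ χ (r n • y) m‖ := by
                gcongr; exact hr1 n
            _ ≤ C * ‖m‖ := by
                rw [one_mul]
                exact ((fderiv ℝ χ (r n • y)).le_opNorm m).trans (by gcongr; exact hC _)
      refine (norm_add₃_le).trans ?_
      rw [norm_mul, norm_mul, norm_mul, norm_mul]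
      gcongr
      · rw [Complex.norm_real]
        exact mul_le_of_le_one_left (norm_nonneg _) (hχ1 _)
      · exact hb m₀
      · exact hb m₁
    · refine Eventually.of_forall fun y => ?_
      have hy : Tendsto (fun n => r n • y) atTop (𝓝 0) := by simpa using hrt.smul_const y
      have t1 : Tendsto (fun n => ((χ (r n • y) : ℝ) : ℂ)) atTop (𝓝 1) := by
        have := ((Complex.continuous_ofReal.comp hχ.continuous).tendsto 0).comp hy
        simpa [hχ0, Function.comp_def] using this
      have t2 : ∀ m, Tendsto (fun n => fderiv ℝ (fun y => ((χ (r n • y) : ℝ) : ℂ) * φ y) y m) atTop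
          (𝓝 (fderiv ℝ φ y m)) := fun m => by
        simp only [hder]
        have t3 : Tendsto (fun n => ((fderiv ℝ χ (r n • y) m : ℝ) : ℂ)) atTop
            (𝓝 ((fderiv ℝ χ 0 m : ℝ) : ℂ)) :=
          ((Complex.continuous_ofReal.comp ((hχ.continuous_fderiv (by norm_num)).clm_apply
            continuous_const)).tendsto 0).comp hy
        have t4 : Tendsto (fun n => ((r n : ℝ) : ℂ)) atTop (𝓝 0) := by
          have := (Complex.continuous_ofReal.tendsto 0).comp hrt
          simpa [Function.comp_def] using this
        have := (t1.mul_const (fderiv ℝ φ y m)).add ((t4.mul t3).mul_const (φ y))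
        simpa using this
      have := (((t1.mul_const (φ y)).mul_const (A y)).add ((t2 m₀).mul_const (B₀ y))).add
        ((t2 m₁).mul_const (B₁ y))
      simpa using this
  refine tendsto_nhds_unique lim ?_
  simp only [hz]
  exact tendsto_const_nhds

/-- A mild function whose inverse Fourier transform vanishes on test functions is zero. -/
lemma IsMild.ae_eq_zero {G : Plane → ℂ} (hG : IsMild G)
    (h : ∀ (ψ : Plane → ℂ) (hψ : ContDiff ℝ ∞ ψ) (hc : HasCompactSupport ψ),
      ∫ k, (𝓕⁻ (hc.toSchwartzMap hψ) : 𝓢(Plane, ℂ)) k * G k = 0) : G =ᵐ[volume] 0 := by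
  obtain ⟨A, B₀, B₁, hd⟩ := hG.exists_decomp
  set m₀ : Plane := EuclideanSpace.single 0 1 with hm₀
  set m₁ : Plane := EuclideanSpace.single 1 1 with hm₁
  set c : ℂ := -(2 * Real.pi * Complex.I) with hc
  have hc0 : c ≠ 0 := by
    rw [hc, neg_ne_zero]
    exact Complex.two_pi_I_ne_zero
  have hint : ∀ (A : Lp ℂ 2 (volume : Measure Plane)) (ψ : 𝓢(Plane, ℂ)),
      Integrable fun y => ψ y * A y := fun A ψ =>
    (ψ.memLp 2 (volume : Measure Plane)).integrable_mul (Lp.memLp A)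
  have key : ∀ ψ : 𝓢(Plane, ℂ), ∫ k, (𝓕⁻ ψ : 𝓢(Plane, ℂ)) k * G k
      = ∫ y, (ψ y * (𝓕⁻ A : Lp ℂ 2 (volume : Measure Plane)) y
        + fderiv ℝ ψ y m₀ * (c⁻¹ • (𝓕⁻ B₀ : Lp ℂ 2 (volume : Measure Plane))) y
        + fderiv ℝ ψ y m₁ * (c⁻¹ • (𝓕⁻ B₁ : Lp ℂ 2 (volume : Measure Plane))) y) := fun ψ => by
    have e1 : ∀ (m : Plane) (B : Lp ℂ 2 (volume : Measure Plane)),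
        ∫ y, fderiv ℝ ψ y m * (c⁻¹ • (𝓕⁻ B : Lp ℂ 2 (volume : Measure Plane))) y
        = ∫ k, (𝓕⁻ ψ : 𝓢(Plane, ℂ)) k * (((inner ℝ k m : ℝ) : ℂ) * B k) := fun m B => by
      have h1 := integral_schwartz_mul_fourierInv B (∂_{m} ψ)
      simp only [fourierInv_lineDeriv_apply, ← hc] at h1
      have h2 : ∫ y, fderiv ℝ ψ y m * (c⁻¹ • (𝓕⁻ B : Lp ℂ 2 (volume : Measure Plane))) y
          = c⁻¹ * ∫ y, (∂_{m} ψ : 𝓢(Plane, ℂ)) y * (𝓕⁻ B : Lp ℂ 2 (volume : Measure Plane)) y := by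
        rw [← integral_const_mul]
        refine integral_congr_ae ?_
        filter_upwards [Lp.coeFn_smul c⁻¹ (𝓕⁻ B : Lp ℂ 2 (volume : Measure Plane))] with y hy
        rw [hy, Pi.smul_apply, smul_eq_mul, SchwartzMap.lineDerivOp_apply_eq_fderiv]
        ring
      rw [h2, ← h1, ← integral_const_mul]
      refine integral_congr_ae (Eventually.of_forall fun k => ?_)
      simp only []
      field_simp
    have i1 : ∀ (m : Plane) (B : Lp ℂ 2 (volume : Measure Plane)),
        Integrable fun k => (𝓕⁻ ψ : 𝓢(Plane, ℂ)) k * (((inner ℝ k m : ℝ) : ℂ) * B k) := fun m B =>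
      (IsMild.inner_mul (Lp.memLp B) m).integrable_mul _
    have j1 : ∀ (m : Plane) (B : Lp ℂ 2 (volume : Measure Plane)),
        Integrable fun y => fderiv ℝ ψ y m * (c⁻¹ • (𝓕⁻ B : Lp ℂ 2 (volume : Measure Plane))) y :=
      fun m B => hint _ (∂_{m} ψ)
    have jA : Integrable fun y => ψ y * (𝓕⁻ A : Lp ℂ 2 (volume : Measure Plane)) y := hint _ ψ
    have jAB : Integrable fun y => ψ y * (𝓕⁻ A : Lp ℂ 2 (volume : Measure Plane)) y
        + fderiv ℝ ψ y m₀ * (c⁻¹ • (𝓕⁻ B₀ : Lp ℂ 2 (volume : Measure Plane))) y := jA.add (j1 _ _)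
    have iA : Integrable fun k => (𝓕⁻ ψ : 𝓢(Plane, ℂ)) k * A k := hint _ _
    have iAB : Integrable fun k => (𝓕⁻ ψ : 𝓢(Plane, ℂ)) k * A k
        + (𝓕⁻ ψ : 𝓢(Plane, ℂ)) k * (((inner ℝ k m₀ : ℝ) : ℂ) * B₀ k) := iA.add (i1 _ _)
    rw [integral_add jAB (j1 _ _), integral_add jA (j1 _ _),
      e1, e1, ← integral_schwartz_mul_fourierInv, ← integral_add iA (i1 _ _),
      ← integral_add iAB (i1 _ _)]
    refine integral_congr_ae ?_
    filter_upwards [hd] with k hk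
    rw [hk]
    simp only [hm₀, hm₁, EuclideanSpace.inner_single_right]
    simp
    ring
  have hall : ∀ ψ : 𝓢(Plane, ℂ), ∫ k, (𝓕⁻ ψ : 𝓢(Plane, ℂ)) k * G k = 0 := fun ψ => by
    rw [key]
    refine integral_schwartz_eq_zero (Lp.memLp _) (Lp.memLp _) (Lp.memLp _) (fun φ hφ hφc => ?_) ψ
    have := h φ hφ hφc
    rw [key] at this
    exact this
  refine ae_eq_zero_of_integral_contDiff_smul_eq_zero hG.locallyIntegrable fun g hg hgc => ?_
  have hg1 : HasCompactSupport (Complex.ofRealCLM ∘ g) := hgc.comp_left rfl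
  have hg2 : ContDiff ℝ ∞ (Complex.ofRealCLM ∘ g) := by fun_prop
  have := hall (𝓕 (hg1.toSchwartzMap hg2))
  rw [fourierInv_fourier_eq] at this
  exact this

/-! ### Weak curls and weak derivatives of slices -/

lemma contDiff_single {s : Space → ℂ} (hs : ContDiff ℝ ∞ s) (i : Fin 3) :
    ContDiff ℝ ∞ fun p => (EuclideanSpace.single i (s p) : Vec) := by
  have h : (fun p => (EuclideanSpace.single i (s p) : Vec))
      = fun p => s p • (EuclideanSpace.single i 1 : Vec) := by
    ext p j
    simp
  rw [h]
  exact hs.smul contDiff_const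

lemma HasWeakCurl.comp_zero {Ω : Set Space} {F C : Space → Vec} (h : HasWeakCurl Ω F C)
    {s : Space → ℂ} (hs : ContDiff ℝ ∞ s) (hc : HasCompactSupport s) (hΩ : tsupport s ⊆ Ω) :
    ∫ p in Ω, (F p 1 * fderiv ℝ s p (dir 2) - F p 2 * fderiv ℝ s p (dir 1))
      = ∫ p in Ω, C p 0 * s p := by
  have key := h (fun p => EuclideanSpace.single 0 (s p)) (contDiff_single hs 0)
    (hc.comp_left (g := fun z => (EuclideanSpace.single 0 z : Vec)) (by simp))
    ((closure_mono (Function.support_comp_subset (g := fun z => (EuclideanSpace.single 0 z : Vec))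
      (by simp) s)).trans hΩ)
  have e1 : ∀ p, dot (F p) (curl (fun p => EuclideanSpace.single 0 (s p)) p)
      = F p 1 * fderiv ℝ s p (dir 2) - F p 2 * fderiv ℝ s p (dir 1) := fun p => by
    simp [dot, curl, pd, Fin.sum_univ_three]
    ring
  have e2 : ∀ p, dot (C p) (EuclideanSpace.single 0 (s p)) = C p 0 * s p := fun p => by
    simp [dot]
  simpa only [e1, e2] using key

lemma HasWeakCurl.comp_one {Ω : Set Space} {F C : Space → Vec} (h : HasWeakCurl Ω F C)
    {s : Space → ℂ} (hs : ContDiff ℝ ∞ s) (hc : HasCompactSupport s) (hΩ : tsupport s ⊆ Ω) :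
    ∫ p in Ω, (F p 2 * fderiv ℝ s p (dir 0) - F p 0 * fderiv ℝ s p (dir 2))
      = ∫ p in Ω, C p 1 * s p := by
  have key := h (fun p => EuclideanSpace.single 1 (s p)) (contDiff_single hs 1)
    (hc.comp_left (g := fun z => (EuclideanSpace.single 1 z : Vec)) (by simp))
    ((closure_mono (Function.support_comp_subset (g := fun z => (EuclideanSpace.single 1 z : Vec))
      (by simp) s)).trans hΩ)
  have e1 : ∀ p, dot (F p) (curl (fun p => EuclideanSpace.single 1 (s p)) p)
      = F p 2 * fderiv ℝ s p (dir 0) - F p 0 * fderiv ℝ s p (dir 2) := fun p => by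
    simp [dot, curl, pd, Fin.sum_univ_three]
    ring
  have e2 : ∀ p, dot (C p) (EuclideanSpace.single 1 (s p)) = C p 1 * s p := fun p => by
    simp [dot]
  simpa only [e1, e2] using key

lemma HasWeakCurl.comp_two {Ω : Set Space} {F C : Space → Vec} (h : HasWeakCurl Ω F C)
    {s : Space → ℂ} (hs : ContDiff ℝ ∞ s) (hc : HasCompactSupport s) (hΩ : tsupport s ⊆ Ω) :
    ∫ p in Ω, (F p 0 * fderiv ℝ s p (dir 1) - F p 1 * fderiv ℝ s p (dir 0))
      = ∫ p in Ω, C p 2 * s p := by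
  have key := h (fun p => EuclideanSpace.single 2 (s p)) (contDiff_single hs 2)
    (hc.comp_left (g := fun z => (EuclideanSpace.single 2 z : Vec)) (by simp))
    ((closure_mono (Function.support_comp_subset (g := fun z => (EuclideanSpace.single 2 z : Vec))
      (by simp) s)).trans hΩ)
  have e1 : ∀ p, dot (F p) (curl (fun p => EuclideanSpace.single 2 (s p)) p)
      = F p 0 * fderiv ℝ s p (dir 1) - F p 1 * fderiv ℝ s p (dir 0) := fun p => by
    simp [dot, curl, pd, Fin.sum_univ_three]
    ring
  have e2 : ∀ p, dot (C p) (EuclideanSpace.single 2 (s p)) = C p 2 * s p := fun p => by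
    simp [dot]
  simpa only [e1, e2] using key

/-! ### Products as test functions -/

/-- The product of a function of `(y, z)` and a function of the signed distance to a plane. -/
def prodTest (a τ : ℝ) (χ : ℝ → ℝ) (ψ : Plane → ℂ) (p : Space) : ℂ :=
  ψ p.2 * ((χ (τ * (a - p.1)) : ℝ) : ℂ)

section prodTest
variable {a τ : ℝ} {χ : ℝ → ℝ} {ψ : Plane → ℂ}

lemma contDiff_prodTest (hχ : ContDiff ℝ ∞ χ) (hψ : ContDiff ℝ ∞ ψ) :
    ContDiff ℝ ∞ (prodTest a τ χ ψ) := by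
  have h1 : ContDiff ℝ ∞ fun p : Space => χ (τ * (a - p.1)) := hχ.comp (by fun_prop)
  exact (hψ.comp contDiff_snd).mul (Complex.ofRealCLM.contDiff.comp h1)

lemma tsupport_prodTest_subset (hτ : τ = 1 ∨ τ = -1) (hχ : HasCompactSupport χ)
    (hψ : HasCompactSupport ψ) :
    tsupport (prodTest a τ χ ψ) ⊆ fromPlane a τ '' (tsupport ψ ×ˢ tsupport χ) := by
  have hk : IsCompact (fromPlane a τ '' (tsupport ψ ×ˢ tsupport χ)) :=
    (hψ.isCompact.prod hχ.isCompact).image (by unfold fromPlane; fun_prop)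
  refine closure_minimal ?_ hk.isClosed
  intro p hp
  have hp' : ψ p.2 ≠ 0 ∧ χ (τ * (a - p.1)) ≠ 0 := by
    simpa [prodTest, Function.mem_support] using hp
  refine ⟨(p.2, τ * (a - p.1)), ⟨subset_tsupport _ hp'.1, subset_tsupport _ hp'.2⟩, ?_⟩
  refine Prod.ext ?_ rfl
  simp only [fromPlane]
  linear_combination (p.1 - a) * sign_mul_self hτ

lemma hasCompactSupport_prodTest (hτ : τ = 1 ∨ τ = -1) (hχ : HasCompactSupport χ)
    (hψ : HasCompactSupport ψ) : HasCompactSupport (prodTest a τ χ ψ) :=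
  IsCompact.of_isClosed_subset ((hψ.isCompact.prod hχ.isCompact).image
    (by unfold fromPlane; fun_prop)) (isClosed_tsupport _) (tsupport_prodTest_subset hτ hχ hψ)

lemma tsupport_prodTest_subset_half (hτ : τ = 1 ∨ τ = -1) (hχ : HasCompactSupport χ)
    (hψ : HasCompactSupport ψ) (hs : tsupport χ ⊆ Ioi 0) :
    tsupport (prodTest a τ χ ψ) ⊆ half a τ := by
  refine (tsupport_prodTest_subset hτ hχ hψ).trans ?_
  rintro _ ⟨q, hq, rfl⟩
  have h1 : (0 : ℝ) < q.2 := hs hq.2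
  have h2 : τ * (a - (a - τ * q.2)) = q.2 := by linear_combination q.2 * sign_mul_self hτ
  change 0 < τ * (a - (a - τ * q.2))
  rw [h2]; exact h1

lemma fderiv_prodTest (hχ : ContDiff ℝ ∞ χ) (hψ : ContDiff ℝ ∞ ψ) (p v : Space) :
    fderiv ℝ (prodTest a τ χ ψ) p v = fderiv ℝ ψ p.2 v.2 * ((χ (τ * (a - p.1)) : ℝ) : ℂ)
      - (τ * v.1 : ℝ) * (ψ p.2 * ((deriv χ (τ * (a - p.1)) : ℝ) : ℂ)) := by
  have e1 : HasFDerivAt (fun p : Space => ψ p.2)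
      ((fderiv ℝ ψ p.2).comp (ContinuousLinearMap.snd ℝ ℝ Plane)) p :=
    (hψ.differentiable (by norm_num) p.2).hasFDerivAt.comp p hasFDerivAt_snd
  have e0 : HasFDerivAt (fun p : Space => τ * (a - p.1))
      (τ • -(ContinuousLinearMap.fst ℝ ℝ Plane)) p :=
    (hasFDerivAt_fst.const_sub a).const_mul τ
  have e2 : HasFDerivAt (fun p : Space => χ (τ * (a - p.1)))
      (deriv χ (τ * (a - p.1)) • (τ • -(ContinuousLinearMap.fst ℝ ℝ Plane))) p :=
    (hχ.differentiable (by norm_num) _).hasDerivAt.comp_hasFDerivAt p e0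
  have e3 := e1.mul (Complex.ofRealCLM.hasFDerivAt.comp p e2)
  have e4 : fderiv ℝ (prodTest a τ χ ψ) p = _ := e3.fderiv
  rw [e4]
  simp
  ring

lemma fderiv_prodTest_zero (hχ : ContDiff ℝ ∞ χ) (hψ : ContDiff ℝ ∞ ψ) (p : Space) :
    fderiv ℝ (prodTest a τ χ ψ) p (dir 0)
      = -(τ : ℂ) * (ψ p.2 * ((deriv χ (τ * (a - p.1)) : ℝ) : ℂ)) := by
  rw [fderiv_prodTest hχ hψ]
  simp [dir]

lemma fderiv_prodTest_one (hχ : ContDiff ℝ ∞ χ) (hψ : ContDiff ℝ ∞ ψ) (p : Space) :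
    fderiv ℝ (prodTest a τ χ ψ) p (dir 1)
      = fderiv ℝ ψ p.2 (EuclideanSpace.single 0 1) * ((χ (τ * (a - p.1)) : ℝ) : ℂ) := by
  rw [fderiv_prodTest hχ hψ]
  simp [dir]

lemma fderiv_prodTest_two (hχ : ContDiff ℝ ∞ χ) (hψ : ContDiff ℝ ∞ ψ) (p : Space) :
    fderiv ℝ (prodTest a τ χ ψ) p (dir 2)
      = fderiv ℝ ψ p.2 (EuclideanSpace.single 1 1) * ((χ (τ * (a - p.1)) : ℝ) : ℂ) := by
  rw [fderiv_prodTest hχ hψ]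
  simp [dir]

end prodTest

/-- If two families satisfy `v' = w` against each test function for almost every parameter, then
`v' = w` for almost every parameter: countably many test functions suffice. -/
lemma ae_isWeakDeriv {v w : Plane → Profile}
    (h : ∀ χ : ℝ → ℝ, ContDiff ℝ ∞ χ → HasCompactSupport χ → tsupport χ ⊆ Ioi 0 →
      ∀ᵐ k, ∫ t in Ioi (0 : ℝ), ((deriv χ t : ℝ) : ℂ) * v k t
        = -∫ t in Ioi (0 : ℝ), (χ t : ℂ) * w k t) :
    ∀ᵐ k, IsWeakDeriv (v k) (w k) := by
  let T := {χ : ℝ → ℝ // ContDiff ℝ ∞ χ ∧ HasCompactSupport χ ∧ tsupport χ ⊆ Ioi 0}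
  have mem : ∀ g : ℝ → ℝ, Continuous g → HasCompactSupport g →
      MemLp (fun t => (g t : ℂ)) 2 halfLine := fun g hg hc =>
    ((Complex.continuous_ofReal.comp hg).memLp_of_hasCompactSupport
      (hc.comp_left (g := fun x : ℝ => (x : ℂ)) (by simp)))
  have m0 : ∀ χ : T, MemLp (fun t => (χ.1 t : ℂ)) 2 halfLine := fun χ =>
    mem _ χ.2.1.continuous χ.2.2.1
  have m1 : ∀ χ : T, MemLp (fun t => ((deriv χ.1 t : ℝ) : ℂ)) 2 halfLine := fun χ =>
    mem _ (χ.2.1.continuous_deriv (by norm_num)) χ.2.2.1.deriv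
  let Φ : T → Profile × Profile := fun χ => ((m1 χ).toLp _, (m0 χ).toLp _)
  have hΦ : ∀ (χ : T) (f g : Profile), inner ℂ (Φ χ).1 f + inner ℂ (Φ χ).2 g
      = (∫ t in Ioi (0 : ℝ), ((deriv χ.1 t : ℝ) : ℂ) * f t)
        + ∫ t in Ioi (0 : ℝ), (χ.1 t : ℂ) * g t := fun χ f g => by
    rw [L2.inner_def, L2.inner_def]
    congr 1
    · refine integral_congr_ae ?_
      filter_upwards [(m1 χ).coeFn_toLp] with t ht
      change inner ℂ ((m1 χ).toLp _ t) (f t) = _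
      rw [ht, RCLike.inner_apply, Complex.conj_ofReal, mul_comm]
    · refine integral_congr_ae ?_
      filter_upwards [(m0 χ).coeFn_toLp] with t ht
      change inner ℂ ((m0 χ).toLp _ t) (g t) = _
      rw [ht, RCLike.inner_apply, Complex.conj_ofReal, mul_comm]
  obtain ⟨D, hDs, hDc, hDd⟩ := (TopologicalSpace.IsSeparable.of_separableSpace
    (range Φ)).exists_countable_dense_subset
  have hD : ∀ d ∈ D, ∀ᵐ k, inner ℂ d.1 (v k) + inner ℂ d.2 (w k) = 0 := fun d hd => by
    obtain ⟨χ, rfl⟩ := hDs hd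
    filter_upwards [h χ.1 χ.2.1 χ.2.2.1 χ.2.2.2] with k hk
    rw [hΦ, hk, neg_add_cancel]
  filter_upwards [(ae_ball_iff hDc).2 hD] with k hk χ h1 h2 h3
  have hcl : IsClosed {d : Profile × Profile | inner ℂ d.1 (v k) + inner ℂ d.2 (w k) = 0} :=
    isClosed_eq (by fun_prop) continuous_const
  have := (closure_minimal (fun d hd => hk d hd) hcl) (hDd ⟨⟨χ, h1, h2, h3⟩, rfl⟩)
  change inner ℂ (Φ ⟨χ, h1, h2, h3⟩).1 (v k) + inner ℂ (Φ ⟨χ, h1, h2, h3⟩).2 (w k) = 0 at this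
  rw [hΦ] at this
  exact eq_neg_of_add_eq_zero_left this

lemma eq_zero_of_isWeakDeriv_zero {w : Profile} (h : IsWeakDeriv (0 : Profile) w) : w = 0 := by
  have hw := locallyIntegrableOn_of_memLp (Lp.memLp w)
  have key := IsOpen.ae_eq_zero_of_integral_contDiff_smul_eq_zero (μ := volume)
    (f := fun t => w t) isOpen_Ioi hw ?_
  · rw [Lp.eq_zero_iff_ae_eq_zero]
    refine (ae_restrict_iff' measurableSet_Ioi).2 ?_
    exact key
  · intro χ hχ hc hs
    have h1 := h χ hχ hc hs
    have h2 : ∫ t in Ioi (0 : ℝ), ((deriv χ t : ℝ) : ℂ) * (0 : Profile) t = 0 := by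
      rw [← integral_zero ℝ ℂ (μ := halfLine)]
      refine integral_congr_ae ?_
      filter_upwards [Lp.coeFn_zero ℂ 2 halfLine] with t ht
      rw [ht]; simp
    rw [h2, setIntegral_Ioi_test hs] at h1
    simp only [Complex.real_smul]
    simpa using h1.symm

/-! ### The curl equations of almost every frequency -/

lemma integrableOn_half_mul {a τ : ℝ} (hτ : τ = 1 ∨ τ = -1) {F : Space → ℂ}
    (hF : MemLp F 2 (volume.restrict (half a τ))) {θ : ℝ → ℂ} (hθ : MemLp θ 2 halfLine)
    (ψ : 𝓢(Plane, ℂ)) :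
    IntegrableOn (fun p => ψ p.2 * θ (τ * (a - p.1)) * F p) (half a τ) := by
  rw [IntegrableOn, ← (measurePreserving_fromPlane hτ).integrable_comp_emb
    (measurableEmbedding_fromPlane hτ)]
  refine (integrable_fromPlane hF hθ ψ hτ).congr (Eventually.of_forall fun q => ?_)
  have : τ * (a - (fromPlane a τ q).1) = q.2 := by
    simp only [fromPlane]; linear_combination q.2 * sign_mul_self hτ
  simp only [Function.comp, this]
  rfl

section Symbol
variable {θ θ' : ℝ → ℂ} (hθ : MemLp θ 2 halfLine) (hθ' : MemLp θ' 2 halfLine) (m m' : Plane)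
  (α β : ℂ)

/-- The Fourier side of testing `∂_m f + ∂_{m'} f'`, `α g` and `β c` against products of a function
of `(y, z)` with the profiles `θ`, `θ'` and `θ`, respectively. -/
def testSymbol (f f' g c : Plane → Profile) (k : Plane) : ℂ :=
  -(2 * Real.pi * Complex.I) * ((inner ℝ k m : ℝ) : ℂ) * profilePairing hθ (f k)
    - (2 * Real.pi * Complex.I) * ((inner ℝ k m' : ℝ) : ℂ) * profilePairing hθ (f' k)
    + α * profilePairing hθ' (g k) - β * profilePairing hθ (c k)

variable (f f' g c : Lp Profile 2 (volume : Measure Plane))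

lemma memLp_profilePairing : MemLp (fun k => profilePairing hθ (f k)) 2 volume :=
  (profilePairing hθ).comp_memLp' (Lp.memLp f)

lemma isMild_testSymbol : IsMild (testSymbol hθ hθ' m m' α β f f' g c) := by
  have h1 := (IsMild.inner_mul (memLp_profilePairing hθ f) m).const_mul (-(2 * Real.pi * Complex.I))
  have h2 := (IsMild.inner_mul (memLp_profilePairing hθ f') m').const_mul (2 * Real.pi * Complex.I)
  have h3 := (IsMild.of_memLp (memLp_profilePairing hθ' g)).const_mul α
  have h4 := (IsMild.of_memLp (memLp_profilePairing hθ c)).const_mul β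
  convert ((h1.sub h2).add h3).sub h4 using 1
  funext k
  simp [testSymbol, mul_assoc]

end Symbol

section Bracket
variable {a τ : ℝ} {θ θ' : ℝ → ℂ} (hθ : MemLp θ 2 halfLine) (hθ' : MemLp θ' 2 halfLine)
  (m m' : Plane) (α β : ℂ) {f f' g c : Space → ℂ}

lemma integral_half_testSymbol (hτ : τ = 1 ∨ τ = -1)
    (hf : MemLp f 2 (volume.restrict (half a τ))) (hf' : MemLp f' 2 (volume.restrict (half a τ)))
    (hg : MemLp g 2 (volume.restrict (half a τ))) (hc : MemLp c 2 (volume.restrict (half a τ)))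
    (ψ : 𝓢(Plane, ℂ)) :
    (∫ p in half a τ, (fderiv ℝ ψ p.2 m * θ (τ * (a - p.1)) * f p
        + fderiv ℝ ψ p.2 m' * θ (τ * (a - p.1)) * f' p
        + α * (ψ p.2 * θ' (τ * (a - p.1)) * g p)))
        - ∫ p in half a τ, β * (ψ p.2 * θ (τ * (a - p.1)) * c p)
      = ∫ k, (𝓕⁻ ψ : 𝓢(Plane, ℂ)) k * testSymbol hθ hθ' m m' α β
          (hat a τ f) (hat a τ f') (hat a τ g) (hat a τ c) k := by
  have i1 : IntegrableOn (fun p => fderiv ℝ ψ p.2 m * θ (τ * (a - p.1)) * f p) (half a τ) :=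
    integrableOn_half_mul hτ hf hθ (∂_{m} ψ)
  have i2 : IntegrableOn (fun p => fderiv ℝ ψ p.2 m' * θ (τ * (a - p.1)) * f' p) (half a τ) :=
    integrableOn_half_mul hτ hf' hθ (∂_{m'} ψ)
  have i3 := (integrableOn_half_mul hτ hg hθ' ψ).const_mul α
  have e1 : ∫ p in half a τ, fderiv ℝ ψ p.2 m * θ (τ * (a - p.1)) * f p = _ :=
    integral_half_mul hτ hf hθ (∂_{m} ψ)
  have e2 : ∫ p in half a τ, fderiv ℝ ψ p.2 m' * θ (τ * (a - p.1)) * f' p = _ :=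
    integral_half_mul hτ hf' hθ (∂_{m'} ψ)
  have e3 := integral_half_mul hτ hg hθ' ψ
  have e4 := integral_half_mul hτ hc hθ ψ
  have j : ∀ (G : Plane → ℂ), MemLp G 2 volume → ∀ φ : 𝓢(Plane, ℂ), Integrable fun k => φ k * G k :=
    fun G hG φ => (φ.memLp 2 (volume : Measure Plane)).integrable_mul hG
  have j1 := j _ (memLp_profilePairing hθ (hat a τ f)) (𝓕⁻ (∂_{m} ψ : 𝓢(Plane, ℂ)))
  have j2 := j _ (memLp_profilePairing hθ (hat a τ f')) (𝓕⁻ (∂_{m'} ψ : 𝓢(Plane, ℂ)))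
  have j3 := (j _ (memLp_profilePairing hθ' (hat a τ g)) (𝓕⁻ ψ)).const_mul α
  have j4 := (j _ (memLp_profilePairing hθ (hat a τ c)) (𝓕⁻ ψ)).const_mul β
  have i12 : IntegrableOn (fun p => fderiv ℝ ψ p.2 m * θ (τ * (a - p.1)) * f p
    + fderiv ℝ ψ p.2 m' * θ (τ * (a - p.1)) * f' p) (half a τ) := i1.add i2
  rw [integral_add i12 i3, integral_add i1 i2,
    integral_const_mul, integral_const_mul, e1, e2, e3, e4, ← integral_const_mul,
    ← integral_const_mul, ← integral_add j1 j2, ← integral_add (by exact j1.add j2) j3,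
    ← integral_sub (by exact (j1.add j2).add j3) j4]
  refine integral_congr_ae (Eventually.of_forall fun k => ?_)
  simp only [fourierInv_lineDeriv_apply, testSymbol]
  ring

lemma ae_testSymbol_eq_zero (hτ : τ = 1 ∨ τ = -1)
    (hf : MemLp f 2 (volume.restrict (half a τ))) (hf' : MemLp f' 2 (volume.restrict (half a τ)))
    (hg : MemLp g 2 (volume.restrict (half a τ))) (hc : MemLp c 2 (volume.restrict (half a τ)))
    (h : ∀ ψ : Plane → ℂ, ContDiff ℝ ∞ ψ → HasCompactSupport ψ →
      ∫ p in half a τ, (fderiv ℝ ψ p.2 m * θ (τ * (a - p.1)) * f p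
        + fderiv ℝ ψ p.2 m' * θ (τ * (a - p.1)) * f' p
        + α * (ψ p.2 * θ' (τ * (a - p.1)) * g p))
      = ∫ p in half a τ, β * (ψ p.2 * θ (τ * (a - p.1)) * c p)) :
    ∀ᵐ k, testSymbol hθ hθ' m m' α β (hat a τ f) (hat a τ f') (hat a τ g) (hat a τ c) k = 0 := by
  refine (isMild_testSymbol hθ hθ' m m' α β _ _ _ _).ae_eq_zero fun ψ hψ hψc => ?_
  rw [← integral_half_testSymbol hθ hθ' m m' α β hτ hf hf' hg hc]
  exact sub_eq_zero.2 (h ψ hψ hψc)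

end Bracket

lemma memLp_ofReal_test {χ : ℝ → ℝ} (hχ : Continuous χ) (hc : HasCompactSupport χ) :
    MemLp (fun t => (χ t : ℂ)) 2 halfLine :=
  (Complex.continuous_ofReal.comp hχ).memLp_of_hasCompactSupport
    (hc.comp_left (g := fun x : ℝ => (x : ℂ)) (by simp))

/-- On the Fourier side, an equation `∂_m f + ∂_x g = β c` (up to signs) becomes an ordinary
differential equation in the distance to the boundary. -/
lemma ae_isWeakDeriv_hat {a τ : ℝ} (hτ : τ = 1 ∨ τ = -1) {f g c : Space → ℂ} (m : Plane) (β : ℂ)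
    (hf : MemLp f 2 (volume.restrict (half a τ))) (hg : MemLp g 2 (volume.restrict (half a τ)))
    (hc : MemLp c 2 (volume.restrict (half a τ)))
    (h : ∀ (χ : ℝ → ℝ) (ψ : Plane → ℂ), ContDiff ℝ ∞ χ → HasCompactSupport χ → tsupport χ ⊆ Ioi 0 →
      ContDiff ℝ ∞ ψ → HasCompactSupport ψ →
      ∫ p in half a τ, (fderiv ℝ ψ p.2 m * (χ (τ * (a - p.1)) : ℂ) * f p
        + τ * (ψ p.2 * ((deriv χ (τ * (a - p.1)) : ℝ) : ℂ) * g p))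
      = ∫ p in half a τ, β * (ψ p.2 * (χ (τ * (a - p.1)) : ℂ) * c p)) :
    ∀ᵐ k, IsWeakDeriv (hat a τ g k) (-(τ : ℂ) • (β • hat a τ c k
      + ((2 * Real.pi * Complex.I) * ((inner ℝ k m : ℝ) : ℂ)) • hat a τ f k) : Profile) := by
  refine ae_isWeakDeriv fun χ hχ hχc hχs => ?_
  have h0 := memLp_ofReal_test hχ.continuous hχc
  have h1 := memLp_ofReal_test (hχ.continuous_deriv (by norm_num)) hχc.deriv
  have key := ae_testSymbol_eq_zero h0 h1 m 0 τ β hτ hf hf hg hc fun ψ hψ hψc => by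
    rw [← h χ ψ hχ hχc hχs hψ hψc]
    refine integral_congr_ae (Eventually.of_forall fun p => ?_)
    simp
  filter_upwards [key] with k hk
  rw [← profilePairing_apply h1, ← profilePairing_apply h0]
  simp only [testSymbol, inner_zero_right, Complex.ofReal_zero, mul_zero, zero_mul, sub_zero] at hk
  simp only [map_smul, map_add, smul_eq_mul]
  have hs : (τ : ℂ) * τ = 1 := by exact_mod_cast sign_mul_self hτ
  linear_combination (-profilePairing h1 (hat a τ g k)) * hs + (τ : ℂ) * hk

section Curl
variable {a τ : ℝ} {F C : Space → Vec}

/-- A weak curl in a half-space, on the Fourier side: the two equations with a normal derivative become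
ordinary differential equations for the tangential components, the third one is algebraic. -/
lemma HasWeakCurl.ae_hat (hτ : τ = 1 ∨ τ = -1) (h : HasWeakCurl (half a τ) F C)
    (hF : ∀ j, MemLp (fun p => F p j) 2 (volume.restrict (half a τ)))
    (hC : ∀ j, MemLp (fun p => C p j) 2 (volume.restrict (half a τ))) :
    ∀ᵐ k : Plane,
      IsWeakDeriv (hat a τ (fun p => F p 1) k) (-(τ : ℂ) • (hat a τ (fun p => C p 2) k
        + ((2 * Real.pi * Complex.I) * ((k 0 : ℝ) : ℂ)) • hat a τ (fun p => F p 0) k) : Profile) ∧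
      IsWeakDeriv (hat a τ (fun p => F p 2) k) (-(τ : ℂ) • (-hat a τ (fun p => C p 1) k
        + ((2 * Real.pi * Complex.I) * ((k 1 : ℝ) : ℂ)) • hat a τ (fun p => F p 0) k) : Profile) ∧
      hat a τ (fun p => C p 0) k = ((2 * Real.pi * Complex.I) * ((k 0 : ℝ) : ℂ)) •
        hat a τ (fun p => F p 2) k - ((2 * Real.pi * Complex.I) * ((k 1 : ℝ) : ℂ)) •
        hat a τ (fun p => F p 1) k := by
  have r1 := ae_isWeakDeriv_hat hτ (EuclideanSpace.single 0 1) 1 (hF 0) (hF 1) (hC 2)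
    fun χ ψ hχ hχc hχs hψ hψc => by
      convert h.comp_two (contDiff_prodTest (a := a) (τ := τ) hχ hψ)
        (hasCompactSupport_prodTest hτ hχc hψc) (tsupport_prodTest_subset_half hτ hχc hψc hχs)
        using 3 with p p
      · rw [fderiv_prodTest_zero hχ hψ, fderiv_prodTest_one hχ hψ]; ring
      · rw [prodTest]; ring
  have r2 := ae_isWeakDeriv_hat hτ (EuclideanSpace.single 1 1) (-1) (hF 0) (hF 2) (hC 1)
    fun χ ψ hχ hχc hχs hψ hψc => by
      have := h.comp_one (contDiff_prodTest (a := a) (τ := τ) hχ hψ)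
        (hasCompactSupport_prodTest hτ hχc hψc) (tsupport_prodTest_subset_half hτ hχc hψc hχs)
      rw [← neg_inj, ← integral_neg, ← integral_neg] at this
      convert this using 3 with p p
      · rw [fderiv_prodTest_zero hχ hψ, fderiv_prodTest_two hχ hψ]; ring
      · rw [prodTest]; ring
  have r0 : ∀ᵐ k : Plane, IsWeakDeriv (0 : Profile) (((2 * Real.pi * Complex.I) * ((k 0 : ℝ) : ℂ)) •
        hat a τ (fun p => F p 2) k - ((2 * Real.pi * Complex.I) * ((k 1 : ℝ) : ℂ)) •
        hat a τ (fun p => F p 1) k - hat a τ (fun p => C p 0) k : Profile) := by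
    refine ae_isWeakDeriv fun χ hχ hχc hχs => ?_
    have h0 := memLp_ofReal_test hχ.continuous hχc
    have key := ae_testSymbol_eq_zero h0 h0 (EuclideanSpace.single 1 1)
      (-EuclideanSpace.single 0 1) 0 1 hτ (hF 1) (hF 2) (hF 0) (hC 0) fun ψ hψ hψc => by
        convert h.comp_zero (contDiff_prodTest (a := a) (τ := τ) hχ hψ)
          (hasCompactSupport_prodTest hτ hχc hψc) (tsupport_prodTest_subset_half hτ hχc hψc hχs)
          using 3 with p p
        · rw [fderiv_prodTest_one hχ hψ, fderiv_prodTest_two hχ hψ, map_neg]; ring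
        · rw [prodTest]; ring
    filter_upwards [key] with k hk
    rw [← profilePairing_apply h0,
      ← profilePairing_apply (memLp_ofReal_test (hχ.continuous_deriv (by norm_num)) hχc.deriv)]
    simp only [testSymbol, inner_neg_right, EuclideanSpace.inner_single_right] at hk
    simp only [map_smul, map_sub, map_zero, smul_eq_mul]
    simp at hk
    linear_combination hk
  filter_upwards [r1, r2, r0] with k h1 h2 h0
  refine ⟨?_, ?_, ?_⟩
  · simpa [EuclideanSpace.inner_single_right] using h1
  · simpa [EuclideanSpace.inner_single_right] using h2
  · exact (sub_eq_zero.1 (eq_zero_of_isWeakDeriv_zero h0)).symm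

end Curl

/-! ### Traces on planes -/

lemma IsWeakDeriv.tendsto_profileMean {f h : Profile} (hd : IsWeakDeriv f h) {ℓ : ℝ} (hℓ : 0 ≤ ℓ) :
    Tendsto (fun n : ℕ => profileMean ℓ (1 / ((n : ℝ) + 1)) f) atTop (𝓝 (profileTrace ℓ f)) := by
  obtain ⟨c, hc⟩ := hd.exists_primitive (Lp.memLp f) (Lp.memLp h)
  rw [tendsto_iff_norm_sub_tendsto_zero]
  refine squeeze_zero (fun _ => norm_nonneg _)
    (fun n => hd.norm_profileMean_sub_profileTrace_le hℓ (by positivity)) ?_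
  have h1 : Tendsto (fun n : ℕ => Real.sqrt (1 / ((n : ℝ) + 1))) atTop (𝓝 0) := by
    have := (Real.continuous_sqrt.tendsto 0).comp (tendsto_one_div_add_atTop_nhds_zero_nat (𝕜 := ℝ))
    simpa [Function.comp_def] using this
  simpa using h1.mul_const ‖h‖

lemma memLp_meanKernel (ℓ δ : ℝ) :
    MemLp ((Ioo ℓ (ℓ + δ)).indicator fun _ => (δ : ℂ)⁻¹) 2 halfLine :=
  memLp_indicator_const _ measurableSet_Ioo _ (Or.inr (ne_top_of_le_ne_top
    (by simp : volume (Ioo ℓ (ℓ + δ)) ≠ ⊤) (Measure.restrict_apply_le _ _)))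

lemma profilePairing_meanKernel {ℓ : ℝ} (hℓ : 0 ≤ ℓ) (δ : ℝ) (f : Profile) :
    profilePairing (memLp_meanKernel ℓ δ) f = profileMean ℓ δ f := by
  rw [profilePairing_apply, profileMean, ← integral_const_mul]
  have hsub : Ioo ℓ (ℓ + δ) ⊆ Ioi 0 := fun s hs => lt_of_le_of_lt hℓ hs.1
  have : ∀ t, (Ioo ℓ (ℓ + δ)).indicator (fun _ => (δ : ℂ)⁻¹) t * f t
      = (Ioo ℓ (ℓ + δ)).indicator (fun t => (δ : ℂ)⁻¹ * f t) t := fun t => by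
    by_cases h : t ∈ Ioo ℓ (ℓ + δ) <;> simp [h]
  simp only [this]
  rw [setIntegral_indicator measurableSet_Ioo, inter_eq_self_of_subset_right hsub]

/-- Families of profiles that are weakly differentiable, with derivatives bounded by `1 + ‖k‖` times
a square integrable function. Such profiles are continuous up to `0`. -/
def HasMildDeriv (G : Plane → Profile) : Prop :=
  ∃ B : Plane → ℝ, MemLp B 2 volume ∧
    ∀ᵐ k, ∃ h : Profile, IsWeakDeriv (G k) h ∧ ‖h‖ ≤ (1 + ‖k‖) * B k

lemma HasMildDeriv.congr {G G' : Plane → Profile} (h : HasMildDeriv G) (he : G =ᵐ[volume] G') :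
    HasMildDeriv G' := by
  obtain ⟨B, hB, h⟩ := h
  refine ⟨B, hB, ?_⟩
  filter_upwards [h, he] with k hk e
  rwa [← e]

lemma HasMildDeriv.smul {G : Plane → Profile} (h : HasMildDeriv G) (c : ℂ) :
    HasMildDeriv (fun k => c • G k) := by
  obtain ⟨B, hB, h⟩ := h
  refine ⟨fun k => ‖c‖ * B k, hB.const_mul _, h.mono ?_⟩
  rintro k ⟨w, h1, h2⟩
  refine ⟨c • w, weakDerivGraph.smul_mem c (mem_weakDerivGraph.2 h1), ?_⟩
  rw [norm_smul]
  calc ‖c‖ * ‖w‖ ≤ ‖c‖ * ((1 + ‖k‖) * B k) := by gcongr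
    _ = _ := by ring

lemma HasMildDeriv.sub {G G' : Plane → Profile} (h : HasMildDeriv G) (h' : HasMildDeriv G') :
    HasMildDeriv (fun k => G k - G' k) := by
  obtain ⟨B, hB, h⟩ := h
  obtain ⟨B', hB', h'⟩ := h'
  refine ⟨fun k => B k + B' k, hB.add hB', ?_⟩
  filter_upwards [h, h']
  rintro k ⟨w, h1, h2⟩ ⟨w', h1', h2'⟩
  refine ⟨w - w', weakDerivGraph.sub_mem (mem_weakDerivGraph.2 h1) (mem_weakDerivGraph.2 h1'), ?_⟩
  refine (norm_sub_le _ _).trans ?_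
  linarith

lemma profileTrace_smul {f h : Profile} (hd : IsWeakDeriv f h) {ℓ : ℝ} (hℓ : 0 ≤ ℓ) (c : ℂ) :
    profileTrace ℓ (c • f : Profile) = c * profileTrace ℓ f := by
  refine Tendsto.limUnder_eq (((hd.tendsto_profileMean hℓ).const_mul c).congr fun n => ?_)
  rw [← profilePairing_meanKernel hℓ, ← profilePairing_meanKernel hℓ, map_smul, smul_eq_mul]

lemma profileTrace_sub {f h f' h' : Profile} (hd : IsWeakDeriv f h) (hd' : IsWeakDeriv f' h')
    {ℓ : ℝ} (hℓ : 0 ≤ ℓ) :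
    profileTrace ℓ (f - f' : Profile) = profileTrace ℓ f - profileTrace ℓ f' := by
  refine Tendsto.limUnder_eq
    (((hd.tendsto_profileMean hℓ).sub (hd'.tendsto_profileMean hℓ)).congr fun n => ?_)
  simp only [← profilePairing_meanKernel hℓ, map_sub]

lemma HasMildDeriv.ae_exists {G : Plane → Profile} (h : HasMildDeriv G) :
    ∀ᵐ k, ∃ w : Profile, IsWeakDeriv (G k) w := by
  obtain ⟨B, -, h⟩ := h
  exact h.mono fun k ⟨w, hw, _⟩ => ⟨w, hw⟩

section
variable {G : Lp Profile 2 (volume : Measure Plane)} {ℓ : ℝ}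

lemma HasMildDeriv.aestronglyMeasurable_profileTrace (h : HasMildDeriv G) (hℓ : 0 ≤ ℓ) :
    AEStronglyMeasurable (fun k => profileTrace ℓ (G k)) volume := by
  refine aestronglyMeasurable_of_tendsto_ae atTop (f := fun (n : ℕ) k =>
    profileMean ℓ (1 / ((n : ℝ) + 1)) (G k)) (fun n => ?_) ?_
  · simp only [← profilePairing_meanKernel hℓ]
    exact (memLp_profilePairing _ G).1
  · exact h.ae_exists.mono fun k ⟨w, hw⟩ => hw.tendsto_profileMean hℓ

/-- The trace inequality: traces of fields with square integrable curl are in `H^{-1/2}`. -/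
lemma HasMildDeriv.exists_norm_profileTrace_le (h : HasMildDeriv G) (hℓ : 0 ≤ ℓ) :
    ∃ b : Plane → ℝ, MemLp b 2 volume ∧
      ∀ᵐ k, 0 ≤ b k ∧ ‖profileTrace ℓ (G k)‖ ≤ Real.sqrt (1 + ‖k‖) * b k := by
  obtain ⟨B, hB, h⟩ := h
  refine ⟨fun k => ‖G k‖ + B k, (Lp.memLp G).norm.add hB, h.mono ?_⟩
  rintro k ⟨w, h1, h2⟩
  have hk : 0 < 1 + ‖k‖ := by positivity
  have hw : ‖w‖ / (1 + ‖k‖) ≤ B k := by rw [div_le_iff₀ hk]; linarith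
  have hB0 : 0 ≤ B k := le_trans (by positivity) hw
  refine ⟨by positivity, (h1.norm_profileTrace_le hℓ hk).trans ?_⟩
  gcongr
  exact add_le_add le_rfl hw

lemma HasMildDeriv.isMild_profileTrace (h : HasMildDeriv G) (hℓ : 0 ≤ ℓ) :
    IsMild fun k => profileTrace ℓ (G k) := by
  obtain ⟨b, hb, h1⟩ := h.exists_norm_profileTrace_le hℓ
  refine IsMild.of_norm_le (h.aestronglyMeasurable_profileTrace hℓ) hb ?_
  filter_upwards [h1] with k hk
  refine hk.2.trans (mul_le_mul_of_nonneg_right ?_ hk.1)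
  rw [Real.sqrt_le_left (by positivity)]
  nlinarith [norm_nonneg k]

end

section Slab
variable {a τ : ℝ} {f : Space → ℂ} {ℓ : ℝ}

lemma integral_half_meanKernel (hτ : τ = 1 ∨ τ = -1) (hℓ : 0 ≤ ℓ)
    (hf : MemLp f 2 (volume.restrict (half a τ))) (ψ : 𝓢(Plane, ℂ)) (δ : ℝ) :
    (δ : ℂ)⁻¹ * ∫ p in {p : Space | τ * (a - p.1) ∈ Ioo ℓ (ℓ + δ)}, ψ p.2 * f p
      = ∫ k, (𝓕⁻ ψ : 𝓢(Plane, ℂ)) k * profileMean ℓ δ (hat a τ f k) := by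
  have h1 := integral_half_mul hτ hf (memLp_meanKernel ℓ δ) ψ
  simp only [profilePairing_meanKernel hℓ] at h1
  rw [← h1, ← integral_const_mul]
  set S := {p : Space | τ * (a - p.1) ∈ Ioo ℓ (ℓ + δ)} with hS
  have hSm : MeasurableSet S := measurableSet_Ioo.preimage (by fun_prop : Measurable fun p : Space => τ * (a - p.1))
  have hsub : S ⊆ half a τ := fun p hp => lt_of_le_of_lt hℓ hp.1
  have : ∀ p : Space, ψ p.2 * (Ioo ℓ (ℓ + δ)).indicator (fun _ => (δ : ℂ)⁻¹) (τ * (a - p.1)) * f p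
      = S.indicator (fun p => (δ : ℂ)⁻¹ * (ψ p.2 * f p)) p := fun p => by
    by_cases h : p ∈ S
    · rw [indicator_of_mem h, indicator_of_mem (by exact h)]; ring
    · rw [indicator_of_notMem h, indicator_of_notMem (by exact h)]; ring
  simp only [this]
  rw [setIntegral_indicator hSm, inter_eq_self_of_subset_right hsub]

/-- The traces in the sense of distributions are given by the traces of the Fourier modes: the mean of a
profile over an interval of length `δ` differs from its trace by at most `√δ` times the norm of its
derivative, which is integrable against Schwartz functions of the frequency. -/
lemma tendsto_slab (hτ : τ = 1 ∨ τ = -1) (hℓ : 0 ≤ ℓ)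
    (hf : MemLp f 2 (volume.restrict (half a τ))) (hd : HasMildDeriv (hat a τ f)) (ψ : 𝓢(Plane, ℂ)) :
    Tendsto (fun δ : ℝ => (δ : ℂ)⁻¹ * ∫ p in {p : Space | τ * (a - p.1) ∈ Ioo ℓ (ℓ + δ)}, ψ p.2 * f p)
      (𝓝[>] 0) (𝓝 (∫ k, (𝓕⁻ ψ : 𝓢(Plane, ℂ)) k * profileTrace ℓ (hat a τ f k))) := by
  simp only [integral_half_meanKernel hτ hℓ hf]
  have hT := (hd.isMild_profileTrace hℓ).integrable_mul (𝓕⁻ ψ)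
  obtain ⟨B, hB, h⟩ := hd
  set g : Plane → ℂ := fun k => ((1 + ‖k‖ : ℝ) : ℂ) * (‖B k‖ : ℝ) with hg
  have hgm : IsMild g := by
    refine IsMild.of_norm_le (g := fun k => ‖B k‖) ?_ hB.norm (Eventually.of_forall fun k => ?_)
    · exact (by fun_prop : Continuous fun k : Plane => ((1 + ‖k‖ : ℝ) : ℂ)).aestronglyMeasurable.mul
        (Complex.continuous_ofReal.comp_aestronglyMeasurable hB.norm.1)
    · rw [hg, norm_mul, Complex.norm_real, Complex.norm_real, norm_norm,
        Real.norm_of_nonneg (by positivity)]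
  have hgi := (hgm.integrable_mul (𝓕⁻ ψ)).norm
  rw [tendsto_iff_norm_sub_tendsto_zero]
  have hlim : Tendsto (fun δ : ℝ => Real.sqrt δ * ∫ k, ‖(𝓕⁻ ψ : 𝓢(Plane, ℂ)) k * g k‖)
      (𝓝[>] 0) (𝓝 0) := by
    have := ((Real.continuous_sqrt.tendsto 0).mono_left (nhdsWithin_le_nhds (s := Ioi 0))).mul_const
      (∫ k, ‖(𝓕⁻ ψ : 𝓢(Plane, ℂ)) k * g k‖)
    simpa using this
  refine squeeze_zero' (Eventually.of_forall fun _ => norm_nonneg _) ?_ hlim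
  filter_upwards [self_mem_nhdsWithin] with δ hδ
  have i1 : Integrable fun k => (𝓕⁻ ψ : 𝓢(Plane, ℂ)) k * profileMean ℓ δ (hat a τ f k) := by
    simp only [← profilePairing_meanKernel hℓ]
    exact ((𝓕⁻ ψ : 𝓢(Plane, ℂ)).memLp 2 (volume : Measure Plane)).integrable_mul
      (memLp_profilePairing _ _)
  rw [← integral_sub i1 hT, ← integral_const_mul]
  refine norm_integral_le_of_norm_le (hgi.const_mul _) ?_
  filter_upwards [h]
  rintro k ⟨w, h1, h2⟩
  rw [← mul_sub, norm_mul, norm_mul]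
  have h3 := h1.norm_profileMean_sub_profileTrace_le hℓ hδ
  have h4 : ‖g k‖ = (1 + ‖k‖) * ‖B k‖ := by
    rw [hg, norm_mul, Complex.norm_real, Complex.norm_real, norm_norm,
        Real.norm_of_nonneg (by positivity)]
  rw [h4]
  calc _ ≤ ‖(𝓕⁻ ψ : 𝓢(Plane, ℂ)) k‖ * (Real.sqrt δ * ((1 + ‖k‖) * ‖B k‖)) := by
        gcongr
        refine h3.trans ?_
        gcongr
        refine h2.trans ?_
        gcongr
        exact Real.le_norm_self _
    _ = _ := by ring

end Slab

section Agree
variable {a a₁ a₂ : ℝ} {F G : Space → Vec}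

lemma slabMean_apply {a τ ℓ h : ℝ} (hℓ : 0 ≤ ℓ) (hτ : τ = 1 ∨ τ = -1) {I : Set ℝ} (hh : 0 < h)
    (hI : {p : Space | p.1 ∈ I} = {p : Space | τ * (a - p.1) ∈ Ioo ℓ (ℓ + h)})
    (hF : ∀ j, MemLp (fun p => F p j) 2 (volume.restrict (half a τ))) (ψ : 𝓢(Plane, ℂ)) (j : Fin 3) :
    slabMean F I h ψ j
      = (h : ℂ)⁻¹ * ∫ p in {p : Space | τ * (a - p.1) ∈ Ioo ℓ (ℓ + h)}, ψ p.2 * F p j := by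
  have hi : ∀ j, IntegrableOn (fun p => (ψ p.2 • F p) j)
      {p : Space | τ * (a - p.1) ∈ Ioo ℓ (ℓ + h)} := fun j => by
    have h1 := integrableOn_half_mul hτ (hF j) (memLp_meanKernel ℓ h) ψ
    have hsub : {p : Space | τ * (a - p.1) ∈ Ioo ℓ (ℓ + h)} ⊆ half a τ :=
      fun p hp => lt_of_le_of_lt hℓ hp.1
    have hm : MeasurableSet {p : Space | τ * (a - p.1) ∈ Ioo ℓ (ℓ + h)} :=
      measurableSet_Ioo.preimage (by fun_prop : Measurable fun p : Space => τ * (a - p.1))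
    refine ((h1.mono_set hsub).const_mul (h : ℂ)).congr ?_
    refine (ae_restrict_iff' hm).2 (Eventually.of_forall fun p hp => ?_)
    have hne : (h : ℂ) ≠ 0 := by exact_mod_cast hh.ne'
    simp only []
    rw [indicator_of_mem (by exact hp), PiLp.smul_apply, smul_eq_mul]
    field_simp
  rw [slabMean, hI, PiLp.smul_apply, eval_integral_piLp hi, Complex.real_smul, Complex.ofReal_inv]
  simp only [PiLp.smul_apply, smul_eq_mul]

/-- The transmission condition on the plane `x = a`, in terms of the Fourier modes on both sides: both
distributional traces exist, and they are determined by their Fourier transforms. -/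
lemma tracesAgree_iff (h₁ : a ≤ a₁) (h₂ : a₂ ≤ a)
    (hF : ∀ j, MemLp (fun p => F p j) 2 (volume.restrict (half a₁ 1)))
    (hG : ∀ j, MemLp (fun p => G p j) 2 (volume.restrict (half a₂ (-1))))
    (hFd : ∀ j, HasMildDeriv (hat a₁ 1 fun p => F p j))
    (hGd : ∀ j, HasMildDeriv (hat a₂ (-1) fun p => G p j)) :
    TracesAgree a F G ↔ ∀ j, ∀ᵐ k, profileTrace (a₁ - a) (hat a₁ 1 (fun p => F p j) k)
      = profileTrace (a - a₂) (hat a₂ (-1) (fun p => G p j) k) := by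
  have ht₁ : (1 : ℝ) = 1 ∨ (1 : ℝ) = -1 := Or.inl rfl
  have ht₂ : (-1 : ℝ) = 1 ∨ (-1 : ℝ) = -1 := Or.inr rfl
  have hl₁ : 0 ≤ a₁ - a := by linarith
  have hl₂ : 0 ≤ a - a₂ := by linarith
  have hI₁ : ∀ h : ℝ, {p : Space | p.1 ∈ Ioo (a - h) a}
      = {p : Space | 1 * (a₁ - p.1) ∈ Ioo (a₁ - a) (a₁ - a + h)} := fun h => by
    ext p
    constructor <;> rintro ⟨h1, h2⟩ <;> constructor <;> linarith
  have hI₂ : ∀ h : ℝ, {p : Space | p.1 ∈ Ioo a (a + h)}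
      = {p : Space | (-1) * (a₂ - p.1) ∈ Ioo (a - a₂) (a - a₂ + h)} := fun h => by
    ext p
    constructor <;> rintro ⟨h1, h2⟩ <;> constructor <;> linarith
  have lim₁ : ∀ (ψ : 𝓢(Plane, ℂ)) (j : Fin 3), Tendsto (fun h : ℝ => slabMean F (Ioo (a - h) a) h ψ j)
      (𝓝[>] 0) (𝓝 (∫ k, (𝓕⁻ ψ : 𝓢(Plane, ℂ)) k *
        profileTrace (a₁ - a) (hat a₁ 1 (fun p => F p j) k))) := fun ψ j => by
    refine (tendsto_slab ht₁ hl₁ (hF j) (hFd j) ψ).congr' ?_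
    filter_upwards [self_mem_nhdsWithin] with h hh
    exact (slabMean_apply hl₁ ht₁ hh (hI₁ h) hF ψ j).symm
  have lim₂ : ∀ (ψ : 𝓢(Plane, ℂ)) (j : Fin 3), Tendsto (fun h : ℝ => slabMean G (Ioo a (a + h)) h ψ j)
      (𝓝[>] 0) (𝓝 (∫ k, (𝓕⁻ ψ : 𝓢(Plane, ℂ)) k *
        profileTrace (a - a₂) (hat a₂ (-1) (fun p => G p j) k))) := fun ψ j => by
    refine (tendsto_slab ht₂ hl₂ (hG j) (hGd j) ψ).congr' ?_
    filter_upwards [self_mem_nhdsWithin] with h hh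
    exact (slabMean_apply hl₂ ht₂ hh (hI₂ h) hG ψ j).symm
  have vec : ∀ {l : Filter ℝ} {u : ℝ → Vec} {v : Fin 3 → ℂ},
      (∀ j, Tendsto (fun h => u h j) l (𝓝 (v j))) → Tendsto u l (𝓝 (WithLp.toLp 2 v)) :=
    fun {l u v} hu => by
      have h1 : Tendsto (fun h => WithLp.ofLp (u h)) l (𝓝 v) := tendsto_pi_nhds.2 hu
      exact ((PiLp.continuous_toLp 2 fun _ : Fin 3 => ℂ).tendsto v).comp h1
  have ev : ∀ {l : Filter ℝ} {u : ℝ → Vec} {v : Vec}, Tendsto u l (𝓝 v) →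
      ∀ j, Tendsto (fun h => u h j) l (𝓝 (v j)) := fun {l u v} hu j => by
    exact ((by fun_prop : Continuous fun w : Vec => w j).tendsto v).comp hu
  constructor
  · intro hA j
    have hz := ((hFd j).isMild_profileTrace hl₁).sub ((hGd j).isMild_profileTrace hl₂)
    have := hz.ae_eq_zero fun ψ hψ hc => by
      obtain ⟨l, hl1, hl2⟩ := hA ψ hψ hc
      have e1 := tendsto_nhds_unique (ev hl1 j) (lim₁ (hc.toSchwartzMap hψ) j)
      have e2 := tendsto_nhds_unique (ev hl2 j) (lim₂ (hc.toSchwartzMap hψ) j)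
      simp only [Pi.sub_apply, mul_sub]
      rw [integral_sub (((hFd j).isMild_profileTrace hl₁).integrable_mul _)
        (((hGd j).isMild_profileTrace hl₂).integrable_mul _), ← e1, ← e2, sub_self]
    filter_upwards [this] with k hk
    exact sub_eq_zero.1 hk
  · intro hA ψ hψ hc
    refine ⟨_, vec (lim₁ (hc.toSchwartzMap hψ)), ?_⟩
    have e : ∀ j, ∫ k, (𝓕⁻ (hc.toSchwartzMap hψ) : 𝓢(Plane, ℂ)) k *
        profileTrace (a₁ - a) (hat a₁ 1 (fun p => F p j) k)
        = ∫ k, (𝓕⁻ (hc.toSchwartzMap hψ) : 𝓢(Plane, ℂ)) k *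
        profileTrace (a - a₂) (hat a₂ (-1) (fun p => G p j) k) := fun j =>
      integral_congr_ae ((hA j).mono fun k hk => by simp only [hk])
    simp only [e]
    exact vec (lim₂ (hc.toSchwartzMap hψ))

end Agree

/-! ### Traces of fields in the whole space -/

section Curl
variable {a τ : ℝ} {F C : Space → Vec}

lemma norm_two_pi_I_mul (x : ℝ) :
    ‖(2 * Real.pi * Complex.I) * (x : ℂ)‖ = 2 * Real.pi * |x| := by
  rw [norm_mul, Complex.norm_real, Real.norm_eq_abs]
  simp [Real.pi_nonneg]

lemma abs_apply_le_norm (k : Plane) (j : Fin 2) : |k j| ≤ ‖k‖ := by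
  simpa using PiLp.norm_apply_le k j

/-- The tangential components of a field with square integrable curl have a normal derivative. -/
lemma HasWeakCurl.hasMildDeriv (hτ : τ = 1 ∨ τ = -1) (h : HasWeakCurl (half a τ) F C)
    (hF : ∀ j, MemLp (fun p => F p j) 2 (volume.restrict (half a τ)))
    (hC : ∀ j, MemLp (fun p => C p j) 2 (volume.restrict (half a τ))) {j : Fin 3} (hj : j ≠ 0) :
    HasMildDeriv (hat a τ fun p => F p j) := by
  have hn : ‖-(τ : ℂ)‖ = 1 := by rcases hτ with rfl | rfl <;> simp
  have key : ∀ (A B : Profile) (k : Plane) (i : Fin 2),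
      ‖-(τ : ℂ) • (A + ((2 * Real.pi * Complex.I) * ((k i : ℝ) : ℂ)) • B)‖
        ≤ (1 + ‖k‖) * (‖A‖ + 2 * Real.pi * ‖B‖) := fun A B k i => by
    rw [norm_smul, hn, one_mul]
    refine (norm_add_le _ _).trans ?_
    rw [norm_smul, norm_two_pi_I_mul]
    have h1 := abs_apply_le_norm k i
    have h2 : 0 ≤ 2 * Real.pi * ‖B‖ := by positivity
    nlinarith [norm_nonneg k, norm_nonneg A, mul_le_mul_of_nonneg_right h1 h2,
      mul_nonneg (norm_nonneg k) (norm_nonneg A)]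
  have hm : ∀ A : Lp Profile 2 (volume : Measure Plane), MemLp (fun k => ‖A k‖
      + 2 * Real.pi * ‖hat a τ (fun p => F p 0) k‖) 2 volume := fun A =>
    (Lp.memLp A).norm.add ((Lp.memLp _).norm.const_mul _)
  have hj' : j = 1 ∨ j = 2 := by fin_cases j <;> simp_all
  rcases hj' with rfl | rfl
  · refine ⟨_, hm (hat a τ fun p => C p 2), ?_⟩
    filter_upwards [h.ae_hat hτ hF hC] with k hk
    exact ⟨_, hk.1, key _ _ _ _⟩
  · refine ⟨_, hm (hat a τ fun p => C p 1), ?_⟩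
    filter_upwards [h.ae_hat hτ hF hC] with k hk
    refine ⟨_, hk.2.1, ?_⟩
    rw [← norm_neg (hat a τ (fun p => C p 1) k)]
    exact key _ _ _ _

lemma curl_eq_zero_of_notMem {φ : Space → Vec} {p : Space} (hp : p ∉ tsupport φ) : curl φ p = 0 := by
  have hz : φ =ᶠ[𝓝 p] 0 := notMem_tsupport_iff_eventuallyEq.1 hp
  have : ∀ i j, pd j i φ p = 0 := fun i j => by
    have : (fun q => φ q i) =ᶠ[𝓝 p] fun _ => 0 := hz.mono fun q hq => by simp [hq]
    rw [pd, this.fderiv_eq]; simp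
  ext i
  fin_cases i <;> simp [curl, this]

lemma setIntegral_dot_curl {Ω : Set Space} {φ : Space → Vec} (hφ : tsupport φ ⊆ Ω)
    (F : Space → Vec) : ∫ p in Ω, dot (F p) (curl φ p) = ∫ p, dot (F p) (curl φ p) :=
  setIntegral_eq_integral_of_forall_compl_eq_zero fun p hp => by
    simp [dot, curl_eq_zero_of_notMem fun h => hp (hφ h)]

lemma setIntegral_dot {Ω : Set Space} {φ : Space → Vec} (hφ : tsupport φ ⊆ Ω)
    (F : Space → Vec) : ∫ p in Ω, dot (F p) (φ p) = ∫ p, dot (F p) (φ p) :=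
  setIntegral_eq_integral_of_forall_compl_eq_zero fun p hp => by
    simp [dot, image_eq_zero_of_notMem_tsupport fun h => hp (hφ h)]

lemma HasWeakCurl.mono {Ω Ω' : Set Space} (h : HasWeakCurl Ω' F C) (hs : Ω ⊆ Ω') :
    HasWeakCurl Ω F C := by
  intro φ h1 h2 h3
  have e := h φ h1 h2 (h3.trans hs)
  rwa [setIntegral_dot_curl (h3.trans hs), setIntegral_dot (h3.trans hs),
    ← setIntegral_dot_curl h3, ← setIntegral_dot h3] at e

instance isAddHaarMeasure_space : (volume : Measure Space).IsAddHaarMeasure := by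
  rw [Measure.volume_eq_prod]; infer_instance

lemma integral_mul_fderiv {f g : Space → ℂ} (hf : ContDiff ℝ ∞ f) (hg : ContDiff ℝ ∞ g)
    (hc : HasCompactSupport g) (v : Space) :
    ∫ p, f p * fderiv ℝ g p v = -∫ p, fderiv ℝ f p v * g p := by
  have hf' : Continuous fun p => fderiv ℝ f p v := (hf.continuous_fderiv (by norm_num)).clm_apply continuous_const
  have hg' : Continuous fun p => fderiv ℝ g p v := (hg.continuous_fderiv (by norm_num)).clm_apply continuous_const
  refine integral_mul_fderiv_eq_neg_fderiv_mul_of_integrable ?_ ?_ ?_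
    (fun x _ => hf.differentiable (by norm_num) x) fun x _ => hg.differentiable (by norm_num) x
  · exact (hf'.mul hg.continuous).integrable_of_hasCompactSupport hc.mul_left
  · exact (hf.continuous.mul hg').integrable_of_hasCompactSupport (hc.fderiv_apply ℝ v).mul_left
  · exact (hf.continuous.mul hg.continuous).integrable_of_hasCompactSupport hc.mul_left

lemma contDiff_component {φ : Space → Vec} (h : ContDiff ℝ ∞ φ) (j : Fin 3) :
    ContDiff ℝ ∞ fun p => φ p j :=
  ((EuclideanSpace.proj (𝕜 := ℂ) j : Vec →L[ℂ] ℂ).restrictScalars ℝ).contDiff.comp h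

lemma hasCompactSupport_component {φ : Space → Vec} (h : HasCompactSupport φ) (j : Fin 3) :
    HasCompactSupport fun p => φ p j :=
  h.comp_left (g := fun v : Vec => v j) (by simp)

lemma integral_alternating {f₀ f₁ f₂ f₃ f₄ f₅ : Space → ℂ} (h₀ : Integrable f₀) (h₁ : Integrable f₁)
    (h₂ : Integrable f₂) (h₃ : Integrable f₃) (h₄ : Integrable f₄) (h₅ : Integrable f₅) :
    ∫ p, (f₀ p - f₁ p + f₂ p - f₃ p + f₄ p - f₅ p) = (∫ p, f₀ p) - (∫ p, f₁ p) + (∫ p, f₂ p)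
      - (∫ p, f₃ p) + (∫ p, f₄ p) - ∫ p, f₅ p := by
  have a₁ : Integrable fun p => f₀ p - f₁ p := h₀.sub h₁
  have a₂ : Integrable fun p => f₀ p - f₁ p + f₂ p := a₁.add h₂
  have a₃ : Integrable fun p => f₀ p - f₁ p + f₂ p - f₃ p := a₂.sub h₃
  have a₄ : Integrable fun p => f₀ p - f₁ p + f₂ p - f₃ p + f₄ p := a₃.add h₄
  rw [integral_sub a₄ h₅, integral_add a₃ h₄, integral_sub a₂ h₃, integral_add a₁ h₂,
    integral_sub h₀ h₁]

/-- A smooth field has its classical curl as weak curl. -/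
lemma hasWeakCurl_of_contDiff {φ : Space → Vec} (hφ : ContDiff ℝ ∞ φ) (Ω : Set Space) :
    HasWeakCurl Ω φ (curl φ) := by
  intro χ h1 h2 h3
  rw [setIntegral_dot_curl h3, setIntegral_dot h3]
  have ibp := fun i j l => integral_mul_fderiv (contDiff_component hφ i) (contDiff_component h1 j) (hasCompactSupport_component h2 j) (dir l)
  have i1 : ∀ i j l, Integrable fun p => φ p i * fderiv ℝ (fun q => χ q j) p (dir l) := fun i j l =>
    ((contDiff_component hφ i).continuous.mul (((contDiff_component h1 j).continuous_fderiv
      (by norm_num)).clm_apply continuous_const)).integrable_of_hasCompactSupport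
      ((hasCompactSupport_component h2 j).fderiv_apply ℝ _).mul_left
  have i2 : ∀ i j l, Integrable fun p => fderiv ℝ (fun q => φ q i) p (dir l) * χ p j := fun i j l =>
    ((((contDiff_component hφ i).continuous_fderiv (by norm_num)).clm_apply continuous_const).mul
      (contDiff_component h1 j).continuous).integrable_of_hasCompactSupport (hasCompactSupport_component h2 j).mul_left
  have e1 : ∫ p, dot (φ p) (curl χ p)
      = ((((((∫ p, φ p 0 * fderiv ℝ (fun q => χ q 2) p (dir 1))
        - ∫ p, φ p 0 * fderiv ℝ (fun q => χ q 1) p (dir 2))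
        + ∫ p, φ p 1 * fderiv ℝ (fun q => χ q 0) p (dir 2))
        - ∫ p, φ p 1 * fderiv ℝ (fun q => χ q 2) p (dir 0))
        + ∫ p, φ p 2 * fderiv ℝ (fun q => χ q 1) p (dir 0))
        - ∫ p, φ p 2 * fderiv ℝ (fun q => χ q 0) p (dir 1)) := by
    rw [← integral_alternating (i1 _ _ _) (i1 _ _ _) (i1 _ _ _) (i1 _ _ _) (i1 _ _ _) (i1 _ _ _)]
    refine integral_congr_ae (Eventually.of_forall fun p => ?_)
    simp [dot, curl, pd, Fin.sum_univ_three]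
    ring
  have e2 : ∫ p, dot (curl φ p) (χ p)
      = ((((((∫ p, fderiv ℝ (fun q => φ q 2) p (dir 1) * χ p 0)
        - ∫ p, fderiv ℝ (fun q => φ q 1) p (dir 2) * χ p 0)
        + ∫ p, fderiv ℝ (fun q => φ q 0) p (dir 2) * χ p 1)
        - ∫ p, fderiv ℝ (fun q => φ q 2) p (dir 0) * χ p 1)
        + ∫ p, fderiv ℝ (fun q => φ q 1) p (dir 0) * χ p 2)
        - ∫ p, fderiv ℝ (fun q => φ q 0) p (dir 1) * χ p 2) := by
    rw [← integral_alternating (i2 _ _ _) (i2 _ _ _) (i2 _ _ _) (i2 _ _ _) (i2 _ _ _) (i2 _ _ _)]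
    refine integral_congr_ae (Eventually.of_forall fun p => ?_)
    simp [dot, curl, pd, Fin.sum_univ_three]
    ring
  rw [e1, e2, ibp, ibp, ibp, ibp, ibp, ibp]
  ring

end Curl

section Whole
variable {a : ℝ}

lemma univ_ae_eq_union_half : (univ : Set Space) =ᵐ[volume] (half a 1 ∪ half a (-1) : Set Space) := by
  have h : (half a 1 ∪ half a (-1))ᶜ ⊆ ({a} ×ˢ univ : Set Space) := fun p hp => by
    simp only [half, mem_compl_iff, mem_union, not_or] at hp
    refine ⟨?_, mem_univ _⟩
    have h1 : ¬ (0 < 1 * (a - p.1)) := hp.1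
    have h2 : ¬ (0 < -1 * (a - p.1)) := hp.2
    exact mem_singleton_iff.2 (by linarith)
  refine (ae_eq_univ.2 (measure_mono_null h ?_)).symm
  rw [Measure.volume_eq_prod, Measure.prod_prod]
  simp

lemma integral_eq_add_half {g : Space → ℂ} (h1 : IntegrableOn g (half a 1))
    (h2 : IntegrableOn g (half a (-1))) :
    ∫ p, g p = (∫ p in half a 1, g p) + ∫ p in half a (-1), g p := by
  rw [← setIntegral_univ, setIntegral_congr_set (univ_ae_eq_union_half (a := a)),
    setIntegral_union _ (measurableSet_half _ _) h1 h2]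
  rw [Set.disjoint_left]
  intro p hp hp'
  have h1 : 0 < 1 * (a - p.1) := hp
  have h2 : 0 < -1 * (a - p.1) := hp'
  linarith

end Whole

/-- The Fourier side of the test integral of an equation, in terms of the trace. -/
lemma testSymbol_eq_trace {τ : ℝ} (hτ : τ = 1 ∨ τ = -1) {χ : ℝ → ℝ} (hχ : ContDiff ℝ ∞ χ)
    (hc : HasCompactSupport χ) (h0 : MemLp (fun t => (χ t : ℂ)) 2 halfLine)
    (h1 : MemLp (fun t => ((deriv χ t : ℝ) : ℂ)) 2 halfLine) (m : Plane) (β : ℂ)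
    (f g c : Plane → Profile) {k : Plane}
    (h : IsWeakDeriv (g k) (-(τ : ℂ) • (β • c k
      + ((2 * Real.pi * Complex.I) * ((inner ℝ k m : ℝ) : ℂ)) • f k) : Profile)) :
    testSymbol h0 h1 m 0 τ β f f g c k = -(τ : ℂ) * (χ 0 : ℂ) * profileTrace 0 (g k) := by
  have e := h.integral_test hχ hc
  rw [← profilePairing_apply h1, ← profilePairing_apply h0] at e
  simp only [map_smul, map_add, smul_eq_mul] at e
  have hs : (τ : ℂ) * τ = 1 := by exact_mod_cast sign_mul_self hτ
  simp only [testSymbol, inner_zero_right, Complex.ofReal_zero, mul_zero, zero_mul, sub_zero, e]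
  linear_combination (β * profilePairing h0 (c k) + (2 * Real.pi * Complex.I) *
    ((inner ℝ k m : ℝ) : ℂ) * profilePairing h0 (f k)) * hs

/-- An equation `∂_m f + ∂_x g = β c` on the whole space makes the traces of `g` from both sides of
a plane equal: testing in each half-space with functions that are `1` on the plane produces the two
traces as boundary terms, and their difference is the test integral over the whole space. -/
lemma ae_trace_eq {a : ℝ} {f g c : Space → ℂ} (m : Plane) (β : ℂ) (hf : MemLp f 2 volume)
    (hg : MemLp g 2 volume) (hc : MemLp c 2 volume)
    (h : ∀ s : Space → ℂ, ContDiff ℝ ∞ s → HasCompactSupport s →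
      ∫ p, (fderiv ℝ s p (0, m) * f p - fderiv ℝ s p (dir 0) * g p) = ∫ p, β * (s p * c p)) :
    ∀ᵐ k, profileTrace 0 (hat a 1 g k) = profileTrace 0 (hat a (-1) g k) := by
  have ht₁ : (1 : ℝ) = 1 ∨ (1 : ℝ) = -1 := Or.inl rfl
  have ht₂ : (-1 : ℝ) = 1 ∨ (-1 : ℝ) = -1 := Or.inr rfl
  let b : ContDiffBump (0 : ℝ) := ⟨1, 2, one_pos, one_lt_two⟩
  have hχ : ContDiff ℝ ∞ b := b.contDiff
  have hχc : HasCompactSupport b := b.hasCompactSupport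
  have hb0 : b 0 = 1 := b.one_of_mem_closedBall (Metric.mem_closedBall_self b.rIn_pos.le)
  have h0 := memLp_ofReal_test hχ.continuous hχc
  have h1 := memLp_ofReal_test (hχ.continuous_deriv (by norm_num)) hχc.deriv
  have eta : ∀ (τ : ℝ) (χ : ℝ → ℝ) (ψ : Plane → ℂ), ContDiff ℝ ∞ χ → ContDiff ℝ ∞ ψ → ∀ p : Space,
      fderiv ℝ (prodTest a τ χ ψ) p (0, m) * f p - fderiv ℝ (prodTest a τ χ ψ) p (dir 0) * g p
      = fderiv ℝ ψ p.2 m * (χ (τ * (a - p.1)) : ℂ) * f p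
        + τ * (ψ p.2 * ((deriv χ (τ * (a - p.1)) : ℝ) : ℂ) * g p) := fun τ χ ψ hχ hψ p => by
    rw [fderiv_prodTest_zero hχ hψ, fderiv_prodTest hχ hψ]
    simp
    ring
  have W : ∀ τ : ℝ, τ = 1 ∨ τ = -1 → ∀ᵐ k, IsWeakDeriv (hat a τ g k) (-(τ : ℂ) • (β • hat a τ c k
      + ((2 * Real.pi * Complex.I) * ((inner ℝ k m : ℝ) : ℂ)) • hat a τ f k) : Profile) :=
    fun τ hτ => by
      refine ae_isWeakDeriv_hat hτ m β (hf.restrict _) (hg.restrict _) (hc.restrict _)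
        fun χ ψ hχ hχc hχs hψ hψc => ?_
      have e := h _ (contDiff_prodTest (a := a) (τ := τ) hχ hψ) (hasCompactSupport_prodTest hτ hχc hψc)
      have hz : ∀ p, p ∉ half a τ → prodTest a τ χ ψ =ᶠ[𝓝 p] 0 := fun p hp =>
        notMem_tsupport_iff_eventuallyEq.1 fun h => hp (tsupport_prodTest_subset_half hτ hχc hψc hχs h)
      have z1 : ∀ p, p ∉ half a τ → fderiv ℝ (prodTest a τ χ ψ) p (0, m) * f p
          - fderiv ℝ (prodTest a τ χ ψ) p (dir 0) * g p = 0 := fun p hp => by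
        rw [(hz p hp).fderiv_eq]; simp
      have z2 : ∀ p, p ∉ half a τ → β * (prodTest a τ χ ψ p * c p) = 0 := fun p hp => by
        rw [(hz p hp).eq_of_nhds]; simp
      rw [← setIntegral_eq_integral_of_forall_compl_eq_zero z1,
        ← setIntegral_eq_integral_of_forall_compl_eq_zero z2] at e
      simp only [eta τ χ ψ hχ hψ] at e
      exact e
  -- the same test function serves both half-spaces, as the bump is even
  have heven : ∀ ψ : Plane → ℂ, prodTest a (-1) b ψ = prodTest a 1 b ψ := fun ψ => by
    funext p
    simp only [prodTest]
    rw [neg_one_mul, one_mul, b.neg]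
  have S := ((isMild_testSymbol h0 h1 m 0 (1 : ℝ) β (hat a 1 f) (hat a 1 f) (hat a 1 g)
    (hat a 1 c)).add (isMild_testSymbol h0 h1 m 0 (-1 : ℝ) β (hat a (-1) f) (hat a (-1) f)
    (hat a (-1) g) (hat a (-1) c))).ae_eq_zero fun ψ hψ hψc => by
      have M := fun (τ : ℝ) => isMild_testSymbol h0 h1 m 0 (τ : ℂ) β (hat a τ f) (hat a τ f)
        (hat a τ g) (hat a τ c)
      have i1 := (M 1).integrable_mul (𝓕⁻ (hψc.toSchwartzMap hψ))
      have i2 := (M (-1)).integrable_mul (𝓕⁻ (hψc.toSchwartzMap hψ))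
      simp only [Pi.add_apply, mul_add]
      rw [integral_add i1 i2, ← integral_half_testSymbol h0 h1 m 0 _ β ht₁ (hf.restrict _)
        (hf.restrict _) (hg.restrict _) (hc.restrict _), ← integral_half_testSymbol h0 h1 m 0 _ β ht₂
        (hf.restrict _) (hf.restrict _) (hg.restrict _) (hc.restrict _)]
      have I1 : ∀ τ : ℝ, τ = 1 ∨ τ = -1 → IntegrableOn (fun p => fderiv ℝ (prodTest a τ b ψ) p (0, m)
          * f p - fderiv ℝ (prodTest a τ b ψ) p (dir 0) * g p) (half a τ) := fun τ hτ => by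
        simp only [eta τ b ψ hχ hψ]
        exact (integrableOn_half_mul hτ (hf.restrict _) h0 (∂_{m} (hψc.toSchwartzMap hψ))).add
          ((integrableOn_half_mul hτ (hg.restrict _) h1 (hψc.toSchwartzMap hψ)).const_mul _)
      have I2 : ∀ τ : ℝ, τ = 1 ∨ τ = -1 → IntegrableOn (fun p => β * (prodTest a τ b ψ p * c p))
          (half a τ) := fun τ hτ =>
        (integrableOn_half_mul hτ (hc.restrict _) h0 (hψc.toSchwartzMap hψ)).const_mul β
      have e := h _ (contDiff_prodTest (a := a) (τ := 1) hχ hψ) (hasCompactSupport_prodTest ht₁ hχc hψc)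
      have I1' := I1 (-1) ht₂
      have I2' := I2 (-1) ht₂
      rw [heven] at I1' I2'
      rw [integral_eq_add_half (I1 1 ht₁) I1', integral_eq_add_half (I2 1 ht₁) I2'] at e
      have e1 := eta 1 b ψ hχ hψ
      have e2 := eta (-1) b ψ hχ hψ
      rw [heven] at e2
      have s2 : ∀ p, ψ p.2 * ((b (-1 * (a - p.1)) : ℝ) : ℂ) = prodTest a 1 b ψ p := fun p => by
        rw [← heven]; rfl
      have t1 : ∀ p : Space, fderiv ℝ (hψc.toSchwartzMap hψ) p.2 (0 : Plane) = 0 := fun p => map_zero _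
      simp only [t1, zero_mul, add_zero]
      have u1 : ∫ p in half a 1, (fderiv ℝ ψ p.2 m * (b (1 * (a - p.1)) : ℂ) * f p
          + ((1 : ℝ) : ℂ) * (ψ p.2 * ((deriv b (1 * (a - p.1)) : ℝ) : ℂ) * g p))
          = ∫ p in half a 1, (fderiv ℝ (prodTest a 1 b ψ) p (0, m) * f p
          - fderiv ℝ (prodTest a 1 b ψ) p (dir 0) * g p) := by simp only [e1]
      have u2 : ∫ p in half a (-1), (fderiv ℝ ψ p.2 m * (b (-1 * (a - p.1)) : ℂ) * f p
          + ((-1 : ℝ) : ℂ) * (ψ p.2 * ((deriv b (-1 * (a - p.1)) : ℝ) : ℂ) * g p))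
          = ∫ p in half a (-1), (fderiv ℝ (prodTest a 1 b ψ) p (0, m) * f p
          - fderiv ℝ (prodTest a 1 b ψ) p (dir 0) * g p) := by simp only [e2]
      have v1 : ∫ p in half a 1, β * (ψ p.2 * (b (1 * (a - p.1)) : ℂ) * c p)
          = ∫ p in half a 1, β * (prodTest a 1 b ψ p * c p) := rfl
      have v2 : ∫ p in half a (-1), β * (ψ p.2 * (b (-1 * (a - p.1)) : ℂ) * c p)
          = ∫ p in half a (-1), β * (prodTest a 1 b ψ p * c p) := by simp only [s2]
      have key : ((∫ p in half a 1, (fderiv ℝ ψ p.2 m * (b (1 * (a - p.1)) : ℂ) * f p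
          + ((1 : ℝ) : ℂ) * (ψ p.2 * ((deriv b (1 * (a - p.1)) : ℝ) : ℂ) * g p)))
          - ∫ p in half a 1, β * (ψ p.2 * (b (1 * (a - p.1)) : ℂ) * c p))
        + ((∫ p in half a (-1), (fderiv ℝ ψ p.2 m * (b (-1 * (a - p.1)) : ℂ) * f p
          + ((-1 : ℝ) : ℂ) * (ψ p.2 * ((deriv b (-1 * (a - p.1)) : ℝ) : ℂ) * g p)))
          - ∫ p in half a (-1), β * (ψ p.2 * (b (-1 * (a - p.1)) : ℂ) * c p)) = 0 := by
        rw [u1, u2, v1, v2]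
        linear_combination e
      exact key
  filter_upwards [S, W 1 ht₁, W (-1) ht₂] with k hk h₁ h₂
  rw [Pi.add_apply, testSymbol_eq_trace ht₁ hχ hχc h0 h1 m β _ _ _ h₁,
    testSymbol_eq_trace ht₂ hχ hχc h0 h1 m β _ _ _ h₂, hb0] at hk
  simp at hk
  linear_combination -hk

lemma HasWeakCurl.ae_trace_eq {F C : Space → Vec} (h : HasWeakCurl univ F C)
    (hF : ∀ j, MemLp (fun p => F p j) 2 volume) (hC : ∀ j, MemLp (fun p => C p j) 2 volume) (a : ℝ)
    {j : Fin 3} (hj : j ≠ 0) :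
    ∀ᵐ k, profileTrace 0 (hat a 1 (fun p => F p j) k)
      = profileTrace 0 (hat a (-1) (fun p => F p j) k) := by
  have hj' : j = 1 ∨ j = 2 := by fin_cases j <;> simp_all
  rcases hj' with rfl | rfl
  · refine MaxwellSchwarz.ae_trace_eq (EuclideanSpace.single 0 1) 1 (hF 0) (hF 1) (hC 2)
      fun s hs hc => ?_
    have e := h.comp_two hs hc (subset_univ _)
    rw [setIntegral_univ, setIntegral_univ] at e
    simp only [mul_comm, one_mul] at e ⊢
    exact e
  · refine MaxwellSchwarz.ae_trace_eq (EuclideanSpace.single 1 1) (-1) (hF 0) (hF 2) (hC 1)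
      fun s hs hc => ?_
    have e := h.comp_one hs hc (subset_univ _)
    rw [setIntegral_univ, setIntegral_univ, ← neg_inj, ← integral_neg, ← integral_neg] at e
    simp only [neg_sub, mul_comm (F _ _), mul_comm (C _ _)] at e
    simp only [neg_one_mul]
    exact e

section Parseval
variable {a τ : ℝ}

lemma integrable_inner_hat (u F : Space → ℂ) :
    Integrable fun k => (inner ℂ (hat a τ u k) (hat a τ F k) : ℂ) :=
  L2.integrable_inner _ _

/-- The identity of Parseval in a half-space. -/
lemma integral_half_conj_mul (hτ : τ = 1 ∨ τ = -1) {u F : Space → ℂ}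
    (hu : MemLp u 2 (volume.restrict (half a τ))) (hF : MemLp F 2 (volume.restrict (half a τ))) :
    ∫ p in half a τ, (starRingEnd ℂ) (u p) * F p
      = ∫ k, (inner ℂ (hat a τ u k) (hat a τ F k) : ℂ) := by
  rw [← L2.inner_def, hat_eq hτ hu, hat_eq hτ hF]
  have h1 := (Lp.fourierTransformₗᵢ Plane Profile).inner_map_map
    (sliceEquiv ((memLp_comp_fromPlane hτ hu).toLp _)) (sliceEquiv ((memLp_comp_fromPlane hτ hF).toLp _))
  refine Eq.trans ?_ h1.symm
  rw [LinearIsometryEquiv.inner_map_map, L2.inner_def, integral_half_eq hτ]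
  refine integral_congr_ae ?_
  filter_upwards [(memLp_comp_fromPlane hτ hu).coeFn_toLp, (memLp_comp_fromPlane hτ hF).coeFn_toLp]
    with q h1 h2
  rw [h1, h2, RCLike.inner_apply, mul_comm]
  rfl

end Parseval

/-- Integration by parts against `e^{-λ t}`, without a boundary term as `f` vanishes at `0`. -/
lemma IsWeakDeriv.inner_expProfile {f h : Profile} (hd : IsWeakDeriv f h) (h0 : profileTrace 0 f = 0)
    {lam : ℝ} (hl : 0 < lam) :
    (inner ℂ h (expProfile lam) : ℂ) = lam * inner ℂ f (expProfile lam) := by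
  let b : ContDiffBump (0 : ℝ) := ⟨1, 2, one_pos, one_lt_two⟩
  have hb : ContDiff ℝ ∞ b := b.contDiff
  have hbc : HasCompactSupport b := b.hasCompactSupport
  obtain ⟨M, hM⟩ := (hb.continuous_deriv (by norm_num)).bounded_above_of_compact_support hbc.deriv
  have hin : ∀ g : Profile, (inner ℂ (expProfile lam) g : ℂ)
      = ∫ t in Ioi (0 : ℝ), (Real.exp (-(lam * t)) : ℂ) * g t := fun g => by
    rw [L2.inner_def]
    refine integral_congr_ae ?_
    filter_upwards [expProfile_ae hl] with t ht
    rw [ht, RCLike.inner_apply, Complex.conj_ofReal, mul_comm]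
  have hint : ∀ g : Profile, IntegrableOn (fun t => (Real.exp (-(lam * t)) : ℂ) * g t) (Ioi 0) :=
    fun g => (memLp_exp hl).integrable_mul (Lp.memLp g)
  let s : ℕ → ℝ := fun n => 1 / ((n : ℝ) + 1)
  have hs : Tendsto s atTop (𝓝 0) := tendsto_one_div_add_atTop_nhds_zero_nat
  have hs1 : ∀ n, 0 < s n ∧ s n ≤ 1 := fun n => by
    refine ⟨by positivity, ?_⟩
    rw [div_le_one (by positivity)]; linarith [(Nat.cast_nonneg n : (0 : ℝ) ≤ n)]
  let χ : ℕ → ℝ → ℝ := fun n t => Real.exp (-(lam * t)) * b (s n * t)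
  have hχ : ∀ n, ContDiff ℝ ∞ (χ n) := fun n =>
    ContDiff.mul (by fun_prop) (hb.comp (by fun_prop))
  have hχc : ∀ n, HasCompactSupport (χ n) := fun n =>
    (hbc.comp_homeomorph (Homeomorph.mulLeft₀ (s n) (hs1 n).1.ne')).mul_left
  have hχ' : ∀ n t, deriv (χ n) t = Real.exp (-(lam * t)) * (s n * deriv b (s n * t) - lam * b (s n * t)) :=
    fun n t => by
      have e1 : HasDerivAt (fun t : ℝ => Real.exp (-(lam * t))) (Real.exp (-(lam * t)) * (-(lam * 1))) t :=
        (((hasDerivAt_id t).const_mul lam).neg).exp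
      have e2 : HasDerivAt (fun t : ℝ => b (s n * t)) (deriv b (s n * t) * (s n * 1)) t :=
        (hb.differentiable (by norm_num) _).hasDerivAt.comp t ((hasDerivAt_id t).const_mul (s n))
      refine (e1.mul e2).deriv.trans ?_
      ring
  have hb1 : Tendsto b (𝓝 0) (𝓝 1) := by
    have := hb.continuous.tendsto 0
    rwa [b.one_of_mem_closedBall (Metric.mem_closedBall_self b.rIn_pos.le)] at this
  have hst : ∀ t, Tendsto (fun n => b (s n * t)) atTop (𝓝 1) := fun t =>
    hb1.comp (by simpa using hs.mul_const t)
  have L1 : Tendsto (fun n => ∫ t in Ioi (0 : ℝ), ((deriv (χ n) t : ℝ) : ℂ) * f t) atTop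
      (𝓝 (∫ t in Ioi (0 : ℝ), -(lam : ℂ) * ((Real.exp (-(lam * t)) : ℂ) * f t))) := by
    refine tendsto_integral_of_dominated_convergence
      (fun t => (M + lam) * ‖(Real.exp (-(lam * t)) : ℂ) * f t‖) (fun n => ?_)
      ((hint f).norm.const_mul _) (fun n => Eventually.of_forall fun t => ?_)
      (Eventually.of_forall fun t => ?_)
    · exact (Complex.continuous_ofReal.comp ((hχ n).continuous_deriv
        (by norm_num))).aestronglyMeasurable.mul (Lp.memLp f).1
    · rw [hχ', Complex.ofReal_mul, mul_right_comm, norm_mul, mul_comm, Complex.norm_real,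
        Real.norm_eq_abs]
      gcongr
      have h1 := hM (s n * t)
      rw [Real.norm_eq_abs] at h1
      have h2 : |b (s n * t)| ≤ 1 := abs_le.2 ⟨by linarith [b.nonneg (x := s n * t)], b.le_one⟩
      have h3 := hs1 n
      calc _ ≤ |s n * deriv b (s n * t)| + |lam * b (s n * t)| := abs_sub _ _
        _ ≤ 1 * M + lam * 1 := by
          rw [abs_mul, abs_mul, abs_of_pos h3.1, abs_of_pos hl]
          gcongr
          exact h3.2
        _ = _ := by ring
    · have h3 : Tendsto (fun n => s n * deriv b (s n * t)) atTop (𝓝 0) := by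
        have := hs.mul (((hb.continuous_deriv (by norm_num)).tendsto 0).comp
          (by simpa using hs.mul_const t : Tendsto (fun n => s n * t) atTop (𝓝 0)))
        simpa using this
      have h4 := (((h3.sub ((hst t).const_mul lam)).const_mul (Real.exp (-(lam * t)))).ofReal).mul_const (f t)
      have h5 : ((Real.exp (-(lam * t)) * (0 - lam * 1) : ℝ) : ℂ) * f t
          = -(lam : ℂ) * ((Real.exp (-(lam * t)) : ℂ) * f t) := by push_cast; ring
      rw [← h5]
      simp only [hχ']
      exact h4
  have L2 : Tendsto (fun n => ∫ t in Ioi (0 : ℝ), ((χ n t : ℝ) : ℂ) * h t) atTop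
      (𝓝 (∫ t in Ioi (0 : ℝ), (Real.exp (-(lam * t)) : ℂ) * h t)) := by
    refine tendsto_integral_of_dominated_convergence
      (fun t => ‖(Real.exp (-(lam * t)) : ℂ) * h t‖) (fun n => ?_)
      (hint h).norm (fun n => Eventually.of_forall fun t => ?_)
      (Eventually.of_forall fun t => ?_)
    · exact (Complex.continuous_ofReal.comp (hχ n).continuous).aestronglyMeasurable.mul (Lp.memLp h).1
    · have h2 : |b (s n * t)| ≤ 1 := abs_le.2 ⟨by linarith [b.nonneg (x := s n * t)], b.le_one⟩
      simp only [χ]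
      rw [Complex.ofReal_mul, mul_right_comm, norm_mul, Complex.norm_real (b _), Real.norm_eq_abs]
      exact mul_le_of_le_one_right (norm_nonneg _) h2
    · have h4 := (((hst t).const_mul (Real.exp (-(lam * t)))).ofReal).mul_const (h t)
      rw [mul_one] at h4
      exact h4
  have e := tendsto_nhds_unique L1 (L2.neg.congr fun n => by
    rw [hd.integral_test (hχ n) (hχc n), h0]; ring)
  rw [integral_const_mul, ← hin, ← hin] at e
  have e' := congrArg (starRingEnd ℂ) e
  simp only [map_mul, map_neg, Complex.conj_ofReal, inner_conj_symm] at e'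
  linear_combination e'

/-- Test functions vanish near the boundary plane, so the traces of their Fourier modes are zero. -/
lemma ae_profileTrace_eq_zero {a τ : ℝ} (hτ : τ = 1 ∨ τ = -1) {u : Space → ℂ}
    (hu : MemLp u 2 (volume.restrict (half a τ))) (hd : HasMildDeriv (hat a τ u))
    (hc : HasCompactSupport u) (hs : tsupport u ⊆ half a τ) :
    ∀ᵐ k, profileTrace 0 (hat a τ u k) = 0 := by
  obtain ⟨δ, hδ, hmin⟩ := hc.isCompact.exists_forall_le' (f := fun p : Space => τ * (a - p.1))
    (by fun_prop) (fun p hp => hs hp)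
  refine (hd.isMild_profileTrace le_rfl).ae_eq_zero fun ψ hψ hψc => ?_
  refine tendsto_nhds_unique (tendsto_slab hτ le_rfl hu hd (hψc.toSchwartzMap hψ)) ?_
  refine tendsto_const_nhds.congr' ?_
  filter_upwards [Ioo_mem_nhdsGT hδ] with r hr
  have hm : MeasurableSet {p : Space | τ * (a - p.1) ∈ Ioo 0 (0 + r)} :=
    measurableSet_Ioo.preimage (by fun_prop : Measurable fun p : Space => τ * (a - p.1))
  rw [setIntegral_eq_zero_of_forall_eq_zero, mul_zero]
  intro p hp
  have : p ∉ tsupport u := fun h => by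
    have h1 := hmin p h
    have h2 : τ * (a - p.1) < 0 + r := hp.2
    linarith [hr.2]
  rw [image_eq_zero_of_notMem_tsupport this, mul_zero]

/-! ### Superposition of exponential modes -/

lemma continuous_pd {φ : Space → Vec} (h : ContDiff ℝ ∞ φ) (i j : Fin 3) : Continuous (pd j i φ) :=
  ((contDiff_component h i).continuous_fderiv (by norm_num)).clm_apply continuous_const

lemma continuous_curl_apply {φ : Space → Vec} (h : ContDiff ℝ ∞ φ) (j : Fin 3) :
    Continuous fun p => curl φ p j := by
  fin_cases j <;> simp only [curl] <;>
    exact (continuous_pd h _ _).sub (continuous_pd h _ _)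

lemma hasCompactSupport_curl {φ : Space → Vec} (h : HasCompactSupport φ) : HasCompactSupport (curl φ) :=
  HasCompactSupport.intro h.isCompact fun _ hp => curl_eq_zero_of_notMem hp

lemma memLp_component {φ : Space → Vec} (h : ContDiff ℝ ∞ φ) (hc : HasCompactSupport φ) (j : Fin 3)
    (μ : Measure Space) [IsFiniteMeasureOnCompacts μ] : MemLp (fun p => φ p j) 2 μ :=
  (contDiff_component h j).continuous.memLp_of_hasCompactSupport (hasCompactSupport_component hc j)

lemma memLp_curl {φ : Space → Vec} (h : ContDiff ℝ ∞ φ) (hc : HasCompactSupport φ) (j : Fin 3)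
    (μ : Measure Space) [IsFiniteMeasureOnCompacts μ] : MemLp (fun p => curl φ p j) 2 μ :=
  (continuous_curl_apply h j).memLp_of_hasCompactSupport
    (hasCompactSupport_component (hasCompactSupport_curl hc) j)

/-- The complex conjugate of a field. -/
def conjField (φ : Space → Vec) (p : Space) : Vec := WithLp.toLp 2 fun j => (starRingEnd ℂ) (φ p j)

@[simp] lemma conjField_apply (φ : Space → Vec) (p : Space) (j : Fin 3) :
    conjField φ p j = (starRingEnd ℂ) (φ p j) := rfl

lemma contDiff_conjField {φ : Space → Vec} (h : ContDiff ℝ ∞ φ) : ContDiff ℝ ∞ (conjField φ) := by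
  have e : conjField φ = fun p => ∑ j, (EuclideanSpace.single j ((starRingEnd ℂ) (φ p j)) : Vec) := by
    funext p
    ext i
    fin_cases i <;> simp [Fin.sum_univ_three]
  rw [e]
  exact ContDiff.sum fun j _ => contDiff_single
    (Complex.conjCLE.contDiff.comp (contDiff_component h j)) j

lemma tsupport_conjField (φ : Space → Vec) : tsupport (conjField φ) ⊆ tsupport φ := by
  refine closure_mono fun p hp h => hp ?_
  ext j
  simp [h]

lemma curl_conjField {φ : Space → Vec} (h : ContDiff ℝ ∞ φ) :
    curl (conjField φ) = conjField (curl φ) := by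
  have e : ∀ i j p, pd j i (conjField φ) p = (starRingEnd ℂ) (pd j i φ p) := fun i j p => by
    have h1 := (Complex.conjCLE.toContinuousLinearMap.hasFDerivAt (x := φ p i)).comp p
      ((contDiff_component h i).differentiable (by norm_num) p).hasFDerivAt
    have h2 : fderiv ℝ (fun q => conjField φ q i) p = _ := h1.fderiv
    rw [pd, h2]
    rfl
  funext p
  ext j
  fin_cases j <;> simp [curl, e]

lemma integral_dot_eq_sum {a τ : ℝ} (hτ : τ = 1 ∨ τ = -1) {F V : Space → Vec}
    (hF : ∀ j, MemLp (fun p => F p j) 2 (volume.restrict (half a τ)))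
    (hV : ∀ j, MemLp (fun p => conjField V p j) 2 (volume.restrict (half a τ))) :
    ∫ p in half a τ, dot (F p) (V p)
      = ∫ k, ∑ j, (inner ℂ (hat a τ (fun p => conjField V p j) k) (hat a τ (fun p => F p j) k) : ℂ) := by
  rw [integral_finsetSum _ fun j _ => integrable_inner_hat _ _]
  simp only [← integral_half_conj_mul hτ (hV _) (hF _)]
  have i : ∀ j, IntegrableOn (fun p => (starRingEnd ℂ) (conjField V p j) * F p j) (half a τ) := fun j =>
    (hV j).star.integrable_mul (hF j)
  rw [← integral_finsetSum _ fun j _ => i j]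
  refine integral_congr_ae (Eventually.of_forall fun p => ?_)
  simp [dot, mul_comm]

/-- Fields whose Fourier modes are decaying exponentials that satisfy the algebraic relations of
`curl F = C` do satisfy it weakly: both sides are evaluated by the identity of Parseval, where the
Fourier modes of the test field satisfy the equations of its own curl and vanish at the boundary. -/
lemma hasWeakCurl_of_hat {a τ : ℝ} (hτ : τ = 1 ∨ τ = -1) {F C : Space → Vec}
    (hF : ∀ j, MemLp (fun p => F p j) 2 (volume.restrict (half a τ)))
    (hC : ∀ j, MemLp (fun p => C p j) 2 (volume.restrict (half a τ)))
    {lam : Plane → ℝ} (hl : ∀ k, 0 < lam k) {f c : Plane → Fin 3 → ℂ}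
    (hFh : ∀ j, ∀ᵐ k, hat a τ (fun p => F p j) k = f k j • expProfile (lam k))
    (hCh : ∀ j, ∀ᵐ k, hat a τ (fun p => C p j) k = c k j • expProfile (lam k))
    (h1 : ∀ k, lam k * f k 1 = τ * (c k 2 + (2 * Real.pi * Complex.I) * ((k 0 : ℝ) : ℂ) * f k 0))
    (h2 : ∀ k, lam k * f k 2 = τ * (-c k 1 + (2 * Real.pi * Complex.I) * ((k 1 : ℝ) : ℂ) * f k 0))
    (h0 : ∀ k, c k 0 = (2 * Real.pi * Complex.I) * ((k 0 : ℝ) : ℂ) * f k 2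
      - (2 * Real.pi * Complex.I) * ((k 1 : ℝ) : ℂ) * f k 1) : HasWeakCurl (half a τ) F C := by
  intro φ hφ hc hs
  have hu := contDiff_conjField hφ
  have hus := (tsupport_conjField φ).trans hs
  have huc : HasCompactSupport (conjField φ) :=
    IsCompact.of_isClosed_subset hc (isClosed_tsupport _) (tsupport_conjField φ)
  have hw := hasWeakCurl_of_contDiff hu (half a τ)
  have m1 := fun j => memLp_component hu huc j (volume.restrict (half a τ))
  have m2 := fun j => memLp_curl hu huc j (volume.restrict (half a τ))
  have z : ∀ j : Fin 3, j ≠ 0 → ∀ᵐ k, profileTrace 0 (hat a τ (fun p => conjField φ p j) k) = 0 :=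
    fun j hj => ae_profileTrace_eq_zero hτ (m1 j) (hw.hasMildDeriv hτ m1 m2 hj)
      (hasCompactSupport_component huc j)
      ((show tsupport (fun p => conjField φ p j) ⊆ tsupport (conjField φ) from
        closure_mono fun p hp h => hp (by simp only [h]; rfl)).trans hus)
  rw [integral_dot_eq_sum hτ hF (by rw [← curl_conjField hφ]; exact m2), integral_dot_eq_sum hτ hC m1,
    ← curl_conjField hφ]
  refine integral_congr_ae ?_
  filter_upwards [hw.ae_hat hτ m1 m2, z 1 (by decide), z 2 (by decide), hFh 0, hFh 1, hFh 2, hCh 0,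
    hCh 1, hCh 2] with k ⟨r1, r2, r0⟩ z1 z2 f0 f1 f2 c0 c1 c2
  have g1 := r1.inner_expProfile z1 (hl k)
  have g2 := r2.inner_expProfile z2 (hl k)
  rw [Fin.sum_univ_three, Fin.sum_univ_three, f0, f1, f2, c0, c1, c2, r0]
  simp only [inner_smul_left, inner_smul_right, inner_add_left, inner_sub_left, inner_neg_left,
    map_mul, map_neg, Complex.conj_ofReal, Complex.conj_I, map_ofNat] at g1 g2 ⊢
  have hs : (τ : ℂ) * τ = 1 := by exact_mod_cast sign_mul_self hτ
  set P0 : ℂ := inner ℂ (hat a τ (fun p => conjField φ p 0) k) (expProfile (lam k))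
  set P1 : ℂ := inner ℂ (hat a τ (fun p => conjField φ p 1) k) (expProfile (lam k))
  set P2 : ℂ := inner ℂ (hat a τ (fun p => conjField φ p 2) k) (expProfile (lam k))
  set K1 : ℂ := inner ℂ (hat a τ (fun p => curl (conjField φ) p 1) k) (expProfile (lam k))
  set K2 : ℂ := inner ℂ (hat a τ (fun p => curl (conjField φ) p 2) k) (expProfile (lam k))
  set Y : ℂ := (2 * Real.pi * Complex.I) * ((k 0 : ℝ) : ℂ) with hY
  set Z : ℂ := (2 * Real.pi * Complex.I) * ((k 1 : ℝ) : ℂ) with hZ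
  have e2 : K2 = -τ * (lam k * P1) + Y * P0 := by
    linear_combination (-(τ : ℂ)) * g1 - (K2 - Y * P0) * hs
  have e1 : K1 = τ * (lam k * P2) - Z * P0 := by
    linear_combination (τ : ℂ) * g2 - (K1 + Z * P0) * hs
  rw [e1, e2]
  linear_combination P2 * τ * h1 k - P1 * τ * h2 k - P0 * h0 k + (P2 * (c k 2 + Y * f k 0)
    - P1 * (-c k 1 + Z * f k 0)) * hs

/-! ### The reflection factor -/

/-- The reflection factor `(λ - p) / (λ + p) e^{-λ L}`, with decay rate `λ` and overlap `L`. -/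
def reflection (p lam L : ℝ) : ℝ := (lam - p) / (lam + p) * Real.exp (-(lam * L))

lemma reflection_nonneg {p lam : ℝ} (hp : 0 < p) (h : p ≤ lam) (L : ℝ) : 0 ≤ reflection p lam L :=
  mul_nonneg (div_nonneg (by linarith) (by linarith)) (Real.exp_pos _).le

lemma reflection_lt_one {p lam L : ℝ} (hp : 0 < p) (h : p ≤ lam) (hL : 0 ≤ L) :
    reflection p lam L < 1 := by
  have h1 : (lam - p) / (lam + p) < 1 := by rw [div_lt_one (by linarith)]; linarith
  have h2 : Real.exp (-(lam * L)) ≤ 1 := Real.exp_le_one_iff.2 (by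
    have := mul_nonneg (hp.le.trans h) hL; linarith)
  have h3 : 0 ≤ (lam - p) / (lam + p) := div_nonneg (by linarith) (by linarith)
  calc reflection p lam L ≤ (lam - p) / (lam + p) * 1 := mul_le_mul_of_nonneg_left h2 h3
    _ < 1 := by linarith

/-- The reflection coefficient of the longitudinal polarization is not larger than that of the
transverse one. -/
lemma abs_reflection_le {p q lam : ℝ} (hp : 0 < p) (hpq : p ≤ q) (h : p * q ≤ lam ^ 2)
    (hl : 0 < lam) : |(lam - q) / (lam + q)| ≤ (lam - p) / (lam + p) := by
  have hq : 0 < q := hp.trans_le hpq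
  rw [abs_div, abs_of_pos (by linarith : 0 < lam + q), div_le_div_iff₀ (by linarith) (by linarith)]
  rcases abs_cases (lam - q) with ⟨h1, _⟩ | ⟨h1, _⟩ <;> rw [h1] <;> nlinarith

/-- The reflection factor is largest at `λ² = p² + 2 p / L`. -/
lemma reflection_le_of_critical {p lam m L : ℝ} (hp : 0 < p) (hl : p ≤ lam) (hm : p < m)
    (hL : L * (m ^ 2 - p ^ 2) = 2 * p) : reflection p lam L ≤ reflection p m L := by
  have hmp : 0 < m - p := by linarith
  have hmp' : 0 < m + p := by linarith
  have hlp : 0 < lam + p := by linarith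
  have hL' : L = 2 * p / ((m - p) * (m + p)) := by
    rw [eq_div_iff (by positivity)]; linarith
  -- with `w` the quotient of the rational factors, `w - 1 ≤ L (λ - m)`
  have key : (lam - p) / (lam + p) ≤ (m - p) / (m + p) * (1 + L * (lam - m)) := by
    have e : (m - p) / (m + p) * (1 + L * (lam - m)) - (lam - p) / (lam + p)
        = 2 * p * (lam - m) ^ 2 / ((m + p) ^ 2 * (lam + p)) := by
      rw [hL']; field_simp; ring
    have : 0 ≤ 2 * p * (lam - m) ^ 2 / ((m + p) ^ 2 * (lam + p)) := by positivity
    linarith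
  have h2 : 1 + L * (lam - m) ≤ Real.exp (L * (lam - m)) := by
    have := Real.add_one_le_exp (L * (lam - m)); linarith
  have h3 : Real.exp (L * (lam - m)) * Real.exp (-(lam * L)) = Real.exp (-(m * L)) := by
    rw [← Real.exp_add]; congr 1; ring
  calc reflection p lam L
      ≤ ((m - p) / (m + p) * Real.exp (L * (lam - m))) * Real.exp (-(lam * L)) :=
        mul_le_mul_of_nonneg_right (key.trans (mul_le_mul_of_nonneg_left h2 (by positivity)))
          (Real.exp_pos _).le
    _ = reflection p m L := by rw [mul_assoc, h3, reflection]

/-- The constant of the equation `curl H = α E` of the homogeneous system. -/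
def Params.α (c : Params) : ℝ := Real.sqrt c.η * c.ε + c.σ

/-- The constant of the equation `curl E = -β H` of the homogeneous system. -/
def Params.β (c : Params) : ℝ := Real.sqrt c.η * c.μ

/-- The value `p` for which the reflection coefficient of the transverse polarization is
`(p - λ) / (p + λ)`; that of the longitudinal one is `(λ - q) / (λ + q)` with `q = α Z`. -/
def Params.p (c : Params) : ℝ := Real.sqrt c.η * Real.sqrt (c.ε * c.μ)

section Params
variable {c : Params} {L : ℝ}

lemma Params.α_pos (hε : 0 < c.ε) (hσ : 0 ≤ c.σ) (hη : 0 < c.η) : 0 < c.α := by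
  have := Real.sqrt_pos.2 hη
  unfold Params.α
  positivity

lemma Params.β_pos (hμ : 0 < c.μ) (hη : 0 < c.η) : 0 < c.β := by
  have := Real.sqrt_pos.2 hη
  unfold Params.β
  positivity

lemma Params.p_pos (hε : 0 < c.ε) (hμ : 0 < c.μ) (hη : 0 < c.η) : 0 < c.p := by
  have := Real.sqrt_pos.2 hη
  unfold Params.p
  positivity

lemma Params.Z_pos (hε : 0 < c.ε) (hμ : 0 < c.μ) : 0 < c.Z := Real.sqrt_pos.2 (by positivity)

lemma Params.β_eq (hε : 0 < c.ε) (hμ : 0 < c.μ) : c.β = c.p * c.Z := by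
  have h1 : Real.sqrt (c.ε * c.μ) * Real.sqrt (c.μ / c.ε) = c.μ := by
    rw [← Real.sqrt_mul (by positivity), show c.ε * c.μ * (c.μ / c.ε) = c.μ ^ 2 by field_simp,
      Real.sqrt_sq hμ.le]
  rw [Params.β, Params.p, Params.Z, mul_assoc, h1]

lemma Params.p_le (hε : 0 < c.ε) (hμ : 0 < c.μ) (hσ : 0 ≤ c.σ) : c.p ≤ c.α * c.Z := by
  have h1 : c.ε * c.Z = Real.sqrt (c.ε * c.μ) := by
    rw [Params.Z, ← Real.sqrt_sq hε.le, ← Real.sqrt_mul (by positivity), Real.sqrt_sq hε.le]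
    congr 1
    field_simp
  have h2 := mul_nonneg hσ (Params.Z_pos hε hμ).le
  rw [Params.α, Params.p, ← h1]
  nlinarith

lemma Params.mul_eq (hε : 0 < c.ε) (hμ : 0 < c.μ) : c.p * (c.α * c.Z) = c.α * c.β := by
  rw [Params.β_eq hε hμ]; ring

/-- Without overlap the bound is trivial. -/
lemma Rcla_zero (hε : 0 < c.ε) (hμ : 0 < c.μ) : Rcla c 0 = 1 := by
  have : Real.sqrt (c.ε * c.μ) ≠ 0 := by positivity
  simp [Rcla, this]

/-- The bound is the reflection factor of its maximum point `m`. -/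
lemma Rcla_eq_reflection (hε : 0 < c.ε) (hμ : 0 < c.μ) (hη : 0 < c.η) (hL : 0 < L) :
    ∃ m, c.p < m ∧ L * (m ^ 2 - c.p ^ 2) = 2 * c.p ∧ Rcla c L = reflection c.p m L := by
  have hs := Real.sqrt_pos.2 hη
  have hM : 0 < Real.sqrt (c.ε * c.μ) := by positivity
  have hM2 : Real.sqrt (c.ε * c.μ) ^ 2 = c.ε * c.μ := Real.sq_sqrt (by positivity)
  set s := Real.sqrt c.η with hsdef
  set M := Real.sqrt (c.ε * c.μ) with hMdef
  have hLs := Real.sqrt_pos.2 (mul_pos hL hs)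
  have hLs2 : Real.sqrt (L * s) ^ 2 = L * s := Real.sq_sqrt (by positivity)
  have hA : Real.sqrt (L * (s * (c.ε * c.μ))) = Real.sqrt (L * s) * M := by
    rw [← hM2, ← mul_assoc, Real.sqrt_mul (by positivity), Real.sqrt_sq hM.le]
  have hB2 : Real.sqrt (L * (s * (c.ε * c.μ)) + 2 * M) ^ 2 = L * s * M ^ 2 + 2 * M := by
    rw [Real.sq_sqrt (by positivity), ← hM2]; ring
  set K := Real.sqrt (L * s) with hK
  set B := Real.sqrt (L * (s * (c.ε * c.μ)) + 2 * M) with hB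
  have hp : c.p = s * M := rfl
  have hR : Rcla c L = (B - K * M) / (B + K * M) * Real.exp (-(K * B)) := by rw [← hA]; rfl
  have hB0 : 0 ≤ B := Real.sqrt_nonneg _
  have hKB : K * M < B := by
    refine lt_of_pow_lt_pow_left₀ 2 hB0 ?_
    rw [hB2, mul_pow, hLs2]; linarith
  have hLK : L = K ^ 2 / s := by rw [hLs2]; field_simp
  refine ⟨s * B / K, ?_, ?_, ?_⟩
  · rw [hp, lt_div_iff₀ hLs]; nlinarith
  · rw [hp, div_pow, mul_pow, hB2, hLs2]
    field_simp
    ring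
  · rw [reflection, hR, hp]
    clear_value B K
    congr 1
    · have h1 : 0 < B + K * M := by positivity
      have h2 : 0 < s * B / K + s * M := by positivity
      rw [div_eq_div_iff h1.ne' h2.ne']
      field_simp
    · congr 2
      rw [hLK]
      field_simp

lemma reflection_le_Rcla (hε : 0 < c.ε) (hμ : 0 < c.μ) (hη : 0 < c.η) (hL : 0 ≤ L) {lam : ℝ}
    (h : c.p ≤ lam) : reflection c.p lam L ≤ Rcla c L := by
  have hp := Params.p_pos hε hμ hη
  rcases hL.eq_or_lt with rfl | hL'
  · rw [Rcla_zero hε hμ]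
    exact (reflection_lt_one hp h le_rfl).le
  · obtain ⟨m, hm, hc, he⟩ := Rcla_eq_reflection hε hμ hη hL'
    rw [he]
    exact reflection_le_of_critical hp h hm hc

lemma Rcla_lt_one (hε : 0 < c.ε) (hμ : 0 < c.μ) (hη : 0 < c.η) (hL : 0 < L) : Rcla c L < 1 := by
  obtain ⟨m, hm, -, he⟩ := Rcla_eq_reflection hε hμ hη hL
  rw [he]
  exact reflection_lt_one (Params.p_pos hε hμ hη) hm.le hL.le

end Params

/-! ### The modes of the homogeneous system -/

/-- The electric components of the mode with wave numbers `y`, `z`, decay rate `lam` and tangential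
components `e₁`, `e₂`, in the half-space with outward normal `(τ, 0, 0)`. -/
def modeE (τ lam y z : ℝ) (e₁ e₂ : ℂ) : Fin 3 → ℂ :=
  ![-(Complex.I * τ / lam) * (y * e₁ + z * e₂), e₁, e₂]

/-- The magnetic components of the mode, `-curl E / β`. -/
def modeH (β τ lam y z : ℝ) (e₁ e₂ : ℂ) : Fin 3 → ℂ :=
  ![-(Complex.I / β) * (y * e₂ - z * e₁),
    τ / (β * lam) * (lam ^ 2 * e₂ - z * (y * e₁ + z * e₂)),
    -(τ / (β * lam)) * (lam ^ 2 * e₁ - y * (y * e₁ + z * e₂))]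

section Mode
variable {α β lam τ y z : ℝ}

lemma ofReal_sq_eq (hlam : lam ^ 2 = y ^ 2 + z ^ 2 + α * β) :
    (lam : ℂ) ^ 2 = y ^ 2 + z ^ 2 + α * β := by exact_mod_cast hlam

/-- The modes satisfy the algebraic relations of `curl E = -β H`. -/
lemma modeE_relations (hβ : β ≠ 0) (hl : lam ≠ 0) (hτ : τ * τ = 1) (e₁ e₂ : ℂ) :
    lam * modeE τ lam y z e₁ e₂ 1 = τ * ((-β : ℂ) * modeH β τ lam y z e₁ e₂ 2
        + Complex.I * y * modeE τ lam y z e₁ e₂ 0) ∧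
    lam * modeE τ lam y z e₁ e₂ 2 = τ * (-((-β : ℂ) * modeH β τ lam y z e₁ e₂ 1)
        + Complex.I * z * modeE τ lam y z e₁ e₂ 0) ∧
    (-β : ℂ) * modeH β τ lam y z e₁ e₂ 0 = Complex.I * y * modeE τ lam y z e₁ e₂ 2
        - Complex.I * z * modeE τ lam y z e₁ e₂ 1 := by
  have hβ' : (β : ℂ) ≠ 0 := by exact_mod_cast hβ
  have hl' : (lam : ℂ) ≠ 0 := by exact_mod_cast hl
  have hτ' : (τ : ℂ) ^ 2 = 1 := by rw [sq]; exact_mod_cast hτ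
  have hI := Complex.I_sq
  simp only [modeE, modeH, Matrix.cons_val]
  refine ⟨?_, ?_, ?_⟩ <;> field_simp <;> simp only [hτ', hI] <;> ring

/-- The modes satisfy the algebraic relations of `curl H = α E`. -/
lemma modeH_relations (hβ : β ≠ 0) (hl : lam ≠ 0) (hτ : τ * τ = 1)
    (hlam : lam ^ 2 = y ^ 2 + z ^ 2 + α * β) (e₁ e₂ : ℂ) :
    lam * modeH β τ lam y z e₁ e₂ 1 = τ * (α * modeE τ lam y z e₁ e₂ 2
        + Complex.I * y * modeH β τ lam y z e₁ e₂ 0) ∧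
    lam * modeH β τ lam y z e₁ e₂ 2 = τ * (-(α * modeE τ lam y z e₁ e₂ 1)
        + Complex.I * z * modeH β τ lam y z e₁ e₂ 0) ∧
    α * modeE τ lam y z e₁ e₂ 0 = Complex.I * y * modeH β τ lam y z e₁ e₂ 2
        - Complex.I * z * modeH β τ lam y z e₁ e₂ 1 := by
  have hβ' : (β : ℂ) ≠ 0 := by exact_mod_cast hβ
  have hl' : (lam : ℂ) ≠ 0 := by exact_mod_cast hl
  have hτ' : (τ : ℂ) ^ 2 = 1 := by rw [sq]; exact_mod_cast hτ
  have hI := Complex.I_sq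
  have hlam' := ofReal_sq_eq hlam
  simp only [modeE, modeH, Matrix.cons_val]
  refine ⟨?_, ?_, ?_⟩ <;> field_simp <;> simp only [hlam', hI] <;> ring

/-- The solutions of the system of ordinary differential equations of a Fourier mode that are square
integrable on the half-line are the decaying exponential modes: growing exponentials are excluded
as `f' + λ f` solves `u' = λ u`. -/
lemma exists_mode (hα : 0 < α) (hβ : 0 < β) (hl : 0 < lam) (hτ : τ * τ = 1)
    (hlam : lam ^ 2 = y ^ 2 + z ^ 2 + α * β) {E H : Fin 3 → Profile}
    (hE₁ : (E 1, -(τ : ℂ) • ((-β : ℂ) • H 2 + (Complex.I * y) • E 0)) ∈ weakDerivGraph)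
    (hE₂ : (E 2, -(τ : ℂ) • (-((-β : ℂ) • H 1) + (Complex.I * z) • E 0)) ∈ weakDerivGraph)
    (hE₀ : (-β : ℂ) • H 0 = (Complex.I * y) • E 2 - (Complex.I * z) • E 1)
    (hH₁ : (H 1, -(τ : ℂ) • ((α : ℂ) • E 2 + (Complex.I * y) • H 0)) ∈ weakDerivGraph)
    (hH₂ : (H 2, -(τ : ℂ) • (-((α : ℂ) • E 1) + (Complex.I * z) • H 0)) ∈ weakDerivGraph)
    (hH₀ : (α : ℂ) • E 0 = (Complex.I * y) • H 2 - (Complex.I * z) • H 1) :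
    ∃ e₁ e₂ : ℂ, (∀ j, E j = modeE τ lam y z e₁ e₂ j • expProfile lam) ∧
      ∀ j, H j = modeH β τ lam y z e₁ e₂ j • expProfile lam := by
  have hα' : (α : ℂ) ≠ 0 := by exact_mod_cast hα.ne'
  have hβ' : (β : ℂ) ≠ 0 := by exact_mod_cast hβ.ne'
  have hl' : (lam : ℂ) ≠ 0 := by exact_mod_cast hl.ne'
  have hτ' : (τ : ℂ) * τ = 1 := by exact_mod_cast hτ
  have hI : Complex.I * Complex.I = -1 := Complex.I_mul_I
  have hlam' := ofReal_sq_eq hlam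
  have e0 : E 0 = (Complex.I / α) • ((y : ℂ) • H 2 - (z : ℂ) • H 1) := by
    have : E 0 = (α : ℂ)⁻¹ • ((α : ℂ) • E 0) := by rw [smul_smul, inv_mul_cancel₀ hα', one_smul]
    rw [this, hH₀]
    module
  have h0 : H 0 = (-(Complex.I / β)) • ((y : ℂ) • E 2 - (z : ℂ) • E 1) := by
    have : H 0 = (-(β : ℂ)⁻¹) • ((-β : ℂ) • H 0) := by
      rw [smul_smul, neg_mul_neg, inv_mul_cancel₀ hβ', one_smul]
    rw [this, hE₀]
    module
  have hτ2 : (τ : ℂ) ^ 2 = 1 := by rw [sq]; exact hτ'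
  -- the second derivatives
  have D1 : (-(τ : ℂ) • ((-β : ℂ) • H 2 + (Complex.I * y) • E 0), ((lam : ℂ) ^ 2) • E 1)
      ∈ weakDerivGraph := by
    have := weakDerivGraph.add_mem (weakDerivGraph.smul_mem ((τ : ℂ) / α * (α * β + y ^ 2)) hH₂)
      (weakDerivGraph.smul_mem (-((τ : ℂ) / α * (y * z))) hH₁)
    convert this using 1
    refine Prod.ext ?_ ?_
    · simp only [Prod.fst_add, Prod.smul_fst]
      rw [e0]
      match_scalars <;> field_simp <;> simp only [Complex.I_sq] <;> ring
    · simp only [Prod.snd_add, Prod.smul_snd]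
      rw [h0]
      match_scalars <;> field_simp <;> simp only [hτ2, hlam', Complex.I_sq] <;> ring
  have D2 : (-(τ : ℂ) • (-((-β : ℂ) • H 1) + (Complex.I * z) • E 0), ((lam : ℂ) ^ 2) • E 2)
      ∈ weakDerivGraph := by
    have := weakDerivGraph.add_mem (weakDerivGraph.smul_mem (-((τ : ℂ) / α * (α * β + z ^ 2))) hH₁)
      (weakDerivGraph.smul_mem ((τ : ℂ) / α * (y * z)) hH₂)
    convert this using 1
    refine Prod.ext ?_ ?_
    · simp only [Prod.fst_add, Prod.smul_fst]
      rw [e0]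
      match_scalars <;> field_simp <;> simp only [Complex.I_sq] <;> ring
    · simp only [Prod.snd_add, Prod.smul_snd]
      rw [h0]
      match_scalars <;> field_simp <;> simp only [hτ2, hlam', Complex.I_sq] <;> ring
  have key : ∀ f h : Profile, (f, h) ∈ weakDerivGraph → (h, ((lam : ℂ) ^ 2) • f) ∈ weakDerivGraph →
      h = (-lam : ℂ) • f ∧ f = profileTrace 0 f • expProfile lam := fun f h h1 h2 => by
    have h3 := weakDerivGraph.add_mem h2 (weakDerivGraph.smul_mem (lam : ℂ) h1)
    have h4 : (h + (lam : ℂ) • f, (lam : ℂ) • (h + (lam : ℂ) • f)) ∈ weakDerivGraph := by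
      convert h3 using 1
      refine Prod.ext rfl ?_
      simp only [Prod.snd_add, Prod.smul_snd]
      module
    have h5 : h = (-lam : ℂ) • f := by
      rw [neg_smul]
      exact eq_neg_of_add_eq_zero_left (eq_zero_of_weakDeriv_pos hl h4)
    exact ⟨h5, eq_smul_exp_of_weakDeriv hl (h5 ▸ h1)⟩
  obtain ⟨d1, x1⟩ := key _ _ hE₁ D1
  obtain ⟨d2, x2⟩ := key _ _ hE₂ D2
  have hH1 : H 1 = ((τ : ℂ) / (β * lam)) • (((lam : ℂ) ^ 2) • E 2 - (z : ℂ) • ((y : ℂ) • E 1 + (z : ℂ) • E 2)) := by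
    have : H 1 = ((τ : ℂ) / (β * lam ^ 2)) • (((y : ℂ) * z) • (-(τ : ℂ) • ((-β : ℂ) • H 2
        + (Complex.I * y) • E 0)) - ((α : ℂ) * β + y ^ 2) • (-(τ : ℂ) • (-((-β : ℂ) • H 1)
        + (Complex.I * z) • E 0))) := by
      rw [e0]
      match_scalars <;> field_simp <;> simp only [hτ2, hlam', Complex.I_sq] <;> ring
    rw [this, d1, d2]
    match_scalars <;> field_simp; simp only [hlam']; ring
  have hH2 : H 2 = (-((τ : ℂ) / (β * lam))) • (((lam : ℂ) ^ 2) • E 1 - (y : ℂ) • ((y : ℂ) • E 1 + (z : ℂ) • E 2)) := by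
    have : H 2 = ((τ : ℂ) / (β * lam ^ 2)) • (((α : ℂ) * β + z ^ 2) • (-(τ : ℂ) • ((-β : ℂ) • H 2
        + (Complex.I * y) • E 0)) - ((y : ℂ) * z) • (-(τ : ℂ) • (-((-β : ℂ) • H 1)
        + (Complex.I * z) • E 0))) := by
      rw [e0]
      match_scalars <;> field_simp <;> simp only [hτ2, hlam', Complex.I_sq] <;> ring
    rw [this, d1, d2]
    match_scalars <;> field_simp; simp only [hlam']; ring
  refine ⟨profileTrace 0 (E 1), profileTrace 0 (E 2), ?_, ?_⟩
  · have hE0 : E 0 = (-(Complex.I * τ / lam)) • ((y : ℂ) • E 1 + (z : ℂ) • E 2) := by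
      rw [e0, hH1, hH2]
      match_scalars <;> field_simp <;> simp only [hlam'] <;> ring
    intro j
    fin_cases j
    · simp only [modeE, Fin.zero_eta, Matrix.cons_val]
      rw [hE0]
      conv_lhs => rw [x1, x2]
      module
    · exact x1
    · exact x2
  · intro j
    fin_cases j
    · simp only [modeH, Fin.zero_eta, Matrix.cons_val]
      rw [h0]
      conv_lhs => rw [x1, x2]
      module
    · simp only [modeH, Fin.mk_one, Matrix.cons_val]
      rw [hH1]
      conv_lhs => rw [x1, x2]
      module
    · simp only [modeH, Fin.reduceFinMk, Matrix.cons_val]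
      rw [hH2]
      conv_lhs => rw [x1, x2]
      module

end Mode

/-! ### The impedance operator on modes -/

/-- The unit normal `(τ, 0, 0)`. -/
def normal (τ : ℝ) : Vec := (τ : ℂ) • n₁

lemma normal_one : normal 1 = n₁ := by simp [normal]

lemma normal_neg_one : normal (-1) = n₂ := by simp [normal, n₂]

/-- The components of the impedance operator for the normal `(τ, 0, 0)`. -/
def impedanceComp (Z τ : ℝ) (e h : Fin 3 → ℂ) : Fin 3 → ℂ :=
  ![0, -(τ / Z) * e 2 - h 1, τ / Z * e 1 - h 2]

lemma impedance_normal (c : Params) {τ : ℝ} (hτ : τ * τ = 1) (E H : Vec) (j : Fin 3) :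
    impedance c (normal τ) E H j = impedanceComp c.Z τ E H j := by
  have hτ' : (τ : ℂ) * τ = 1 := by exact_mod_cast hτ
  fin_cases j
  · simp [impedance, impedanceComp, cross, normal, n₁, crossProduct]
  · simp [impedance, impedanceComp, cross, normal, n₁, crossProduct]
    linear_combination (-(H 1)) * hτ'
  · simp [impedance, impedanceComp, cross, normal, n₁, crossProduct]
    linear_combination (-(H 2)) * hτ'

section Step
variable {α β lam τ y z Z : ℝ} {e₁ e₂ d₁ d₂ : ℂ}

/-- The tangential electric amplitudes of the mode with incoming impedance data `d`. The auxiliary value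
`S` is `y e₁ + z e₂`. -/
def solveAmp (α β Z τ lam y z : ℝ) (d : Fin 3 → ℂ) : ℂ × ℂ :=
  let S := (y * (τ * d 2) - z * (τ * d 1)) / (1 / Z + α / lam)
  ((τ * d 2 + y * S / (β * lam)) / (1 / Z + lam / β),
    (-(τ * d 1) + z * S / (β * lam)) / (1 / Z + lam / β))

/-- A mode decomposed into its two polarizations `S = y e₁ + z e₂` and `T = y e₂ - z e₁`, on which
the impedance operator is diagonal. -/
lemma impedanceComp_polarization (hβ : 0 < β) (hl : 0 < lam) (hZ : 0 < Z) (s : ℝ) (hs : s * s = 1)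
    (hlam : lam ^ 2 = y ^ 2 + z ^ 2 + α * β) (e₁ e₂ : ℂ) :
    let u := impedanceComp Z s (modeE τ lam y z e₁ e₂) (modeH β τ lam y z e₁ e₂)
    s * (y * u 2 - z * u 1) = (1 / Z + s * τ * (α / lam)) * (y * e₁ + z * e₂) ∧
    -s * (y * u 1 + z * u 2) = (1 / Z + s * τ * (lam / β)) * (y * e₂ - z * e₁) := by
  have hβ' : (β : ℂ) ≠ 0 := by exact_mod_cast hβ.ne'
  have hl' : (lam : ℂ) ≠ 0 := by exact_mod_cast hl.ne'
  have hZ' : (Z : ℂ) ≠ 0 := by exact_mod_cast hZ.ne'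
  have hs' : (s : ℂ) ^ 2 = 1 := by rw [sq]; exact_mod_cast hs
  have hlam' := ofReal_sq_eq hlam
  simp only [impedanceComp, modeE, modeH, Matrix.cons_val]
  constructor
  · field_simp
    simp only [hlam']
    linear_combination (β * lam * (y * e₁ + z * e₂)) * hs'
  · field_simp
    linear_combination (β * lam * (y * e₂ - z * e₁)) * hs'

/-- The squared modulus of the components of a mode. -/
def modeEnergy (β τ lam y z : ℝ) (e₁ e₂ : ℂ) : ℝ :=
  ∑ j, (‖modeE τ lam y z e₁ e₂ j‖ ^ 2 + ‖modeH β τ lam y z e₁ e₂ j‖ ^ 2)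

lemma modeEnergy_nonneg : 0 ≤ modeEnergy β τ lam y z e₁ e₂ :=
  Finset.sum_nonneg fun _ _ => by positivity

lemma norm_sq_polarization (y z : ℝ) (a b : ℂ) :
    ‖(y : ℂ) * a + z * b‖ ^ 2 + ‖(y : ℂ) * b - z * a‖ ^ 2
      = (y ^ 2 + z ^ 2) * (‖a‖ ^ 2 + ‖b‖ ^ 2) := by
  simp only [Complex.sq_norm, Complex.normSq_apply]
  simp
  ring

/-- The energy is diagonal in the polarizations. -/
lemma modeEnergy_eq (hβ : 0 < β) (hl : 0 < lam) (hτ : τ * τ = 1)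
    (hlam : lam ^ 2 = y ^ 2 + z ^ 2 + α * β) (e₁ e₂ : ℂ) :
    (y ^ 2 + z ^ 2) * modeEnergy β τ lam y z e₁ e₂
      = (1 + (y ^ 2 + z ^ 2 + α ^ 2) / lam ^ 2) * ‖(y : ℂ) * e₁ + z * e₂‖ ^ 2
        + (1 + (y ^ 2 + z ^ 2 + lam ^ 2) / β ^ 2) * ‖(y : ℂ) * e₂ - z * e₁‖ ^ 2 := by
  have hβ' : (β : ℂ) ≠ 0 := by exact_mod_cast hβ.ne'
  have hl' : (lam : ℂ) ≠ 0 := by exact_mod_cast hl.ne'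
  have hlam' := ofReal_sq_eq hlam
  have hτr : τ ^ 2 = 1 := by rw [sq, hτ]
  have p1 := norm_sq_polarization y z e₁ e₂
  have p2 := norm_sq_polarization y z (modeH β τ lam y z e₁ e₂ 1) (modeH β τ lam y z e₁ e₂ 2)
  have q1 : (y : ℂ) * modeH β τ lam y z e₁ e₂ 1 + z * modeH β τ lam y z e₁ e₂ 2
      = τ * lam / β * (y * e₂ - z * e₁) := by
    simp only [modeH, Matrix.cons_val]
    field_simp
    ring
  have q2 : (y : ℂ) * modeH β τ lam y z e₁ e₂ 2 - z * modeH β τ lam y z e₁ e₂ 1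
      = -(τ * α / lam) * (y * e₁ + z * e₂) := by
    simp only [modeH, Matrix.cons_val]
    field_simp
    simp only [hlam']
    ring
  have n0 : ‖modeE τ lam y z e₁ e₂ 0‖ ^ 2 = ‖(y : ℂ) * e₁ + z * e₂‖ ^ 2 / lam ^ 2 := by
    simp only [modeE, Matrix.cons_val, norm_mul, norm_neg, norm_div, mul_pow, div_pow,
      Complex.norm_I, Complex.norm_real, Real.norm_eq_abs, sq_abs, hτr]
    ring
  have n0' : ‖modeH β τ lam y z e₁ e₂ 0‖ ^ 2 = ‖(y : ℂ) * e₂ - z * e₁‖ ^ 2 / β ^ 2 := by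
    simp only [modeH, Matrix.cons_val, norm_mul, norm_neg, norm_div, mul_pow, div_pow,
      Complex.norm_I, Complex.norm_real, Real.norm_eq_abs, sq_abs]
    ring
  rw [q1, q2] at p2
  simp only [norm_mul, norm_neg, norm_div, mul_pow, div_pow, Complex.norm_real,
    Real.norm_eq_abs, sq_abs, hτr] at p2
  have e1 : modeE τ lam y z e₁ e₂ 1 = e₁ := rfl
  have e2 : modeE τ lam y z e₁ e₂ 2 = e₂ := rfl
  rw [modeEnergy, Fin.sum_univ_three, n0, n0', e1, e2]
  have hb2 : β ^ 2 ≠ 0 := by positivity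
  have hl2 : lam ^ 2 ≠ 0 := by positivity
  linear_combination -p1 - p2

/-- An amplitude with the reflection coefficient `B / A` is reduced by the reflection factor. -/
lemma norm_sq_le_reflection {p lam L A B : ℝ} {S S' : ℂ} (hA : 0 < A)
    (h1 : (A : ℂ) * S = ((Real.exp (-(lam * L)) * B : ℝ) : ℂ) * S')
    (h2 : |B| ≤ A * ((lam - p) / (lam + p))) :
    ‖S‖ ^ 2 ≤ reflection p lam L ^ 2 * ‖S'‖ ^ 2 := by
  have h3 := congrArg norm h1
  rw [norm_mul, norm_mul, Complex.norm_real, Complex.norm_real, Real.norm_eq_abs,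
    Real.norm_eq_abs, abs_of_pos hA, abs_mul, abs_of_pos (Real.exp_pos _)] at h3
  rw [← mul_pow]
  refine pow_le_pow_left₀ (norm_nonneg _) ?_ 2
  refine le_of_mul_le_mul_left ?_ hA
  rw [h3, reflection]
  calc Real.exp (-(lam * L)) * |B| * ‖S'‖
      ≤ Real.exp (-(lam * L)) * (A * ((lam - p) / (lam + p))) * ‖S'‖ := by gcongr
    _ = _ := by ring

/-- The reflection coefficient of the transverse polarization. -/
lemma sub_eq_neg_mul_reflection {p : ℝ} (hβ : 0 < β) (hl : 0 < lam) (hZ : 0 < Z) (hp : 0 < p)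
    (hβp : β = p * Z) :
    1 / Z - lam / β = -((1 / Z + lam / β) * ((lam - p) / (lam + p))) := by
  subst hβp
  have : lam + p ≠ 0 := by linarith
  field_simp
  ring

/-- The impedance data of the modes with `y e₁ + z e₂ = 0`. -/
lemma impedanceComp_transverse (hβ : 0 < β) (hl : 0 < lam) {s : ℝ} (hs : s * s = 1)
    (hS : (y : ℂ) * e₁ + z * e₂ = 0) (j : Fin 3) :
    impedanceComp Z s (modeE τ lam y z e₁ e₂) (modeH β τ lam y z e₁ e₂) j
      = s * (1 / Z + s * τ * (lam / β)) * (![0, -e₂, e₁] : Fin 3 → ℂ) j := by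
  have hβ' : (β : ℂ) ≠ 0 := by exact_mod_cast hβ.ne'
  have hl' : (lam : ℂ) ≠ 0 := by exact_mod_cast hl.ne'
  have hs' : (s : ℂ) * s = 1 := by exact_mod_cast hs
  have e : (τ : ℂ) / (β * lam) * lam ^ 2 = τ * (lam / β) := by field_simp
  fin_cases j <;> simp only [impedanceComp, modeE, modeH, hS, Fin.zero_eta, Fin.mk_one,
    Fin.reduceFinMk, Matrix.cons_val, mul_zero, sub_zero, neg_mul, ← mul_assoc, e]
  · linear_combination (τ * (lam / β) * e₂ : ℂ) * hs'
  · linear_combination (-(τ * (lam / β) * e₁) : ℂ) * hs'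

/-- For `(y, z) ≠ 0` the energy estimate holds in each of the two polarizations. -/
lemma modeEnergy_le_of_pos {p L : ℝ} (hα : 0 < α) (hβ : 0 < β) (hl : 0 < lam) (hZ : 0 < Z) (hp : 0 < p)
    (hτ : τ * τ = 1) (hlam : lam ^ 2 = y ^ 2 + z ^ 2 + α * β) (hn : 0 < y ^ 2 + z ^ 2)
    (hβp : β = p * Z) (hpq : p ≤ α * Z) {e₁' e₂' : ℂ}
    (h : ∀ j, impedanceComp Z τ (modeE τ lam y z e₁ e₂) (modeH β τ lam y z e₁ e₂) j
      = Real.exp (-(lam * L)) *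
        impedanceComp Z τ (modeE (-τ) lam y z e₁' e₂') (modeH β (-τ) lam y z e₁' e₂') j) :
    modeEnergy β τ lam y z e₁ e₂
      ≤ reflection p lam L ^ 2 * modeEnergy β (-τ) lam y z e₁' e₂' := by
  obtain ⟨u1, u2⟩ := impedanceComp_polarization (τ := τ) (α := α) hβ hl hZ τ hτ hlam e₁ e₂
  obtain ⟨v1, v2⟩ := impedanceComp_polarization (τ := -τ) (α := α) hβ hl hZ τ hτ hlam e₁' e₂'
  have hτ' : (τ : ℂ) * τ = 1 := by exact_mod_cast hτ
  have hpq2 : p * (α * Z) ≤ lam ^ 2 := by rw [hlam, hβp]; nlinarith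
  have hpl : p ≤ lam := by
    refine le_of_sq_le_sq ?_ hl.le
    nlinarith
  set x : ℝ := Real.exp (-(lam * L)) with hx
  have hcS : 0 < 1 / Z + α / lam := by positivity
  have hcT : 0 < 1 / Z + lam / β := by positivity
  have hS : ((1 / Z + α / lam : ℝ) : ℂ) * (y * e₁ + z * e₂)
      = ((x * (1 / Z - α / lam) : ℝ) : ℂ) * (y * e₁' + z * e₂') := by
    rw [h 1, h 2] at u1
    push_cast at u1 v1 ⊢
    linear_combination x * v1 - u1 + ((α / lam : ℂ) * (y * e₁ + z * e₂)
      + x * (α / lam : ℂ) * (y * e₁' + z * e₂')) * (-hτ')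
  have hT : ((1 / Z + lam / β : ℝ) : ℂ) * (y * e₂ - z * e₁)
      = ((x * (1 / Z - lam / β) : ℝ) : ℂ) * (y * e₂' - z * e₁') := by
    rw [h 1, h 2] at u2
    push_cast at u2 v2 ⊢
    linear_combination x * v2 - u2 + ((lam / β : ℂ) * (y * e₂ - z * e₁)
      + x * (lam / β : ℂ) * (y * e₂' - z * e₁')) * (-hτ')
  have hq : 0 < α * Z := by positivity
  have bS : ‖(y : ℂ) * e₁ + z * e₂‖ ^ 2 ≤ reflection p lam L ^ 2 * ‖(y : ℂ) * e₁' + z * e₂'‖ ^ 2 := by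
    refine norm_sq_le_reflection hcS hS ?_
    have h1 := abs_reflection_le hp hpq hpq2 hl
    have e1 : 1 / Z - α / lam = (1 / Z + α / lam) * ((lam - α * Z) / (lam + α * Z)) := by
      field_simp
    rw [e1, abs_mul, abs_of_pos hcS]
    gcongr
  have bT : ‖(y : ℂ) * e₂ - z * e₁‖ ^ 2 ≤ reflection p lam L ^ 2 * ‖(y : ℂ) * e₂' - z * e₁'‖ ^ 2 := by
    refine norm_sq_le_reflection hcT hT (le_of_eq ?_)
    rw [sub_eq_neg_mul_reflection hβ hl hZ hp hβp, abs_neg, abs_of_nonneg]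
    exact mul_nonneg hcT.le (div_nonneg (by linarith) (by linarith))
  have E1 := modeEnergy_eq (α := α) hβ hl hτ hlam e₁ e₂
  have E2 := modeEnergy_eq (α := α) (τ := -τ) hβ hl (by rw [neg_mul_neg]; exact hτ) hlam e₁' e₂'
  refine le_of_mul_le_mul_left ?_ hn
  rw [E1, mul_left_comm, E2, mul_add, mul_left_comm (reflection p lam L ^ 2),
    mul_left_comm (reflection p lam L ^ 2)]
  gcongr

/-- For `(y, z) = 0` the two polarizations degenerate, and the energy is given by the amplitudes. -/
lemma modeEnergy_zero (hβ : 0 < β) (hl : 0 < lam) (hτ : τ * τ = 1) (e₁ e₂ : ℂ) :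
    modeEnergy β τ lam 0 0 e₁ e₂ = (1 + lam ^ 2 / β ^ 2) * (‖e₁‖ ^ 2 + ‖e₂‖ ^ 2) := by
  have hτr : τ ^ 2 = 1 := by rw [sq, hτ]
  have hl' := hl.ne'
  rw [modeEnergy, Fin.sum_univ_three]
  simp only [modeE, modeH, Matrix.cons_val, norm_mul, norm_neg, norm_div, mul_pow, div_pow, hτr,
    Complex.norm_real, Real.norm_eq_abs, sq_abs, Complex.ofReal_zero, zero_mul, add_zero, sub_zero,
    mul_zero, norm_zero, norm_pow]
  field_simp
  ring

/-- One step of the algorithm reduces the energy of a mode by the square of its reflection factor. -/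
lemma modeEnergy_le {p L : ℝ} (hα : 0 < α) (hβ : 0 < β) (hl : 0 < lam) (hZ : 0 < Z) (hp : 0 < p)
    (hτ : τ * τ = 1) (hlam : lam ^ 2 = y ^ 2 + z ^ 2 + α * β)
    (hβp : β = p * Z) (hpq : p ≤ α * Z) {e₁' e₂' : ℂ}
    (h : ∀ j, impedanceComp Z τ (modeE τ lam y z e₁ e₂) (modeH β τ lam y z e₁ e₂) j
      = Real.exp (-(lam * L)) *
        impedanceComp Z τ (modeE (-τ) lam y z e₁' e₂') (modeH β (-τ) lam y z e₁' e₂') j) :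
    modeEnergy β τ lam y z e₁ e₂
      ≤ reflection p lam L ^ 2 * modeEnergy β (-τ) lam y z e₁' e₂' := by
  rcases (by positivity : 0 ≤ y ^ 2 + z ^ 2).eq_or_lt with hn | hn
  swap
  · exact modeEnergy_le_of_pos hα hβ hl hZ hp hτ hlam hn hβp hpq h
  -- at the frequency zero both components are transverse
  obtain rfl : y = 0 := by nlinarith [sq_nonneg y, sq_nonneg z]
  obtain rfl : z = 0 := by nlinarith [sq_nonneg z]
  have hpl : p ≤ lam := by
    refine le_of_sq_le_sq ?_ hl.le
    rw [hlam, hβp]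
    nlinarith
  have hcT : 0 < 1 / Z + lam / β := by positivity
  have hb : |1 / Z - lam / β| ≤ (1 / Z + lam / β) * ((lam - p) / (lam + p)) := by
    rw [sub_eq_neg_mul_reflection hβ hl hZ hp hβp, abs_neg, abs_of_nonneg]
    exact mul_nonneg hcT.le (div_nonneg (by linarith) (by linarith))
  have hτ' : (τ : ℂ) * τ = 1 := by exact_mod_cast hτ
  have h1 := h 1
  have h2 := h 2
  rw [impedanceComp_transverse hβ hl hτ (by simp), impedanceComp_transverse hβ hl hτ (by simp)]
    at h1 h2
  simp only [Matrix.cons_val] at h1 h2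
  push_cast at h1 h2
  have b1 : ‖e₁‖ ^ 2 ≤ reflection p lam L ^ 2 * ‖e₁'‖ ^ 2 := by
    refine norm_sq_le_reflection hcT ?_ hb
    push_cast
    linear_combination τ * h2 + (-(1 / Z * e₁) - τ * τ * (lam / β) * e₁ - lam / β * e₁
      + Complex.exp (-(lam * L)) * (1 / Z * e₁' - τ * τ * (lam / β) * e₁' - lam / β * e₁')) * hτ'
  have b2 : ‖e₂‖ ^ 2 ≤ reflection p lam L ^ 2 * ‖e₂'‖ ^ 2 := by
    refine norm_sq_le_reflection hcT ?_ hb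
    push_cast
    linear_combination -τ * h1 + (-(1 / Z * e₂) - τ * τ * (lam / β) * e₂ - lam / β * e₂
      + Complex.exp (-(lam * L)) * (1 / Z * e₂' - τ * τ * (lam / β) * e₂' - lam / β * e₂')) * hτ'
  rw [modeEnergy_zero hβ hl hτ, modeEnergy_zero hβ hl (by rw [neg_mul_neg]; exact hτ)]
  have h3 : 0 ≤ 1 + lam ^ 2 / β ^ 2 := by positivity
  nlinarith

end Step

section Solve
variable {α β lam τ y z Z : ℝ}

lemma solveAmp_sum (hα : 0 < α) (hβ : 0 < β) (hl : 0 < lam) (hZ : 0 < Z)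
    (hlam : lam ^ 2 = y ^ 2 + z ^ 2 + α * β) (d : Fin 3 → ℂ) :
    y * (solveAmp α β Z τ lam y z d).1 + z * (solveAmp α β Z τ lam y z d).2
      = (y * (τ * d 2) - z * (τ * d 1)) / (1 / Z + α / lam) := by
  have hβ' : (β : ℂ) ≠ 0 := by exact_mod_cast hβ.ne'
  have hl' : (lam : ℂ) ≠ 0 := by exact_mod_cast hl.ne'
  have hZ' : (Z : ℂ) ≠ 0 := by exact_mod_cast hZ.ne'
  have hlam' := ofReal_sq_eq hlam
  have h1 : (1 / Z + α / lam : ℂ) ≠ 0 := by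
    exact_mod_cast (by positivity : 0 < 1 / Z + α / lam).ne'
  have h2 : (1 / Z + lam / β : ℂ) ≠ 0 := by
    exact_mod_cast (by positivity : 0 < 1 / Z + lam / β).ne'
  have h3 : (1 / Z + lam / β : ℂ) = (1 / Z + α / lam) + (y ^ 2 + z ^ 2) / (β * lam) := by
    field_simp
    linear_combination Z * hlam'
  have hS' := div_mul_cancel₀ (y * (τ * d 2) - z * (τ * d 1) : ℂ) h1
  set S : ℂ := (y * (τ * d 2) - z * (τ * d 1)) / (1 / Z + α / lam) with hS
  have u1 : (solveAmp α β Z τ lam y z d).1 = (τ * d 2 + y * S / (β * lam)) / (1 / Z + lam / β) := by rw [hS]; rfl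
  have u2 : (solveAmp α β Z τ lam y z d).2 = (-(τ * d 1) + z * S / (β * lam)) / (1 / Z + lam / β) := by
    rw [hS]; rfl
  clear_value S
  rw [u1, u2, mul_div_assoc', mul_div_assoc', ← add_div, div_eq_iff h2, h3, mul_add _ _ ((_ + _) / _), hS']
  ring

/-- The amplitudes `solveAmp` produce the prescribed impedance data. -/
lemma impedanceComp_solveAmp (hα : 0 < α) (hβ : 0 < β) (hl : 0 < lam) (hZ : 0 < Z)
    (hτ : τ * τ = 1) (hlam : lam ^ 2 = y ^ 2 + z ^ 2 + α * β) (d : Fin 3 → ℂ) {j : Fin 3}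
    (hj : j ≠ 0) :
    impedanceComp Z τ
      (modeE τ lam y z (solveAmp α β Z τ lam y z d).1 (solveAmp α β Z τ lam y z d).2)
      (modeH β τ lam y z (solveAmp α β Z τ lam y z d).1 (solveAmp α β Z τ lam y z d).2) j = d j := by
  have hβ' : (β : ℂ) ≠ 0 := by exact_mod_cast hβ.ne'
  have hl' : (lam : ℂ) ≠ 0 := by exact_mod_cast hl.ne'
  have hZ' : (Z : ℂ) ≠ 0 := by exact_mod_cast hZ.ne'
  have hτ' : (τ : ℂ) ^ 2 = 1 := by rw [sq]; exact_mod_cast hτ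
  have h2 : (1 / Z + lam / β : ℂ) ≠ 0 := by
    exact_mod_cast (by positivity : 0 < 1 / Z + lam / β).ne'
  have hS := solveAmp_sum (τ := τ) hα hβ hl hZ hlam d
  have e1 : (solveAmp α β Z τ lam y z d).1 * (1 / Z + lam / β) = τ * d 2
      + y * (y * (solveAmp α β Z τ lam y z d).1 + z * (solveAmp α β Z τ lam y z d).2) / (β * lam) := by
    rw [hS]; exact div_mul_cancel₀ _ h2
  have e2 : (solveAmp α β Z τ lam y z d).2 * (1 / Z + lam / β) = -(τ * d 1)
      + z * (y * (solveAmp α β Z τ lam y z d).1 + z * (solveAmp α β Z τ lam y z d).2) / (β * lam) := by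
    rw [hS]; exact div_mul_cancel₀ _ h2
  have hj' : j = 1 ∨ j = 2 := by fin_cases j <;> simp_all
  rcases hj' with rfl | rfl
  · simp only [impedanceComp, modeE, modeH, Matrix.cons_val]
    field_simp at e2 ⊢
    linear_combination (-(τ : ℂ)) * e2 + β * lam * Z * d 1 * hτ'
  · simp only [impedanceComp, modeE, modeH, Matrix.cons_val]
    field_simp at e1 ⊢
    linear_combination (τ : ℂ) * e1 + β * lam * Z * d 2 * hτ'

/-- All components of the mode are bounded by its impedance data, uniformly in the wave number. -/
lemma norm_mode_le (hα : 0 < α) (hβ : 0 < β) (hl : 0 < lam) (hZ : 0 < Z)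
    (hτ : τ * τ = 1) (hlam : lam ^ 2 = y ^ 2 + z ^ 2 + α * β) (d : Fin 3 → ℂ) (j : Fin 3) :
    ‖modeE τ lam y z (solveAmp α β Z τ lam y z d).1 (solveAmp α β Z τ lam y z d).2 j‖
      ≤ (2 * Z + 3) * (‖d 1‖ + ‖d 2‖) ∧
    ‖modeH β τ lam y z (solveAmp α β Z τ lam y z d).1 (solveAmp α β Z τ lam y z d).2 j‖
      ≤ (2 * Z + 3) * (‖d 1‖ + ‖d 2‖) := by
  have hl' : (lam : ℂ) ≠ 0 := by exact_mod_cast hl.ne'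
  have hβ' : (β : ℂ) ≠ 0 := by exact_mod_cast hβ.ne'
  set e := solveAmp α β Z τ lam y z d with he
  set D := ‖d 1‖ + ‖d 2‖ with hD
  have hD0 : 0 ≤ D := by positivity
  have hτn : |τ| = 1 := by
    have h := abs_mul_abs_self τ
    rw [hτ] at h
    nlinarith [abs_nonneg τ]
  have hτc : ‖(τ : ℂ)‖ = 1 := by rw [Complex.norm_real, Real.norm_eq_abs, hτn]
  have hy : |y| ≤ lam := abs_le_of_sq_le_sq (by rw [hlam]; nlinarith [mul_pos hα hβ]) hl.le
  have hz : |z| ≤ lam := abs_le_of_sq_le_sq (by rw [hlam]; nlinarith [mul_pos hα hβ]) hl.le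
  have hcS : 0 < 1 / Z + α / lam := by positivity
  have hcT : 0 < 1 / Z + lam / β := by positivity
  have hnS : ‖(1 / Z + α / lam : ℂ)‖ = 1 / Z + α / lam := by
    have : (1 / Z + α / lam : ℂ) = ((1 / Z + α / lam : ℝ) : ℂ) := by push_cast; rfl
    rw [this, Complex.norm_real, Real.norm_of_nonneg hcS.le]
  have hnT : ‖(1 / Z + lam / β : ℂ)‖ = 1 / Z + lam / β := by
    have : (1 / Z + lam / β : ℂ) = ((1 / Z + lam / β : ℝ) : ℂ) := by push_cast; rfl
    rw [this, Complex.norm_real, Real.norm_of_nonneg hcT.le]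
  have cross : ∀ a b : ℂ, ‖(y : ℂ) * a‖ ≤ lam * ‖a‖ ∧ ‖(z : ℂ) * b‖ ≤ lam * ‖b‖ := fun a b => by
    rw [norm_mul, norm_mul, Complex.norm_real, Complex.norm_real, Real.norm_eq_abs, Real.norm_eq_abs]
    constructor <;> gcongr
  have hS := solveAmp_sum (τ := τ) hα hβ hl hZ hlam d
  set S : ℂ := y * e.1 + z * e.2 with hSdef
  have bS : ‖S‖ ≤ Z * (lam * D) := by
    rw [hS, norm_div, hnS, div_le_iff₀ hcS]
    have h1 := norm_sub_le ((y : ℂ) * (τ * d 2)) (z * (τ * d 1))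
    have h2 := cross (τ * d 2) (τ * d 1)
    rw [norm_mul (τ : ℂ), norm_mul (τ : ℂ), hτc] at h2
    have h3 : Z * (lam * D) * (1 / Z) = lam * D := by field_simp
    have h4 : 0 ≤ Z * (lam * D) * (α / lam) := by positivity
    rw [mul_add, h3]
    rw [hD] at h4 ⊢
    nlinarith
  have b1 : ∀ w : ℝ, |w| ≤ lam → ∀ v : ℂ, ‖v‖ ≤ D →
      ‖(v + w * S / (β * lam)) / (1 / Z + lam / β)‖ ≤ 2 * Z * D := fun w hw v hv => by
    rw [norm_div, hnT, div_le_iff₀ hcT]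
    have h1 : ‖(w : ℂ) * S / (β * lam)‖ ≤ lam * (Z * (lam * D)) / (β * lam) := by
      rw [norm_div, norm_mul, norm_mul, Complex.norm_real, Complex.norm_real, Complex.norm_real,
        Real.norm_eq_abs, Real.norm_of_nonneg hβ.le, Real.norm_of_nonneg hl.le]
      gcongr
    have h2 : lam * (Z * (lam * D)) / (β * lam) = Z * D * (lam / β) := by field_simp
    have h3 : 2 * Z * D * (1 / Z + lam / β) = 2 * D + 2 * (Z * D * (lam / β)) := by field_simp
    have h4 : 0 ≤ Z * D * (lam / β) := by positivity
    refine (norm_add_le _ _).trans ?_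
    rw [h3]
    linarith
  have n1 : ‖(τ : ℂ) * d 2‖ ≤ D := by
    rw [norm_mul, hτc, one_mul, hD]; linarith [norm_nonneg (d 1)]
  have n2 : ‖-((τ : ℂ) * d 1)‖ ≤ D := by
    rw [norm_neg, norm_mul, hτc, one_mul, hD]; linarith [norm_nonneg (d 2)]
  have be1 : ‖e.1‖ ≤ 2 * Z * D := by
    have := b1 y hy _ n1
    rwa [hS] at this
  have be2 : ‖e.2‖ ≤ 2 * Z * D := by
    have := b1 z hz _ n2
    rwa [hS] at this
  have hZD : 0 ≤ Z * D := by positivity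
  have i1 := impedanceComp_solveAmp hα hβ hl hZ hτ hlam d (j := 1) (by decide)
  have i2 := impedanceComp_solveAmp hα hβ hl hZ hτ hlam d (j := 2) (by decide)
  rw [← he] at i1 i2
  have hR : (2 * Z + 3) * D = 2 * Z * D + 3 * D := by ring
  have bZ : ∀ v : ℂ, ‖v‖ ≤ 2 * Z * D → ‖(τ : ℂ) / Z * v‖ ≤ 2 * D := fun v hv => by
    rw [norm_mul, norm_div, hτc, Complex.norm_real, Real.norm_of_nonneg hZ.le]
    calc 1 / Z * ‖v‖ ≤ 1 / Z * (2 * Z * D) := by gcongr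
      _ = 2 * D := by field_simp
  clear_value e D
  rw [hR]
  constructor
  · fin_cases j
    · change ‖-(Complex.I * τ / lam) * S‖ ≤ _
      rw [norm_mul, norm_neg, norm_div, norm_mul, Complex.norm_I, hτc, Complex.norm_real,
        Real.norm_of_nonneg hl.le]
      calc 1 * 1 / lam * ‖S‖ ≤ 1 * 1 / lam * (Z * (lam * D)) := by gcongr
        _ = Z * D := by field_simp
        _ ≤ _ := by linarith
    · change ‖e.1‖ ≤ _
      linarith
    · change ‖e.2‖ ≤ _
      linarith
  · fin_cases j
    · have hpol := (impedanceComp_polarization (τ := τ) (α := α) hβ hl hZ τ hτ hlam e.1 e.2).2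
      simp only [i1, i2] at hpol
      have hτ' : (τ : ℂ) * τ = 1 := by exact_mod_cast hτ
      rw [hτ', one_mul] at hpol
      have bT : ‖(y : ℂ) * e.2 - z * e.1‖ ≤ β * D := by
        have h1 := congrArg norm hpol
        rw [norm_mul, norm_mul, norm_neg, hτc, one_mul, hnT] at h1
        have h2 := norm_add_le ((y : ℂ) * d 1) (z * d 2)
        have h3 := cross (d 1) (d 2)
        have h4 : (1 / Z + lam / β) * ‖(y : ℂ) * e.2 - z * e.1‖ ≤ lam * D := by
          rw [← h1, hD]; linarith
        refine le_of_mul_le_mul_left (h4.trans ?_) hcT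
        have h5 : (1 / Z + lam / β) * (β * D) = β * D / Z + lam * D := by field_simp
        have h6 : 0 ≤ β * D / Z := by positivity
        rw [h5]; linarith
      change ‖-(Complex.I / β) * ((y : ℂ) * e.2 - z * e.1)‖ ≤ _
      rw [norm_mul, norm_neg, norm_div, Complex.norm_I, Complex.norm_real, Real.norm_of_nonneg hβ.le]
      calc 1 / β * ‖(y : ℂ) * e.2 - z * e.1‖ ≤ 1 / β * (β * D) := by gcongr
        _ = D := by field_simp
        _ ≤ _ := by linarith
    · have h1 : modeH β τ lam y z e.1 e.2 1 = -((τ / Z) * e.2) - d 1 := by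
        rw [← i1]; simp only [impedanceComp, modeE, Matrix.cons_val]; ring
      change ‖modeH β τ lam y z e.1 e.2 1‖ ≤ _
      rw [h1]
      have h2 := norm_sub_le (-((τ / Z : ℂ) * e.2)) (d 1)
      rw [norm_neg] at h2
      have h3 := bZ _ be2
      have h4 : ‖d 1‖ ≤ D := by rw [hD]; linarith [norm_nonneg (d 2)]
      linarith
    · have h1 : modeH β τ lam y z e.1 e.2 2 = (τ / Z) * e.1 - d 2 := by
        rw [← i2]; simp only [impedanceComp, modeE, Matrix.cons_val]; ring
      change ‖modeH β τ lam y z e.1 e.2 2‖ ≤ _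
      rw [h1]
      have h2 := norm_sub_le ((τ / Z : ℂ) * e.1) (d 2)
      have h3 := bZ _ be1
      have h4 : ‖d 2‖ ≤ D := by rw [hD]; linarith [norm_nonneg (d 1)]
      linarith

end Solve

/-! ### Regular fields -/

/-- The sign conditions on the constants. -/
structure Params.Admissible (c : Params) : Prop where
  hε : 0 < c.ε
  hμ : 0 < c.μ
  hσ : 0 ≤ c.σ
  hη : 0 < c.η

/-- Pairs `(E, H)` of fields as functions, so that the half-space may vary. -/
abbrev FieldPair : Type := (Space → Vec) × (Space → Vec)

/-- The decay rate `λ = √(|2πk|² + α β)` of the modes with frequency `k`. -/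
def Params.decay (c : Params) (k : Plane) : ℝ :=
  Real.sqrt ((2 * Real.pi * k 0) ^ 2 + (2 * Real.pi * k 1) ^ 2 + c.α * c.β)

section Decay
variable {c : Params}

lemma Params.Admissible.α_pos (hc : c.Admissible) : 0 < c.α := Params.α_pos hc.hε hc.hσ hc.hη
lemma Params.Admissible.β_pos (hc : c.Admissible) : 0 < c.β := Params.β_pos hc.hμ hc.hη
lemma Params.Admissible.p_pos (hc : c.Admissible) : 0 < c.p := Params.p_pos hc.hε hc.hμ hc.hη
lemma Params.Admissible.Z_pos (hc : c.Admissible) : 0 < c.Z := Params.Z_pos hc.hε hc.hμ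

lemma decay_sq (hc : c.Admissible) (k : Plane) :
    c.decay k ^ 2 = (2 * Real.pi * k 0) ^ 2 + (2 * Real.pi * k 1) ^ 2 + c.α * c.β := by
  have := mul_pos hc.α_pos hc.β_pos
  rw [Params.decay, Real.sq_sqrt (by positivity)]

lemma decay_pos (hc : c.Admissible) (k : Plane) : 0 < c.decay k := by
  have := mul_pos hc.α_pos hc.β_pos
  exact Real.sqrt_pos.2 (by positivity)

lemma p_sq_le (hc : c.Admissible) : c.p ^ 2 ≤ c.α * c.β := by
  rw [← Params.mul_eq hc.hε hc.hμ, sq]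
  exact mul_le_mul_of_nonneg_left (Params.p_le hc.hε hc.hμ hc.hσ) hc.p_pos.le

lemma p_le_of_sq (hc : c.Admissible) {lam y z : ℝ} (hl : 0 < lam)
    (h : lam ^ 2 = y ^ 2 + z ^ 2 + c.α * c.β) : c.p ≤ lam := by
  refine le_of_sq_le_sq ?_ hl.le
  have := p_sq_le hc
  nlinarith

lemma p_le_decay (hc : c.Admissible) (k : Plane) : c.p ≤ c.decay k :=
  p_le_of_sq hc (decay_pos hc k) (decay_sq hc k)

lemma continuous_decay : Continuous c.decay := by
  unfold Params.decay
  fun_prop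

end Decay

/-- The partial Fourier transforms of the components. -/
def hatVec (a τ : ℝ) (F : Space → Vec) (k : Plane) (j : Fin 3) : Profile :=
  hat a τ (fun p => F p j) k

/-- The Fourier transforms of the traces of the components at distance `ℓ` from the boundary. -/
def traceVec (a τ ℓ : ℝ) (F : Space → Vec) (k : Plane) (j : Fin 3) : ℂ :=
  profileTrace ℓ (hatVec a τ F k j)

/-- Square integrable fields whose tangential components have traces. There is no condition on the
normal component, which the impedance operator does not involve. -/
structure IsRegular (a τ : ℝ) (F : Space → Vec) : Prop where
  memLp : MemLp F 2 (volume.restrict (half a τ))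
  mild : ∀ j, j ≠ 0 → HasMildDeriv (hat a τ fun p => F p j)

section Regular
variable {a τ : ℝ}

lemma IsRegular.memLp_apply {F : Space → Vec} (h : IsRegular a τ F) (j : Fin 3) :
    MemLp (fun p => F p j) 2 (volume.restrict (half a τ)) := memLp_piLp_iff.1 h.memLp j

lemma hatVec_sub (hτ : τ = 1 ∨ τ = -1) {F G : Space → Vec}
    (hF : MemLp F 2 (volume.restrict (half a τ))) (hG : MemLp G 2 (volume.restrict (half a τ)))
    (j : Fin 3) : ∀ᵐ k, hatVec a τ (F - G) k j = hatVec a τ F k j - hatVec a τ G k j := by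
  have h := hat_sub hτ (memLp_piLp_iff.1 hF j) (memLp_piLp_iff.1 hG j)
  have h1 : (fun p => (F - G) p j) = (fun p => F p j) - fun p => G p j := by ext; simp
  filter_upwards [Lp.coeFn_sub (hat a τ fun p => F p j) (hat a τ fun p => G p j)] with k hk
  rw [hatVec, h1, h, hk]
  rfl

lemma hatVec_smul (hτ : τ = 1 ∨ τ = -1) {F : Space → Vec}
    (hF : MemLp F 2 (volume.restrict (half a τ))) (r : ℂ)
    (j : Fin 3) : ∀ᵐ k, hatVec a τ (fun p => r • F p) k j = r • hatVec a τ F k j := by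
  have h := hat_smul hτ r (memLp_piLp_iff.1 hF j)
  have h1 : (fun p => (r • F p) j) = r • (fun p => F p j) := by ext; simp
  filter_upwards [Lp.coeFn_smul r (hat a τ fun p => F p j)] with k hk
  rw [hatVec, h1, h, hk]
  rfl

lemma IsRegular.sub (hτ : τ = 1 ∨ τ = -1) {F G : Space → Vec} (hF : IsRegular a τ F)
    (hG : IsRegular a τ G) : IsRegular a τ (F - G) where
  memLp := hF.memLp.sub hG.memLp
  mild j hj := ((hF.mild j hj).sub (hG.mild j hj)).congr <| by
    filter_upwards [hatVec_sub hτ hF.memLp hG.memLp j] with k hk using hk.symm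

lemma traceVec_sub (hτ : τ = 1 ∨ τ = -1) {F G : Space → Vec} (hF : IsRegular a τ F)
    (hG : IsRegular a τ G) {ℓ : ℝ} (hℓ : 0 ≤ ℓ) {j : Fin 3} (hj : j ≠ 0) :
    ∀ᵐ k, traceVec a τ ℓ (F - G) k j = traceVec a τ ℓ F k j - traceVec a τ ℓ G k j := by
  filter_upwards [hatVec_sub hτ hF.memLp hG.memLp j, (hF.mild j hj).ae_exists,
    (hG.mild j hj).ae_exists] with k hk ⟨w, hw⟩ ⟨w', hw'⟩
  rw [traceVec, hk]
  exact profileTrace_sub hw hw' hℓ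

lemma hasMildDeriv_linear_comb (hτ : τ = 1 ∨ τ = -1) {f g : Space → ℂ} (r s : ℂ)
    (hf : MemLp f 2 (volume.restrict (half a τ))) (hg : MemLp g 2 (volume.restrict (half a τ)))
    (hfd : HasMildDeriv (hat a τ f)) (hgd : HasMildDeriv (hat a τ g)) :
    MemLp (r • f - s • g) 2 (volume.restrict (half a τ)) ∧
    HasMildDeriv (hat a τ (r • f - s • g)) ∧
    ∀ ℓ : ℝ, 0 ≤ ℓ → ∀ᵐ k, profileTrace ℓ (hat a τ (r • f - s • g) k)
      = r * profileTrace ℓ (hat a τ f k) - s * profileTrace ℓ (hat a τ g k) := by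
  have he : (fun k => r • hat a τ f k - s • hat a τ g k) =ᵐ[volume] hat a τ (r • f - s • g) := by
    rw [hat_sub hτ (hf.const_smul r) (hg.const_smul s), hat_smul hτ r hf, hat_smul hτ s hg]
    filter_upwards [Lp.coeFn_sub (r • hat a τ f) (s • hat a τ g), Lp.coeFn_smul r (hat a τ f),
      Lp.coeFn_smul s (hat a τ g)] with k h1 h2 h3
    rw [h1, Pi.sub_apply, h2, h3]
    rfl
  refine ⟨(hf.const_smul r).sub (hg.const_smul s), ((hfd.smul r).sub (hgd.smul s)).congr he,
    fun ℓ hℓ => ?_⟩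
  filter_upwards [he, hfd.ae_exists, hgd.ae_exists] with k hk ⟨w, hw⟩ ⟨w', hw'⟩
  have e1 : IsWeakDeriv (r • hat a τ f k : Profile) (r • w : Profile) :=
    mem_weakDerivGraph.1 (weakDerivGraph.smul_mem r (mem_weakDerivGraph.2 hw))
  have e2 : IsWeakDeriv (s • hat a τ g k : Profile) (s • w' : Profile) :=
    mem_weakDerivGraph.1 (weakDerivGraph.smul_mem s (mem_weakDerivGraph.2 hw'))
  rw [← hk, profileTrace_sub e1 e2 hℓ, profileTrace_smul hw hℓ, profileTrace_smul hw' hℓ]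

lemma impedance_regular (c : Params) (hτ : τ = 1 ∨ τ = -1) {s : ℝ} (hs : s * s = 1) {u : FieldPair}
    (h₁ : IsRegular a τ u.1) (h₂ : IsRegular a τ u.2) (j : Fin 3) :
    MemLp (fun p => impedance c (normal s) (u.1 p) (u.2 p) j) 2 (volume.restrict (half a τ)) ∧
    HasMildDeriv (hat a τ fun p => impedance c (normal s) (u.1 p) (u.2 p) j) ∧
    ∀ ℓ : ℝ, 0 ≤ ℓ → ∀ᵐ k, profileTrace ℓ (hat a τ (fun p => impedance c (normal s) (u.1 p) (u.2 p) j) k)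
      = impedanceComp c.Z s (traceVec a τ ℓ u.1 k) (traceVec a τ ℓ u.2 k) j := by
  simp only [impedance_normal c hs]
  have key : ∃ (r r' : ℂ) (i i' : Fin 3), i ≠ 0 ∧ i' ≠ 0 ∧
      ∀ e h : Fin 3 → ℂ, impedanceComp c.Z s e h j = r * e i - r' * h i' := by
    fin_cases j
    · exact ⟨0, 0, 1, 1, by decide, by decide, fun e h => by simp [impedanceComp]⟩
    · exact ⟨-(s / c.Z), 1, 2, 1, by decide, by decide, fun e h => by simp [impedanceComp]⟩
    · exact ⟨s / c.Z, 1, 1, 2, by decide, by decide, fun e h => by simp [impedanceComp]⟩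
  obtain ⟨r, r', i, i', hi, hi', he⟩ := key
  simp only [he]
  exact hasMildDeriv_linear_comb hτ r r' (h₁.memLp_apply i) (h₂.memLp_apply i') (h₁.mild i hi)
    (h₂.mild i' hi')

end Regular

/-! ### The energy of homogeneous solutions -/

/-- The traces of the impedance fields on a plane agree if and only if their partial Fourier
transforms do. -/
lemma tracesAgree_impedance_iff (c : Params) {a a₁ a₂ s : ℝ} (h₁ : a ≤ a₁) (h₂ : a₂ ≤ a)
    (hs : s * s = 1) {u v : FieldPair} (hu₁ : IsRegular a₁ 1 u.1) (hu₂ : IsRegular a₁ 1 u.2)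
    (hv₁ : IsRegular a₂ (-1) v.1) (hv₂ : IsRegular a₂ (-1) v.2) :
    TracesAgree a (fun p => impedance c (normal s) (u.1 p) (u.2 p))
      (fun p => impedance c (normal s) (v.1 p) (v.2 p)) ↔
    ∀ j, ∀ᵐ k, impedanceComp c.Z s (traceVec a₁ 1 (a₁ - a) u.1 k) (traceVec a₁ 1 (a₁ - a) u.2 k) j
      = impedanceComp c.Z s (traceVec a₂ (-1) (a - a₂) v.1 k) (traceVec a₂ (-1) (a - a₂) v.2 k) j := by
  have hu := impedance_regular c (Or.inl rfl) hs hu₁ hu₂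
  have hv := impedance_regular c (Or.inr rfl) hs hv₁ hv₂
  rw [tracesAgree_iff h₁ h₂ (fun j => (hu j).1) (fun j => (hv j).1) (fun j => (hu j).2.1)
    (fun j => (hv j).2.1)]
  refine forall_congr' fun j => ?_
  have e1 := (hu j).2.2 (a₁ - a) (by linarith)
  have e2 := (hv j).2.2 (a - a₂) (by linarith)
  constructor
  · intro h
    filter_upwards [h, e1, e2] with k hk h1 h2
    rw [← h1, ← h2, hk]
  · intro h
    filter_upwards [h, e1, e2] with k hk h1 h2
    rw [h1, h2, hk]

/-- Square integrable solutions of the homogeneous system `curl E = -β H`, `curl H = α E`. -/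
structure IsHomogeneous (c : Params) (Ω : Set Space) (u : FieldPair) : Prop where
  memLp₁ : MemLp u.1 2 (volume.restrict Ω)
  memLp₂ : MemLp u.2 2 (volume.restrict Ω)
  curl₁ : HasWeakCurl Ω u.1 fun p => (-c.β : ℂ) • u.2 p
  curl₂ : HasWeakCurl Ω u.2 fun p => (c.α : ℂ) • u.1 p

lemma isRegular_of_hasWeakCurl {a τ : ℝ} (hτ : τ = 1 ∨ τ = -1) {F C : Space → Vec}
    (h : HasWeakCurl (half a τ) F C) (hF : MemLp F 2 (volume.restrict (half a τ)))
    (hC : MemLp C 2 (volume.restrict (half a τ))) : IsRegular a τ F :=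
  ⟨hF, fun _ hj => h.hasMildDeriv hτ (memLp_piLp_iff.1 hF) (memLp_piLp_iff.1 hC) hj⟩

section Homogeneous
variable {c : Params} {a τ : ℝ} {u v : FieldPair}

lemma IsHomogeneous.mono {Ω Ω' : Set Space} (h : IsHomogeneous c Ω' u) (hs : Ω ⊆ Ω') :
    IsHomogeneous c Ω u :=
  ⟨h.memLp₁.mono_measure (Measure.restrict_mono hs le_rfl),
    h.memLp₂.mono_measure (Measure.restrict_mono hs le_rfl), h.curl₁.mono hs, h.curl₂.mono hs⟩

lemma IsHomogeneous.zero {Ω : Set Space} : IsHomogeneous c Ω 0 :=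
  ⟨MemLp.zero, MemLp.zero, fun φ _ _ _ => by simp [dot], fun φ _ _ _ => by simp [dot]⟩

/-- Almost every frequency of a homogeneous solution in a half-space is a decaying mode. -/
lemma IsHomogeneous.ae_exists_mode (hc : c.Admissible) (hτ : τ = 1 ∨ τ = -1)
    (h : IsHomogeneous c (half a τ) u) :
    ∀ᵐ k : Plane, ∃ e₁ e₂ : ℂ,
      (∀ j, hatVec a τ u.1 k j = modeE τ (c.decay k) (2 * Real.pi * k 0) (2 * Real.pi * k 1) e₁ e₂ j
        • expProfile (c.decay k)) ∧
      ∀ j, hatVec a τ u.2 k j = modeH c.β τ (c.decay k) (2 * Real.pi * k 0) (2 * Real.pi * k 1) e₁ e₂ j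
        • expProfile (c.decay k) := by
  have m1 := memLp_piLp_iff.1 h.memLp₁
  have m2 := memLp_piLp_iff.1 h.memLp₂
  have m3 := memLp_piLp_iff.1 (h.memLp₂.const_smul (-c.β : ℂ))
  have m4 := memLp_piLp_iff.1 (h.memLp₁.const_smul (c.α : ℂ))
  filter_upwards [h.curl₁.ae_hat hτ m1 m3, h.curl₂.ae_hat hτ m2 m4,
    ae_all_iff.2 (hatVec_smul hτ h.memLp₂ (-c.β : ℂ)),
    ae_all_iff.2 (hatVec_smul hτ h.memLp₁ (c.α : ℂ))] with k hE hH s1 s2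
  have e0 : (2 * Real.pi * Complex.I) * ((k 0 : ℝ) : ℂ) = Complex.I * ((2 * Real.pi * k 0 : ℝ) : ℂ) := by
    push_cast; ring
  have e1 : (2 * Real.pi * Complex.I) * ((k 1 : ℝ) : ℂ) = Complex.I * ((2 * Real.pi * k 1 : ℝ) : ℂ) := by
    push_cast; ring
  simp only [hatVec] at s1 s2
  rw [s1, s1, s1, e0, e1] at hE
  rw [s2, s2, s2, e0, e1] at hH
  exact exists_mode hc.α_pos hc.β_pos (decay_pos hc k) (sign_mul_self hτ) (decay_sq hc k)
    (E := hatVec a τ u.1 k) (H := hatVec a τ u.2 k)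
    (mem_weakDerivGraph.2 hE.1) (mem_weakDerivGraph.2 hE.2.1) hE.2.2
    (mem_weakDerivGraph.2 hH.1) (mem_weakDerivGraph.2 hH.2.1) hH.2.2

/-- The energy of the frequency `k`: the squared norm of its profiles. -/
def hatEnergy (a τ : ℝ) (u : FieldPair) (k : Plane) : ℝ :=
  ∑ j, (‖hatVec a τ u.1 k j‖ ^ 2 + ‖hatVec a τ u.2 k j‖ ^ 2)

lemma hatEnergy_nonneg (k : Plane) : 0 ≤ hatEnergy a τ u k :=
  Finset.sum_nonneg fun _ _ => by positivity

lemma eLpNorm_vec_sq (hτ : τ = 1 ∨ τ = -1) {F : Space → Vec}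
    (hF : MemLp F 2 (volume.restrict (half a τ))) :
    eLpNorm F 2 (volume.restrict (half a τ)) ^ 2
      = ∫⁻ k, ENNReal.ofReal (∑ j, ‖hatVec a τ F k j‖ ^ 2) := by
  have hj := memLp_piLp_iff.1 hF
  have e1 : ∀ p, ‖F p‖ₑ ^ 2 = ∑ j, ‖F p j‖ₑ ^ 2 := fun p => by
    have := EuclideanSpace.norm_sq_eq (F p)
    simp only [← ofReal_norm, ← ENNReal.ofReal_pow (norm_nonneg _)]
    rw [this, ENNReal.ofReal_sum_of_nonneg fun _ _ => by positivity]
  rw [eLpNorm_two_sq, lintegral_congr e1, lintegral_finsetSum' _ fun j _ =>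
    (hj j).1.enorm.pow_const 2]
  simp only [← eLpNorm_two_sq, eLpNorm_hat hτ (hj _)]
  simp only [eLpNorm_two_sq]
  rw [← lintegral_finsetSum' _ fun j _ => (Lp.aestronglyMeasurable _).enorm.pow_const 2]
  refine lintegral_congr fun k => ?_
  rw [ENNReal.ofReal_sum_of_nonneg fun _ _ => by positivity]
  simp only [← ofReal_norm, ← ENNReal.ofReal_pow (norm_nonneg _)]
  rfl

lemma aemeasurable_hatEnergy : AEMeasurable (fun k => ENNReal.ofReal (hatEnergy a τ u k)) volume := by
  refine ENNReal.measurable_ofReal.comp_aemeasurable ?_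
  unfold hatEnergy
  refine Finset.aemeasurable_fun_sum _ fun j _ => ?_
  exact ((Lp.aestronglyMeasurable _).norm.aemeasurable.pow_const 2).add
    ((Lp.aestronglyMeasurable _).norm.aemeasurable.pow_const 2)

/-- The theorem of Plancherel for pairs of fields. -/
lemma lintegral_hatEnergy (hτ : τ = 1 ∨ τ = -1) (h₁ : MemLp u.1 2 (volume.restrict (half a τ)))
    (h₂ : MemLp u.2 2 (volume.restrict (half a τ))) :
    eLpNorm u.1 2 (volume.restrict (half a τ)) ^ 2 + eLpNorm u.2 2 (volume.restrict (half a τ)) ^ 2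
      = ∫⁻ k, ENNReal.ofReal (hatEnergy a τ u k) := by
  rw [eLpNorm_vec_sq hτ h₁, eLpNorm_vec_sq hτ h₂, ← lintegral_add_left']
  · refine lintegral_congr fun k => ?_
    rw [← ENNReal.ofReal_add (Finset.sum_nonneg fun _ _ => by positivity)
      (Finset.sum_nonneg fun _ _ => by positivity), hatEnergy, Finset.sum_add_distrib]
  · refine ENNReal.measurable_ofReal.comp_aemeasurable ?_
    refine Finset.aemeasurable_fun_sum _ fun j _ => ?_
    exact (Lp.aestronglyMeasurable _).norm.aemeasurable.pow_const 2

/-- In terms of the Fourier transforms of traces: the incoming impedance data of `u`, in the half-space with boundary `{a} × ℝ²` and outward normal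
`(τ, 0, 0)`, are those of `v`, given in the half-space with the opposite normal that overlaps by
`L`. -/
def Transmits (c : Params) (a τ L : ℝ) (u v : FieldPair) : Prop :=
  ∀ j, ∀ᵐ k, impedanceComp c.Z τ (traceVec a τ 0 u.1 k) (traceVec a τ 0 u.2 k) j
    = impedanceComp c.Z τ (traceVec (a - τ * L) (-τ) L v.1 k) (traceVec (a - τ * L) (-τ) L v.2 k) j

lemma impedanceComp_congr {Z s : ℝ} {e h e' h' : Fin 3 → ℂ} (he : ∀ j, j ≠ 0 → e j = e' j)
    (hh : ∀ j, j ≠ 0 → h j = h' j) (j : Fin 3) :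
    impedanceComp Z s e h j = impedanceComp Z s e' h' j := by
  simp only [impedanceComp, he 1 (by decide), he 2 (by decide), hh 1 (by decide), hh 2 (by decide)]

lemma impedanceComp_sub (Z s : ℝ) (e h e' h' : Fin 3 → ℂ) (j : Fin 3) :
    impedanceComp Z s (fun i => e i - e' i) (fun i => h i - h' i) j
      = impedanceComp Z s e h j - impedanceComp Z s e' h' j := by
  fin_cases j <;> simp [impedanceComp] <;> ring

lemma impedanceComp_smul (Z s : ℝ) (r : ℂ) (e h : Fin 3 → ℂ) (j : Fin 3) :
    impedanceComp Z s (fun i => e i * r) (fun i => h i * r) j = r * impedanceComp Z s e h j := by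
  fin_cases j <;> simp [impedanceComp] <;> ring

lemma ae_impedanceComp_sub (hτ : τ = 1 ∨ τ = -1) (Z s : ℝ) {ℓ : ℝ} (hℓ : 0 ≤ ℓ)
    (hu₁ : IsRegular a τ u.1) (hu₂ : IsRegular a τ u.2)
    (hv₁ : IsRegular a τ v.1) (hv₂ : IsRegular a τ v.2) (j : Fin 3) :
    ∀ᵐ k, impedanceComp Z s (traceVec a τ ℓ (u - v).1 k) (traceVec a τ ℓ (u - v).2 k) j
      = impedanceComp Z s (traceVec a τ ℓ u.1 k) (traceVec a τ ℓ u.2 k) j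
        - impedanceComp Z s (traceVec a τ ℓ v.1 k) (traceVec a τ ℓ v.2 k) j := by
  have h1 : ∀ᵐ k, ∀ j, j ≠ 0 → traceVec a τ ℓ (u - v).1 k j = traceVec a τ ℓ u.1 k j - traceVec a τ ℓ v.1 k j :=
    ae_all_iff.2 fun j => ae_all_iff.2 fun hj => traceVec_sub hτ hu₁ hv₁ hℓ hj
  have h2 : ∀ᵐ k, ∀ j, j ≠ 0 → traceVec a τ ℓ (u - v).2 k j = traceVec a τ ℓ u.2 k j - traceVec a τ ℓ v.2 k j :=
    ae_all_iff.2 fun j => ae_all_iff.2 fun hj => traceVec_sub hτ hu₂ hv₂ hℓ hj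
  filter_upwards [h1, h2] with k h1 h2
  rw [← impedanceComp_sub]
  exact impedanceComp_congr h1 h2 j

/-- The energy of almost every frequency is reduced by the square of its reflection factor. -/
lemma hatEnergy_le (hc : c.Admissible) (hτ : τ = 1 ∨ τ = -1) {L : ℝ} (hL : 0 ≤ L)
    (hu : IsHomogeneous c (half a τ) u) (hv : IsHomogeneous c (half (a - τ * L) (-τ)) v)
    (ht : Transmits c a τ L u v) :
    ∀ᵐ k, hatEnergy a τ u k
      ≤ reflection c.p (c.decay k) L ^ 2 * hatEnergy (a - τ * L) (-τ) v k := by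
  have hτ' : -τ = 1 ∨ -τ = -1 := by rcases hτ with rfl | rfl <;> norm_num
  filter_upwards [hu.ae_exists_mode hc hτ, hv.ae_exists_mode hc hτ', ae_all_iff.2 ht]
    with k ⟨e₁, e₂, hE, hH⟩ ⟨e₁', e₂', hE', hH'⟩ htk
  have hl := decay_pos hc k
  -- both energies carry the same factor `‖e^{-λ t}‖² = (2 λ)⁻¹`
  have en : ∀ {σ : ℝ} {E H : Fin 3 → Profile} {x y : ℂ},
      (∀ j, E j = modeE σ (c.decay k) (2 * Real.pi * k 0) (2 * Real.pi * k 1) x y j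
        • expProfile (c.decay k)) →
      (∀ j, H j = modeH c.β σ (c.decay k) (2 * Real.pi * k 0) (2 * Real.pi * k 1) x y j
        • expProfile (c.decay k)) → ∑ j, (‖E j‖ ^ 2 + ‖H j‖ ^ 2)
        = modeEnergy c.β σ (c.decay k) (2 * Real.pi * k 0) (2 * Real.pi * k 1) x y
          / (2 * c.decay k) := fun h1 h2 => by
    simp only [h1, h2, norm_smul_expProfile_sq hl]
    rw [modeEnergy, Finset.sum_div]
    exact Finset.sum_congr rfl fun _ _ => by ring
  rw [hatEnergy, hatEnergy, en hE hH, en hE' hH', ← mul_div_assoc]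
  refine div_le_div_of_nonneg_right ?_ (by positivity)
  refine modeEnergy_le hc.α_pos hc.β_pos hl hc.Z_pos hc.p_pos (sign_mul_self hτ) (decay_sq hc k)
    (Params.β_eq hc.hε hc.hμ) (Params.p_le hc.hε hc.hμ hc.hσ) fun j => ?_
  have t1 : ∀ j, traceVec a τ 0 u.1 k j = _ := fun j => by
    rw [traceVec, hE, profileTrace_smul_exp hl _ le_rfl]
  have t2 : ∀ j, traceVec a τ 0 u.2 k j = _ := fun j => by
    rw [traceVec, hH, profileTrace_smul_exp hl _ le_rfl]
  have t3 : ∀ j, traceVec (a - τ * L) (-τ) L v.1 k j = _ := fun j => by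
    rw [traceVec, hE', profileTrace_smul_exp hl _ hL]
  have t4 : ∀ j, traceVec (a - τ * L) (-τ) L v.2 k j = _ := fun j => by
    rw [traceVec, hH', profileTrace_smul_exp hl _ hL]
  have := htk j
  rw [funext t1, funext t2, funext t3, funext t4, impedanceComp_smul, impedanceComp_smul] at this
  simpa using this

/-- A pair of fields without energy vanishes. -/
lemma ae_eq_zero_of_hatEnergy (hτ : τ = 1 ∨ τ = -1)
    (h₁ : MemLp u.1 2 (volume.restrict (half a τ))) (h₂ : MemLp u.2 2 (volume.restrict (half a τ)))
    (h : ∀ᵐ k, hatEnergy a τ u k ≤ 0) :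
    u.1 =ᵐ[volume.restrict (half a τ)] 0 ∧ u.2 =ᵐ[volume.restrict (half a τ)] 0 := by
  have h3 : ∫⁻ k, ENNReal.ofReal (hatEnergy a τ u k) = 0 := by
    rw [lintegral_congr_ae (g := fun _ => 0), lintegral_zero]
    filter_upwards [h] with k hk using ENNReal.ofReal_of_nonpos hk
  rw [← lintegral_hatEnergy hτ h₁ h₂, add_eq_zero, pow_eq_zero_iff two_ne_zero,
    pow_eq_zero_iff two_ne_zero] at h3
  exact ⟨(eLpNorm_eq_zero_iff h₁.1 two_ne_zero).1 h3.1, (eLpNorm_eq_zero_iff h₂.1 two_ne_zero).1 h3.2⟩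

end Homogeneous

/-! ### Homogeneous solutions with prescribed impedance data -/

section Synthesis
variable {c : Params} {a τ : ℝ}

/-- The amplitudes `solveAmp` at the frequency `k`. -/
def Params.amp (c : Params) (τ : ℝ) (k : Plane) (d : Fin 3 → ℂ) : ℂ × ℂ :=
  solveAmp c.α c.β c.Z τ (c.decay k) (2 * Real.pi * k 0) (2 * Real.pi * k 1) d

lemma measurable_mode (c : Params) (τ : ℝ) (j : Fin 3) :
    Measurable (fun q : Plane × (Fin 3 → ℂ) => modeE τ (c.decay q.1) (2 * Real.pi * q.1 0)
      (2 * Real.pi * q.1 1) (c.amp τ q.1 q.2).1 (c.amp τ q.1 q.2).2 j) ∧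
    Measurable (fun q : Plane × (Fin 3 → ℂ) => modeH c.β τ (c.decay q.1) (2 * Real.pi * q.1 0)
      (2 * Real.pi * q.1 1) (c.amp τ q.1 q.2).1 (c.amp τ q.1 q.2).2 j) := by
  have hd : Measurable c.decay := continuous_decay.measurable
  have h1 : Measurable fun q : Plane × (Fin 3 → ℂ) => (c.decay q.1 : ℂ) :=
    Complex.measurable_ofReal.comp (hd.comp measurable_fst)
  have h2 : ∀ i, Measurable fun q : Plane × (Fin 3 → ℂ) => ((2 * Real.pi * q.1 i : ℝ) : ℂ) := fun i =>
    Complex.measurable_ofReal.comp (by fun_prop)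
  have h3 : ∀ i, Measurable fun q : Plane × (Fin 3 → ℂ) => q.2 i := fun i => by fun_prop
  have a1 : Measurable fun q : Plane × (Fin 3 → ℂ) => (c.amp τ q.1 q.2).1 := by
    have := h2 0; have := h2 1; have := h3 1; have := h3 2
    simp only [Params.amp, solveAmp]
    fun_prop
  have a2 : Measurable fun q : Plane × (Fin 3 → ℂ) => (c.amp τ q.1 q.2).2 := by
    have := h2 0; have := h2 1; have := h3 1; have := h3 2
    simp only [Params.amp, solveAmp]
    fun_prop
  have := h2 0
  have := h2 1
  constructor <;> fin_cases j <;> simp only [modeE, modeH, Fin.zero_eta, Fin.mk_one, Fin.reduceFinMk,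
    Matrix.cons_val] <;> fun_prop

lemma one_add_norm_le_decay (hc : c.Admissible) :
    ∃ C : ℝ, 0 ≤ C ∧ ∀ k : Plane, 1 + ‖k‖ ≤ C * c.decay k := by
  have hm := Real.sqrt_pos.2 (mul_pos hc.α_pos hc.β_pos)
  set m := Real.sqrt (c.α * c.β) with hmdef
  have hm2 : m ^ 2 = c.α * c.β := Real.sq_sqrt (mul_pos hc.α_pos hc.β_pos).le
  refine ⟨1 / m + 1, by positivity, fun k => ?_⟩
  have hd := decay_sq hc k
  have hdp := decay_pos hc k
  have hk : ‖k‖ ^ 2 = k 0 ^ 2 + k 1 ^ 2 := by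
    rw [EuclideanSpace.real_norm_sq_eq, Fin.sum_univ_two]
  have hpi : (1 : ℝ) ≤ 2 * Real.pi := by linarith [Real.pi_gt_three]
  have hpi2 : (1 : ℝ) ≤ (2 * Real.pi) ^ 2 := by nlinarith
  have h1 : m ≤ c.decay k := le_of_sq_le_sq (by rw [hd, hm2]; nlinarith [sq_nonneg (2 * Real.pi * k 0), sq_nonneg (2 * Real.pi * k 1)]) hdp.le
  have h2 : ‖k‖ ≤ c.decay k := by
    refine le_of_sq_le_sq ?_ hdp.le
    rw [hd, hk, mul_pow, mul_pow (2 * Real.pi)]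
    nlinarith [sq_nonneg (k 0), sq_nonneg (k 1), mul_pos hc.α_pos hc.β_pos]
  have h3 : 1 ≤ 1 / m * c.decay k := by
    rw [one_div, inv_mul_eq_div, le_div_iff₀ hm]; linarith
  linarith

/-- Profiles with the decay of the modes and amplitudes controlled by traces are square integrable. -/
lemma memLp_smul_expProfile (hc : c.Admissible) {f : Plane → ℂ} {b : Plane → ℝ} (hb : MemLp b 2 volume)
    (hf : AEStronglyMeasurable f volume)
    (h : ∀ᵐ k, 0 ≤ b k ∧ ‖f k‖ ≤ Real.sqrt (1 + ‖k‖) * b k) :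
    MemLp (fun k => f k • expProfile (c.decay k)) 2 volume := by
  obtain ⟨C, hC, hCk⟩ := one_add_norm_le_decay hc
  refine (hb.const_mul (Real.sqrt C)).of_le
    (hf.smul (continuous_expProfile_comp continuous_decay (decay_pos hc)).aestronglyMeasurable) ?_
  filter_upwards [h] with k ⟨hb0, hk⟩
  have hl := decay_pos hc k
  have hr : 0 ≤ Real.sqrt C * b k := by positivity
  rw [Real.norm_of_nonneg hr]
  refine le_of_sq_le_sq ?_ hr
  rw [norm_smul_expProfile_sq hl, div_le_iff₀ (by positivity), mul_pow, Real.sq_sqrt hC]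
  have h1 : ‖f k‖ ^ 2 ≤ (1 + ‖k‖) * b k ^ 2 := by
    have := pow_le_pow_left₀ (norm_nonneg _) hk 2
    rwa [mul_pow, Real.sq_sqrt (by positivity)] at this
  have h2 := mul_le_mul_of_nonneg_right (hCk k) (sq_nonneg (b k))
  have h3 : 0 ≤ C * c.decay k * b k ^ 2 := by positivity
  nlinarith

/-- A homogeneous solution in a half-space with prescribed incoming impedance data. -/
lemma exists_homogeneous (hc : c.Admissible) (hτ : τ = 1 ∨ τ = -1) (a : ℝ) {d : Plane → Fin 3 → ℂ}
    (hd : ∀ j, AEStronglyMeasurable (fun k => d k j) volume) {b : Plane → ℝ} (hb : MemLp b 2 volume)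
    (h : ∀ᵐ k, 0 ≤ b k ∧ ‖d k 1‖ + ‖d k 2‖ ≤ Real.sqrt (1 + ‖k‖) * b k) :
    ∃ u : FieldPair, IsHomogeneous c (half a τ) u ∧ ∀ j, j ≠ 0 → ∀ᵐ k,
      impedanceComp c.Z τ (traceVec a τ 0 u.1 k) (traceVec a τ 0 u.2 k) j = d k j := by
  have hττ := sign_mul_self hτ
  have hZ := hc.Z_pos
  have hl := decay_pos hc
  set fE : Plane → Fin 3 → ℂ := fun k j => modeE τ (c.decay k) (2 * Real.pi * k 0)
      (2 * Real.pi * k 1) (c.amp τ k (d k)).1 (c.amp τ k (d k)).2 j with hfE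
  set fH : Plane → Fin 3 → ℂ := fun k j => modeH c.β τ (c.decay k) (2 * Real.pi * k 0)
      (2 * Real.pi * k 1) (c.amp τ k (d k)).1 (c.amp τ k (d k)).2 j with hfH
  have hdm : AEMeasurable (fun k => (k, d k)) volume :=
    aemeasurable_id.prodMk (aemeasurable_pi_lambda _ fun j => (hd j).aemeasurable)
  have mE : ∀ j, AEStronglyMeasurable (fun k => fE k j) volume := fun j =>
    ((measurable_mode c τ j).1.comp_aemeasurable hdm).aestronglyMeasurable
  have mH : ∀ j, AEStronglyMeasurable (fun k => fH k j) volume := fun j =>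
    ((measurable_mode c τ j).2.comp_aemeasurable hdm).aestronglyMeasurable
  have bd := fun k j => norm_mode_le (τ := τ) hc.α_pos hc.β_pos (hl k) hZ hττ (decay_sq hc k) (d k) j
  have hb' := hb.const_mul (2 * c.Z + 3)
  have lE : ∀ j, MemLp (fun k => fE k j • expProfile (c.decay k)) 2 volume := fun j =>
    memLp_smul_expProfile hc hb' (mE j) <| by
      filter_upwards [h] with k ⟨h0, hk⟩
      refine ⟨by positivity, (bd k j).1.trans ?_⟩
      calc (2 * c.Z + 3) * (‖d k 1‖ + ‖d k 2‖) ≤ (2 * c.Z + 3) * (Real.sqrt (1 + ‖k‖) * b k) := by gcongr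
        _ = _ := by ring
  have lH : ∀ j, MemLp (fun k => fH k j • expProfile (c.decay k)) 2 volume := fun j =>
    memLp_smul_expProfile hc hb' (mH j) <| by
      filter_upwards [h] with k ⟨h0, hk⟩
      refine ⟨by positivity, (bd k j).2.trans ?_⟩
      calc (2 * c.Z + 3) * (‖d k 1‖ + ‖d k 2‖) ≤ (2 * c.Z + 3) * (Real.sqrt (1 + ‖k‖) * b k) := by gcongr
        _ = _ := by ring
  choose E hE hEh using fun j => exists_of_hat (a := a) hτ ((lE j).toLp _)
  choose H hH hHh using fun j => exists_of_hat (a := a) hτ ((lH j).toLp _)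
  set u : FieldPair := (fun p => WithLp.toLp 2 fun j => E j p, fun p => WithLp.toLp 2 fun j => H j p)
    with hu
  have u1 : MemLp u.1 2 (volume.restrict (half a τ)) := memLp_piLp_iff.2 hE
  have u2 : MemLp u.2 2 (volume.restrict (half a τ)) := memLp_piLp_iff.2 hH
  have v1 : ∀ j, ∀ᵐ k, hatVec a τ u.1 k j = fE k j • expProfile (c.decay k) := fun j => by
    have : hat a τ (fun p => u.1 p j) = _ := hEh j
    simp only [hatVec, this]
    exact (lE j).coeFn_toLp
  have v2 : ∀ j, ∀ᵐ k, hatVec a τ u.2 k j = fH k j • expProfile (c.decay k) := fun j => by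
    have : hat a τ (fun p => u.2 p j) = _ := hHh j
    simp only [hatVec, this]
    exact (lH j).coeFn_toLp
  have w1 : ∀ j, ∀ᵐ k, hatVec a τ (fun p => (-c.β : ℂ) • u.2 p) k j
      = ((-c.β : ℂ) * fH k j) • expProfile (c.decay k) := fun j => by
    filter_upwards [v2 j, hatVec_smul hτ u2 (-c.β : ℂ) j] with k h1 h2
    rw [h2, h1, smul_smul]
  have w2 : ∀ j, ∀ᵐ k, hatVec a τ (fun p => (c.α : ℂ) • u.1 p) k j
      = ((c.α : ℂ) * fE k j) • expProfile (c.decay k) := fun j => by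
    filter_upwards [v1 j, hatVec_smul hτ u1 (c.α : ℂ) j] with k h1 h2
    rw [h2, h1, smul_smul]
  have e0 : ∀ k : Plane, (2 * Real.pi * Complex.I) * ((k 0 : ℝ) : ℂ)
      = Complex.I * ((2 * Real.pi * k 0 : ℝ) : ℂ) := fun k => by push_cast; ring
  have e1 : ∀ k : Plane, (2 * Real.pi * Complex.I) * ((k 1 : ℝ) : ℂ)
      = Complex.I * ((2 * Real.pi * k 1 : ℝ) : ℂ) := fun k => by push_cast; ring
  have rE := fun k : Plane => modeE_relations (τ := τ) (lam := c.decay k) (y := 2 * Real.pi * k 0)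
    (z := 2 * Real.pi * k 1) hc.β_pos.ne' (hl k).ne' hττ (c.amp τ k (d k)).1 (c.amp τ k (d k)).2
  have rH := fun k : Plane => modeH_relations (τ := τ) hc.β_pos.ne' (hl k).ne' hττ (decay_sq hc k)
    (c.amp τ k (d k)).1 (c.amp τ k (d k)).2
  have hom : IsHomogeneous c (half a τ) u := by
    refine ⟨u1, u2, ?_, ?_⟩
    · refine hasWeakCurl_of_hat hτ (memLp_piLp_iff.1 u1)
        (memLp_piLp_iff.1 (u2.const_smul (-c.β : ℂ))) hl v1 w1 (fun k => ?_) (fun k => ?_) fun k => ?_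
      · rw [e0]; exact (rE k).1
      · rw [e1]; exact (rE k).2.1
      · rw [e0, e1]; exact (rE k).2.2
    · refine hasWeakCurl_of_hat hτ (memLp_piLp_iff.1 u2)
        (memLp_piLp_iff.1 (u1.const_smul (c.α : ℂ))) hl v2 w2 (fun k => ?_) (fun k => ?_) fun k => ?_
      · rw [e0]; exact (rH k).1
      · rw [e1]; exact (rH k).2.1
      · rw [e0, e1]; exact (rH k).2.2
  refine ⟨u, hom, fun j hj => ?_⟩
  filter_upwards [ae_all_iff.2 v1, ae_all_iff.2 v2] with k h1 h2
  have t1 : ∀ j, traceVec a τ 0 u.1 k j = fE k j := fun j => by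
    rw [traceVec, h1, profileTrace_smul_exp (hl k) _ le_rfl]; simp
  have t2 : ∀ j, traceVec a τ 0 u.2 k j = fH k j := fun j => by
    rw [traceVec, h2, profileTrace_smul_exp (hl k) _ le_rfl]; simp
  rw [funext t1, funext t2]
  exact impedanceComp_solveAmp hc.α_pos hc.β_pos (hl k) hZ hττ (decay_sq hc k) (d k) hj

end Synthesis

/-! ### Existence in the whole space -/

/-- The smooth fields with compact support. -/
abbrev TestField : Type := {φ : Space → Vec // ContDiff ℝ ∞ φ ∧ HasCompactSupport φ}

lemma memLp_testField (φ : TestField) : MemLp φ.1 2 (volume.restrict univ) :=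
  memLp_piLp_iff.2 fun j => memLp_component φ.2.1 φ.2.2 j _

lemma memLp_curl_testField (φ : TestField) : MemLp (curl φ.1) 2 (volume.restrict univ) :=
  memLp_piLp_iff.2 fun j => memLp_curl φ.2.1 φ.2.2 j _

/-- A test field as an element of `L²`. -/
def testLp (φ : TestField) : L2Field univ := (memLp_testField φ).toLp _

/-- The classical curl of a test field as an element of `L²`. -/
def curlLp (φ : TestField) : L2Field univ := (memLp_curl_testField φ).toLp _

lemma inner_conjField (φ : Space → Vec) (p : Space) (v : Vec) :
    inner ℂ (conjField φ p) v = dot v (φ p) := by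
  simp [PiLp.inner_apply, dot]

lemma conjField_conjField (φ : Space → Vec) : conjField (conjField φ) = φ := by
  ext p j
  simp

lemma inner_toLp {φ : Space → Vec} (hφ : MemLp φ 2 (volume.restrict univ)) (F : L2Field univ) :
    inner ℂ (hφ.toLp φ) F = ∫ p in univ, dot (F p) (conjField φ p) := by
  rw [L2.inner_def]
  refine integral_congr_ae ?_
  filter_upwards [hφ.coeFn_toLp] with p hp
  rw [hp, ← inner_conjField, conjField_conjField]

/-- Weak curls as an orthogonality relation in `L²`. The conjugation in the inner product is absorbed
by conjugating the test field. -/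
lemma hasWeakCurl_univ_iff (F C : L2Field univ) :
    HasWeakCurl univ F C ↔ ∀ φ : TestField, inner ℂ (curlLp φ) F = inner ℂ (testLp φ) C := by
  have key : ∀ φ : TestField, (inner ℂ (curlLp φ) F = inner ℂ (testLp φ) C ↔
      ∫ p in univ, dot (F p) (curl (conjField φ.1) p) = ∫ p in univ, dot (C p) (conjField φ.1 p)) :=
    fun φ => by
      rw [curlLp, testLp, inner_toLp, inner_toLp, curl_conjField φ.2.1]
  have hcs : ∀ {φ : Space → Vec}, HasCompactSupport φ → HasCompactSupport (conjField φ) := fun hφ =>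
    IsCompact.of_isClosed_subset hφ (isClosed_tsupport _) (tsupport_conjField _)
  constructor
  · intro h φ
    exact (key φ).2 (h _ (contDiff_conjField φ.2.1) (hcs φ.2.2) (subset_univ _))
  · intro h φ h1 h2 _
    have := (key ⟨conjField φ, contDiff_conjField h1, hcs h2⟩).1 (h _)
    rwa [conjField_conjField] at this

lemma hasWeakCurl_testLp (φ : TestField) : HasWeakCurl univ (testLp φ) (curlLp φ) := by
  intro ψ h1 h2 h3
  have := hasWeakCurl_of_contDiff φ.2.1 univ ψ h1 h2 h3
  rw [integral_congr_ae (g := fun p => dot (φ.1 p) (curl ψ p)), this]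
  · refine integral_congr_ae ?_
    filter_upwards [(memLp_curl_testField φ).coeFn_toLp] with p hp
    rw [curlLp, hp]
  · filter_upwards [(memLp_testField φ).coeFn_toLp] with p hp
    rw [testLp, hp]

/-- In the Hilbert space of pairs, the orthogonal complement of the graph of `t curl` consists of the
pairs `(-t curl b, b)`; decomposing a pair solves `E - t curl b = F₁`, `t curl E + b = F₂`. -/
lemma exists_curl_decomposition {t : ℝ} (ht : 0 < t) (F₁ F₂ : L2Field univ) :
    ∃ E P A b : L2Field univ, HasWeakCurl univ E ((t⁻¹ : ℂ) • P : L2Field univ) ∧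
      HasWeakCurl univ b (-(t⁻¹ : ℂ) • A : L2Field univ) ∧ E + A = F₁ ∧ P + b = F₂ := by
  have htc : (t : ℂ) ≠ 0 := by exact_mod_cast ht.ne'
  set K := WithLp 2 (L2Field univ × L2Field univ)
  let γ : TestField → K := fun φ => WithLp.toLp 2 (testLp φ, (t : ℂ) • curlLp φ)
  let δ : TestField → K := fun φ => WithLp.toLp 2 ((t : ℂ) • curlLp φ, -testLp φ)
  let G : Submodule ℂ K := (Submodule.span ℂ (range γ)).topologicalClosure
  have hin : ∀ (f₁ f₂ : L2Field univ) (y : K), inner ℂ (WithLp.toLp 2 (f₁, f₂) : K) y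
      = inner ℂ f₁ (WithLp.ofLp y).1 + inner ℂ f₂ (WithLp.ofLp y).2 := fun _ _ _ => rfl
  have hG : G ≤ (Submodule.span ℂ (range δ))ᗮ := by
    refine Submodule.topologicalClosure_minimal _ ?_ (Submodule.isClosed_orthogonal _)
    rw [Submodule.span_le]
    rintro _ ⟨φ, rfl⟩
    rw [SetLike.mem_coe, Submodule.mem_orthogonal]
    intro x hx
    refine Submodule.span_induction ?_ (by simp) (fun x y _ _ h1 h2 => by rw [inner_add_left, h1, h2, add_zero])
      (fun r x _ h => by rw [inner_smul_left, h, mul_zero]) hx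
    rintro _ ⟨ψ, rfl⟩
    have h := (hasWeakCurl_univ_iff _ _).1 (hasWeakCurl_testLp φ) ψ
    simp only [γ, δ]
    rw [hin, inner_smul_left, inner_smul_right, inner_neg_left, h, Complex.conj_ofReal]
    ring
  obtain ⟨y, hy, z, hz, hyz⟩ := G.exists_add_mem_mem_orthogonal (WithLp.toLp 2 (F₁, F₂))
  refine ⟨(WithLp.ofLp y).1, (WithLp.ofLp y).2, (WithLp.ofLp z).1, (WithLp.ofLp z).2, ?_, ?_, ?_, ?_⟩
  · refine (hasWeakCurl_univ_iff _ _).2 fun φ => ?_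
    have h := (Submodule.mem_orthogonal _ _).1 (hG hy) (δ φ) (Submodule.subset_span ⟨φ, rfl⟩)
    simp only [δ] at h
    rw [hin, inner_smul_left, inner_neg_left, Complex.conj_ofReal] at h
    rw [inner_smul_right]
    rw [← sub_eq_add_neg, sub_eq_zero] at h
    rw [← h, inv_mul_cancel_left₀ htc]
  · refine (hasWeakCurl_univ_iff _ _).2 fun φ => ?_
    have h := (Submodule.mem_orthogonal _ _).1 hz (γ φ)
      (Submodule.le_topologicalClosure _ (Submodule.subset_span ⟨φ, rfl⟩))
    simp only [γ] at h
    rw [hin, inner_smul_left, Complex.conj_ofReal] at h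
    rw [inner_smul_right, eq_neg_of_add_eq_zero_left h, neg_mul_neg, inv_mul_cancel_left₀ htc]
  · exact (congrArg (fun q : K => (WithLp.ofLp q).1) hyz).symm
  · exact (congrArg (fun q : K => (WithLp.ofLp q).2) hyz).symm

lemma HasWeakCurl.congr {Ω : Set Space} {F F' C C' : Space → Vec} (h : HasWeakCurl Ω F C)
    (hF : F =ᵐ[volume.restrict Ω] F') (hC : C =ᵐ[volume.restrict Ω] C') : HasWeakCurl Ω F' C' := by
  intro φ h1 h2 h3
  rw [integral_congr_ae (g := fun p => dot (F p) (curl φ p)),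
    integral_congr_ae (f := fun p => dot (C' p) (φ p)) (g := fun p => dot (C p) (φ p))]
  · exact h φ h1 h2 h3
  · filter_upwards [hC] with p hp
    rw [hp]
  · filter_upwards [hF] with p hp
    rw [hp]

lemma HasWeakCurl.const_smul {Ω : Set Space} {F C : Space → Vec} (h : HasWeakCurl Ω F C) (r : ℂ) :
    HasWeakCurl Ω (fun p => r • F p) (fun p => r • C p) := by
  intro φ h1 h2 h3
  have e : ∀ v w : Vec, dot (r • v) w = r * dot v w := fun v w => by
    simp [dot, Finset.mul_sum, mul_assoc]
  simp only [e, integral_const_mul]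
  rw [h φ h1 h2 h3]

lemma HasWeakCurl.smul_Lp {Ω : Set Space} {F C : L2Field Ω} (h : HasWeakCurl Ω F C) (r : ℂ) :
    HasWeakCurl Ω (r • F : L2Field Ω) (r • C : L2Field Ω) :=
  (h.const_smul r).congr (Lp.coeFn_smul r F).symm (Lp.coeFn_smul r C).symm

/-- With `t = (α β)^{-1/2}` and `H = b / (β t)`, the decomposition of `(-J / α, t g)` solves the system. -/
lemma exists_solvesMaxwell {c : Params} (hc : c.Admissible) (J g : L2Field univ) :
    ∃ U : L2Pair univ, SolvesMaxwell c U J g := by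
  have hα := hc.α_pos
  have hβ := hc.β_pos
  set t := (Real.sqrt (c.α * c.β))⁻¹ with ht
  have ht0 : 0 < t := by positivity
  have ht2 : t ^ 2 * (c.α * c.β) = 1 := by
    rw [ht, inv_pow, Real.sq_sqrt (by positivity), inv_mul_cancel₀ (by positivity)]
  have hα' : (c.α : ℂ) ≠ 0 := by exact_mod_cast hα.ne'
  have hβ' : (c.β : ℂ) ≠ 0 := by exact_mod_cast hβ.ne'
  have ht' : (t : ℂ) ≠ 0 := by exact_mod_cast ht0.ne'
  have ht2' : (t : ℂ) ^ 2 * (c.α * c.β) = 1 := by exact_mod_cast ht2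
  obtain ⟨E, P, A, b, hE, hb, h1, h2⟩ := exists_curl_decomposition ht0 (-(c.α : ℂ)⁻¹ • J) ((t : ℂ) • g)
  set s : ℂ := (c.β : ℂ)⁻¹ * (t : ℂ)⁻¹ with hs
  have hH : HasWeakCurl univ (s • b : L2Field univ) (s • (-(t⁻¹ : ℂ) • A) : L2Field univ) :=
    hb.smul_Lp s
  refine ⟨(E, s • b), _, _, hE, hH, ?_, ?_⟩
  · have e : -((c.α : ℂ) • E) + s • (-(t⁻¹ : ℂ) • A) = J := by
      have : J = -((c.α : ℂ) • (E + A)) := by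
        rw [h1, smul_smul, mul_neg, mul_inv_cancel₀ hα', neg_smul, one_smul, neg_neg]
      rw [this, smul_smul, smul_add, neg_add]
      have e2 : s * -(t : ℂ)⁻¹ = -c.α := by
        rw [hs]
        field_simp
        linear_combination ht2'
      rw [e2, neg_smul]
    filter_upwards [Lp.coeFn_add (-((c.α : ℂ) • E)) (s • (-(t⁻¹ : ℂ) • A)),
      Lp.coeFn_neg ((c.α : ℂ) • E), Lp.coeFn_smul (c.α : ℂ) E] with p q1 q2 q3
    rw [e, Pi.add_apply, q2, Pi.neg_apply, q3, Pi.smul_apply] at q1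
    rw [q1, Params.α]
    have : ((Real.sqrt c.η * c.ε + c.σ : ℝ) : ℂ) • E p = (Real.sqrt c.η * c.ε + c.σ) • E p :=
      Complex.coe_smul _ _
    rw [this, add_smul]
    abel
  · have e : (c.β : ℂ) • s • b + (t⁻¹ : ℂ) • P = g := by
      have : g = (t⁻¹ : ℂ) • (P + b) := by rw [h2, smul_smul, inv_mul_cancel₀ ht', one_smul]
      rw [this, smul_smul, hs, mul_inv_cancel_left₀ hβ', smul_add, add_comm]
    filter_upwards [Lp.coeFn_add ((c.β : ℂ) • s • b) ((t⁻¹ : ℂ) • P),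
      Lp.coeFn_smul (c.β : ℂ) (s • b)] with p q1 q2
    rw [e, Pi.add_apply, q2, Pi.smul_apply] at q1
    rw [q1]
    have : (c.β : ℂ) • (s • b : L2Field univ) p = c.β • (s • b : L2Field univ) p := Complex.coe_smul _ _
    rw [this]
    rfl

/-! ### Transmission conditions and uniqueness -/

section Linear
variable {Ω : Set Space} {F F' C C' : Space → Vec}

lemma integrable_dot_of_memLp (hF : MemLp F 2 (volume.restrict Ω))
    (hC : ∀ j, MemLp (fun p => C p j) 2 (volume.restrict Ω)) :
    Integrable (fun p => dot (F p) (C p)) (volume.restrict Ω) :=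
  integrable_finsetSum _ fun j _ => (memLp_piLp_iff.1 hF j).integrable_mul (hC j)

lemma dot_add (v v' w : Vec) : dot (v + v') w = dot v w + dot v' w := by
  simp [dot, add_mul, Finset.sum_add_distrib]

lemma HasWeakCurl.add (h : HasWeakCurl Ω F C) (h' : HasWeakCurl Ω F' C')
    (hF : MemLp F 2 (volume.restrict Ω)) (hC : MemLp C 2 (volume.restrict Ω))
    (hF' : MemLp F' 2 (volume.restrict Ω)) (hC' : MemLp C' 2 (volume.restrict Ω)) :
    HasWeakCurl Ω (F + F') (C + C') := by
  intro φ h1 h2 h3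
  have m1 := fun j => memLp_component h1 h2 j (volume.restrict Ω)
  have m2 := fun j => memLp_curl h1 h2 j (volume.restrict Ω)
  simp only [Pi.add_apply, dot_add]
  rw [integral_add (integrable_dot_of_memLp hF m2) (integrable_dot_of_memLp hF' m2),
    integral_add (integrable_dot_of_memLp hC m1) (integrable_dot_of_memLp hC' m1), h φ h1 h2 h3,
    h' φ h1 h2 h3]

lemma HasWeakCurl.sub (h : HasWeakCurl Ω F C) (h' : HasWeakCurl Ω F' C')
    (hF : MemLp F 2 (volume.restrict Ω)) (hC : MemLp C 2 (volume.restrict Ω))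
    (hF' : MemLp F' 2 (volume.restrict Ω)) (hC' : MemLp C' 2 (volume.restrict Ω)) :
    HasWeakCurl Ω (F - F') (C - C') := by
  have := h.add (h'.const_smul (-1)) hF hC (hF'.const_smul (-1 : ℂ)) (hC'.const_smul (-1 : ℂ))
  convert this using 1 <;> · ext p : 1; simp [sub_eq_add_neg]

end Linear

/-- Square integrable solutions of the system with sources, as functions. -/
structure IsSolution (c : Params) (Ω : Set Space) (J g : Space → Vec) (u : FieldPair) : Prop where
  memLp₁ : MemLp u.1 2 (volume.restrict Ω)
  memLp₂ : MemLp u.2 2 (volume.restrict Ω)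
  curl₁ : HasWeakCurl Ω u.1 fun p => g p - (c.β : ℂ) • u.2 p
  curl₂ : HasWeakCurl Ω u.2 fun p => J p + (c.α : ℂ) • u.1 p

/-- The representatives of a pair in `L²(Ω)⁶`. -/
def toPair {Ω : Set Space} (u : L2Pair Ω) : FieldPair := (u.1, u.2)

section Solution
variable {c : Params} {Ω : Set Space} {J g : L2Field univ} {u v : FieldPair}

lemma memLp_restrict (F : L2Field univ) (Ω : Set Space) : MemLp F 2 (volume.restrict Ω) :=
  (Lp.memLp F).mono_measure (Measure.restrict_mono (subset_univ Ω) le_rfl)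

lemma solvesMaxwell_iff (u : L2Pair Ω) : SolvesMaxwell c u J g ↔ IsSolution c Ω J g (toPair u) := by
  have eα : ∀ v : Vec, (c.α : ℂ) • v = (Real.sqrt c.η * c.ε) • v + c.σ • v := fun v => by
    rw [← add_smul]; exact Complex.coe_smul _ _
  have eβ : ∀ v : Vec, (c.β : ℂ) • v = (Real.sqrt c.η * c.μ) • v := fun v => Complex.coe_smul _ _
  have m1 : MemLp (fun p => g p - (c.β : ℂ) • u.2 p) 2 (volume.restrict Ω) :=
    (memLp_restrict g Ω).sub ((Lp.memLp u.2).const_smul (c.β : ℂ))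
  have m2 : MemLp (fun p => J p + (c.α : ℂ) • u.1 p) 2 (volume.restrict Ω) :=
    (memLp_restrict J Ω).add ((Lp.memLp u.1).const_smul (c.α : ℂ))
  constructor
  · rintro ⟨CE, CH, h1, h2, h3, h4⟩
    refine ⟨Lp.memLp _, Lp.memLp _, h1.congr (ae_eq_refl _) ?_, h2.congr (ae_eq_refl _) ?_⟩
    · filter_upwards [h4] with p hp
      rw [← hp, eβ]
      simp [toPair]
    · filter_upwards [h3] with p hp
      rw [← hp, eα]
      simp only [toPair]
      abel
  · intro h
    refine ⟨m1.toLp _, m2.toLp _, h.curl₁.congr (ae_eq_refl _) m1.coeFn_toLp.symm,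
      h.curl₂.congr (ae_eq_refl _) m2.coeFn_toLp.symm, ?_, ?_⟩
    · filter_upwards [m2.coeFn_toLp] with p hp
      rw [hp, eα]
      abel
    · filter_upwards [m1.coeFn_toLp] with p hp
      rw [hp, eβ]
      abel

lemma IsSolution.memLp_curl₁ (h : IsSolution c Ω J g u) :
    MemLp (fun p => g p - (c.β : ℂ) • u.2 p) 2 (volume.restrict Ω) :=
  (memLp_restrict g Ω).sub (h.memLp₂.const_smul (c.β : ℂ))

lemma IsSolution.memLp_curl₂ (h : IsSolution c Ω J g u) :
    MemLp (fun p => J p + (c.α : ℂ) • u.1 p) 2 (volume.restrict Ω) :=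
  (memLp_restrict J Ω).add (h.memLp₁.const_smul (c.α : ℂ))

lemma IsSolution.mono {Ω' : Set Space} (h : IsSolution c Ω' J g u) (hs : Ω ⊆ Ω') :
    IsSolution c Ω J g u :=
  ⟨h.memLp₁.mono_measure (Measure.restrict_mono hs le_rfl),
    h.memLp₂.mono_measure (Measure.restrict_mono hs le_rfl), h.curl₁.mono hs, h.curl₂.mono hs⟩

lemma IsSolution.sub (h : IsSolution c Ω J g u) (h' : IsSolution c Ω J g v) :
    IsHomogeneous c Ω (u - v) where
  memLp₁ := h.memLp₁.sub h'.memLp₁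
  memLp₂ := h.memLp₂.sub h'.memLp₂
  curl₁ := by
    have := h.curl₁.sub h'.curl₁ h.memLp₁ h.memLp_curl₁ h'.memLp₁ h'.memLp_curl₁
    refine this.congr (ae_eq_refl _) (Eventually.of_forall fun p => ?_)
    change (g p - (c.β : ℂ) • u.2 p) - (g p - (c.β : ℂ) • v.2 p) = (-c.β : ℂ) • (u.2 p - v.2 p)
    module
  curl₂ := by
    have := h.curl₂.sub h'.curl₂ h.memLp₂ h.memLp_curl₂ h'.memLp₂ h'.memLp_curl₂
    refine this.congr (ae_eq_refl _) (Eventually.of_forall fun p => ?_)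
    change (J p + (c.α : ℂ) • u.1 p) - (J p + (c.α : ℂ) • v.1 p) = (c.α : ℂ) • (u.1 p - v.1 p)
    module

lemma IsSolution.add (h : IsSolution c Ω J g u) (h' : IsHomogeneous c Ω v) :
    IsSolution c Ω J g (u + v) where
  memLp₁ := h.memLp₁.add h'.memLp₁
  memLp₂ := h.memLp₂.add h'.memLp₂
  curl₁ := by
    have := h.curl₁.add h'.curl₁ h.memLp₁ h.memLp_curl₁ h'.memLp₁ (h'.memLp₂.const_smul (-c.β : ℂ))
    refine this.congr (ae_eq_refl _) (Eventually.of_forall fun p => ?_)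
    change (g p - (c.β : ℂ) • u.2 p) + (-c.β : ℂ) • v.2 p = g p - (c.β : ℂ) • (u.2 p + v.2 p)
    module
  curl₂ := by
    have := h.curl₂.add h'.curl₂ h.memLp₂ h.memLp_curl₂ h'.memLp₂ (h'.memLp₁.const_smul (c.α : ℂ))
    refine this.congr (ae_eq_refl _) (Eventually.of_forall fun p => ?_)
    change (J p + (c.α : ℂ) • u.1 p) + (c.α : ℂ) • v.1 p = J p + (c.α : ℂ) • (u.1 p + v.1 p)
    module

lemma IsSolution.congr (h : IsSolution c Ω J g u) (h₁ : u.1 =ᵐ[volume.restrict Ω] v.1)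
    (h₂ : u.2 =ᵐ[volume.restrict Ω] v.2) : IsSolution c Ω J g v where
  memLp₁ := h.memLp₁.ae_eq h₁
  memLp₂ := h.memLp₂.ae_eq h₂
  curl₁ := h.curl₁.congr h₁ <| by filter_upwards [h₂] with p hp; rw [hp]
  curl₂ := h.curl₂.congr h₂ <| by filter_upwards [h₁] with p hp; rw [hp]

/-- Both fields of the pair are regular. -/
def IsRegularPair (a τ : ℝ) (u : FieldPair) : Prop := IsRegular a τ u.1 ∧ IsRegular a τ u.2

variable {a τ L : ℝ}

lemma IsRegularPair.sub (hτ : τ = 1 ∨ τ = -1) (hu : IsRegularPair a τ u) (hv : IsRegularPair a τ v) :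
    IsRegularPair a τ (u - v) := ⟨hu.1.sub hτ hv.1, hu.2.sub hτ hv.2⟩

lemma IsSolution.isRegular (hτ : τ = 1 ∨ τ = -1) (h : IsSolution c (half a τ) J g u) :
    IsRegularPair a τ u :=
  ⟨isRegular_of_hasWeakCurl hτ h.curl₁ h.memLp₁ h.memLp_curl₁,
    isRegular_of_hasWeakCurl hτ h.curl₂ h.memLp₂ h.memLp_curl₂⟩

lemma transmits_one_iff (hL : 0 ≤ L) (hu : IsRegularPair a 1 u) (hv : IsRegularPair (a - L) (-1) v) :
    TracesAgree a (fun p => impedance c n₁ (u.1 p) (u.2 p))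
      (fun p => impedance c n₁ (v.1 p) (v.2 p)) ↔ Transmits c a 1 L u v := by
  rw [← normal_one, tracesAgree_impedance_iff c le_rfl (by linarith : a - L ≤ a) (by norm_num)
    hu.1 hu.2 hv.1 hv.2, Transmits]
  simp

lemma transmits_neg_one_iff (hL : 0 ≤ L) (hu : IsRegularPair a (-1) u)
    (hv : IsRegularPair (a + L) 1 v) :
    TracesAgree a (fun p => impedance c n₂ (v.1 p) (v.2 p))
      (fun p => impedance c n₂ (u.1 p) (u.2 p)) ↔ Transmits c a (-1) L u v := by
  rw [← normal_neg_one, tracesAgree_impedance_iff c (by linarith : a ≤ a + L) le_rfl (by norm_num)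
    hv.1 hv.2 hu.1 hu.2, Transmits]
  simp only [neg_neg, neg_mul, one_mul, sub_neg_eq_add, sub_self, add_sub_cancel_left]
  exact forall_congr' fun j => ⟨fun h => by filter_upwards [h] with k hk using hk.symm,
    fun h => by filter_upwards [h] with k hk using hk.symm⟩

lemma neg_sign (hτ : τ = 1 ∨ τ = -1) : -τ = 1 ∨ -τ = -1 := by rcases hτ with rfl | rfl <;> norm_num

/-- A solution in the whole space satisfies all transmission conditions, as its tangential traces from
both sides of a plane agree. -/
lemma IsSolution.transmits (hτ : τ = 1 ∨ τ = -1) (hL : 0 ≤ L) (h : IsSolution c univ J g u) (a : ℝ) :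
    Transmits c a τ L u u := by
  have hr : ∀ a τ : ℝ, (τ = 1 ∨ τ = -1) → IsRegularPair a τ u := fun a τ hτ =>
    (h.mono (subset_univ _)).isRegular hτ
  have ha : ∀ s : ℝ, s * s = 1 → TracesAgree a (fun p => impedance c (normal s) (u.1 p) (u.2 p))
      (fun p => impedance c (normal s) (u.1 p) (u.2 p)) := fun s hs => by
    rw [tracesAgree_impedance_iff c le_rfl le_rfl hs (hr a 1 (Or.inl rfl)).1 (hr a 1 (Or.inl rfl)).2
      (hr a (-1) (Or.inr rfl)).1 (hr a (-1) (Or.inr rfl)).2, sub_self]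
    have m := fun {F : Space → Vec} (hF : MemLp F 2 (volume.restrict univ)) =>
      memLp_piLp_iff.1 (show MemLp F 2 volume by rwa [Measure.restrict_univ] at hF)
    have h1 : ∀ᵐ k, ∀ j : Fin 3, j ≠ 0 → traceVec a 1 0 u.1 k j = traceVec a (-1) 0 u.1 k j :=
      ae_all_iff.2 fun j => ae_all_iff.2 fun hj => h.curl₁.ae_trace_eq (m h.memLp₁) (m h.memLp_curl₁) a hj
    have h2 : ∀ᵐ k, ∀ j : Fin 3, j ≠ 0 → traceVec a 1 0 u.2 k j = traceVec a (-1) 0 u.2 k j :=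
      ae_all_iff.2 fun j => ae_all_iff.2 fun hj => h.curl₂.ae_trace_eq (m h.memLp₂) (m h.memLp_curl₂) a hj
    intro j
    filter_upwards [h1, h2] with k h1 h2 using impedanceComp_congr h1 h2 j
  rcases hτ with rfl | rfl
  · rw [← transmits_one_iff hL (hr _ _ (Or.inl rfl)) (hr _ _ (Or.inr rfl)), ← normal_one]
    exact ha 1 (by norm_num)
  · rw [← transmits_neg_one_iff hL (hr _ _ (Or.inr rfl)) (hr _ _ (Or.inl rfl)), ← normal_neg_one]
    exact ha (-1) (by norm_num)

/-- Transmission conditions may be subtracted. -/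
lemma Transmits.sub (hτ : τ = 1 ∨ τ = -1) (hL : 0 ≤ L) {u' v' : FieldPair} (h : Transmits c a τ L u v)
    (h' : Transmits c a τ L u' v') (hu : IsRegularPair a τ u) (hu' : IsRegularPair a τ u')
    (hv : IsRegularPair (a - τ * L) (-τ) v) (hv' : IsRegularPair (a - τ * L) (-τ) v') :
    Transmits c a τ L (u - u') (v - v') := by
  intro j
  filter_upwards [h j, h' j, ae_impedanceComp_sub hτ c.Z τ le_rfl hu.1 hu.2 hu'.1 hu'.2 j,
    ae_impedanceComp_sub (neg_sign hτ) c.Z τ hL hv.1 hv.2 hv'.1 hv'.2 j] with k h1 h2 h3 h4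
  rw [h3, h4, h1, h2]

lemma ae_hatEnergy_zero (hτ : τ = 1 ∨ τ = -1) : ∀ᵐ k, hatEnergy a τ 0 k = 0 := by
  have h : ∀ᵐ k, ∀ j, hatVec a τ 0 k j = 0 := ae_all_iff.2 fun j => by
    filter_upwards [hatVec_sub hτ (a := a) (MemLp.zero (ε := Vec)) (MemLp.zero (ε := Vec)) j] with k hk
    rwa [sub_self, sub_self] at hk
  filter_upwards [h] with k hk
  simp [hatEnergy, hk]

/-- Uniqueness for the subdomain problem: the difference of two solutions has zero incoming data, hence
no energy. -/
lemma IsSolution.ae_eq_of_transmits (hc : c.Admissible) (hτ : τ = 1 ∨ τ = -1) (hL : 0 ≤ L)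
    {u' : FieldPair} (h : IsSolution c (half a τ) J g u) (h' : IsSolution c (half a τ) J g u')
    (hv : IsRegularPair (a - τ * L) (-τ) v) (ht : Transmits c a τ L u v)
    (ht' : Transmits c a τ L u' v) :
    u.1 =ᵐ[volume.restrict (half a τ)] u'.1 ∧ u.2 =ᵐ[volume.restrict (half a τ)] u'.2 := by
  have h0 := ht.sub hτ hL ht' (h.isRegular hτ) (h'.isRegular hτ) hv hv
  rw [sub_self] at h0
  have h1 := hatEnergy_le hc hτ hL (h.sub h') IsHomogeneous.zero h0
  have h2 := ae_eq_zero_of_hatEnergy (u := u - u') hτ (h.sub h').memLp₁ (h.sub h').memLp₂ <| by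
    filter_upwards [h1, ae_hatEnergy_zero (neg_sign hτ)] with k h1 h2
    rwa [h2, mul_zero] at h1
  exact ⟨by filter_upwards [h2.1] with p hp using sub_eq_zero.1 hp,
    by filter_upwards [h2.2] with p hp using sub_eq_zero.1 hp⟩

/-- Existence for the subdomain problem, by correcting the solution in the whole space. -/
lemma exists_isSolution_transmits (hc : c.Admissible) (hτ : τ = 1 ∨ τ = -1) (hL : 0 ≤ L)
    {U : FieldPair} (hU : IsSolution c univ J g U) (hv : IsRegularPair (a - τ * L) (-τ) v) :
    ∃ u, IsSolution c (half a τ) J g u ∧ Transmits c a τ L u v := by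
  have hUo := (hU.mono (subset_univ (half a τ)))
  have hUv := (hU.mono (subset_univ (half (a - τ * L) (-τ)))).isRegular (neg_sign hτ)
  have hw := hv.sub (neg_sign hτ) hUv
  have hi := impedance_regular c (neg_sign hτ) (sign_mul_self hτ) hw.1 hw.2
  obtain ⟨b₁, hb₁, hk₁⟩ := (hi 1).2.1.exists_norm_profileTrace_le hL
  obtain ⟨b₂, hb₂, hk₂⟩ := (hi 2).2.1.exists_norm_profileTrace_le hL
  -- the correction carries the impedance data of `v - U`
  obtain ⟨w, hw1, hw2⟩ := exists_homogeneous hc hτ a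
    (fun j => (hi j).2.1.aestronglyMeasurable_profileTrace hL) (hb₁.add hb₂) <| by
      filter_upwards [hk₁, hk₂] with k ⟨h1, h2⟩ ⟨h3, h4⟩
      refine ⟨add_nonneg h1 h3, ?_⟩
      rw [Pi.add_apply, mul_add]
      exact add_le_add h2 h4
  have hs := hUo.add hw1
  refine ⟨U + w, hs, fun j => ?_⟩
  have h1 := ae_impedanceComp_sub hτ c.Z τ le_rfl (hs.isRegular hτ).1 (hs.isRegular hτ).2
    (hUo.isRegular hτ).1 (hUo.isRegular hτ).2 j
  rw [add_sub_cancel_left] at h1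
  have h2 := ae_impedanceComp_sub (neg_sign hτ) c.Z τ hL hv.1 hv.2 hUv.1 hUv.2 j
  have hd : ∀ᵐ k, impedanceComp c.Z τ (traceVec a τ 0 w.1 k) (traceVec a τ 0 w.2 k) j
      = impedanceComp c.Z τ (traceVec (a - τ * L) (-τ) L (v - U).1 k)
        (traceVec (a - τ * L) (-τ) L (v - U).2 k) j := by
    by_cases hj : j = 0
    · subst hj
      exact Eventually.of_forall fun k => by simp [impedanceComp]
    · filter_upwards [hw2 j hj, (hi j).2.2 L hL] with k h1 h2
      rw [h1, h2]
  filter_upwards [h1, h2, hd, hU.transmits hτ hL a j] with k h1 h2 h3 h4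
  rw [h3, h2, h4] at h1
  exact (sub_left_inj.1 h1).symm

/-- Uniqueness in the whole space: the traces on a plane match from both sides, so that the energies
of the two halves bound each other with a factor below `1`. -/
lemma IsHomogeneous.ae_eq_zero (hc : c.Admissible) (h : IsHomogeneous c univ u)
    (ht : ∀ τ : ℝ, τ = 1 ∨ τ = -1 → Transmits c 0 τ 0 u u) :
    u.1 =ᵐ[volume] 0 ∧ u.2 =ᵐ[volume] 0 := by
  have h1 := hatEnergy_le hc (Or.inl rfl) le_rfl (h.mono (subset_univ _)) (h.mono (subset_univ _))
    (ht 1 (Or.inl rfl))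
  have h2 := hatEnergy_le hc (Or.inr rfl) le_rfl (h.mono (subset_univ _)) (h.mono (subset_univ _))
    (ht (-1) (Or.inr rfl))
  simp only [mul_zero, sub_zero, neg_neg] at h1 h2
  have key : ∀ᵐ k, hatEnergy 0 1 u k ≤ 0 ∧ hatEnergy 0 (-1) u k ≤ 0 := by
    filter_upwards [h1, h2] with k h1 h2
    have r0 := reflection_nonneg hc.p_pos (p_le_decay hc k) 0
    have r1 := reflection_lt_one hc.p_pos (p_le_decay hc k) le_rfl
    have r2 : reflection c.p (c.decay k) 0 ^ 2 < 1 := by nlinarith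
    have n1 : 0 ≤ hatEnergy 0 1 u k := hatEnergy_nonneg k
    have n2 : 0 ≤ hatEnergy 0 (-1) u k := hatEnergy_nonneg k
    constructor <;> nlinarith
  have z1 := ae_eq_zero_of_hatEnergy (u := u) (Or.inl rfl) (h.mono (subset_univ (half 0 1))).memLp₁
    (h.mono (subset_univ _)).memLp₂ (key.mono fun _ h => h.1)
  have z2 := ae_eq_zero_of_hatEnergy (u := u) (Or.inr rfl) (h.mono (subset_univ (half 0 (-1)))).memLp₁
    (h.mono (subset_univ _)).memLp₂ (key.mono fun _ h => h.2)
  have glue : ∀ F : Space → Vec, F =ᵐ[volume.restrict (half 0 1)] 0 →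
      F =ᵐ[volume.restrict (half 0 (-1))] 0 → F =ᵐ[volume] 0 := fun F h1 h2 => by
    rw [← Measure.restrict_univ (μ := volume),
      Measure.restrict_congr_set (univ_ae_eq_union_half (a := 0))]
    exact ae_restrict_union_iff _ _ _ |>.2 ⟨h1, h2⟩
  exact ⟨glue _ z1.1 z2.1, glue _ z1.2 z2.2⟩

lemma IsSolution.ae_eq (hc : c.Admissible) (h : IsSolution c univ J g u)
    (h' : IsSolution c univ J g v) : u.1 =ᵐ[volume] v.1 ∧ u.2 =ᵐ[volume] v.2 := by
  have h2 := (h.sub h').ae_eq_zero hc fun τ hτ => by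
    refine (h.transmits hτ le_rfl 0).sub hτ le_rfl (h'.transmits hτ le_rfl 0) ?_ ?_ ?_ ?_
    · exact (h.mono (subset_univ _)).isRegular hτ
    · exact (h'.mono (subset_univ _)).isRegular hτ
    · exact (h.mono (subset_univ _)).isRegular (neg_sign hτ)
    · exact (h'.mono (subset_univ _)).isRegular (neg_sign hτ)
  exact ⟨by filter_upwards [h2.1] with p hp using sub_eq_zero.1 hp,
    by filter_upwards [h2.2] with p hp using sub_eq_zero.1 hp⟩

end Solution

/-! ### The Schwarz iteration -/

/-- Two sequences whose terms are each determined by the preceding term of the other one. -/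
lemma existsUnique_alternating {A B : Type*} {P : A → Prop} {Q : B → Prop} {R : A → B → Prop}
    {S : B → A → Prop} (hR : ∀ b, Q b → ∃! a, R a b) (hS : ∀ a, P a → ∃! b, S b a)
    (hP : ∀ a b, R a b → P a) (hQ : ∀ b a, S b a → Q b) {a₀ : A} {b₀ : B} (ha : P a₀) (hb : Q b₀) :
    ∃! u : (ℕ → A) × (ℕ → B), u.1 0 = a₀ ∧ u.2 0 = b₀ ∧
      ∀ n, R (u.1 (n + 1)) (u.2 n) ∧ S (u.2 (n + 1)) (u.1 n) := by
  choose f hf hfu using hR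
  choose g hg hgu using hS
  let w : ℕ → {a // P a} × {b // Q b} := fun n => Nat.rec (⟨a₀, ha⟩, ⟨b₀, hb⟩)
    (fun _ x => (⟨f x.2.1 x.2.2, hP _ _ (hf _ _)⟩, ⟨g x.1.1 x.1.2, hQ _ _ (hg _ _)⟩)) n
  refine ⟨(fun n => (w n).1.1, fun n => (w n).2.1), ⟨rfl, rfl, fun n => ⟨hf _ _, hg _ _⟩⟩, ?_⟩
  rintro ⟨u, v⟩ ⟨h1, h2, h3⟩
  have key : ∀ n, u n = (w n).1.1 ∧ v n = (w n).2.1 := fun n => by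
    induction n with
    | zero => exact ⟨h1, h2⟩
    | succ n ih =>
      obtain ⟨e1, e2⟩ := h3 n
      simp only [ih.1, ih.2] at e1 e2
      exact ⟨hfu _ (w n).2.2 _ e1, hgu _ (w n).1.2 _ e2⟩
  exact Prod.ext (funext fun n => (key n).1) (funext fun n => (key n).2)

section Energy
variable {X : Type*} [MeasurableSpace X] {μ : Measure X} {d e : ℕ → X → ℝ} {r : X → ℝ}

/-- Energies that are reduced by factors below `1` tend to zero in the mean: the factors need not
be bounded away from `1`, by dominated convergence. -/
lemma tendsto_lintegral_of_alternating (hd : ∀ n, AEMeasurable (fun x => ENNReal.ofReal (d n x)) μ)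
    (hd0 : ∀ n x, 0 ≤ d n x) (he0 : ∀ n x, 0 ≤ e n x)
    (h1 : ∀ n, ∀ᵐ x ∂μ, d (n + 2) x ≤ r x ^ 2 * e (n + 1) x)
    (h2 : ∀ n, ∀ᵐ x ∂μ, e (n + 2) x ≤ r x ^ 2 * d (n + 1) x)
    (hr0 : ∀ x, 0 ≤ r x) (hr : ∀ x, r x < 1)
    (hf : ∫⁻ x, ENNReal.ofReal (d 1 x) ∂μ ≠ ⊤) (hf' : ∫⁻ x, ENNReal.ofReal (e 1 x) ∂μ ≠ ⊤) :
    Tendsto (fun n => ∫⁻ x, ENNReal.ofReal (d n x) ∂μ) atTop (𝓝 0) := by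
  have key : ∀ᵐ x ∂μ, ∀ n, d (n + 1) x ≤ (r x ^ 2) ^ n * (d 1 x + e 1 x) ∧
      e (n + 1) x ≤ (r x ^ 2) ^ n * (d 1 x + e 1 x) := by
    filter_upwards [ae_all_iff.2 h1, ae_all_iff.2 h2] with x h1 h2 n
    induction n with
    | zero => simp [hd0, he0]
    | succ n ih =>
      have hr2 : 0 ≤ r x ^ 2 := sq_nonneg _
      constructor
      · calc d (n + 1 + 1) x ≤ r x ^ 2 * e (n + 1) x := h1 n
          _ ≤ r x ^ 2 * ((r x ^ 2) ^ n * (d 1 x + e 1 x)) := mul_le_mul_of_nonneg_left ih.2 hr2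
          _ = _ := by ring
      · calc e (n + 1 + 1) x ≤ r x ^ 2 * d (n + 1) x := h2 n
          _ ≤ r x ^ 2 * ((r x ^ 2) ^ n * (d 1 x + e 1 x)) := mul_le_mul_of_nonneg_left ih.1 hr2
          _ = _ := by ring
  rw [← tendsto_add_atTop_iff_nat 1, ← lintegral_zero (μ := μ)]
  refine tendsto_lintegral_of_dominated_convergence' (fun x => ENNReal.ofReal (d 1 x + e 1 x))
    (fun n => hd (n + 1)) (fun n => ?_) ?_ ?_
  · filter_upwards [key] with x hx
    refine ENNReal.ofReal_le_ofReal ((hx n).1.trans ?_)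
    refine mul_le_of_le_one_left (add_nonneg (hd0 _ _) (he0 _ _)) (pow_le_one₀ (sq_nonneg _) ?_)
    exact pow_le_one₀ (hr0 x) (hr x).le
  · simp only [ENNReal.ofReal_add (hd0 _ _) (he0 _ _)]
    rw [lintegral_add_left' (hd 1)]
    exact ENNReal.add_ne_top.2 ⟨hf, hf'⟩
  · filter_upwards [key] with x hx
    rw [← ENNReal.ofReal_zero]
    refine (ENNReal.continuous_ofReal.tendsto 0).comp ?_
    have h3 : r x ^ 2 < 1 := pow_lt_one₀ (hr0 x) (hr x) two_ne_zero
    have h4 := (tendsto_pow_atTop_nhds_zero_of_lt_one (sq_nonneg _) h3).mul_const (d 1 x + e 1 x)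
    rw [zero_mul] at h4
    exact squeeze_zero (fun n => hd0 _ _) (fun n => (hx n).1) h4

/-- Two steps reduce the total energy by the fourth power of the largest factor. -/
lemma lintegral_le_of_alternating {R : ℝ}
    (h1 : ∀ n, ∀ᵐ x ∂μ, d (n + 2) x ≤ r x ^ 2 * e (n + 1) x)
    (h2 : ∀ n, ∀ᵐ x ∂μ, e (n + 2) x ≤ r x ^ 2 * d (n + 1) x)
    (hd0 : ∀ n x, 0 ≤ d n x) (hr0 : ∀ x, 0 ≤ r x) (hr : ∀ x, r x ≤ R) {n : ℕ} (hn : 1 ≤ n) :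
    ∫⁻ x, ENNReal.ofReal (d (n + 2) x) ∂μ
      ≤ ENNReal.ofReal (R ^ 2) ^ 2 * ∫⁻ x, ENNReal.ofReal (d n x) ∂μ := by
  obtain ⟨n, rfl⟩ : ∃ m, n = m + 1 := ⟨n - 1, by omega⟩
  rw [← lintegral_const_mul' _ _ (by finiteness)]
  refine lintegral_mono_ae ?_
  filter_upwards [h1 (n + 1), h2 n] with x h1 h2
  rw [← ENNReal.ofReal_pow (sq_nonneg _), ← ENNReal.ofReal_mul (by positivity)]
  refine ENNReal.ofReal_le_ofReal ?_
  have h3 : r x ^ 2 ≤ R ^ 2 := pow_le_pow_left₀ (hr0 x) (hr x) 2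
  calc d (n + 1 + 2) x ≤ r x ^ 2 * e (n + 2) x := h1
    _ ≤ r x ^ 2 * (r x ^ 2 * d (n + 1) x) := mul_le_mul_of_nonneg_left h2 (sq_nonneg _)
    _ = (r x ^ 2) ^ 2 * d (n + 1) x := by ring
    _ ≤ (R ^ 2) ^ 2 * d (n + 1) x :=
      mul_le_mul_of_nonneg_right (pow_le_pow_left₀ (sq_nonneg _) h3 2) (hd0 _ _)

end Energy

lemma Ω₁_eq (L : ℝ) : Ω₁ L = half L 1 := by ext; simp [Ω₁, half]

lemma Ω₂_eq : Ω₂ = half 0 (-1) := by ext; simp [Ω₂, half]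

section Step
variable {c : Params} {Ω : Set Space} {J g : L2Field univ} {u v : FieldPair} {a τ L : ℝ}

lemma Transmits.congr_left (hτ : τ = 1 ∨ τ = -1) {u' : FieldPair} (h : Transmits c a τ L u v)
    (hu : IsRegularPair a τ u) (h₁ : u.1 =ᵐ[volume.restrict (half a τ)] u'.1)
    (h₂ : u.2 =ᵐ[volume.restrict (half a τ)] u'.2) : Transmits c a τ L u' v := by
  have e : ∀ {F F' : Space → Vec}, IsRegular a τ F → F =ᵐ[volume.restrict (half a τ)] F' →
      traceVec a τ 0 F = traceVec a τ 0 F' := fun {F F'} hF he => by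
    funext k j
    rw [traceVec, traceVec, hatVec, hatVec, hat_congr hτ (hF.memLp_apply j) (F' := fun p => F' p j)]
    filter_upwards [he] with p hp
    rw [hp]
  unfold Transmits
  rw [← e hu.1 h₁, ← e hu.2 h₂]
  exact h

/-- The subdomain problem is well posed. -/
lemma existsUnique_solvesMaxwell (hc : c.Admissible) (hτ : τ = 1 ∨ τ = -1) (hL : 0 ≤ L)
    (hΩ : Ω = half a τ) (hv : IsRegularPair (a - τ * L) (-τ) v) :
    ∃! u : L2Pair Ω, SolvesMaxwell c u J g ∧ Transmits c a τ L (toPair u) v := by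
  subst hΩ
  obtain ⟨U, hU⟩ := exists_solvesMaxwell hc J g
  obtain ⟨u, hu, ht⟩ := exists_isSolution_transmits (a := a) hc hτ hL ((solvesMaxwell_iff U).1 hU) hv
  have e1 := hu.memLp₁.coeFn_toLp.symm
  have e2 := hu.memLp₂.coeFn_toLp.symm
  refine ⟨(hu.memLp₁.toLp _, hu.memLp₂.toLp _), ⟨(solvesMaxwell_iff _).2 (hu.congr e1 e2),
    ht.congr_left hτ (hu.isRegular hτ) e1 e2⟩, ?_⟩
  rintro w ⟨hw1, hw2⟩
  obtain ⟨e3, e4⟩ := ((solvesMaxwell_iff w).1 hw1).ae_eq_of_transmits hc hτ hL hu hv hw2 ht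
  exact Prod.ext (Lp.ext (e3.trans e1)) (Lp.ext (e4.trans e2))

lemma HasL2Curl.isRegular {u : L2Pair Ω} (hτ : τ = 1 ∨ τ = -1) (hΩ : Ω = half a τ)
    (h : HasL2Curl u) : IsRegularPair a τ (toPair u) := by
  subst hΩ
  obtain ⟨⟨C, hC⟩, ⟨D, hD⟩⟩ := h
  exact ⟨isRegular_of_hasWeakCurl hτ hC (Lp.memLp _) (Lp.memLp _),
    isRegular_of_hasWeakCurl hτ hD (Lp.memLp _) (Lp.memLp _)⟩

lemma SolvesMaxwell.hasL2Curl {u : L2Pair Ω} {J g : Space → Vec} (h : SolvesMaxwell c u J g) :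
    HasL2Curl u := by
  obtain ⟨C, D, h1, h2, -⟩ := h
  exact ⟨⟨C, h1⟩, ⟨D, h2⟩⟩

lemma tracesAgree_Ω₁_iff (hL : 0 ≤ L) {u : L2Pair (Ω₁ L)} {v : L2Pair Ω₂} (hu : HasL2Curl u)
    (hv : HasL2Curl v) : TracesAgree L (impedanceField c n₁ u) (impedanceField c n₁ v) ↔
      Transmits c L 1 L (toPair u) (toPair v) := by
  have h1 : IsRegularPair L 1 (toPair u) := hu.isRegular (Or.inl rfl) (Ω₁_eq L)
  have h2 : IsRegularPair (L - L) (-1) (toPair v) := by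
    rw [sub_self]
    exact hv.isRegular (Or.inr rfl) Ω₂_eq
  have h := transmits_one_iff (c := c) hL h1 h2
  simp only [toPair] at h
  exact h

lemma tracesAgree_Ω₂_iff (hL : 0 ≤ L) {u : L2Pair (Ω₁ L)} {v : L2Pair Ω₂} (hu : HasL2Curl u)
    (hv : HasL2Curl v) : TracesAgree 0 (impedanceField c n₂ u) (impedanceField c n₂ v) ↔
      Transmits c 0 (-1) L (toPair v) (toPair u) := by
  have h1 : IsRegularPair 0 (-1) (toPair v) := hv.isRegular (Or.inr rfl) Ω₂_eq
  have h2 : IsRegularPair (0 + L) 1 (toPair u) := by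
    rw [zero_add]
    exact hu.isRegular (Or.inl rfl) (Ω₁_eq L)
  have h := transmits_neg_one_iff (c := c) hL h1 h2
  simp only [toPair] at h
  exact h

/-- The algorithm is well defined: a guess with square integrable curls has impedance traces, and so
has each iterate. -/
lemma existsUnique_iteration (hc : c.Admissible) (hL : 0 ≤ L) {a₁ : L2Pair (Ω₁ L)} {a₂ : L2Pair Ω₂}
    (h₁ : HasL2Curl a₁) (h₂ : HasL2Curl a₂) :
    ∃! u : (ℕ → L2Pair (Ω₁ L)) × (ℕ → L2Pair Ω₂),
      u.1 0 = a₁ ∧ u.2 0 = a₂ ∧ IsSchwarzIteration c L J g u.1 u.2 := by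
  have hR : ∀ v : L2Pair Ω₂, HasL2Curl v → ∃! u : L2Pair (Ω₁ L), SolvesMaxwell c u J g ∧
      TracesAgree L (impedanceField c n₁ u) (impedanceField c n₁ v) := fun v hv => by
    refine (existsUnique_congr fun u => ?_).1 (existsUnique_solvesMaxwell (J := J) (g := g) hc
      (Or.inl rfl) hL (Ω₁_eq L) (v := toPair v)
      (by rw [one_mul, sub_self]; exact hv.isRegular (Or.inr rfl) Ω₂_eq))
    exact and_congr_right fun h => (tracesAgree_Ω₁_iff hL h.hasL2Curl hv).symm
  have hS : ∀ u : L2Pair (Ω₁ L), HasL2Curl u → ∃! v : L2Pair Ω₂, SolvesMaxwell c v J g ∧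
      TracesAgree 0 (impedanceField c n₂ u) (impedanceField c n₂ v) := fun u hu => by
    refine (existsUnique_congr fun v => ?_).1 (existsUnique_solvesMaxwell (J := J) (g := g) hc
      (Or.inr rfl) hL Ω₂_eq (v := toPair u)
      (by simp only [neg_neg, neg_mul, one_mul, sub_neg_eq_add, zero_add]
          exact hu.isRegular (Or.inl rfl) (Ω₁_eq L)))
    exact and_congr_right fun h => (tracesAgree_Ω₂_iff hL hu h.hasL2Curl).symm
  refine (existsUnique_congr fun u => ?_).1 (existsUnique_alternating hR hS
    (fun _ _ h => h.1.hasL2Curl) (fun _ _ h => h.1.hasL2Curl) h₁ h₂)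
  refine and_congr_right fun _ => and_congr_right fun _ => ⟨fun h => ?_, fun h n => ?_⟩
  · exact ⟨fun n => (h n).1.1, fun n => (h n).1.2, fun n => (h n).2.1, fun n => (h n).2.2⟩
  · exact ⟨⟨h.solves₁ n, h.trans₁ n⟩, ⟨h.solves₂ n, h.trans₂ n⟩⟩

lemma l2Error_eq (hτ : τ = 1 ∨ τ = -1) (hΩ : Ω = half a τ) (u : L2Pair Ω) (U : L2Pair univ) :
    l2Error u U
      = (∫⁻ k, ENNReal.ofReal (hatEnergy a τ (toPair u - toPair U) k)) ^ (1 / 2 : ℝ) := by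
  subst hΩ
  rw [← lintegral_hatEnergy hτ ((Lp.memLp u.1).sub (memLp_restrict U.1 _))
    ((Lp.memLp u.2).sub (memLp_restrict U.2 _))]
  rfl

lemma lintegral_hatEnergy_ne_top (hτ : τ = 1 ∨ τ = -1) (h₁ : MemLp u.1 2 (volume.restrict (half a τ)))
    (h₂ : MemLp u.2 2 (volume.restrict (half a τ))) :
    ∫⁻ k, ENNReal.ofReal (hatEnergy a τ u k) ≠ ⊤ := by
  rw [← lintegral_hatEnergy hτ h₁ h₂]
  exact ENNReal.add_ne_top.2 ⟨ENNReal.pow_ne_top h₁.2.ne, ENNReal.pow_ne_top h₂.2.ne⟩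

/-- The errors are homogeneous solutions that satisfy the transmission conditions of the algorithm, so
the energies of their frequencies decrease alternately. The initial guess need not solve the system;
the estimates start with the first iterates. -/
lemma IsSchwarzIteration.tendsto (hc : c.Admissible) (hL : 0 ≤ L) {U : L2Pair univ}
    (hU : SolvesMaxwell c U J g) {u₁ : ℕ → L2Pair (Ω₁ L)} {u₂ : ℕ → L2Pair Ω₂}
    (h : IsSchwarzIteration c L J g u₁ u₂) :
    Tendsto (fun n => l2Error (u₁ n) U) atTop (𝓝 0) ∧
    Tendsto (fun n => l2Error (u₂ n) U) atTop (𝓝 0) ∧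
    ∀ n, 1 ≤ n →
      l2Error (u₁ (n + 2)) U ≤ ENNReal.ofReal (Rcla c L ^ 2) * l2Error (u₁ n) U ∧
      l2Error (u₂ (n + 2)) U ≤ ENNReal.ofReal (Rcla c L ^ 2) * l2Error (u₂ n) U := by
  have hV := (solvesMaxwell_iff U).1 hU
  have s1 : ∀ n, IsSolution c (half L 1) J g (toPair (u₁ (n + 1))) := fun n =>
    ((solvesMaxwell_iff _).1 (h.solves₁ n)).mono (Ω₁_eq L).ge
  have s2 : ∀ n, IsSolution c (half 0 (-1)) J g (toPair (u₂ (n + 1))) := fun n =>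
    ((solvesMaxwell_iff _).1 (h.solves₂ n)).mono Ω₂_eq.ge
  have V1 := hV.mono (subset_univ (half L 1))
  have V2 := hV.mono (subset_univ (half 0 (-1)))
  set d : ℕ → Plane → ℝ := fun n => hatEnergy L 1 (toPair (u₁ n) - toPair U) with hd
  set e : ℕ → Plane → ℝ := fun n => hatEnergy 0 (-1) (toPair (u₂ n) - toPair U) with he
  have t1 : ∀ n, ∀ᵐ k, d (n + 2) k ≤ reflection c.p (c.decay k) L ^ 2 * e (n + 1) k := fun n => by
    have ht := (tracesAgree_Ω₁_iff hL (h.solves₁ (n + 1)).hasL2Curl (h.solves₂ n).hasL2Curl).1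
      (h.trans₁ (n + 1))
    have ho : L - 1 * L = 0 := by ring
    have hs := ht.sub (Or.inl rfl) hL (hV.transmits (Or.inl rfl) hL L)
      ((s1 (n + 1)).isRegular (Or.inl rfl)) (V1.isRegular (Or.inl rfl))
      (by rw [ho]; exact (s2 n).isRegular (Or.inr rfl)) (by rw [ho]; exact V2.isRegular (Or.inr rfl))
    have := hatEnergy_le hc (Or.inl rfl) hL ((s1 (n + 1)).sub V1) (by rw [ho]; exact (s2 n).sub V2) hs
    rwa [ho] at this
  have t2 : ∀ n, ∀ᵐ k, e (n + 2) k ≤ reflection c.p (c.decay k) L ^ 2 * d (n + 1) k := fun n => by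
    have ht := (tracesAgree_Ω₂_iff hL (h.solves₁ n).hasL2Curl (h.solves₂ (n + 1)).hasL2Curl).1
      (h.trans₂ (n + 1))
    have ho : (0 : ℝ) - -1 * L = L := by ring
    have ho' : -(-1 : ℝ) = 1 := by ring
    have hs := ht.sub (Or.inr rfl) hL (hV.transmits (Or.inr rfl) hL 0)
      ((s2 (n + 1)).isRegular (Or.inr rfl)) (V2.isRegular (Or.inr rfl))
      (by rw [ho, ho']; exact (s1 n).isRegular (Or.inl rfl))
      (by rw [ho, ho']; exact V1.isRegular (Or.inl rfl))
    have := hatEnergy_le hc (Or.inr rfl) hL ((s2 (n + 1)).sub V2)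
      (by rw [ho, ho']; exact (s1 n).sub V1) hs
    rwa [ho, ho'] at this
  have r0 := fun k => reflection_nonneg hc.p_pos (p_le_decay hc k) L
  have r1 := fun k => reflection_lt_one hc.p_pos (p_le_decay hc k) hL
  have rR := fun k => reflection_le_Rcla hc.hε hc.hμ hc.hη hL (p_le_decay hc k)
  have d0 : ∀ n k, 0 ≤ d n k := fun n k => hatEnergy_nonneg k
  have e0 : ∀ n k, 0 ≤ e n k := fun n k => hatEnergy_nonneg k
  have fd := lintegral_hatEnergy_ne_top (Or.inl rfl) ((s1 0).sub V1).memLp₁ ((s1 0).sub V1).memLp₂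
  have fe := lintegral_hatEnergy_ne_top (Or.inr rfl) ((s2 0).sub V2).memLp₁ ((s2 0).sub V2).memLp₂
  simp only [fun n => l2Error_eq (Or.inl rfl) (Ω₁_eq L) (u₁ n) U,
    fun n => l2Error_eq (Or.inr rfl) Ω₂_eq (u₂ n) U]
  have root : ∀ {s : ℕ → ENNReal}, Tendsto s atTop (𝓝 0) →
      Tendsto (fun n => s n ^ (1 / 2 : ℝ)) atTop (𝓝 0) := fun {s} hs => by
    have := (ENNReal.continuous_rpow_const (y := (1 / 2 : ℝ))).continuousAt.tendsto.comp hs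
    rwa [ENNReal.zero_rpow_of_pos (by norm_num)] at this
  have root' : ∀ {x y z : ENNReal}, x ≤ z ^ 2 * y → x ^ (1 / 2 : ℝ) ≤ z * y ^ (1 / 2 : ℝ) :=
    fun {x y z} hx => by
      refine (ENNReal.rpow_le_rpow hx (by norm_num)).trans_eq ?_
      rw [ENNReal.mul_rpow_of_nonneg _ _ (by norm_num), ← ENNReal.rpow_natCast, ← ENNReal.rpow_mul]
      norm_num
  refine ⟨root ?_, root ?_, fun n hn => ⟨root' ?_, root' ?_⟩⟩
  · exact tendsto_lintegral_of_alternating (fun n => aemeasurable_hatEnergy) d0 e0 t1 t2 r0 r1 fd fe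
  · exact tendsto_lintegral_of_alternating (fun n => aemeasurable_hatEnergy) e0 d0 t2 t1 r0 r1 fe fd
  · exact lintegral_le_of_alternating t1 t2 d0 r0 rR hn
  · exact lintegral_le_of_alternating t2 t1 e0 r0 rR hn

end Step

/-! ### Plane waves -/

/-- The open half-line of the points `x` in front of `a`, for the outward normal `τ`. -/
def ray (a τ : ℝ) : Set ℝ := {x | 0 < τ * (a - x)}

lemma ray_one (a : ℝ) : ray a 1 = Iio a := by ext; simp [ray]

lemma ray_neg_one (a : ℝ) : ray a (-1) = Ioi a := by ext; simp [ray]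

section Ray
variable {a τ : ℝ}

lemma isOpen_ray : IsOpen (ray a τ) := isOpen_lt continuous_const (by fun_prop)

lemma closure_ray (hτ : τ = 1 ∨ τ = -1) : closure (ray a τ) = {x | 0 ≤ τ * (a - x)} := by
  rcases hτ with rfl | rfl
  · rw [ray_one, closure_Iio]; ext; simp
  · rw [ray_neg_one, closure_Ioi]; ext; simp

lemma measurePreserving_ray (hτ : τ = 1 ∨ τ = -1) :
    MeasurePreserving (fun t : ℝ => a - τ * t) (volume.restrict (Ioi 0)) (volume.restrict (ray a τ)) := by
  have h1 : MeasurePreserving (fun t : ℝ => a - τ * t) volume volume := by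
    rcases hτ with rfl | rfl
    · simpa using Measure.measurePreserving_sub_left (volume : Measure ℝ) a
    · simpa using measurePreserving_add_left (volume : Measure ℝ) a
  have h3 := h1.restrict_preimage (isOpen_ray (a := a) (τ := τ)).measurableSet
  have h4 : (fun t : ℝ => a - τ * t) ⁻¹' ray a τ = Ioi 0 := by
    ext t
    have : τ * (τ * t) = t := by linear_combination t * sign_mul_self hτ
    simp [ray, this]
  rwa [h4] at h3

lemma measurePreserving_ray_symm (hτ : τ = 1 ∨ τ = -1) :
    MeasurePreserving (fun x : ℝ => τ * (a - x)) (volume.restrict (ray a τ)) (volume.restrict (Ioi 0)) := by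
  have h1 : MeasurePreserving (fun x : ℝ => τ * (a - x)) volume volume := by
    rcases hτ with rfl | rfl
    · simpa using Measure.measurePreserving_sub_left (volume : Measure ℝ) a
    · simpa using measurePreserving_sub_right (volume : Measure ℝ) a
  exact h1.restrict_preimage measurableSet_Ioi

end Ray

section PlaneWave
variable {k : EuclideanSpace ℝ (Fin 2)} {F : ℝ → Vec} {d : Vec} {p : Space}

lemma hasDerivAt_vec {F : ℝ → Vec} {d : Vec} {x : ℝ} :
    HasDerivAt F d x ↔ ∀ j, HasDerivAt (fun x => F x j) (d j) x := by
  let e := PiLp.continuousLinearEquiv 2 ℝ fun _ : Fin 3 => ℂ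
  constructor
  · intro h
    exact hasDerivAt_pi.1 (e.toContinuousLinearMap.hasFDerivAt.comp_hasDerivAt x h)
  · intro h
    exact e.symm.toContinuousLinearMap.hasFDerivAt.comp_hasDerivAt x
      (hasDerivAt_pi (φ := fun x j => F x j).2 h)

lemma pd_planeWave (hF : HasDerivAt F d p.1) (i : Fin 3) :
    pd 0 i (planeWave k F) p = Complex.exp (Complex.I * (inner ℝ k p.2 : ℝ)) * d i ∧
    pd 1 i (planeWave k F) p
      = Complex.exp (Complex.I * (inner ℝ k p.2 : ℝ)) * (Complex.I * k 0 * F p.1 i) ∧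
    pd 2 i (planeWave k F) p
      = Complex.exp (Complex.I * (inner ℝ k p.2 : ℝ)) * (Complex.I * k 1 * F p.1 i) := by
  let ℓ : Space →L[ℝ] ℂ := Complex.I • (Complex.ofRealCLM.comp
    ((innerSL ℝ k).comp (ContinuousLinearMap.snd ℝ ℝ (EuclideanSpace ℝ (Fin 2)))))
  have hℓ : ∀ q : Space, ℓ q = Complex.I * (inner ℝ k q.2 : ℝ) := fun q => rfl
  have h1 : HasFDerivAt (fun q : Space => Complex.exp (ℓ q)) (Complex.exp (ℓ p) • ℓ) p :=
    ℓ.hasFDerivAt.cexp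
  have h2 := ((hasDerivAt_vec.1 hF i).hasFDerivAt).comp p
    (hasFDerivAt_fst (𝕜 := ℝ) (E := ℝ) (F := EuclideanSpace ℝ (Fin 2)) (p := p))
  have h3 := h1.mul h2
  have h4 : (fun q => planeWave k F q i)
      = (fun q : Space => Complex.exp (ℓ q)) * (fun x => F x i) ∘ Prod.fst := by
    funext q
    simp [planeWave, hℓ]
  have hk : ∀ i : Fin 2, inner ℝ k (EuclideanSpace.single i (1 : ℝ)) = k i := fun i => by
    rw [EuclideanSpace.inner_single_right]; simp
  refine ⟨?_, ?_, ?_⟩ <;> rw [pd, h4, show fderiv ℝ _ p = _ from h3.fderiv]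
  · simp [dir, hℓ]
  · simp [dir, hℓ, hk]; ring
  · simp [dir, hℓ, hk]; ring

lemma curl_planeWave (hF : HasDerivAt F d p.1) :
    curl (planeWave k F) p = Complex.exp (Complex.I * (inner ℝ k p.2 : ℝ)) •
      (!₂[Complex.I * k 0 * F p.1 2 - Complex.I * k 1 * F p.1 1,
        Complex.I * k 1 * F p.1 0 - d 2, d 1 - Complex.I * k 0 * F p.1 0] : Vec) := by
  ext j
  fin_cases j <;> simp [curl, pd_planeWave hF] <;> ring

/-- The curl equation for plane waves is a system of ordinary differential equations. -/
lemma curl_planeWave_eq_iff (hF : HasDerivAt F d p.1) (C : ℝ → Vec) :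
    curl (planeWave k F) p = planeWave k C p ↔
      C p.1 0 = Complex.I * k 0 * F p.1 2 - Complex.I * k 1 * F p.1 1 ∧
      d 1 = C p.1 2 + Complex.I * k 0 * F p.1 0 ∧ d 2 = -C p.1 1 + Complex.I * k 1 * F p.1 0 := by
  rw [curl_planeWave hF, planeWave, smul_right_inj (Complex.exp_ne_zero _)]
  constructor
  · intro h
    have h0 := congrArg (fun v : Vec => v 0) h
    have h1 := congrArg (fun v : Vec => v 1) h
    have h2 := congrArg (fun v : Vec => v 2) h
    simp at h0 h1 h2
    exact ⟨h0.symm, by linear_combination h2, by linear_combination -h1⟩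
  · rintro ⟨h0, h1, h2⟩
    ext j
    fin_cases j
    · simp [h0]
    · simp [h2]
    · simp [h1]

end PlaneWave

/-- The field with components `f j e^{-λ t}`, where `t` is the distance to the point `a`. -/
def modeField (a τ lam : ℝ) (f : Fin 3 → ℂ) (x : ℝ) : Vec :=
  WithLp.toLp 2 fun j => f j * Real.exp (-(lam * (τ * (a - x))))

section Modes
variable {c : Params} {a τ lam : ℝ} {k : EuclideanSpace ℝ (Fin 2)}

lemma hasDerivAt_modeField (a τ lam : ℝ) (f : Fin 3 → ℂ) (x : ℝ) :
    HasDerivAt (modeField a τ lam f) ((lam * τ : ℂ) • modeField a τ lam f x) x := by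
  refine hasDerivAt_vec.2 fun j => ?_
  have h1 : HasDerivAt (fun x : ℝ => Real.exp (-(lam * (τ * (a - x)))))
      (Real.exp (-(lam * (τ * (a - x)))) * (lam * τ)) x := by
    exact HasDerivAt.exp
      (((((hasDerivAt_id x).const_sub a).const_mul τ).const_mul lam).neg.congr_deriv (by ring))
  have h2 := h1.ofReal_comp.const_mul (f j)
  refine h2.congr_deriv ?_
  simp only [modeField, PiLp.smul_apply, smul_eq_mul]
  push_cast
  ring

lemma memLp_modeField (hτ : τ = 1 ∨ τ = -1) (hl : 0 < lam) (f : Fin 3 → ℂ) :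
    MemLp (modeField a τ lam f) 2 (volume.restrict (ray a τ)) :=
  memLp_piLp_iff.2 fun j =>
    ((memLp_exp hl).comp_measurePreserving (measurePreserving_ray_symm hτ)).const_mul (f j)

lemma planeWave_smul (r : ℂ) (F : ℝ → Vec) (p : Space) :
    planeWave k (fun x => r • F x) p = r • planeWave k F p := by
  simp only [planeWave]
  rw [smul_comm]

lemma eq_E_iff (c : Params) (A B : Vec) :
    -((Real.sqrt c.η * c.ε) • A) + B - c.σ • A = 0 ↔ B = (c.α : ℂ) • A := by
  have : (c.α : ℂ) • A = (Real.sqrt c.η * c.ε) • A + c.σ • A := by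
    rw [← add_smul]; exact Complex.coe_smul _ _
  rw [this]
  constructor <;> intro h
  · rw [← sub_eq_zero, ← h]; abel
  · rw [h]; abel

lemma eq_H_iff (c : Params) (A B : Vec) :
    (Real.sqrt c.η * c.μ) • A + B = 0 ↔ B = (-c.β : ℂ) • A := by
  have : (c.β : ℂ) • A = (Real.sqrt c.η * c.μ) • A := Complex.coe_smul _ _
  rw [neg_smul, this, add_comm, eq_neg_iff_add_eq_zero]

/-- The decaying exponential modes are modes in the sense of the algorithm. -/
lemma isMode_modeField (hc : c.Admissible) (hτ : τ = 1 ∨ τ = -1) (hl : 0 < lam)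
    (hlam : lam ^ 2 = k 0 ^ 2 + k 1 ^ 2 + c.α * c.β) (e₁ e₂ : ℂ) :
    IsMode c k (ray a τ) (modeField a τ lam (modeE τ lam (k 0) (k 1) e₁ e₂),
      modeField a τ lam (modeH c.β τ lam (k 0) (k 1) e₁ e₂)) := by
  have hd := hasDerivAt_modeField a τ lam
  have hτ' : (τ : ℂ) * τ = 1 := by exact_mod_cast sign_mul_self hτ
  obtain ⟨r1, r2, r0⟩ := modeE_relations (τ := τ) (y := k 0) (z := k 1) hc.β_pos.ne' hl.ne'
    (sign_mul_self hτ) e₁ e₂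
  obtain ⟨s1, s2, s0⟩ := modeH_relations (τ := τ) hc.β_pos.ne' hl.ne' (sign_mul_self hτ) hlam e₁ e₂
  refine ⟨memLp_modeField hτ hl _, memLp_modeField hτ hl _,
    fun x _ => (hd _ x).continuousAt.continuousWithinAt,
    fun x _ => (hd _ x).continuousAt.continuousWithinAt,
    fun x _ => (hd _ x).differentiableAt.differentiableWithinAt,
    fun x _ => (hd _ x).differentiableAt.differentiableWithinAt, fun p _ => ?_, fun p _ => ?_⟩
  · rw [eq_E_iff, ← planeWave_smul, curl_planeWave_eq_iff (hd _ p.1)]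
    simp only [modeField, PiLp.smul_apply, smul_eq_mul]
    set x : ℂ := ((Real.exp (-(lam * (τ * (a - p.1)))) : ℝ) : ℂ)
    refine ⟨by linear_combination x * s0, ?_, ?_⟩
    · linear_combination x * τ * s1 + x * (c.α * modeE τ lam (k 0) (k 1) e₁ e₂ 2
        + Complex.I * k 0 * modeH c.β τ lam (k 0) (k 1) e₁ e₂ 0) * hτ'
    · linear_combination x * τ * s2 + x * (-(c.α * modeE τ lam (k 0) (k 1) e₁ e₂ 1)
        + Complex.I * k 1 * modeH c.β τ lam (k 0) (k 1) e₁ e₂ 0) * hτ'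
  · rw [eq_H_iff, ← planeWave_smul, curl_planeWave_eq_iff (hd _ p.1)]
    simp only [modeField, PiLp.smul_apply, smul_eq_mul]
    set x : ℂ := ((Real.exp (-(lam * (τ * (a - p.1)))) : ℝ) : ℂ)
    refine ⟨by linear_combination x * r0, ?_, ?_⟩
    · linear_combination x * τ * r1 + x * (-c.β * modeH c.β τ lam (k 0) (k 1) e₁ e₂ 2
        + Complex.I * k 0 * modeE τ lam (k 0) (k 1) e₁ e₂ 0) * hτ'
    · linear_combination x * τ * r2 + x * (-(-c.β * modeH c.β τ lam (k 0) (k 1) e₁ e₂ 1)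
        + Complex.I * k 1 * modeE τ lam (k 0) (k 1) e₁ e₂ 0) * hτ'

/-- The profile of a component in the distance to `a`. -/
lemma memLp_profile (hτ : τ = 1 ∨ τ = -1) {F : ℝ → Vec} (hF : MemLp F 2 (volume.restrict (ray a τ)))
    (j : Fin 3) : MemLp (fun t : ℝ => F (a - τ * t) j) 2 (volume.restrict (Ioi 0)) :=
  (memLp_piLp_iff.1 hF j).comp_measurePreserving (measurePreserving_ray hτ)

/-- The relations of a plane wave in terms of its profiles. -/
lemma profile_relations (hτ : τ = 1 ∨ τ = -1) {F G : ℝ → Vec} (r : ℂ)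
    (hF : MemLp F 2 (volume.restrict (ray a τ))) (hG : MemLp G 2 (volume.restrict (ray a τ)))
    (hFd : DifferentiableOn ℝ F (ray a τ))
    (h : ∀ p : Space, p.1 ∈ ray a τ → curl (planeWave k F) p = r • planeWave k G p) :
    let f : Fin 3 → Profile := fun j => (memLp_profile hτ hF j).toLp _
    let g : Fin 3 → Profile := fun j => (memLp_profile hτ hG j).toLp _
    (f 1, -(τ : ℂ) • (r • g 2 + (Complex.I * k 0) • f 0)) ∈ weakDerivGraph ∧
    (f 2, -(τ : ℂ) • (-(r • g 1) + (Complex.I * k 1) • f 0)) ∈ weakDerivGraph ∧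
    r • g 0 = (Complex.I * k 0) • f 2 - (Complex.I * k 1) • f 1 := by
  intro f g
  have hmem : ∀ t : ℝ, 0 < t → a - τ * t ∈ ray a τ := fun t ht => by
    have : τ * (τ * t) = t := by linear_combination t * sign_mul_self hτ
    simpa [ray, this] using ht
  have hd : ∀ t : ℝ, 0 < t → HasDerivAt F (deriv F (a - τ * t)) (a - τ * t) := fun t ht =>
    ((hFd _ (hmem t ht)).differentiableAt (isOpen_ray.mem_nhds (hmem t ht))).hasDerivAt
  have hrel := fun (t : ℝ) (ht : 0 < t) => by
    have := h (a - τ * t, 0) (hmem t ht)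
    rw [← planeWave_smul] at this
    exact (curl_planeWave_eq_iff (p := (a - τ * t, 0)) (hd t ht) (fun x => r • G x)).1 this
  have hcomp : ∀ (j : Fin 3) (t : ℝ), 0 < t →
      HasDerivAt (fun t : ℝ => F (a - τ * t) j) (-τ * deriv F (a - τ * t) j) t := fun j t ht => by
    have h1 : HasDerivAt (fun t : ℝ => a - τ * t) (-τ) t := by
      simpa using ((hasDerivAt_id t).const_mul τ).const_sub a
    have e : (-τ : ℂ) * deriv F (a - τ * t) j = (-τ : ℝ) • deriv F (a - τ * t) j := by simp
    rw [e]
    exact (hasDerivAt_vec.1 (hd t ht) j).scomp t h1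
  have hf : ∀ j, f j =ᵐ[volume.restrict (Ioi 0)] fun t => F (a - τ * t) j := fun j =>
    (memLp_profile hτ hF j).coeFn_toLp
  have hg : ∀ j, g j =ᵐ[volume.restrict (Ioi 0)] fun t => G (a - τ * t) j := fun j =>
    (memLp_profile hτ hG j).coeFn_toLp
  have key : ∀ (j : Fin 3) (h : Profile),
      (h =ᵐ[volume.restrict (Ioi (0 : ℝ))] fun t => -τ * deriv F (a - τ * t) j) →
      (f j, h) ∈ weakDerivGraph := fun j h hh =>
    mem_weakDerivGraph.2 <| (isWeakDeriv_of_hasDerivAt (hcomp j) ((Lp.memLp h).ae_eq hh)).congr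
      (hf j).symm hh.symm
  have hpos : ∀ᵐ t ∂(volume.restrict (Ioi (0 : ℝ))), t ∈ Ioi (0 : ℝ) :=
    ae_restrict_mem measurableSet_Ioi
  refine ⟨key 1 _ ?_, key 2 _ ?_, Lp.ext ?_⟩
  · filter_upwards [hpos, hf 0, hg 2, Lp.coeFn_smul (-(τ : ℂ)) (r • g 2 + (Complex.I * k 0) • f 0),
      Lp.coeFn_add (r • g 2) ((Complex.I * k 0 : ℂ) • f 0), Lp.coeFn_smul r (g 2),
      Lp.coeFn_smul (Complex.I * k 0 : ℂ) (f 0)] with t ht h1 h2 h3 h4 h5 h6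
    rw [h3, Pi.smul_apply, h4, Pi.add_apply, h5, h6, Pi.smul_apply, Pi.smul_apply, h1, h2,
      (hrel t ht).2.1]
    simp
  · filter_upwards [hpos, hf 0, hg 1, Lp.coeFn_smul (-(τ : ℂ)) (-(r • g 1) + (Complex.I * k 1) • f 0),
      Lp.coeFn_add (-(r • g 1)) ((Complex.I * k 1 : ℂ) • f 0), Lp.coeFn_smul r (g 1),
      Lp.coeFn_smul (Complex.I * k 1 : ℂ) (f 0), Lp.coeFn_neg (r • g 1)] with t ht h1 h2 h3 h4 h5 h6 h7
    rw [h3, Pi.smul_apply, h4, Pi.add_apply, h7, Pi.neg_apply, h5, h6, Pi.smul_apply, Pi.smul_apply,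
      h1, h2, (hrel t ht).2.2]
    simp
  · filter_upwards [hpos, hf 1, hf 2, hg 0, Lp.coeFn_smul r (g 0),
      Lp.coeFn_sub ((Complex.I * k 0 : ℂ) • f 2) ((Complex.I * k 1 : ℂ) • f 1),
      Lp.coeFn_smul (Complex.I * k 0 : ℂ) (f 2),
      Lp.coeFn_smul (Complex.I * k 1 : ℂ) (f 1)] with t ht h1 h2 h3 h4 h5 h6 h7
    rw [h4, h5, Pi.sub_apply, h6, h7, Pi.smul_apply, Pi.smul_apply, Pi.smul_apply, h1, h2, h3]
    simpa using (hrel t ht).1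

/-- All modes are decaying exponential modes. -/
lemma IsMode.exists_eq_modeField (hc : c.Admissible) (hτ : τ = 1 ∨ τ = -1) (hl : 0 < lam)
    (hlam : lam ^ 2 = k 0 ^ 2 + k 1 ^ 2 + c.α * c.β) {u : (ℝ → Vec) × (ℝ → Vec)}
    (h : IsMode c k (ray a τ) u) : ∃ e₁ e₂ : ℂ, ∀ x, 0 ≤ τ * (a - x) →
      u.1 x = modeField a τ lam (modeE τ lam (k 0) (k 1) e₁ e₂) x ∧
      u.2 x = modeField a τ lam (modeH c.β τ lam (k 0) (k 1) e₁ e₂) x := by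
  obtain ⟨hE1, hE2, hE0⟩ := profile_relations (k := k) hτ (-c.β : ℂ) h.memLp_E h.memLp_H
    h.differentiableOn_E fun p hp => (eq_H_iff _ _ _).1 (h.eq_H p hp)
  obtain ⟨hH1, hH2, hH0⟩ := profile_relations (k := k) hτ (c.α : ℂ) h.memLp_H h.memLp_E
    h.differentiableOn_H fun p hp => (eq_E_iff _ _ _).1 (h.eq_E p hp)
  obtain ⟨e₁, e₂, hE, hH⟩ := exists_mode hc.α_pos hc.β_pos hl (sign_mul_self hτ) hlam
    (E := fun j => (memLp_profile hτ h.memLp_E j).toLp _)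
    (H := fun j => (memLp_profile hτ h.memLp_H j).toLp _) hE1 hE2 hE0 hH1 hH2 hH0
  have key : ∀ {F : ℝ → Vec} (hF : MemLp F 2 (volume.restrict (ray a τ))) (f : Fin 3 → ℂ),
      ContinuousOn F (closure (ray a τ)) →
      (∀ j, (memLp_profile hτ hF j).toLp _ = f j • expProfile lam) →
      ∀ x, 0 ≤ τ * (a - x) → F x = modeField a τ lam f x := fun {F} hF f hc he x hx => by
    have hmem : ∀ t ∈ Ici (0 : ℝ), a - τ * t ∈ closure (ray a τ) := fun t ht => by
      have : τ * (τ * t) = t := by linear_combination t * sign_mul_self hτ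
      rw [closure_ray hτ]
      simpa [this] using ht
    have hcont : ContinuousOn (fun t : ℝ => F (a - τ * t)) (Ici 0) :=
      hc.comp (by fun_prop) hmem
    ext j
    have hcj : ContinuousOn (fun t : ℝ => F (a - τ * t) j) (Ici 0) :=
      (EuclideanSpace.proj (𝕜 := ℂ) j).continuous.comp_continuousOn hcont
    have hej : Continuous fun t : ℝ => f j * ((Real.exp (-(lam * t)) : ℝ) : ℂ) :=
      continuous_const.mul (Complex.continuous_ofReal.comp (by fun_prop))
    have hae : (fun t : ℝ => F (a - τ * t) j) =ᵐ[volume.restrict (Ioi 0)]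
        fun t => f j * ((Real.exp (-(lam * t)) : ℝ) : ℂ) := by
      have h1 := (memLp_profile hτ hF j).coeFn_toLp
      rw [he j] at h1
      filter_upwards [h1, Lp.coeFn_smul (f j) (expProfile lam), expProfile_ae hl] with t h1 h2 h3
      rw [← h1, h2, Pi.smul_apply, h3, smul_eq_mul]
    have h0 := (Measure.eqOn_open_of_ae_eq hae isOpen_Ioi (hcj.mono Ioi_subset_Ici_self)
      hej.continuousOn).of_subset_closure hcj hej.continuousOn Ioi_subset_Ici_self
      (by rw [closure_Ioi])
    have := h0 (show τ * (a - x) ∈ Ici (0 : ℝ) from hx)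
    have hx' : a - τ * (τ * (a - x)) = x := by linear_combination (x - a) * sign_mul_self hτ
    simp only [hx'] at this
    exact this
  exact ⟨e₁, e₂, fun x hx => ⟨key h.memLp_E _ h.continuousOn_E hE x hx,
    key h.memLp_H _ h.continuousOn_H hH x hx⟩⟩

end Modes

/-! ### The convergence factor of a mode -/

section Eigenvalues
variable {c : Params} {a τ lam L y z β : ℝ} {k : EuclideanSpace ℝ (Fin 2)}

lemma impedance_modeField (c : Params) {s : ℝ} (hs : s * s = 1) (a τ lam : ℝ) (f h : Fin 3 → ℂ)
    (x : ℝ) (j : Fin 3) :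
    impedance c (normal s) (modeField a τ lam f x) (modeField a τ lam h x) j
      = Real.exp (-(lam * (τ * (a - x)))) * impedanceComp c.Z s f h j := by
  rw [impedance_normal c hs]
  exact impedanceComp_smul c.Z s _ f h j

lemma mode_smul (r e₁ e₂ : ℂ) (j : Fin 3) :
    modeE τ lam y z (r * e₁) (r * e₂) j = r * modeE τ lam y z e₁ e₂ j ∧
    modeH β τ lam y z (r * e₁) (r * e₂) j = r * modeH β τ lam y z e₁ e₂ j := by
  constructor <;> fin_cases j <;> simp only [modeE, modeH, Fin.zero_eta, Fin.mk_one,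
    Fin.reduceFinMk, Matrix.cons_val] <;> ring

lemma modeField_of_eq_smul {f g : Fin 3 → ℂ} {r : ℂ} (h : ∀ j, g j = r * f j) (x : ℝ) :
    modeField a τ lam g x = r • modeField a τ lam f x := by
  ext j
  simp [modeField, h, mul_assoc]

lemma eq_smul_of_modeField {f g : Fin 3 → ℂ} {r : ℂ} {x : ℝ}
    (h : modeField a τ lam g x = r • modeField a τ lam f x) (j : Fin 3) : g j = r * f j := by
  have h1 := congrArg (fun v : Vec => v j) h
  simp only [modeField, PiLp.smul_apply, smul_eq_mul, ← mul_assoc] at h1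
  exact mul_right_cancel₀ (by exact_mod_cast (Real.exp_pos _).ne') h1

/-- A matching condition for two modes, evaluated at the plane. -/
lemma impedance_modeField_eq_iff (c : Params) {s : ℝ} (hs : s * s = 1) (hL : a - s * L = y)
    (f h f' h' : Fin 3 → ℂ) :
    impedance c (normal s) (modeField a s lam f a) (modeField a s lam h a)
      = impedance c (normal s) (modeField y (-s) lam f' a) (modeField y (-s) lam h' a) ↔
    ∀ j, impedanceComp c.Z s f h j = Real.exp (-(lam * L)) * impedanceComp c.Z s f' h' j := by
  have e1 : -(lam * (s * (a - a))) = 0 := by ring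
  have e2 : -(lam * (-s * (y - a))) = -(lam * L) := by
    rw [← hL]; linear_combination (-(lam * L)) * hs
  constructor
  · intro h0 j
    have := congrArg (fun v : Vec => v j) h0
    simp only [impedance_modeField c hs, e1, e2] at this
    simpa using this
  · intro h0
    ext j
    rw [impedance_modeField c hs, impedance_modeField c hs, e1, e2, h0]
    simp

/-- The spectral radius of two steps is the square of the reflection factor. It is attained by a mode
without longitudinal part, which each step multiplies by `-ρ`; no eigenvalue exceeds it by the energy
estimate. -/
lemma isGreatest_modeEigenvalues (hc : c.Admissible) (hL : 0 ≤ L) (hl : 0 < lam)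
    (hlam : lam ^ 2 = k 0 ^ 2 + k 1 ^ 2 + c.α * c.β) :
    IsGreatest ((fun κ : ℂ => ‖κ‖) '' modeEigenvalues c L k) (reflection c.p lam L ^ 2) := by
  have hpl := p_le_of_sq hc hl hlam
  have hρ := reflection_nonneg hc.p_pos hpl L
  have hβp := Params.β_eq hc.hε hc.hμ
  have hone : (1 : ℝ) * 1 = 1 := by norm_num
  have hneg : (-1 : ℝ) * (-1) = 1 := by norm_num
  have ho₁ : L - 1 * L = 0 := by ring
  have ho₂ : (0 : ℝ) - -1 * L = L := by ring
  have m1 := fun f h f' h' => impedance_modeField_eq_iff (lam := lam) c hone ho₁ f h f' h'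
  have m2 := fun f h f' h' => impedance_modeField_eq_iff (lam := lam) c hneg ho₂ f h f' h'
  rw [normal_one] at m1
  rw [normal_neg_one, neg_neg] at m2
  constructor
  · -- a mode without longitudinal part is an eigenvector
    obtain ⟨e₁, e₂, hS, hne⟩ : ∃ e₁ e₂ : ℂ, (k 0 : ℂ) * e₁ + k 1 * e₂ = 0 ∧ (e₁ ≠ 0 ∨ e₂ ≠ 0) := by
      by_cases h : k 0 = 0 ∧ k 1 = 0
      · exact ⟨1, 0, by simp [h.1], Or.inl one_ne_zero⟩
      · refine ⟨-k 1, k 0, by ring, ?_⟩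
        by_contra hcon
        push Not at hcon
        exact h ⟨by exact_mod_cast hcon.2, by exact_mod_cast neg_eq_zero.1 hcon.1⟩
    set ρ : ℂ := ((reflection c.p lam L : ℝ) : ℂ) with hρdef
    have hSr : ∀ r : ℂ, (k 0 : ℂ) * (r * e₁) + k 1 * (r * e₂) = 0 := fun r => by
      linear_combination r * hS
    have href : (1 / c.Z - lam / c.β : ℂ) * Real.exp (-(lam * L)) = -((1 / c.Z + lam / c.β) * ρ) := by
      have h1 : (1 / c.Z - lam / c.β) * Real.exp (-(lam * L))
          = -((1 / c.Z + lam / c.β) * reflection c.p lam L) := by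
        rw [sub_eq_neg_mul_reflection hc.β_pos hl hc.Z_pos hc.p_pos hβp, reflection]
        ring
      rw [hρdef]
      exact_mod_cast h1
    have hvec : ∀ (r : ℂ) (j : Fin 3), (![0, -(r * e₂), r * e₁] : Fin 3 → ℂ) j
        = r * (![0, -e₂, e₁] : Fin 3 → ℂ) j := fun r j => by fin_cases j <;> simp
    refine ⟨((reflection c.p lam L ^ 2 : ℝ) : ℂ), ⟨
      (modeField L 1 lam (modeE 1 lam (k 0) (k 1) e₁ e₂),
        modeField L 1 lam (modeH c.β 1 lam (k 0) (k 1) e₁ e₂)),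
      (modeField 0 (-1) lam (modeE (-1) lam (k 0) (k 1) (-ρ * e₁) (-ρ * e₂)),
        modeField 0 (-1) lam (modeH c.β (-1) lam (k 0) (k 1) (-ρ * e₁) (-ρ * e₂))),
      (modeField L 1 lam (modeE 1 lam (k 0) (k 1) (ρ ^ 2 * e₁) (ρ ^ 2 * e₂)),
        modeField L 1 lam (modeH c.β 1 lam (k 0) (k 1) (ρ ^ 2 * e₁) (ρ ^ 2 * e₂))),
      ?_, ?_, ?_, ?_, ?_, ?_, ?_⟩, ?_⟩
    · rw [← ray_one]; exact isMode_modeField hc (Or.inl rfl) hl hlam _ _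
    · rw [← ray_neg_one]; exact isMode_modeField hc (Or.inr rfl) hl hlam _ _
    · rw [← ray_one]; exact isMode_modeField hc (Or.inl rfl) hl hlam _ _
    · refine ⟨L - 1, by linarith, Or.inl fun h0 => ?_⟩
      have h1 : modeField L 1 lam (modeE 1 lam (k 0) (k 1) e₁ e₂) (L - 1)
          = (0 : ℂ) • modeField L 1 lam (modeE 1 lam (k 0) (k 1) e₁ e₂) (L - 1) := by
        rw [zero_smul]; exact h0
      have h2 := eq_smul_of_modeField h1
      have z1 := h2 1
      have z2 := h2 2
      simp only [modeE, Matrix.cons_val, zero_mul] at z1 z2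
      exact hne.elim (fun h => h z1) fun h => h z2
    · refine (m2 _ _ _ _).2 fun j => ?_
      rw [impedanceComp_transverse hc.β_pos hl hneg (hSr _),
        impedanceComp_transverse hc.β_pos hl hneg hS, hvec]
      push_cast at href ⊢
      linear_combination (![0, -e₂, e₁] : Fin 3 → ℂ) j * href
    · refine (m1 _ _ _ _).2 fun j => ?_
      rw [impedanceComp_transverse hc.β_pos hl hone (hSr _),
        impedanceComp_transverse hc.β_pos hl hone (hSr _), hvec, hvec]
      push_cast at href ⊢
      linear_combination ρ * (![0, -e₂, e₁] : Fin 3 → ℂ) j * href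
    · intro x _
      have e : ((reflection c.p lam L ^ 2 : ℝ) : ℂ) = ρ ^ 2 := by rw [hρdef]; push_cast; rfl
      rw [e]
      exact ⟨modeField_of_eq_smul (fun j => (mode_smul (β := c.β) _ _ _ j).1) x,
        modeField_of_eq_smul (fun j => (mode_smul _ _ _ j).2) x⟩
    · simp only [Complex.norm_real]
      exact Real.norm_of_nonneg (sq_nonneg _)
  · rintro _ ⟨κ, ⟨u, v, w, hu, hv, hw, ⟨x₀, hx₀, hne⟩, huv, hvw, hκ⟩, rfl⟩
    rw [← ray_one] at hu hw
    rw [← ray_neg_one] at hv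
    obtain ⟨e₁, e₂, hu'⟩ := hu.exists_eq_modeField hc (Or.inl rfl) hl hlam
    obtain ⟨f₁, f₂, hv'⟩ := hv.exists_eq_modeField hc (Or.inr rfl) hl hlam
    obtain ⟨g₁, g₂, hw'⟩ := hw.exists_eq_modeField hc (Or.inl rfl) hl hlam
    rw [(hv' 0 (by simp)).1, (hv' 0 (by simp)).2, (hu' 0 (by simpa using hL)).1,
      (hu' 0 (by simpa using hL)).2] at huv
    rw [(hw' L (by simp)).1, (hw' L (by simp)).2, (hv' L (by simpa using hL)).1,
      (hv' L (by simpa using hL)).2] at hvw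
    have b1 := modeEnergy_le (L := L) hc.α_pos hc.β_pos hl hc.Z_pos hc.p_pos hneg hlam hβp
      (Params.p_le hc.hε hc.hμ hc.hσ) (e₁' := e₁) (e₂' := e₂) (by rw [neg_neg]; exact (m2 _ _ _ _).1 huv)
    have b2 := modeEnergy_le (L := L) hc.α_pos hc.β_pos hl hc.Z_pos hc.p_pos hone hlam hβp
      (Params.p_le hc.hε hc.hμ hc.hσ) ((m1 _ _ _ _).1 hvw)
    rw [neg_neg] at b1
    obtain ⟨k1, k2⟩ := hκ x₀ hx₀
    have hx₀' : 0 ≤ 1 * (L - x₀) := by linarith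
    rw [(hw' x₀ hx₀').1, (hu' x₀ hx₀').1] at k1
    rw [(hw' x₀ hx₀').2, (hu' x₀ hx₀').2] at k2
    have b3 : modeEnergy c.β 1 lam (k 0) (k 1) g₁ g₂
        = ‖κ‖ ^ 2 * modeEnergy c.β 1 lam (k 0) (k 1) e₁ e₂ := by
      simp only [modeEnergy, eq_smul_of_modeField k1, eq_smul_of_modeField k2, norm_mul, mul_pow,
        ← mul_add, ← Finset.mul_sum]
    have b4 : 0 < modeEnergy c.β 1 lam (k 0) (k 1) e₁ e₂ := by
      refine lt_of_le_of_ne modeEnergy_nonneg fun h0 => ?_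
      have h1 := (Finset.sum_eq_zero_iff_of_nonneg fun j _ => by positivity).1 h0.symm
      have h2 : ∀ j, modeE 1 lam (k 0) (k 1) e₁ e₂ j = 0 := fun j => by
        have := h1 j (Finset.mem_univ j)
        have h3 := sq_nonneg ‖modeE 1 lam (k 0) (k 1) e₁ e₂ j‖
        have h4 := sq_nonneg ‖modeH c.β 1 lam (k 0) (k 1) e₁ e₂ j‖
        exact norm_eq_zero.1 (pow_eq_zero_iff two_ne_zero |>.1 (by linarith))
      have h3 : ∀ j, modeH c.β 1 lam (k 0) (k 1) e₁ e₂ j = 0 := fun j => by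
        have := h1 j (Finset.mem_univ j)
        have h3 := sq_nonneg ‖modeE 1 lam (k 0) (k 1) e₁ e₂ j‖
        have h4 := sq_nonneg ‖modeH c.β 1 lam (k 0) (k 1) e₁ e₂ j‖
        exact norm_eq_zero.1 (pow_eq_zero_iff two_ne_zero |>.1 (by linarith))
      rw [(hu' x₀ hx₀').1, (hu' x₀ hx₀').2] at hne
      refine hne.elim (fun h => h ?_) fun h => h ?_
      · ext j; simp [modeField, h2]
      · ext j; simp [modeField, h3]
    have b5 : ‖κ‖ ^ 2 * modeEnergy c.β 1 lam (k 0) (k 1) e₁ e₂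
        ≤ (reflection c.p lam L ^ 2) ^ 2 * modeEnergy c.β 1 lam (k 0) (k 1) e₁ e₂ := by
      rw [← b3]
      refine b2.trans ((mul_le_mul_of_nonneg_left b1 (sq_nonneg _)).trans_eq (by ring))
    exact le_of_sq_le_sq (le_of_mul_le_mul_right b5 b4) (sq_nonneg _)

lemma convergenceFactor_eq (hc : c.Admissible) (hL : 0 ≤ L) (hl : 0 < lam)
    (hlam : lam ^ 2 = k 0 ^ 2 + k 1 ^ 2 + c.α * c.β) :
    convergenceFactor c L k = reflection c.p lam L := by
  rw [convergenceFactor, (isGreatest_modeEigenvalues hc hL hl hlam).csSup_eq,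
    Real.sqrt_sq (reflection_nonneg hc.p_pos (p_le_of_sq hc hl hlam) L)]

end Eigenvalues

end MaxwellSchwarz

end

theorem theorem4p1 (c : MaxwellSchwarz.Params) (L : ℝ)
    (hε : 0 < c.ε) (hμ : 0 < c.μ) (hσ : 0 ≤ c.σ) (hη : 0 < c.η) (hL : 0 ≤ L)
    (J g : MaxwellSchwarz.L2Field univ) :
    -- the problem on the whole space is well posed in L², and the algorithm converges to
    -- its solution U
    (∃ U : MaxwellSchwarz.L2Pair univ,
      MaxwellSchwarz.SolvesMaxwell c U J g ∧
      (∀ V : MaxwellSchwarz.L2Pair univ, MaxwellSchwarz.SolvesMaxwell c V J g → V = U) ∧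
      -- the iterates exist and are unique for every guess with square integrable curls
      (∀ (a₁ : MaxwellSchwarz.L2Pair (MaxwellSchwarz.Ω₁ L))
          (a₂ : MaxwellSchwarz.L2Pair MaxwellSchwarz.Ω₂),
        MaxwellSchwarz.HasL2Curl a₁ → MaxwellSchwarz.HasL2Curl a₂ →
        ∃! u : (ℕ → MaxwellSchwarz.L2Pair (MaxwellSchwarz.Ω₁ L)) ×
            (ℕ → MaxwellSchwarz.L2Pair MaxwellSchwarz.Ω₂),
          u.1 0 = a₁ ∧ u.2 0 = a₂ ∧ MaxwellSchwarz.IsSchwarzIteration c L J g u.1 u.2) ∧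
      -- convergence for every guess in L² from which the algorithm can be run
      (∀ (u₁ : ℕ → MaxwellSchwarz.L2Pair (MaxwellSchwarz.Ω₁ L))
          (u₂ : ℕ → MaxwellSchwarz.L2Pair MaxwellSchwarz.Ω₂),
        MaxwellSchwarz.IsSchwarzIteration c L J g u₁ u₂ →
        Tendsto (fun n => MaxwellSchwarz.l2Error (u₁ n) U) atTop (𝓝 0) ∧
        Tendsto (fun n => MaxwellSchwarz.l2Error (u₂ n) U) atTop (𝓝 0) ∧
        ∀ n, 1 ≤ n →
          MaxwellSchwarz.l2Error (u₁ (n + 2)) U ≤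
            ENNReal.ofReal (MaxwellSchwarz.Rcla c L ^ 2) * MaxwellSchwarz.l2Error (u₁ n) U ∧
          MaxwellSchwarz.l2Error (u₂ (n + 2)) U ≤
            ENNReal.ofReal (MaxwellSchwarz.Rcla c L ^ 2) * MaxwellSchwarz.l2Error (u₂ n) U)) ∧
    -- the convergence factors of the Fourier modes
    (∀ k : EuclideanSpace ℝ (Fin 2),
      IsGreatest ((fun κ : ℂ => ‖κ‖) '' MaxwellSchwarz.modeEigenvalues c L k)
        (MaxwellSchwarz.convergenceFactor c L k ^ 2) ∧
      MaxwellSchwarz.convergenceFactor c L k < 1 ∧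
      MaxwellSchwarz.convergenceFactor c L k ≤ MaxwellSchwarz.Rcla c L) ∧
    (0 < L → MaxwellSchwarz.Rcla c L < 1) := by
  have hc : c.Admissible := ⟨hε, hμ, hσ, hη⟩
  refine ⟨?_, fun k => ?_, fun hL' => MaxwellSchwarz.Rcla_lt_one hε hμ hη hL'⟩
  · obtain ⟨U, hU⟩ := MaxwellSchwarz.exists_solvesMaxwell hc J g
    refine ⟨U, hU, fun V hV => ?_, fun a₁ a₂ h₁ h₂ => MaxwellSchwarz.existsUnique_iteration hc hL h₁ h₂,
      fun u₁ u₂ h => h.tendsto hc hL hU⟩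
    obtain ⟨e₁, e₂⟩ := ((MaxwellSchwarz.solvesMaxwell_iff V).1 hV).ae_eq hc
      ((MaxwellSchwarz.solvesMaxwell_iff U).1 hU)
    rw [← Measure.restrict_univ (μ := volume)] at e₁ e₂
    exact Prod.ext (Lp.ext e₁) (Lp.ext e₂)
  · have hpos := mul_pos hc.α_pos hc.β_pos
    have hn : 0 < k 0 ^ 2 + k 1 ^ 2 + c.α * c.β := by positivity
    have hlam := Real.sq_sqrt hn.le
    have hl := Real.sqrt_pos.2 hn
    have hp := MaxwellSchwarz.p_le_of_sq hc hl hlam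
    rw [MaxwellSchwarz.convergenceFactor_eq hc hL hl hlam]
    exact ⟨MaxwellSchwarz.isGreatest_modeEigenvalues hc hL hl hlam,
      MaxwellSchwarz.reflection_lt_one hc.p_pos hp hL,
      MaxwellSchwarz.reflection_le_Rcla hε hμ hη hL hp⟩
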